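/- **Setting.** Let $n \ge 2$ and $1 \le m \le n$ be integers. Let $\omega_0 = (\omega_{0ij})_{i,j=1}^n$ be a tensor field on $\mathbb{R}^n$ with $(1+|x|)^{n+m+1}\omega_0 \in L^1(\mathbb{R}^n)$, and let $a = (a_j)_{j=1}^n$ be the velocity field given by the Biot–Savart law $$a_j(x) = -\sum_{k=1}^n \partial_k(-\Delta)^{-1}\omega_{0kj}(x) = \frac{\Gamma(n/2)}{2\pi^{n/2}} \sum_{k=1}^n \int_{\mathbb{R}^n} \frac{x_k-y_k}{|x-y|^n}\,\omega_{0kj}(y)\,dy .$$ Assume that $\omega_{0ij} = \partial_i a_j - \partial_j a_i$ in the sense of distributions. Let $u$ be a smooth global solution of the Navier–Stokes equations $$\partial_t u + (u\cdot\nabla)u = \Delta u - \nabla p, \qquad \nabla\cdot u = 0 \qquad (t>0,\ x\in\mathbb{R}^n)$$ with a smooth pressure $p$, such that $u(t) \to a$ in the sense of distributions as $t \to 0+$, and such that for every $1 \le q \le \infty$ there is a constant $C$ with $\|u(t)\|_{L^q} \le C(1+t)^{-\frac n2(1-\frac1q)-\frac12}$ for all $t>0$. Let $\omega_{ij} = \partial_i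 u_j - \partial_j u_i$ be its vorticity and $G(t,x) = (4\pi t)^{-n/2}e^{-|x|^2/(4t)}$. For $2 \le p \le m+1$ define $\Omega_p = (\Omega_{hk;p})_{h,k=1}^n$ by $$\begin{aligned}\Omega_{hk;p}(t) ={}& \sum_{|\alpha|=p}\frac{\nabla^\alpha G(t)}{\alpha!}\int_{\mathbb{R}^n}(-y)^\alpha\omega_{0hk}(y)\,dy\\ &+ \sum_{2l+|\beta|=p-1}\sum_{j=1}^n \frac{\partial_t^l\nabla^\beta\partial_k G(t)}{l!\,\beta!}\int_0^\infty\!\!\int_{\mathbb{R}^n}(-s)^l(-y)^\beta(\omega_{jh}u_j)(s,y)\,dy\,ds\\ &- \sum_{2l+|\beta|=p-1}\sum_{j=1}^n \frac{\partial_t^l\nabla^\beta\partial_h G(t)}{l!\,\beta!}\int_0^\infty\!\!\int_{\mathbb{R}^n}(-s)^l(-y)^\beta(\omega_{jk}u_j)(s,y)\,dy\,ds ,\end{aligned}$$ and put $L_m(t) = 1$ if $m \le n-1$ and $L_n(t) = \log(2+t)$. **Proposition 2.3.** The space-time integrals in the definition of $\Omega_p$, $2 \le p \le m+1$, converge absolutely,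 and for all $1 \le q \le \infty$ and all real $0 \le \mu \le n+m+1$ there is a constant $C$, independent of $t$, such that for all $t > 0$ $$\Bigl\| |x|^\mu\Bigl(\omega(t) - \sum_{p=2}^{m+1}\Omega_p(t)\Bigr)\Bigr\|_{L^q(\mathbb{R}^n)} \le C\, t^{-\frac n2(1-\frac1q)}\Bigl(t^{-\frac m2-\frac12+\frac\mu2} + (1+t)^{-\frac m2-\frac12+\frac\mu2}\Bigr)(1+t)^{-\frac12}L_m(t).$$ -/

import Mathlib

open MeasureTheory Filter Topology Set
open scoped ContDiff ENNReal

noncomputable section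

namespace NSVorticity

/-- Euclidean space `ℝⁿ`. -/
abbrev E (n : ℕ) : Type := EuclideanSpace ℝ (Fin n)

/-- The partial derivative `∂_i f`. -/
def pderiv {n : ℕ} (i : Fin n) (f : E n → ℝ) : E n → ℝ :=
  fun x => fderiv ℝ f x (EuclideanSpace.single i 1)

/-- The multi-index derivative `∇^β f = ∂_1^{β_1} ⋯ ∂_n^{β_n} f`. -/
def multiDeriv {n : ℕ} (β : Fin n → ℕ) (f : E n → ℝ) : E n → ℝ :=
  (List.finRange n).foldr (fun i g => (pderiv i)^[β i] g) f

/-- The multi-index factorial `β! = β_1! ⋯ β_n!`. -/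
def multiFactorial {n : ℕ} (β : Fin n → ℕ) : ℕ := ∏ i, (β i).factorial

/-- The monomial `x^β = x_1^{β_1} ⋯ x_n^{β_n}`. -/
def monom {n : ℕ} (β : Fin n → ℕ) (x : E n) : ℝ := ∏ i, x i ^ β i

/-- The heat kernel `G(t,x) = (4πt)^{-n/2} exp(-|x|²/(4t))`. -/
def heatKernel (n : ℕ) (t : ℝ) (x : E n) : ℝ :=
  (4 * Real.pi * t) ^ (-(n : ℝ) / 2) * Real.exp (-‖x‖ ^ 2 / (4 * t))

/-- The vorticity tensor `ω_{ij} = ∂_i u_j - ∂_j u_i` of a time-dependent vector field `u`. -/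
def vorticity {n : ℕ} (u : ℝ → E n → E n) (i j : Fin n) (t : ℝ) (x : E n) : ℝ :=
  pderiv i (fun y => u t y j) x - pderiv j (fun y => u t y i) x

/-- The Biot-Savart field `a_j = -∑_k ∂_k (-Δ)⁻¹ w_{kj} = -∑_k R_k (-Δ)^{-1/2} w_{kj}` of a
tensor `w`. The convolution kernel of `-∂_k (-Δ)⁻¹` on `ℝⁿ`, `n ≥ 2`, is
`Γ(n/2) / (2 π^{n/2}) · x_k / |x|ⁿ`; the integral converges for almost every `x` if `w` is
integrable. -/
def biotSavart {n : ℕ} (w : Fin n → Fin n → E n → ℝ) (j : Fin n) (x : E n) : ℝ :=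
  Real.Gamma ((n : ℝ) / 2) / (2 * Real.pi ^ ((n : ℝ) / 2)) *
    ∑ k, ∫ y, (x k - y k) / ‖x - y‖ ^ n * w k j y

/-- `w_{ij} = ∂_i a_j - ∂_j a_i` in the sense of distributions. -/
def IsWeakCurl {n : ℕ} (w : Fin n → Fin n → E n → ℝ) (a : Fin n → E n → ℝ) : Prop :=
  ∀ (i j : Fin n) (φ : E n → ℝ), ContDiff ℝ ∞ φ → HasCompactSupport φ →
    ∫ x, φ x * w i j x = -∫ x, (pderiv i φ x * a j x - pderiv j φ x * a i x)

/-- `u` is a smooth global solution of the incompressible Navier-Stokes equations on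
`(0,∞) × ℝⁿ` for some smooth pressure, and takes the initial velocity `a` in the sense of
distributions as `t → 0+`. -/
structure IsSmoothNSSolution {n : ℕ} (a : Fin n → E n → ℝ) (u : ℝ → E n → E n) : Prop where
  smooth : ContDiffOn ℝ ∞ (Function.uncurry u) (Ioi 0 ×ˢ univ)
  momentum : ∃ p : ℝ → E n → ℝ, ContDiffOn ℝ ∞ (Function.uncurry p) (Ioi 0 ×ˢ univ) ∧
    ∀ t : ℝ, 0 < t → ∀ (x : E n) (j : Fin n),
      deriv (fun s => u s x j) t + ∑ h, u t x h * pderiv h (fun y => u t y j) x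
        = ∑ h, pderiv h (pderiv h (fun y => u t y j)) x - pderiv j (p t) x
  divergence_free : ∀ t : ℝ, 0 < t → ∀ x : E n, ∑ j, pderiv j (fun y => u t y j) x = 0
  initial : ∀ (j : Fin n) (φ : E n → ℝ), ContDiff ℝ ∞ φ → HasCompactSupport φ →
    Tendsto (fun t => ∫ x, φ x * u t x j) (𝓝[>] 0) (𝓝 (∫ x, φ x * a j x))

/-- The decay rates `‖u(t)‖_{L^q} ≤ C (1+t)^{-(n/2)(1-1/q) - 1/2}`, for all `1 ≤ q ≤ ∞`. -/
def HasVelocityDecay {n : ℕ} (u : ℝ → E n → E n) : Prop :=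
  ∀ q : ℝ≥0∞, 1 ≤ q → ∃ C : ℝ, ∀ t : ℝ, 0 < t →
    eLpNorm (u t) q volume ≤
      ENNReal.ofReal (C * (1 + t) ^ (-((n : ℝ) / 2) * (1 - (1 / q).toReal) - 1 / 2))

/-- The space-time moment
`∫_0^∞ ∫ (-s)^l (-y)^β (ω_{jh} u_j)(s,y) dy ds`. -/
def nonlinearMoment {n : ℕ} (u : ℝ → E n → E n) (l : ℕ) (β : Fin n → ℕ) (j h : Fin n) : ℝ :=
  ∫ s in Ioi (0 : ℝ), ∫ y : E n,
    (-s) ^ l * monom β (-y) * (vorticity u j h s y * u s y j)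

/-- The profile `Ω_{hk;p}(t,x)` of the vorticity, for `p ≥ 1`. The sum over `2l + |β| = p - 1`
is written as a sum over `l ≤ (p - 1) / 2` and then over `|β| = p - 1 - 2l`. -/
def Omega {n : ℕ} (u : ℝ → E n → E n) (w : Fin n → Fin n → E n → ℝ) (h k : Fin n) (p : ℕ)
    (t : ℝ) (x : E n) : ℝ :=
  (∑ α ∈ Finset.piAntidiag (Finset.univ : Finset (Fin n)) p,
      multiDeriv α (heatKernel n t) x / (multiFactorial α : ℝ) *
        ∫ y, monom α (-y) * w h k y)
  + (∑ l ∈ Finset.range ((p - 1) / 2 + 1),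
      ∑ β ∈ Finset.piAntidiag (Finset.univ : Finset (Fin n)) (p - 1 - 2 * l), ∑ j,
        iteratedDeriv l (fun s => multiDeriv β (pderiv k (heatKernel n s)) x) t /
          ((l.factorial : ℝ) * (multiFactorial β : ℝ)) * nonlinearMoment u l β j h)
  - (∑ l ∈ Finset.range ((p - 1) / 2 + 1),
      ∑ β ∈ Finset.piAntidiag (Finset.univ : Finset (Fin n)) (p - 1 - 2 * l), ∑ j,
        iteratedDeriv l (fun s => multiDeriv β (pderiv h (heatKernel n s)) x) t /
          ((l.factorial : ℝ) * (multiFactorial β : ℝ)) * nonlinearMoment u l β j k)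

/-- `L_m(t) = 1` for `m < n`, and `L_n(t) = log (2 + t)`. -/
def logFactor (n m : ℕ) (t : ℝ) : ℝ := if m = n then Real.log (2 + t) else 1

end NSVorticity

end

/-! Taking the curl removes the pressure: with f_h = Σ_j ω_{jh} u_j one has ∂_t ω_{hk} = Δω_{hk} +
∂_k f_h − ∂_h f_k, hence ω_{hk}(t) = G(t) * ω_{0hk} + ∫_0^t (∂_k G(t−s) * f_h(s) − ∂_h G(t−s) *
f_k(s)) ds (`DecayingFlow.representation`). Expand G(t−s, x−y) about (t, x) to a fixed parabolic
order, a time derivative counting twice. The first term, and the part s < t/2 of the second, become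
derivatives of G times moments of ω_0 and of f. The profile Ω_p is the part of order p after the
moments over (0, t/2) are replaced by moments over (0, ∞). Orders 0 and 1 are absent because ω_0 has
vanishing mean and first moments and f has vanishing mean, which follows from div u = 0 and the curl
structure through `integral_divergence_eq_zero`.

The error consists of the Taylor remainders (`HC.remainder_bound`), the interaction at times s in
(t/2, t) (`WeightedDecay.exists_late_force_le`) and the tails of the moments
(`exists_taylorPart_sub_Omega_le`). For t ≥ 1 each is estimated in L^1 and L^∞ with the weight
(1+|x|/√t)^{n+m+1}; for t ≤ 1 the vorticity and the profiles are bounded separately. The other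
exponents q follow by interpolation, and |x|^μ is dominated by the weight. The remainder of the
nonlinear term is governed by ∫_0^{t/2} (1+s)^{(m+1)/2} (1+s)^{-(n+3)/2} ds, which is bounded for m
< n and logarithmic for m = n; this is the origin of L_m.

The factor (1+s)^{-(n+3)/2} is the decay of the weighted L^1 norm of |u||ω|. The velocity supplies
(1+s)^{-(n+1)/2}, so the weighted vorticity has to supply (1+s)^{-1} in L^1, although only
smoothness for t > 0 is known about it at the outset. A Duhamel formula with compactly supported
cutoff gives an interior estimate (`exists_interior_estimate`), which self-improves to a bound by 1
+ t^{-1/2} (`DecayingFlow.exists_vort_le`). This allows the cutoff to be removed and the starting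
time to tend to 0. With a truncated weight, the weighted norms then satisfy a Volterra inequality
with kernel (t−τ)^{-1/2}(1+τ)^{-3/2}, whose solutions are bounded uniformly in time
(`exists_volterra_bound`); this yields `DecayingFlow.weightedDecay_zero`. Finally the expansion is
applied to itself: to the orders N = 0 and N = 1 its Taylor part vanishes, so that the remainder
estimate is a decay estimate gaining (1+t)^{-1/2} each time (`WeightedDecay.improve`,
`DecayingFlow.weightedDecay_two`). -/

noncomputable section

namespace NSVorticity

variable {n : ℕ}

/-! ### Calculus of smooth functions on the open half-space of positive times -/

/-- Smoothness on `(0,∞) × ℝⁿ`. -/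
def SM (f : ℝ → E n → ℝ) : Prop := ContDiffOn ℝ ∞ (Function.uncurry f) (Ioi 0 ×ˢ univ)

/-- The time derivative. -/
def dt (f : ℝ → E n → ℝ) : ℝ → E n → ℝ := fun t x => deriv (fun s => f s x) t

/-- The spatial partial derivative of a time-dependent function. -/
def dx (i : Fin n) (f : ℝ → E n → ℝ) : ℝ → E n → ℝ := fun t x => pderiv i (f t) x

/-- The unit coordinate vector. -/
abbrev ev (i : Fin n) : E n := EuclideanSpace.single i 1

lemma isOpen_halfSpace : IsOpen (Ioi (0 : ℝ) ×ˢ (univ : Set (E n))) := isOpen_Ioi.prod isOpen_univ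

lemma mem_nhds_halfSpace {t : ℝ} (ht : 0 < t) (x : E n) :
    Ioi (0 : ℝ) ×ˢ (univ : Set (E n)) ∈ 𝓝 (t, x) :=
  isOpen_halfSpace.mem_nhds ⟨ht, mem_univ _⟩

lemma SM.contDiffAt {f : ℝ → E n → ℝ} (hf : SM f) {t : ℝ} (ht : 0 < t) (x : E n) :
    ContDiffAt ℝ ∞ (Function.uncurry f) (t, x) :=
  ContDiffOn.contDiffAt hf (mem_nhds_halfSpace ht x)

lemma SM.differentiableAt {f : ℝ → E n → ℝ} (hf : SM f) {t : ℝ} (ht : 0 < t) (x : E n) :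
    DifferentiableAt ℝ (Function.uncurry f) (t, x) :=
  (hf.contDiffAt ht x).differentiableAt (by simp)

lemma SM.slice {f : ℝ → E n → ℝ} (hf : SM f) {t : ℝ} (ht : 0 < t) : ContDiff ℝ ∞ (f t) := by
  rw [contDiff_iff_contDiffAt]
  intro x
  exact (hf.contDiffAt ht x).comp x (f := fun y => (t, y)) (by fun_prop)

lemma SM.slice_differentiable {f : ℝ → E n → ℝ} (hf : SM f) {t : ℝ} (ht : 0 < t) :
    Differentiable ℝ (f t) := (hf.slice ht).differentiable (by simp)

lemma SM.time_differentiableAt {f : ℝ → E n → ℝ} (hf : SM f) {t : ℝ} (ht : 0 < t) (x : E n) :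
    DifferentiableAt ℝ (fun s => f s x) t :=
  (hf.differentiableAt ht x).comp t (f := fun s => (s, x)) (by fun_prop)

lemma SM.hasDerivAt {f : ℝ → E n → ℝ} (hf : SM f) {t : ℝ} (ht : 0 < t) (x : E n) :
    HasDerivAt (fun s => f s x) (dt f t x) t := (hf.time_differentiableAt ht x).hasDerivAt

lemma SM.continuousOn {f : ℝ → E n → ℝ} (hf : SM f) :
    ContinuousOn (Function.uncurry f) (Ioi 0 ×ˢ univ) := ContDiffOn.continuousOn hf

lemma SM.slice_continuous {f : ℝ → E n → ℝ} (hf : SM f) {t : ℝ} (ht : 0 < t) :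
    Continuous (f t) := (hf.slice ht).continuous

lemma SM.dx_eq {f : ℝ → E n → ℝ} (hf : SM f) (i : Fin n) {t : ℝ} (ht : 0 < t) (x : E n) :
    dx i f t x = fderiv ℝ (Function.uncurry f) (t, x) (0, ev i) := by
  have h1 : HasFDerivAt (fun y : E n => (t, y)) (ContinuousLinearMap.inr ℝ ℝ (E n)) x :=
    hasFDerivAt_prodMk_right t x
  have := (hf.differentiableAt ht x).hasFDerivAt.comp x h1
  have e : f t = Function.uncurry f ∘ fun y => (t, y) := rfl
  rw [dx, pderiv, e, this.fderiv]
  simp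

lemma SM.dt_eq {f : ℝ → E n → ℝ} (hf : SM f) {t : ℝ} (ht : 0 < t) (x : E n) :
    dt f t x = fderiv ℝ (Function.uncurry f) (t, x) (1, 0) := by
  have h1 : HasFDerivAt (fun s : ℝ => (s, x)) (ContinuousLinearMap.inl ℝ ℝ (E n)) t :=
    hasFDerivAt_prodMk_left t x
  have := ((hf.differentiableAt ht x).hasFDerivAt.comp t h1).hasDerivAt
  have e : (fun s => f s x) = Function.uncurry f ∘ fun y => (y, x) := rfl
  rw [dt, e, this.deriv]
  simp

lemma SM.fderiv_apply {f : ℝ → E n → ℝ} (hf : SM f) (v : ℝ × E n) :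
    SM (fun t x => fderiv ℝ (Function.uncurry f) (t, x) v) := by
  have : ContDiffOn ℝ ∞ (fderiv ℝ (Function.uncurry f)) (Ioi 0 ×ˢ univ) :=
    ContDiffOn.fderiv_of_isOpen hf isOpen_halfSpace (by simp)
  exact this.clm_apply contDiffOn_const

lemma SM.congr {f g : ℝ → E n → ℝ} (hf : SM f) (h : ∀ t, 0 < t → ∀ x, g t x = f t x) : SM g :=
  ContDiffOn.congr hf fun p hp => h p.1 hp.1 p.2

lemma SM.dx {f : ℝ → E n → ℝ} (hf : SM f) (i : Fin n) : SM (dx i f) :=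
  (hf.fderiv_apply (0, ev i)).congr fun _ ht x => hf.dx_eq i ht x

lemma SM.dt {f : ℝ → E n → ℝ} (hf : SM f) : SM (dt f) :=
  (hf.fderiv_apply (1, 0)).congr fun _ ht x => hf.dt_eq ht x

lemma SM.add {f g : ℝ → E n → ℝ} (hf : SM f) (hg : SM g) : SM (fun t x => f t x + g t x) :=
  ContDiffOn.add hf hg

lemma SM.sub {f g : ℝ → E n → ℝ} (hf : SM f) (hg : SM g) : SM (fun t x => f t x - g t x) :=
  ContDiffOn.sub hf hg

lemma SM.mul {f g : ℝ → E n → ℝ} (hf : SM f) (hg : SM g) : SM (fun t x => f t x * g t x) :=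
  ContDiffOn.mul hf hg

lemma SM.const_mul {f : ℝ → E n → ℝ} (c : ℝ) (hf : SM f) : SM (fun t x => c * f t x) :=
  ContDiffOn.mul contDiffOn_const hf

lemma SM.sum {ι : Type*} {s : Finset ι} {f : ι → ℝ → E n → ℝ} (hf : ∀ i ∈ s, SM (f i)) :
    SM (fun t x => ∑ i ∈ s, f i t x) := by
  have : ContDiffOn ℝ ∞ (fun p : ℝ × E n => ∑ i ∈ s, Function.uncurry (f i) p) (Ioi 0 ×ˢ univ) :=
    ContDiffOn.sum fun i hi => hf i hi
  exact this

lemma dx_congr {f g : ℝ → E n → ℝ} (h : ∀ t, 0 < t → ∀ x, f t x = g t x) (i : Fin n) {t : ℝ}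
    (ht : 0 < t) (x : E n) : dx i f t x = dx i g t x := by
  have : f t = g t := funext fun y => h t ht y
  rw [dx, dx, this]

lemma dt_congr {f g : ℝ → E n → ℝ} (h : ∀ t, 0 < t → ∀ x, f t x = g t x) {t : ℝ}
    (ht : 0 < t) (x : E n) : dt f t x = dt g t x := by
  apply Filter.EventuallyEq.deriv_eq
  filter_upwards [Ioi_mem_nhds ht] with s hs using h s hs x

/-- Both `dx i` and `dt` are directional derivatives of the uncurried function, so this one symmetry
covers all interchanges of derivatives in space and time. -/
lemma fderiv_fderiv_apply_comm {F : ℝ × E n → ℝ} {p : ℝ × E n} (hF : ContDiffAt ℝ ∞ F p)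
    (v w : ℝ × E n) :
    fderiv ℝ (fun q => fderiv ℝ F q v) p w = fderiv ℝ (fun q => fderiv ℝ F q w) p v := by
  have h2 : DifferentiableAt ℝ (fderiv ℝ F) p :=
    (hF.fderiv_right (m := ∞) (by simp)).differentiableAt (by simp)
  have hs := (hF.isSymmSndFDerivAt (by simp only [minSmoothness_of_isRCLikeNormedField]; exact WithTop.coe_le_coe.2 (le_top : (2 : ℕ∞) ≤ ⊤))).eq w v
  rw [fderiv_clm_apply h2 (differentiableAt_const v), fderiv_clm_apply h2 (differentiableAt_const w)]
  simpa using hs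

lemma SM.dx_dx_comm {f : ℝ → E n → ℝ} (hf : SM f) (i j : Fin n) {t : ℝ} (ht : 0 < t) (x : E n) :
    NSVorticity.dx i (NSVorticity.dx j f) t x = NSVorticity.dx j (NSVorticity.dx i f) t x := by
  rw [dx_congr (fun t ht x => hf.dx_eq j ht x) i ht x,
    dx_congr (fun t ht x => hf.dx_eq i ht x) j ht x,
    (hf.fderiv_apply _).dx_eq i ht x, (hf.fderiv_apply _).dx_eq j ht x]
  exact fderiv_fderiv_apply_comm (hf.contDiffAt ht x) _ _

lemma SM.dt_dx_comm {f : ℝ → E n → ℝ} (hf : SM f) (i : Fin n) {t : ℝ} (ht : 0 < t) (x : E n) :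
    NSVorticity.dt (NSVorticity.dx i f) t x = NSVorticity.dx i (NSVorticity.dt f) t x := by
  rw [dt_congr (fun t ht x => hf.dx_eq i ht x) ht x,
    dx_congr (fun t ht x => hf.dt_eq ht x) i ht x,
    (hf.fderiv_apply _).dt_eq ht x, (hf.fderiv_apply _).dx_eq i ht x]
  exact fderiv_fderiv_apply_comm (hf.contDiffAt ht x) _ _

lemma pderiv_add {f g : E n → ℝ} {x : E n} (hf : DifferentiableAt ℝ f x)
    (hg : DifferentiableAt ℝ g x) (i : Fin n) :
    pderiv i (fun y => f y + g y) x = pderiv i f x + pderiv i g x := by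
  simp [pderiv, fderiv_fun_add hf hg]

lemma pderiv_sub {f g : E n → ℝ} {x : E n} (hf : DifferentiableAt ℝ f x)
    (hg : DifferentiableAt ℝ g x) (i : Fin n) :
    pderiv i (fun y => f y - g y) x = pderiv i f x - pderiv i g x := by
  simp [pderiv, fderiv_fun_sub hf hg]

lemma pderiv_mul {f g : E n → ℝ} {x : E n} (hf : DifferentiableAt ℝ f x)
    (hg : DifferentiableAt ℝ g x) (i : Fin n) :
    pderiv i (fun y => f y * g y) x = pderiv i f x * g x + f x * pderiv i g x := by
  simp [pderiv, fderiv_fun_mul hf hg]; ring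

lemma pderiv_const_mul {f : E n → ℝ} {x : E n} (c : ℝ) (hf : DifferentiableAt ℝ f x) (i : Fin n) :
    pderiv i (fun y => c * f y) x = c * pderiv i f x := by
  simp [pderiv, fderiv_const_mul hf]

lemma pderiv_sum {ι : Type*} {s : Finset ι} {f : ι → E n → ℝ} {x : E n}
    (hf : ∀ j ∈ s, DifferentiableAt ℝ (f j) x) (i : Fin n) :
    pderiv i (fun y => ∑ j ∈ s, f j y) x = ∑ j ∈ s, pderiv i (f j) x := by
  simp [pderiv, fderiv_fun_sum hf]

lemma contDiff_pderiv {f : E n → ℝ} (hf : ContDiff ℝ ∞ f) (i : Fin n) :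
    ContDiff ℝ ∞ (pderiv i f) :=
  (hf.fderiv_right (m := ∞) (by simp)).clm_apply contDiff_const

/-! ### The vorticity equation -/

/-- The force `f_h = ∑_j ω_{jh} u_j` of the vorticity equation. -/
def force (u : ℝ → E n → E n) (h : Fin n) (t : ℝ) (x : E n) : ℝ :=
  ∑ j, vorticity u j h t x * u t x j

lemma SM.component {u : ℝ → E n → E n}
    (hu : ContDiffOn ℝ ∞ (Function.uncurry u) (Ioi 0 ×ˢ univ)) (j : Fin n) :
    SM (fun t x => u t x j) := by
  have h : ContDiff ℝ ∞ (fun v : E n => v j) := by fun_prop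
  exact h.comp_contDiffOn hu

lemma SM.vorticity {u : ℝ → E n → E n}
    (hu : ContDiffOn ℝ ∞ (Function.uncurry u) (Ioi 0 ×ˢ univ)) (i j : Fin n) :
    SM (vorticity u i j) :=
  ((SM.component hu j).dx i).sub ((SM.component hu i).dx j)

lemma SM.force {u : ℝ → E n → E n}
    (hu : ContDiffOn ℝ ∞ (Function.uncurry u) (Ioi 0 ×ˢ univ)) (h : Fin n) :
    SM (force u h) :=
  SM.sum fun j _ => (SM.vorticity hu j h).mul (SM.component hu j)

/-- Since Σ_j u_j ∂_j u_b = Σ_j ω_{jb} u_j + ½ ∂_b |u|², the convection term is the force up to a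
gradient, and the curl annihilates that gradient together with the pressure. The proof expands both
sides into derivatives of the components and cancels symmetric sums. -/
lemma vorticity_equation {u : ℝ → E n → E n} {p : ℝ → E n → ℝ}
    (hu : ContDiffOn ℝ ∞ (Function.uncurry u) (Ioi 0 ×ˢ univ)) (hp : SM p)
    (hmom : ∀ t : ℝ, 0 < t → ∀ (x : E n) (j : Fin n),
      deriv (fun s => u s x j) t + ∑ h, u t x h * pderiv h (fun y => u t y j) x
        = ∑ h, pderiv h (pderiv h (fun y => u t y j)) x - pderiv j (p t) x)
    (h k : Fin n) {t : ℝ} (ht : 0 < t) (x : E n) :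
    dt (vorticity u h k) t x = ∑ i, dx i (dx i (vorticity u h k)) t x
      + (dx k (force u h) t x - dx h (force u k) t x) := by
  set U : Fin n → ℝ → E n → ℝ := fun j t x => u t x j with hU
  have sU : ∀ j, SM (U j) := fun j => SM.component hu j
  have d1 : ∀ j, DifferentiableAt ℝ (U j t) x := fun j => (sU j).slice_differentiable ht x
  have d2 : ∀ i j, DifferentiableAt ℝ (dx i (U j) t) x := fun i j =>
    ((sU j).dx i).slice_differentiable ht x
  have d3 : ∀ l i j, DifferentiableAt ℝ (dx l (dx i (U j)) t) x := fun l i j =>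
    (((sU j).dx i).dx l).slice_differentiable ht x
  -- differentiated momentum equation
  have key : ∀ a b : Fin n, dt (dx a (U b)) t x =
      ∑ j, dx j (dx j (dx a (U b))) t x - dx a (dx b p) t x
        - ∑ j, (dx a (U j) t x * dx j (U b) t x + U j t x * dx a (dx j (U b)) t x) := by
    intro a b
    have e : (fun y => dt (U b) t y) = fun y => (∑ j, dx j (dx j (U b)) t y - dx b p t y)
        - ∑ j, U j t y * dx j (U b) t y := by
      funext y
      have := hmom t ht y b
      simp only [dt, dx, hU]
      rw [eq_sub_iff_add_eq]
      exact this
    rw [(sU b).dt_dx_comm a ht x]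
    have : dx a (dt (U b)) t x = pderiv a (fun y => dt (U b) t y) x := rfl
    rw [this, e, pderiv_sub, pderiv_sub, pderiv_sum, pderiv_sum]
    · congr 1
      · congr 1
        refine Finset.sum_congr rfl fun j _ => ?_
        change dx a (dx j (dx j (U b))) t x = _
        rw [((sU b).dx j).dx_dx_comm a j ht x]
        exact dx_congr (fun t ht x => (sU b).dx_dx_comm a j ht x) j ht x
      · refine Finset.sum_congr rfl fun j _ => ?_
        rw [pderiv_mul (d1 j) (d2 j b)]
        rfl
    · exact fun j _ => (d1 j).mul (d2 j b)
    · exact fun j _ => d3 j j b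
    · exact DifferentiableAt.fun_sum fun j _ => d3 j j b
    · exact (hp.dx b).slice_differentiable ht x
    · exact (DifferentiableAt.fun_sum fun j _ => d3 j j b).sub
        ((hp.dx b).slice_differentiable ht x)
    · exact DifferentiableAt.fun_sum fun j _ => (d1 j).mul (d2 j b)
  have kf : ∀ a b : Fin n, dx a (force u b) t x = ∑ j,
      ((dx a (dx j (U b)) t x - dx a (dx b (U j)) t x) * U j t x
        + (dx j (U b) t x - dx b (U j) t x) * dx a (U j) t x) := by
    intro a b
    have : dx a (force u b) t x = pderiv a (fun y => ∑ j, (dx j (U b) t y - dx b (U j) t y) *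
      U j t y) x := rfl
    rw [this, pderiv_sum]
    · refine Finset.sum_congr rfl fun j _ => ?_
      rw [pderiv_mul (f := fun y => dx j (U b) t y - dx b (U j) t y) ((d2 j b).sub (d2 b j)) (d1 j),
        pderiv_sub (d2 j b) (d2 b j)]
      rfl
    · exact fun j _ => ((d2 j b).sub (d2 b j)).mul (d1 j)
  have e1 : dt (vorticity u h k) t x = dt (dx h (U k)) t x - dt (dx k (U h)) t x :=
    (((sU k).dx h).hasDerivAt ht x).sub (((sU h).dx k).hasDerivAt ht x) |>.deriv
  have e2 : ∀ i, dx i (dx i (vorticity u h k)) t x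
      = dx i (dx i (dx h (U k))) t x - dx i (dx i (dx k (U h))) t x := by
    intro i
    have : dx i (vorticity u h k) t = fun y => dx i (dx h (U k)) t y - dx i (dx k (U h)) t y := by
      funext y
      exact pderiv_sub (((sU k).dx h).slice_differentiable ht y)
        (((sU h).dx k).slice_differentiable ht y) i
    change pderiv i (dx i (vorticity u h k) t) x = _
    rw [this]
    exact pderiv_sub (d3 i h k) (d3 i k h) i
  rw [e1, key h k, key k h, kf, kf, hp.dx_dx_comm h k ht x, Finset.sum_congr rfl fun i _ => e2 i]
  have e3 : ∀ j, dx k (dx h (U j)) t x = dx h (dx k (U j)) t x :=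
    fun j => (sU j).dx_dx_comm k h ht x
  simp only [e3, Finset.sum_sub_distrib, Finset.sum_add_distrib, sub_mul]
  have c1 : ∀ a b : Fin n, ∑ j, U j t x * dx a (dx j (U b)) t x
      = ∑ j, dx a (dx j (U b)) t x * U j t x := fun a b =>
    Finset.sum_congr rfl fun j _ => mul_comm _ _
  have c2 : ∑ j, dx k (U j) t x * dx h (U j) t x = ∑ j, dx h (U j) t x * dx k (U j) t x :=
    Finset.sum_congr rfl fun j _ => mul_comm _ _
  have c3 : ∀ a b : Fin n, ∑ j, dx a (U j) t x * dx j (U b) t x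
      = ∑ j, dx j (U b) t x * dx a (U j) t x := fun a b =>
    Finset.sum_congr rfl fun j _ => mul_comm _ _
  rw [c1, c1, c2, c3 h k, c3 k h]
  ring

/-! ### Derivatives of the heat kernel and their decay -/

/-- The polynomially decaying majorant `t^{-(n+a)/2} (1 + |x|/√t)^{-K}`. -/
def kb (K a : ℕ) (t : ℝ) (x : E n) : ℝ := (√t ^ (n + a) * (1 + ‖x‖ / √t) ^ K)⁻¹

/-- Finite sums of functions `c t^{-b} x^γ G(t,x)` that are parabolically homogeneous of degree
`-n-a`, such as the derivatives of the heat kernel of parabolic order `a`. -/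
inductive HC : ℕ → (ℝ → E n → ℝ) → Prop
  | base : HC 0 (heatKernel n)
  | mulx {a : ℕ} {F : ℝ → E n → ℝ} (i : Fin n) : HC a F → HC (a + 1) (fun t x => x i / t * F t x)
  | divt {a : ℕ} {F : ℝ → E n → ℝ} : HC a F → HC (a + 2) (fun t x => F t x / t)
  | add {a : ℕ} {F F' : ℝ → E n → ℝ} : HC a F → HC a F' → HC a (fun t x => F t x + F' t x)
  | smul {a : ℕ} {F : ℝ → E n → ℝ} (c : ℝ) : HC a F → HC a (fun t x => c * F t x)
  | congr {a : ℕ} {F F' : ℝ → E n → ℝ} : HC a F → (∀ t, 0 < t → ∀ x, F' t x = F t x) → HC a F'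

lemma kb_nonneg (K a : ℕ) (t : ℝ) (x : E n) : 0 ≤ kb K a t x := by
  unfold kb; positivity

lemma kb_anti {K K' : ℕ} (h : K ≤ K') (a : ℕ) {t : ℝ} (ht : 0 < t) (x : E n) :
    kb K' a t x ≤ kb K a t x := by
  unfold kb
  have h1 : 1 ≤ 1 + ‖x‖ / √t := le_add_of_nonneg_right (by positivity)
  have h2 : 0 < √t := Real.sqrt_pos.2 ht
  gcongr

lemma kb_le (K a : ℕ) {t : ℝ} (ht : 0 < t) (x : E n) : kb K a t x ≤ (√t ^ (n + a))⁻¹ := by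
  refine (kb_anti (Nat.zero_le K) a ht x).trans ?_
  simp [kb]

lemma kb_add (K a b : ℕ) (t : ℝ) (x : E n) : kb K (a + b) t x = kb K a t x / √t ^ b := by
  unfold kb
  rw [← add_assoc, pow_add (√t) (n + a) b, mul_inv, mul_inv, mul_inv, div_eq_mul_inv]
  ring

/-- This is how spatial weights are paid for: derivatives of the heat kernel are bounded by `kb K`
for every `K`, so a weight of power `L` is absorbed by starting from `K + L`. -/
lemma weight_kb (K L a : ℕ) {t : ℝ} (ht : 0 < t) (x : E n) :
    (1 + ‖x‖ / √t) ^ L * kb (K + L) a t x = kb K a t x := by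
  unfold kb
  have h1 : (1 + ‖x‖ / √t) ^ L ≠ 0 := by positivity
  rw [pow_add _ K L, ← mul_assoc, mul_inv _ ((1 + ‖x‖ / √t) ^ L), mul_comm, inv_mul_cancel_right₀ h1]

lemma SM.congr_smul_inv {F : ℝ → E n → ℝ} (hF : SM F) : SM (fun t x => F t x / t) := by
  have : ContDiffOn ℝ ∞ (fun p : ℝ × E n => p.1) (Ioi 0 ×ˢ univ) := contDiff_fst.contDiffOn
  exact ContDiffOn.div hF this fun p hp => ne_of_gt hp.1

lemma SM.coord_div (i : Fin n) : SM (fun t (x : E n) => x i / t) := by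
  have h1 : ContDiff ℝ ∞ (fun p : ℝ × E n => p.2 i) := by fun_prop
  have : ContDiffOn ℝ ∞ (fun p : ℝ × E n => p.1) (Ioi 0 ×ˢ univ) := contDiff_fst.contDiffOn
  exact h1.contDiffOn.div this fun p hp => ne_of_gt hp.1

lemma SM.heatKernel : SM (heatKernel n) := by
  intro p hp
  have hp : 0 < p.1 := hp.1
  have h1 : ContDiffAt ℝ ∞ (fun p : ℝ × E n => (4 * Real.pi * p.1) ^ (-(n : ℝ) / 2)) p := by
    apply ContDiffAt.rpow_const_of_ne
    · fun_prop
    · have := Real.pi_pos; positivity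
  have h2 : ContDiffAt ℝ ∞ (fun p : ℝ × E n => Real.exp (-‖p.2‖ ^ 2 / (4 * p.1))) p := by
    apply ContDiffAt.exp
    apply ContDiffAt.div
    · exact ((contDiff_norm_sq ℝ).comp contDiff_snd).neg.contDiffAt
    · fun_prop
    · positivity
  exact (h1.mul h2).contDiffWithinAt

lemma HC.sm {a : ℕ} {F : ℝ → E n → ℝ} (h : HC a F) : SM F := by
  induction h with
  | base => exact SM.heatKernel
  | mulx i _ ih => exact (SM.coord_div i).mul ih
  | divt _ ih => exact ih.congr_smul_inv
  | add _ _ h1 h2 => exact h1.add h2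
  | smul c _ ih => exact ih.const_mul c
  | congr _ h ih => exact ih.congr h

lemma pderiv_heatKernel (i : Fin n) {t : ℝ} (ht : 0 < t) (x : E n) :
    pderiv i (heatKernel n t) x = -(1 / 2) * (x i / t * heatKernel n t x) := by
  have h1 : HasFDerivAt (fun x : E n => -‖x‖ ^ 2 / (4 * t)) ((-(1 / (4 * t))) • (2 • innerSL ℝ x)) x := by
    have h0 : HasFDerivAt (fun x : E n => ‖x‖ ^ 2) (2 • innerSL ℝ x) x := by
      rw [← fderiv_norm_sq_apply]
      exact ((contDiff_norm_sq ℝ (n := 1)).differentiable (by simp) x).hasFDerivAt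
    have h1 := h0.const_mul (-(1 / (4 * t)))
    refine h1.congr_of_eventuallyEq (Eventually.of_forall fun y => ?_)
    simp only
    ring
  have h2 := (h1.exp.const_mul ((4 * Real.pi * t) ^ (-(n : ℝ) / 2))).fderiv
  have h3 : heatKernel n t = fun x => (4 * Real.pi * t) ^ (-(n : ℝ) / 2) *
    Real.exp (-‖x‖ ^ 2 / (4 * t)) := rfl
  rw [pderiv, h3, h2]
  simp [EuclideanSpace.inner_single_right]
  field_simp
  ring

lemma dt_heatKernel {t : ℝ} (ht : 0 < t) (x : E n) :
    dt (heatKernel n) t x =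
      (-(n : ℝ) / 2) * (heatKernel n t x / t) + 1 / 4 * ∑ i, x i / t * (x i / t * heatKernel n t x) := by
  have hpi := Real.pi_pos
  have h1 : HasDerivAt (fun s : ℝ => (4 * Real.pi * s) ^ (-(n : ℝ) / 2))
      ((4 * Real.pi * 1) * (-(n : ℝ) / 2) * (4 * Real.pi * t) ^ (-(n : ℝ) / 2 - 1)) t :=
    ((hasDerivAt_id t).const_mul (4 * Real.pi)).rpow_const (Or.inl (by positivity))
  have h2 : HasDerivAt (fun s : ℝ => Real.exp (-‖x‖ ^ 2 / (4 * s)))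
      (Real.exp (-‖x‖ ^ 2 / (4 * t)) * (‖x‖ ^ 2 / (4 * t ^ 2))) t := by
    have := ((hasDerivAt_const t (-‖x‖ ^ 2)).fun_div ((hasDerivAt_id t).const_mul 4)
      (by simp; positivity)).exp
    refine this.congr_deriv ?_
    simp only [id, zero_mul, zero_sub, neg_mul, neg_neg, mul_one]
    congr 1
    field_simp
  have h3 := (h1.mul h2).deriv
  have e : (fun s => heatKernel n s x) = (fun s : ℝ => (4 * Real.pi * s) ^ (-(n : ℝ) / 2)) *
    (fun s : ℝ => Real.exp (-‖x‖ ^ 2 / (4 * s))) := rfl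
  rw [dt, e, h3, Real.rpow_sub_one (by positivity)]
  have h4 : ∑ i, x i / t * (x i / t * heatKernel n t x) = ‖x‖ ^ 2 / t ^ 2 * heatKernel n t x := by
    rw [EuclideanSpace.norm_sq_eq, Finset.sum_div, Finset.sum_mul]
    refine Finset.sum_congr rfl fun i _ => ?_
    simp
    ring
  rw [h4]
  simp only [heatKernel]
  field_simp

/-- The member `F₀` is requested only to represent the empty sum, as 0 · F₀; the inductive class has
no constructor for zero. -/
lemma HC.sum {ι : Type*} {s : Finset ι} {a : ℕ} {F₀ : ℝ → E n → ℝ} (h₀ : HC a F₀)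
    {F : ι → ℝ → E n → ℝ} (h : ∀ i ∈ s, HC a (F i)) : HC a (fun t x => ∑ i ∈ s, F i t x) := by
  classical
  induction s using Finset.induction_on with
  | empty => exact (h₀.smul 0).congr (by simp)
  | insert i s hi ih =>
    refine ((h i (by simp)).add (ih fun j hj => h j (by simp [hj]))).congr ?_
    intro t _ x
    rw [Finset.sum_insert hi]

lemma HC.dx {a : ℕ} {F : ℝ → E n → ℝ} (h : HC a F) (i : Fin n) : HC (a + 1) (dx i F) := by
  induction h with
  | base =>
    exact ((HC.base.mulx i).smul (-(1 / 2))).congr fun t ht x => pderiv_heatKernel i ht x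
  | @mulx a F j hF ih =>
    -- The derivative of x_j/t is δ_{ij}/t, and F/t has order a + 2, which is the order required.
    refine ((hF.divt.smul (if i = j then 1 else 0)).add (ih.mulx j)).congr fun t ht x => ?_
    have h1 : DifferentiableAt ℝ (fun y : E n => y j / t) x := by fun_prop
    have : pderiv i (fun y : E n => y j / t * F t y) x = _ :=
      pderiv_mul h1 (hF.sm.slice_differentiable ht x) i
    rw [NSVorticity.dx, this]
    have h2 : pderiv i (fun y : E n => y j / t) x = (if i = j then 1 else 0) / t := by
      have : HasFDerivAt (fun y : E n => y j / t) ((1 / t) • EuclideanSpace.proj (𝕜 := ℝ) j) x := by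
        have := (EuclideanSpace.proj (𝕜 := ℝ) j : E n →L[ℝ] ℝ).hasFDerivAt (x := x)
        refine (this.const_mul (1 / t)).congr_of_eventuallyEq (Eventually.of_forall fun y => ?_)
        simp [div_eq_inv_mul]
      rw [pderiv, this.fderiv]
      simp [eq_comm, div_eq_inv_mul]
    rw [h2, NSVorticity.dx]
    ring
  | @divt a F hF ih =>
    refine ih.divt.congr fun t ht x => ?_
    have h := pderiv_const_mul (1 / t) (hF.sm.slice_differentiable ht x) i
    rw [NSVorticity.dx, NSVorticity.dx]
    simp only [div_eq_inv_mul, mul_one] at h ⊢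
    exact h
  | add h1 h2 ih1 ih2 =>
    exact (ih1.add ih2).congr fun t ht x =>
      pderiv_add (h1.sm.slice_differentiable ht x) (h2.sm.slice_differentiable ht x) i
  | smul c h ih =>
    exact (ih.smul c).congr fun t ht x => pderiv_const_mul c (h.sm.slice_differentiable ht x) i
  | congr _ h ih => exact ih.congr fun t ht x => dx_congr h i ht x

lemma HC.dt {a : ℕ} {F : ℝ → E n → ℝ} (h : HC a F) : HC (a + 2) (dt F) := by
  induction h with
  | base =>
    refine ((HC.base.divt.smul (-(n : ℝ) / 2)).add ((HC.sum HC.base.divt (s := Finset.univ)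
      fun i _ => (HC.base.mulx i).mulx i).smul (1 / 4))).congr fun t ht x => ?_
    exact dt_heatKernel ht x
  | @mulx a F j hF ih =>
    refine ((hF.divt.mulx j).smul (-1) |>.add (ih.mulx j)).congr fun t ht x => ?_
    have h1 : HasDerivAt (fun s : ℝ => x j / s) (-(x j) / t ^ 2) t := by
      have := (hasDerivAt_const t (x j)).fun_div (hasDerivAt_id t) ht.ne'
      simpa using this
    have := (h1.fun_mul (hF.sm.hasDerivAt ht x)).deriv
    rw [NSVorticity.dt, this]
    field_simp
  | @divt a F hF ih =>
    refine ((hF.divt.divt.smul (-1)).add ih.divt).congr fun t ht x => ?_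
    have := ((hF.sm.hasDerivAt ht x).fun_div (hasDerivAt_id t) ht.ne').deriv
    simp only [id] at this
    rw [NSVorticity.dt, this]
    field_simp
    ring
  | add h1 h2 ih1 ih2 =>
    exact (ih1.add ih2).congr fun t ht x =>
      ((h1.sm.hasDerivAt ht x).fun_add (h2.sm.hasDerivAt ht x)).deriv
  | smul c h ih =>
    exact (ih.smul c).congr fun t ht x => ((h.sm.hasDerivAt ht x).const_mul c).deriv
  | congr _ h ih => exact ih.congr fun t ht x => dt_congr h ht x

/-- From (1+r)^K ≤ K! e^{1+r} and 1 + r − r²/4 = 2 − (r−2)²/4 ≤ 2. -/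
lemma one_add_pow_mul_exp_le (K : ℕ) {r : ℝ} (hr : 0 ≤ r) :
    (1 + r) ^ K * Real.exp (-r ^ 2 / 4) ≤ K.factorial * Real.exp 2 := by
  have h1 := Real.pow_div_factorial_le_exp (1 + r) (by linarith) K
  rw [div_le_iff₀ (by positivity)] at h1
  calc (1 + r) ^ K * Real.exp (-r ^ 2 / 4)
      ≤ (Real.exp (1 + r) * K.factorial) * Real.exp (-r ^ 2 / 4) := by gcongr
    _ = K.factorial * Real.exp (1 + r + -r ^ 2 / 4) := by rw [Real.exp_add (1 + r)]; ring
    _ ≤ K.factorial * Real.exp 2 := by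
      gcongr
      nlinarith [sq_nonneg (r - 2)]

lemma rpow_neg_half {t : ℝ} (ht : 0 < t) (k : ℕ) : t ^ (-(k : ℝ) / 2) = (√t ^ k)⁻¹ := by
  rw [Real.sqrt_eq_rpow, ← Real.rpow_natCast, ← Real.rpow_mul ht.le, ← Real.rpow_neg ht.le]
  congr 1
  ring

/-- Gaussian decay beats every power, so `K` is arbitrary while the power of √t is fixed by
parabolic homogeneity. -/
lemma HC.bound {a : ℕ} {F : ℝ → E n → ℝ} (h : HC a F) :
    ∀ K : ℕ, ∃ C : ℝ, 0 ≤ C ∧ ∀ t, 0 < t → ∀ x, |F t x| ≤ C * kb K a t x := by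
  induction h with
  | base =>
    intro K
    refine ⟨K.factorial * Real.exp 2, by positivity, fun t ht x => ?_⟩
    have hs : 0 < √t := Real.sqrt_pos.2 ht
    have hpi := Real.pi_gt_three
    rw [heatKernel, Real.mul_rpow (by positivity) ht.le, rpow_neg_half ht]
    have e : -‖x‖ ^ 2 / (4 * t) = -(‖x‖ / √t) ^ 2 / 4 := by
      rw [div_pow, Real.sq_sqrt ht.le]; field_simp
    have h1 := one_add_pow_mul_exp_le K (r := ‖x‖ / √t) (by positivity)
    have h2 : (4 * Real.pi) ^ (-(n : ℝ) / 2) ≤ 1 :=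
      Real.rpow_le_one_of_one_le_of_nonpos (by linarith) (by
        have : (0 : ℝ) ≤ n := Nat.cast_nonneg n
        linarith)
    have h3 : 0 ≤ (4 * Real.pi) ^ (-(n : ℝ) / 2) := by positivity
    rw [e, abs_of_nonneg (by positivity), kb, mul_inv, add_zero]
    rw [← le_div_iff₀' (by positivity)] at h1
    calc (4 * Real.pi) ^ (-(n : ℝ) / 2) * (√t ^ n)⁻¹ * Real.exp (-(‖x‖ / √t) ^ 2 / 4)
        ≤ 1 * (√t ^ n)⁻¹ * (K.factorial * Real.exp 2 / (1 + ‖x‖ / √t) ^ K) := by gcongr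
      _ = _ := by ring
  | @mulx a F i hF ih =>
    intro K
    -- The factor |x|/√t costs one power of the weight, and the remaining 1/√t raises the order by
    -- one.
    obtain ⟨C, hC, h⟩ := ih (K + 1)
    refine ⟨C, hC, fun t ht x => ?_⟩
    have hs : 0 < √t := Real.sqrt_pos.2 ht
    have hx : |x i| ≤ ‖x‖ := PiLp.norm_apply_le x i
    rw [abs_mul, abs_div, abs_of_pos ht, kb_add, ← weight_kb K 1 a ht, pow_one, pow_one]
    calc |x i| / t * |F t x| ≤ ‖x‖ / t * (C * kb (K + 1) a t x) := by gcongr; exact h t ht x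
      _ = C * ((‖x‖ / √t) * kb (K + 1) a t x / √t) := by
          have : t = √t * √t := (Real.mul_self_sqrt ht.le).symm
          nth_rewrite 1 [this]
          field_simp
      _ ≤ _ := by
          gcongr
          · exact kb_nonneg _ _ _ _
          · linarith
  | @divt a F hF ih =>
    intro K
    obtain ⟨C, hC, h⟩ := ih K
    refine ⟨C, hC, fun t ht x => ?_⟩
    rw [abs_div, abs_of_pos ht, kb_add, Real.sq_sqrt ht.le, ← mul_div_assoc]
    gcongr
    exact h t ht x
  | add h1 h2 ih1 ih2 =>
    intro K
    obtain ⟨C, hC, h⟩ := ih1 K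
    obtain ⟨C', hC', h'⟩ := ih2 K
    refine ⟨C + C', by positivity, fun t ht x => ?_⟩
    rw [add_mul]
    exact (abs_add_le _ _).trans (add_le_add (h t ht x) (h' t ht x))
  | smul c h ih =>
    intro K
    obtain ⟨C, hC, h⟩ := ih K
    refine ⟨|c| * C, by positivity, fun t ht x => ?_⟩
    rw [abs_mul, mul_assoc]
    gcongr
    exact h t ht x
  | congr _ h ih =>
    intro K
    obtain ⟨C, hC, h'⟩ := ih K
    exact ⟨C, hC, fun t ht x => by rw [h t ht x]; exact h' t ht x⟩

lemma heat_equation {t : ℝ} (ht : 0 < t) (x : E n) :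
    dt (heatKernel n) t x = ∑ i, dx i (dx i (heatKernel n)) t x := by
  have h : ∀ i : Fin n, dx i (dx i (heatKernel n)) t x =
      -(1 / 2) * (heatKernel n t x / t) + 1 / 4 * (x i / t * (x i / t * heatKernel n t x)) := by
    intro i
    have e : dx i (heatKernel n) t = fun y => (-(1 / 2) / t) * (y i * heatKernel n t y) := by
      funext y
      rw [dx, pderiv_heatKernel i ht y]; ring
    have d1 : DifferentiableAt ℝ (fun y : E n => y i) x := by fun_prop
    have d2 := (SM.heatKernel (n := n)).slice_differentiable ht x
    change pderiv i (dx i (heatKernel n) t) x = _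
    rw [e, pderiv_const_mul (f := fun y => y i * heatKernel n t y) _ (d1.mul d2), pderiv_mul d1 d2, pderiv_heatKernel i ht]
    have h2 : pderiv i (fun y : E n => y i) x = 1 := by
      have := (EuclideanSpace.proj (𝕜 := ℝ) i : E n →L[ℝ] ℝ).hasFDerivAt (x := x)
      have e : (fun y : E n => y i) = (EuclideanSpace.proj (𝕜 := ℝ) i : E n →L[ℝ] ℝ) := rfl
      rw [pderiv, e, this.fderiv]
      simp
    rw [h2]
    ring
  rw [dt_heatKernel ht, Finset.sum_congr rfl fun i _ => h i, Finset.sum_add_distrib,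
    ← Finset.mul_sum, ← Finset.mul_sum]
  simp only [Finset.sum_const, Finset.card_univ, Fintype.card_fin, nsmul_eq_mul]
  ring

lemma heatKernel_nonneg {t : ℝ} (ht : 0 < t) (x : E n) : 0 ≤ heatKernel n t x := by
  have := Real.pi_pos
  unfold heatKernel; positivity

lemma integral_heatKernel_one : ∫ x : E n, heatKernel n 1 x = 1 := by
  have h := GaussianFourier.integral_rexp_neg_mul_sq_norm (V := E n) (b := 1 / 4) (by norm_num)
  have hpi := Real.pi_pos
  simp only [heatKernel]
  rw [integral_const_mul]
  have e : (fun x : E n => Real.exp (-‖x‖ ^ 2 / (4 * 1))) =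
      fun x : E n => Real.exp (-(1 / 4) * ‖x‖ ^ 2) := by funext x; congr 1; ring
  rw [e, h, finrank_euclideanSpace, Fintype.card_fin]
  have : Real.pi / (1 / 4) = 4 * Real.pi * 1 := by ring
  rw [this, ← Real.rpow_add (by positivity)]
  simp [neg_div]

/-! ### Parabolic Taylor expansion of the heat kernel -/

/-- The one-dimensional Taylor formula for a chain of derivatives. -/
lemma abs_sub_taylor_le (N : ℕ) (H : ℕ → ℝ → ℝ) (y C : ℝ) (hC : 0 ≤ C)
    (hder : ∀ b < N, ∀ z, |z| ≤ |y| → HasDerivAt (H b) (H (b + 1) z) z)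
    (hN : ∀ z, |z| ≤ |y| → |H N z| ≤ C) :
    |H 0 y - ∑ b ∈ Finset.range N, y ^ b / (b.factorial : ℝ) * H b 0| ≤ C * |y| ^ N := by
  induction N generalizing H y with
  | zero => simpa using hN y le_rfl
  | succ N ih =>
    set D : ℝ → ℝ := fun z => H 0 z - ∑ b ∈ Finset.range (N + 1), z ^ b / (b.factorial : ℝ) * H b 0
    -- `D'` is the remainder of order `N` of the shifted chain, so the induction hypothesis bounds
    -- it and the mean value inequality integrates the bound. The factorial in the remainder is not
    -- needed and is given away.
    set D' : ℝ → ℝ := fun z => H 1 z - ∑ b ∈ Finset.range N, z ^ b / (b.factorial : ℝ) * H (b + 1) 0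
    have hD : ∀ z, |z| ≤ |y| → HasDerivAt D (D' z) z := by
      intro z hz
      refine (hder 0 (by omega) z hz).fun_sub ?_
      have e : (fun z : ℝ => ∑ b ∈ Finset.range (N + 1), z ^ b / (b.factorial : ℝ) * H b 0)
          = fun z => (∑ b ∈ Finset.range N, z ^ (b + 1) / ((b + 1).factorial : ℝ) * H (b + 1) 0)
            + H 0 0 := by
        funext z
        rw [Finset.sum_range_succ']
        simp
      rw [e]
      refine (HasDerivAt.fun_sum fun b _ => ?_).add_const _
      have := ((hasDerivAt_pow (b + 1) z).div_const ((b + 1).factorial : ℝ)).mul_const (H (b + 1) 0)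
      refine this.congr_deriv ?_
      rw [Nat.factorial_succ]
      push_cast
      have : ((b : ℝ) + 1) ≠ 0 := by positivity
      field_simp
    have hb : ∀ z ∈ Icc (-|y|) |y|, ‖D' z‖ ≤ C * |y| ^ N := by
      intro z hz
      have hz : |z| ≤ |y| := abs_le.2 hz
      refine (ih (fun b => H (b + 1)) z (fun b hb w hw => hder (b + 1) (by omega) w (hw.trans hz))
        (fun w hw => hN w (hw.trans hz))).trans ?_
      gcongr
    have := (convex_Icc (-|y|) |y|).norm_image_sub_le_of_norm_hasDerivWithin_le
      (fun z hz => (hD z (abs_le.2 hz)).hasDerivWithinAt) hb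
      (x := 0) (y := y) ⟨by simp, by simp⟩ (abs_le.1 le_rfl)
    have D0 : D 0 = 0 := by
      simp [D, Finset.sum_range_succ']
    rw [D0, sub_zero, sub_zero] at this
    rw [pow_succ, ← mul_assoc]
    exact this

/-- Derivatives in the coordinates of a list. -/
def listDeriv (L : List (Fin n)) (β : Fin n → ℕ) (f : E n → ℝ) : E n → ℝ :=
  L.foldr (fun i g => (pderiv i)^[β i] g) f

lemma listDeriv_congr {L : List (Fin n)} {β γ : Fin n → ℕ} (h : ∀ i ∈ L, β i = γ i) (f : E n → ℝ) :
    listDeriv L β f = listDeriv L γ f := by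
  induction L with
  | nil => rfl
  | cons v L ih =>
    have h1 := ih fun i hi => h i (by simp [hi])
    simp only [listDeriv, List.foldr_cons] at h1 ⊢
    rw [h1, h v (by simp)]

lemma HC.iterate_pderiv {a : ℕ} {F : ℝ → E n → ℝ} (h : HC a F) (i : Fin n) (b : ℕ) :
    HC (a + b) (fun t => (pderiv i)^[b] (F t)) := by
  induction b with
  | zero => exact h
  | succ b ih =>
    refine (ih.dx i).congr fun t _ x => ?_
    rw [Function.iterate_succ_apply']
    rfl

lemma HC.listD {a : ℕ} {F : ℝ → E n → ℝ} (h : HC a F) (L : List (Fin n)) (β : Fin n → ℕ) :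
    HC (a + (L.map β).sum) (fun t => listDeriv L β (F t)) := by
  induction L with
  | nil => exact h
  | cons v L ih =>
    have := ih.iterate_pderiv v (β v)
    rw [List.map_cons, List.sum_cons, Nat.add_comm (β v), ← Nat.add_assoc]
    exact this

lemma HC.multiD {a : ℕ} {F : ℝ → E n → ℝ} (h : HC a F) (β : Fin n → ℕ) :
    HC (a + ∑ i, β i) (fun t => multiDeriv β (F t)) := by
  have := h.listD (List.finRange n) β
  rwa [← List.ofFn_eq_map, List.sum_ofFn] at this

lemma HC.iterD {a : ℕ} {F : ℝ → E n → ℝ} (h : HC a F) (l : ℕ) :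
    HC (a + 2 * l) (fun t x => iteratedDeriv l (fun s => F s x) t) := by
  induction l with
  | zero => exact h.congr fun t _ x => by simp
  | succ l ih =>
    refine ih.dt.congr fun t _ x => ?_
    rw [iteratedDeriv_succ]
    rfl

/-- A displacement of at most two parabolic lengths changes 1 + |x|/√t by a factor at most 3. -/
lemma kb_shift (K a : ℕ) {t : ℝ} (ht : 0 < t) (x z : E n) (hz : ‖z‖ ≤ 2 * √t) :
    kb K a t (x + z) ≤ 3 ^ K * kb K a t x := by
  have hs : 0 < √t := Real.sqrt_pos.2 ht
  have h1 : 1 + ‖x‖ / √t ≤ 3 * (1 + ‖x + z‖ / √t) := by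
    have : ‖x‖ ≤ ‖x + z‖ + ‖z‖ := by simpa using norm_sub_le (x + z) z
    have h2 : ‖x‖ / √t ≤ (‖x + z‖ + 2 * √t) / √t := by gcongr; linarith
    rw [add_div, mul_div_cancel_right₀ _ hs.ne'] at h2
    have : 0 ≤ ‖x + z‖ / √t := by positivity
    linarith
  have h3 : (1 + ‖x‖ / √t) ^ K ≤ 3 ^ K * (1 + ‖x + z‖ / √t) ^ K := by
    rw [← mul_pow]; gcongr
  unfold kb
  rw [mul_inv, mul_inv, mul_left_comm]
  gcongr
  rw [← div_eq_mul_inv, le_div_iff₀ (by positivity), inv_mul_le_iff₀ (by positivity)]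
  linarith

lemma kb_time (K a : ℕ) {t t' : ℝ} (ht : 0 < t) (h1 : t / 2 ≤ t') (h2 : t' ≤ 2 * t) (x : E n) :
    kb K a t' x ≤ 2 ^ (n + a + K) * kb K a t x := by
  have h0 : 0 < √t := Real.sqrt_pos.2 ht
  have h1 : √t ≤ 2 * √t' := by
    rw [Real.sqrt_le_left (by positivity), mul_pow, Real.sq_sqrt (by linarith)]
    linarith
  have h2 : √t' ≤ 2 * √t := by
    rw [Real.sqrt_le_left (by positivity), mul_pow, Real.sq_sqrt (by linarith)]
    linarith
  have h3 : 0 < √t' := by linarith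
  unfold kb
  rw [mul_inv, mul_inv, pow_add 2 (n + a), mul_mul_mul_comm]
  have h4 : (√t' ^ (n + a))⁻¹ ≤ 2 ^ (n + a) * (√t ^ (n + a))⁻¹ := by
    rw [← div_eq_mul_inv, le_div_iff₀ (by positivity), inv_mul_le_iff₀ (by positivity), mul_comm,
      ← mul_pow]
    gcongr
  have h5 : ((1 + ‖x‖ / √t') ^ K)⁻¹ ≤ 2 ^ K * ((1 + ‖x‖ / √t) ^ K)⁻¹ := by
    rw [← div_eq_mul_inv, le_div_iff₀ (by positivity), inv_mul_le_iff₀ (by positivity), mul_comm,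
      ← mul_pow]
    gcongr
    rw [mul_add, mul_one]
    have h6 : ‖x‖ / √t ≤ 2 * (‖x‖ / √t') := by
      rw [mul_div_assoc', div_le_div_iff₀ h0 h3]
      nlinarith [norm_nonneg x]
    linarith
  gcongr

lemma hasDerivAt_line {f : E n → ℝ} (hf : Differentiable ℝ f) (x : E n) (v : Fin n) (z : ℝ) :
    HasDerivAt (fun z : ℝ => f (x + z • ev v)) (pderiv v f (x + z • ev v)) z := by
  have h1 : HasDerivAt (fun z : ℝ => x + z • ev v) (ev v) z := by
    simpa using ((hasDerivAt_id z).smul_const (ev v)).const_add x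
  exact (hf (x + z • ev v)).hasFDerivAt.comp_hasDerivAt z h1

/-- Spatial remainders of order `N`. -/
def SpaceRem (K a N : ℕ) (R : ℝ → E n → E n → ℝ) : Prop :=
  ∃ C : ℝ, 0 ≤ C ∧ ∀ t, 0 < t → ∀ x y : E n, ‖y‖ ≤ 2 * √t →
    |R t x y| ≤ C * kb K a t x * (‖y‖ / √t) ^ N

lemma SpaceRem.add {K a N : ℕ} {R R' : ℝ → E n → E n → ℝ} (h : SpaceRem K a N R)
    (h' : SpaceRem K a N R') : SpaceRem K a N (fun t x y => R t x y + R' t x y) := by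
  obtain ⟨C, hC, h⟩ := h
  obtain ⟨C', hC', h'⟩ := h'
  refine ⟨C + C', by positivity, fun t ht x y hy => ?_⟩
  rw [add_mul, add_mul]
  exact (abs_add_le _ _).trans (add_le_add (h t ht x y hy) (h' t ht x y hy))

lemma SpaceRem.sum {ι : Type*} {s : Finset ι} {K a N : ℕ} {R : ι → ℝ → E n → E n → ℝ}
    (h : ∀ i ∈ s, SpaceRem K a N (R i)) : SpaceRem K a N (fun t x y => ∑ i ∈ s, R i t x y) := by
  classical
  induction s using Finset.induction_on with
  | empty => exact ⟨0, le_rfl, by simp⟩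
  | insert i s hi ih =>
    have := (h i (by simp)).add (ih fun j hj => h j (by simp [hj]))
    simpa only [Finset.sum_insert hi] using this

lemma abs_monom_le (β : Fin n → ℕ) (y : E n) : |monom β (-y)| ≤ ‖y‖ ^ ∑ i, β i := by
  rw [monom, Finset.abs_prod, ← Finset.prod_pow_eq_pow_sum]
  refine Finset.prod_le_prod (fun i _ => abs_nonneg _) fun i _ => ?_
  rw [abs_pow]
  have : |(-y) i| ≤ ‖y‖ := by simpa using PiLp.norm_apply_le y i
  gcongr

lemma abs_monom_div_le (β : Fin n → ℕ) (y : E n) :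
    |monom β (-y) / (multiFactorial β : ℝ)| ≤ ‖y‖ ^ ∑ i, β i := by
  rw [abs_div]
  refine (div_le_self (abs_nonneg _) ?_).trans (abs_monom_le β y)
  rw [Nat.abs_cast]
  exact_mod_cast Nat.one_le_iff_ne_zero.2 (Finset.prod_ne_zero_iff.2 fun i _ => Nat.factorial_ne_zero _)

/-- The part of a vector supported on a finite set of coordinates. -/
def partOf (s : Finset (Fin n)) (y : E n) : E n := ∑ i ∈ s, y i • ev i

lemma norm_coord_smul_le (y : E n) (v : Fin n) : ‖y v • ev v‖ ≤ ‖y‖ := by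
  rw [norm_smul]
  simpa using PiLp.norm_apply_le y v

lemma partOf_univ (y : E n) : partOf Finset.univ y = y := by
  ext j
  simp [partOf, Pi.single_apply]

lemma multiFactorial_add_single {β : Fin n → ℕ} {v : Fin n} (hv : β v = 0) (b : ℕ) :
    multiFactorial (β + fun i => if i = v then b else 0) = multiFactorial β * b.factorial := by
  classical
  unfold multiFactorial
  rw [← Finset.mul_prod_erase _ _ (Finset.mem_univ v), ← Finset.mul_prod_erase _ (fun i => (β i).factorial)
    (Finset.mem_univ v), Finset.prod_congr rfl (g := fun i => (β i).factorial)]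
  · simp [hv, mul_comm]
  · intro i hi
    simp [Finset.ne_of_mem_erase hi]

lemma monom_add_single {β : Fin n → ℕ} {v : Fin n} (b : ℕ) (y : E n) :
    monom (β + fun i => if i = v then b else 0) y = monom β y * y v ^ b := by
  classical
  unfold monom
  simp only [Pi.add_apply, pow_add, Finset.prod_mul_distrib]
  congr 1
  rw [Finset.prod_eq_single v] <;> simp +contextual

lemma listDeriv_add_single {L : List (Fin n)} {β : Fin n → ℕ} {v : Fin n} (hv : β v = 0)
    (hL : v ∉ L) (b : ℕ) (f : E n → ℝ) :
    listDeriv (v :: L) (β + fun i => if i = v then b else 0) f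
      = (pderiv v)^[b] (listDeriv L β f) := by
  have h1 : listDeriv L (β + fun i => if i = v then b else 0) f = listDeriv L β f := by
    refine listDeriv_congr (fun i hi => ?_) f
    have : i ≠ v := fun h => hL (h ▸ hi)
    simp [this]
  have h2 : (β + fun i => if i = v then b else 0) v = b := by simp [hv]
  simp only [listDeriv, List.foldr_cons] at h1 ⊢
  rw [h1, h2]

/-- Taylor's formula in the coordinates of a list. -/
lemma HC.spaceTaylor_list {L : List (Fin n)} (hL : L.Nodup) {a : ℕ} {F : ℝ → E n → ℝ}
    (h : HC a F) (K N : ℕ) :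
    SpaceRem K a N (fun t x y => F t (x - partOf L.toFinset y) -
      ∑ j ∈ Finset.range N, ∑ β ∈ Finset.piAntidiag L.toFinset j,
        monom β (-y) / (multiFactorial β : ℝ) * listDeriv L β (F t) x) := by
  induction L generalizing N with
  | nil =>
    rcases N with _ | N
    · obtain ⟨C, hC, hb⟩ := h.bound K
      exact ⟨C, hC, fun t ht x y _ => by simpa [partOf] using hb t ht x⟩
    · refine ⟨0, le_rfl, fun t ht x y _ => ?_⟩
      have : ∀ j ∈ Finset.range N, ∑ β ∈ Finset.piAntidiag ([] : List (Fin n)).toFinset (j + 1),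
        monom β (-y) / (multiFactorial β : ℝ) * listDeriv [] β (F t) x = 0 := by
        intro j _
        simp
      beta_reduce
      rw [Finset.sum_range_succ', Finset.sum_eq_zero this]
      simp [partOf, monom, multiFactorial, listDeriv]
  | cons v L ih =>
    have hv : v ∉ L := (List.nodup_cons.1 hL).1
    have hv' : v ∉ L.toFinset := by simpa using hv
    have hβv : ∀ {j : ℕ} {β : Fin n → ℕ}, β ∈ Finset.piAntidiag L.toFinset j → β v = 0 := by
      intro j β hβ
      by_contra hne
      exact hv' ((Finset.mem_piAntidiag.1 hβ).2 v hne)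
    have hsum : ∀ {j : ℕ} {β : Fin n → ℕ}, β ∈ Finset.piAntidiag L.toFinset j →
        ∑ i, β i = j ∧ (L.map β).sum = j := by
      intro j β hβ
      obtain ⟨h1, h2⟩ := Finset.mem_piAntidiag.1 hβ
      constructor
      · rw [← h1]
        refine (Finset.sum_subset (Finset.subset_univ _) fun i _ hi => ?_).symm
        by_contra hne
        exact hi (h2 i hne)
      · rw [← h1, ← List.sum_toFinset β (List.nodup_cons.1 hL).2]
    -- the remainder of the expansion in the tail
    have h1 : SpaceRem K a N (fun t x y => F t (x - y v • ev v - partOf L.toFinset y) -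
      ∑ j ∈ Finset.range N, ∑ β ∈ Finset.piAntidiag L.toFinset j,
        monom β (-y) / (multiFactorial β : ℝ) * listDeriv L β (F t) (x - y v • ev v)) := by
      obtain ⟨C, hC, hb⟩ := ih (List.nodup_cons.1 hL).2 N
      refine ⟨C * 3 ^ K, by positivity, fun t ht x y hy => ?_⟩
      refine (hb t ht (x - y v • ev v) y hy).trans ?_
      have : kb K a t (x - y v • ev v) ≤ 3 ^ K * kb K a t x := by
        rw [sub_eq_add_neg]
        refine kb_shift K a ht x _ ?_
        rw [norm_neg]
        exact (norm_coord_smul_le y v).trans hy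
      refine mul_le_mul_of_nonneg_right ?_ (by positivity)
      rw [mul_assoc C]
      gcongr
    -- the remainders of the expansions in the first coordinate
    have h2 : ∀ j ∈ Finset.range N, ∀ β ∈ Finset.piAntidiag L.toFinset j,
        SpaceRem K a N (fun t x y => monom β (-y) / (multiFactorial β : ℝ) *
          (listDeriv L β (F t) (x - y v • ev v) - ∑ b ∈ Finset.range (N - j),
            (-y v) ^ b / (b.factorial : ℝ) * (pderiv v)^[b] (listDeriv L β (F t)) x)) := by
      intro j hj β hβ
      have hj := Finset.mem_range.1 hj
      have hG : HC (a + j) (fun t => listDeriv L β (F t)) := by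
        have := h.listD L β
        rwa [(hsum hβ).2] at this
      have hI := hG.iterate_pderiv v
      -- A coefficient of order j in the other coordinates carries the factor |y|^j already, so
      -- expanding it to order N − j in the new coordinate makes the total order N.
      obtain ⟨C, hC, hb⟩ := (hI (N - j)).bound K
      refine ⟨C * 3 ^ K, by positivity, fun t ht x y hy => ?_⟩
      have hs : 0 < √t := Real.sqrt_pos.2 ht
      have hyv : |y v| ≤ ‖y‖ := PiLp.norm_apply_le y v
      have := abs_sub_taylor_le (N - j)
        (fun b z => (pderiv v)^[b] (listDeriv L β (F t)) (x + z • ev v)) (-y v)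
        (C * 3 ^ K * kb K (a + j + (N - j)) t x)
        (by have := kb_nonneg K (a + j + (N - j)) t x; positivity) ?_ ?_
      · simp only [Function.iterate_zero, id, zero_smul, add_zero, neg_smul, ← sub_eq_add_neg,
          abs_neg] at this
        rw [abs_mul]
        have hjN : j + (N - j) = N := by omega
        calc _ ≤ ‖y‖ ^ j * (C * 3 ^ K * kb K (a + j + (N - j)) t x * ‖y‖ ^ (N - j)) := by
              refine mul_le_mul ?_ (this.trans ?_) (abs_nonneg _) (by positivity)
              · rw [← (hsum hβ).1]; exact abs_monom_div_le β y
              · have := kb_nonneg K (a + j + (N - j)) t x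
                gcongr
          _ = C * 3 ^ K * kb K (a + N) t x * ‖y‖ ^ N := by
              have e : ‖y‖ ^ j * ‖y‖ ^ (N - j) = ‖y‖ ^ N := by rw [← pow_add, hjN]
              rw [add_assoc, hjN, ← e]; ring
          _ = _ := by rw [kb_add, div_pow]; ring
      · intro b _ z _
        have := hasDerivAt_line ((hI b).sm.slice_differentiable ht) x v z
        simpa only [Function.iterate_succ_apply'] using this
      · intro z hz
        refine (hb t ht _).trans ?_
        rw [mul_assoc]
        gcongr
        refine kb_shift K _ ht x _ ?_
        rw [abs_neg] at hz
        rw [norm_smul]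
        simp only [PiLp.norm_single, norm_one, mul_one, Real.norm_eq_abs]
        linarith
    refine (h1.add (SpaceRem.sum fun j hj => SpaceRem.sum (h2 j hj))) |> fun h3 => ?_
    convert h3 using 4 with t x y
    have e1 : x - partOf (v :: L).toFinset y = x - y v • ev v - partOf L.toFinset y := by
      rw [List.toFinset_cons, partOf, Finset.sum_insert hv', partOf]; abel
    rw [e1]
    simp only [mul_sub, Finset.sum_sub_distrib]
    rw [sub_add_sub_cancel]
    congr 1
    -- A multi-index of order J on `v :: L` splits into one of order k on `L` and the exponent J − k
    -- of `v`. Summed over J < N these pairs form a triangle, which `Finset.sum_range_diag_flip`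
    -- reorders.
    have e2 : ∀ J, ∑ β ∈ Finset.piAntidiag (v :: L).toFinset J,
        monom β (-y) / (multiFactorial β : ℝ) * listDeriv (v :: L) β (F t) x
        = ∑ k ∈ Finset.range (J + 1), ∑ β ∈ Finset.piAntidiag L.toFinset k,
          monom β (-y) / (multiFactorial β : ℝ) * ((-y v) ^ (J - k) / ((J - k).factorial : ℝ) *
            (pderiv v)^[J - k] (listDeriv L β (F t)) x) := by
      intro J
      rw [List.toFinset_cons, ← Finset.cons_eq_insert _ _ hv', Finset.piAntidiag_cons,
        Finset.sum_disjiUnion, Finset.Nat.sum_antidiagonal_eq_sum_range_succ_mk,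
        ← Finset.sum_range_reflect]
      refine Finset.sum_congr rfl fun k hk => ?_
      have hk := Finset.mem_range.1 hk
      rw [Finset.sum_map]
      have e3 : J - (J + 1 - 1 - k) = k := by omega
      have e4 : J + 1 - 1 - k = J - k := by omega
      simp only [e3]
      refine Finset.sum_congr rfl fun β hβ => ?_
      rw [e4]
      simp only [addRightEmbedding_apply]
      rw [multiFactorial_add_single (hβv hβ), monom_add_single, listDeriv_add_single (hβv hβ) hv]
      simp only [PiLp.neg_apply]
      push_cast
      rw [mul_div_mul_comm]
      ring
    rw [Finset.sum_congr rfl fun J _ => e2 J]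
    simp only [Finset.mul_sum]
    have := Finset.sum_range_diag_flip N (fun k b => ∑ β ∈ Finset.piAntidiag L.toFinset k,
          monom β (-y) / (multiFactorial β : ℝ) * ((-y v) ^ b / (b.factorial : ℝ) *
            (pderiv v)^[b] (listDeriv L β (F t)) x))
    rw [this]
    refine Finset.sum_congr rfl fun j _ => ?_
    rw [Finset.sum_comm]

lemma HC.spaceTaylor {a : ℕ} {F : ℝ → E n → ℝ} (h : HC a F) (K N : ℕ) :
    SpaceRem K a N (fun t x y => F t (x - y) -
      ∑ j ∈ Finset.range N, ∑ β ∈ Finset.piAntidiag Finset.univ j,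
        monom β (-y) / (multiFactorial β : ℝ) * multiDeriv β (F t) x) := by
  have := h.spaceTaylor_list (List.nodup_finRange n) K N
  simp only [List.toFinset_finRange, partOf_univ] at this
  exact this

/-- The parabolic Taylor polynomial of order less than `N` of `(s, y) ↦ F (t - s) (x - y)`. -/
def heatTaylor (N : ℕ) (F : ℝ → E n → ℝ) (t : ℝ) (x : E n) (s : ℝ) (y : E n) : ℝ :=
  ∑ j ∈ Finset.range N, ∑ l ∈ Finset.range (j / 2 + 1),
    ∑ β ∈ Finset.piAntidiag (Finset.univ : Finset (Fin n)) (j - 2 * l),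
      iteratedDeriv l (fun τ => multiDeriv β (F τ) x) t /
        ((l.factorial : ℝ) * (multiFactorial β : ℝ)) * ((-s) ^ l * monom β (-y))

/-- With j = i + 2l, the condition j < N on the time order l reads l < (N − i + 1)/2 in integer
division. -/
lemma sum_parabolic_reindex (N : ℕ) (f : ℕ → ℕ → ℝ) :
    ∑ i ∈ Finset.range N, ∑ l ∈ Finset.range ((N - i + 1) / 2), f i l
      = ∑ j ∈ Finset.range N, ∑ l ∈ Finset.range (j / 2 + 1), f (j - 2 * l) l := by
  rw [Finset.sum_sigma', Finset.sum_sigma']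
  refine Finset.sum_nbij' (fun p => ⟨p.1 + 2 * p.2, p.2⟩) (fun p => ⟨p.1 - 2 * p.2, p.2⟩)
    ?_ ?_ ?_ ?_ ?_
  · rintro ⟨i, l⟩ h
    simp only [Finset.mem_sigma, Finset.mem_range] at h ⊢
    omega
  · rintro ⟨i, l⟩ h
    simp only [Finset.mem_sigma, Finset.mem_range] at h ⊢
    omega
  · rintro ⟨i, l⟩ h
    simp
  · rintro ⟨i, l⟩ h
    simp only [Finset.mem_sigma, Finset.mem_range] at h
    have : i - 2 * l + 2 * l = i := by omega
    simp [this]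
  · rintro ⟨i, l⟩ h
    simp

lemma sum_of_mem_piAntidiag {j : ℕ} {β : Fin n → ℕ}
    (h : β ∈ Finset.piAntidiag (Finset.univ : Finset (Fin n)) j) : ∑ i, β i = j :=
  (Finset.mem_piAntidiag.1 h).1

/-- Space-time remainders of parabolic order `N` near the origin. -/
def NearRem (K a N : ℕ) (R : ℝ → E n → ℝ → E n → ℝ) : Prop :=
  ∃ C : ℝ, 0 ≤ C ∧ ∀ t, 0 < t → ∀ x : E n, ∀ s, 0 ≤ s → s ≤ t / 2 → ∀ y : E n, ‖y‖ ≤ √t →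
    |R t x s y| ≤ C * kb K a t x * ((√s + ‖y‖) / √t) ^ N

lemma NearRem.add {K a N : ℕ} {R R' : ℝ → E n → ℝ → E n → ℝ} (h : NearRem K a N R)
    (h' : NearRem K a N R') : NearRem K a N (fun t x s y => R t x s y + R' t x s y) := by
  obtain ⟨C, hC, h⟩ := h
  obtain ⟨C', hC', h'⟩ := h'
  refine ⟨C + C', by positivity, fun t ht x s hs hst y hy => ?_⟩
  rw [add_mul, add_mul]
  exact (abs_add_le _ _).trans (add_le_add (h t ht x s hs hst y hy) (h' t ht x s hs hst y hy))

lemma NearRem.sum {ι : Type*} {s : Finset ι} {K a N : ℕ} {R : ι → ℝ → E n → ℝ → E n → ℝ}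
    (h : ∀ i ∈ s, NearRem K a N (R i)) :
    NearRem K a N (fun t x τ y => ∑ i ∈ s, R i t x τ y) := by
  classical
  induction s using Finset.induction_on with
  | empty => exact ⟨0, le_rfl, by simp⟩
  | insert i s hi ih =>
    have := (h i (by simp)).add (ih fun j hj => h j (by simp [hj]))
    simpa only [Finset.sum_insert hi] using this

/-- After the spatial expansion, the coefficient of order i still has to be expanded in time, only
as far as the total parabolic order N. -/
lemma HC.timeTaylor {a i N : ℕ} (hi : i < N) {G : ℝ → E n → ℝ} (hG : HC (a + i) G)
    {β : Fin n → ℕ} (hβ : ∑ j, β j = i) (K : ℕ) :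
    NearRem K a N (fun t x s y => monom β (-y) / (multiFactorial β : ℝ) *
      (G (t - s) x - ∑ l ∈ Finset.range ((N - i + 1) / 2),
        (-s) ^ l / (l.factorial : ℝ) * iteratedDeriv l (fun τ => G τ x) t)) := by
  set L := (N - i + 1) / 2 with hL
  obtain ⟨C, hC, hb⟩ := (hG.iterD L).bound K
  refine ⟨C * 2 ^ (n + (a + i + 2 * L) + K) * 2 ^ (i + 2 * L), by positivity,
    fun t ht x s hs hst y hy => ?_⟩
  have h0 : 0 < √t := Real.sqrt_pos.2 ht
  have hk := kb_nonneg K (a + i + 2 * L) t x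
  have := abs_sub_taylor_le L (fun l z => iteratedDeriv l (fun τ => G τ x) (t + z)) (-s)
    (C * (2 ^ (n + (a + i + 2 * L) + K) * kb K (a + i + 2 * L) t x)) (by positivity) ?_ ?_
  · simp only [iteratedDeriv_zero, add_zero, ← sub_eq_add_neg, abs_neg, abs_of_nonneg hs] at this
    rw [abs_mul]
    have hr : (√s + ‖y‖) / √t ≤ 2 := by
      rw [div_le_iff₀ h0]
      have : √s ≤ √t := Real.sqrt_le_sqrt (by linarith)
      linarith
    have hr0 : 0 ≤ (√s + ‖y‖) / √t := by positivity
    -- Time derivatives count twice, so the order reached is N or N + 1. The surplus power of (√s +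
    -- |y|)/√t is harmless, because this ratio is at most 2 here.
    have hge : N ≤ i + 2 * L := by omega
    calc _ ≤ ‖y‖ ^ i * (C * (2 ^ (n + (a + i + 2 * L) + K) * kb K (a + i + 2 * L) t x) * s ^ L) := by
          refine mul_le_mul ?_ this (abs_nonneg _) (by positivity)
          rw [← hβ]; exact abs_monom_div_le β y
      _ = C * 2 ^ (n + (a + i + 2 * L) + K) * kb K a t x *
            ((‖y‖ / √t) ^ i * (√s / √t) ^ (2 * L)) := by
          rw [add_assoc a, kb_add, pow_add (√t), div_pow, div_pow, pow_mul (√s), Real.sq_sqrt hs]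
          field_simp
      _ ≤ C * 2 ^ (n + (a + i + 2 * L) + K) * kb K a t x *
            (((√s + ‖y‖) / √t) ^ i * ((√s + ‖y‖) / √t) ^ (2 * L)) := by
          have := kb_nonneg K a t x
          have : 0 ≤ √s := Real.sqrt_nonneg s
          have : 0 ≤ ‖y‖ := norm_nonneg y
          gcongr <;> linarith
      _ = C * 2 ^ (n + (a + i + 2 * L) + K) * kb K a t x *
            (((√s + ‖y‖) / √t) ^ (i + 2 * L - N) * ((√s + ‖y‖) / √t) ^ N) := by
          rw [← pow_add, ← pow_add, Nat.sub_add_cancel hge]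
      _ ≤ C * 2 ^ (n + (a + i + 2 * L) + K) * kb K a t x *
            (2 ^ (i + 2 * L) * ((√s + ‖y‖) / √t) ^ N) := by
          have := kb_nonneg K a t x
          gcongr
          calc ((√s + ‖y‖) / √t) ^ (i + 2 * L - N) ≤ 2 ^ (i + 2 * L - N) := by gcongr
            _ ≤ 2 ^ (i + 2 * L) := by gcongr <;> [norm_num; omega]
      _ = _ := by ring
  · intro l _ z hz
    rw [abs_neg, abs_of_nonneg hs] at hz
    have ht' : 0 < t + z := by linarith [(abs_le.1 hz).1]
    have h1 := (hG.iterD l).sm.hasDerivAt ht' x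
    rw [iteratedDeriv_succ]
    exact h1.comp_const_add t z
  · intro z hz
    rw [abs_neg, abs_of_nonneg hs] at hz
    refine (hb (t + z) (by linarith [(abs_le.1 hz).1]) x).trans ?_
    gcongr
    exact kb_time K (a + i + 2 * L) ht (by linarith [(abs_le.1 hz).1])
      (by linarith [(abs_le.1 hz).2]) x

lemma heatTaylor_eq (N : ℕ) (F : ℝ → E n → ℝ) (t : ℝ) (x : E n) (s : ℝ) (y : E n) :
    heatTaylor N F t x s y = ∑ i ∈ Finset.range N, ∑ β ∈ Finset.piAntidiag Finset.univ i,
      monom β (-y) / (multiFactorial β : ℝ) * ∑ l ∈ Finset.range ((N - i + 1) / 2),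
        (-s) ^ l / (l.factorial : ℝ) * iteratedDeriv l (fun τ => multiDeriv β (F τ) x) t := by
  have h1 : ∀ i, ∑ β ∈ Finset.piAntidiag Finset.univ i,
      monom β (-y) / (multiFactorial β : ℝ) * ∑ l ∈ Finset.range ((N - i + 1) / 2),
        (-s) ^ l / (l.factorial : ℝ) * iteratedDeriv l (fun τ => multiDeriv β (F τ) x) t
      = ∑ l ∈ Finset.range ((N - i + 1) / 2), ∑ β ∈ Finset.piAntidiag Finset.univ i,
        iteratedDeriv l (fun τ => multiDeriv β (F τ) x) t /
        ((l.factorial : ℝ) * (multiFactorial β : ℝ)) * ((-s) ^ l * monom β (-y)) := by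
    intro i
    rw [Finset.sum_comm]
    refine Finset.sum_congr rfl fun β _ => ?_
    rw [Finset.mul_sum]
    refine Finset.sum_congr rfl fun l _ => ?_
    rw [← div_div, div_eq_mul_inv, div_eq_mul_inv, div_eq_mul_inv, div_eq_mul_inv]
    ring
  rw [Finset.sum_congr rfl fun i _ => h1 i]
  exact (sum_parabolic_reindex N fun i l => ∑ β ∈ Finset.piAntidiag Finset.univ i,
        iteratedDeriv l (fun τ => multiDeriv β (F τ) x) t /
        ((l.factorial : ℝ) * (multiFactorial β : ℝ)) * ((-s) ^ l * monom β (-y))).symm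

/-- The expansion is made in space at time t − s first, and the coefficients are then expanded in
time about t. -/
lemma HC.nearTaylor {a : ℕ} {F : ℝ → E n → ℝ} (h : HC a F) (K N : ℕ) :
    NearRem K a N (fun t x s y => F (t - s) (x - y) - heatTaylor N F t x s y) := by
  have h1 : NearRem K a N (fun t x s y => F (t - s) (x - y) -
      ∑ i ∈ Finset.range N, ∑ β ∈ Finset.piAntidiag Finset.univ i,
        monom β (-y) / (multiFactorial β : ℝ) * multiDeriv β (F (t - s)) x) := by
    obtain ⟨C, hC, hb⟩ := h.spaceTaylor K N
    refine ⟨C * 2 ^ (n + a + K) * 2 ^ N, by positivity, fun t ht x s hs hst y hy => ?_⟩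
    have h0 : 0 < √t := Real.sqrt_pos.2 ht
    -- Here s ≤ t/2 is used. It is also the reason why `SpaceRem` admits |y| up to twice the
    -- parabolic length: |y| ≤ √t has to be admissible at time t − s.
    have h1 : √t ≤ 2 * √(t - s) := by
      rw [Real.sqrt_le_left (by positivity), mul_pow, Real.sq_sqrt (by linarith)]
      linarith
    have h2 : 0 < √(t - s) := by linarith
    refine (hb (t - s) (by linarith) x y (hy.trans h1)).trans ?_
    calc _ ≤ C * (2 ^ (n + a + K) * kb K a t x) * (2 * ((√s + ‖y‖) / √t)) ^ N := by
          have := kb_nonneg K a t x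
          gcongr
          · exact kb_time K a ht (by linarith) (by linarith) x
          · rw [mul_div_assoc', div_le_div_iff₀ h2 h0]
            nlinarith [norm_nonneg y, Real.sqrt_nonneg s]
      _ = _ := by rw [mul_pow]; ring
  have h2 := NearRem.sum (s := Finset.range N) fun i hi =>
    NearRem.sum (s := Finset.piAntidiag Finset.univ i) fun β hβ =>
      HC.timeTaylor (β := β) (a := a) (Finset.mem_range.1 hi) (by
        have := h.multiD β
        rwa [sum_of_mem_piAntidiag hβ] at this) (sum_of_mem_piAntidiag hβ) K
  refine (h1.add h2) |> fun h3 => ?_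
  convert h3 using 5 with t x s y
  simp only [mul_sub, Finset.sum_sub_distrib]
  rw [sub_add_sub_cancel, heatTaylor_eq]

/-- The coefficients of the parabolic Taylor polynomial belong to the heat class. -/
lemma HC.coeff {a : ℕ} {F : ℝ → E n → ℝ} (h : HC a F) (l : ℕ) (β : Fin n → ℕ) :
    HC (a + (2 * l + ∑ i, β i)) (fun t x => iteratedDeriv l (fun τ => multiDeriv β (F τ) x) t) := by
  have := (h.multiD β).iterD l
  rwa [add_assoc, add_comm (∑ i, β i)] at this

lemma HC.coeff_bound {a : ℕ} {F : ℝ → E n → ℝ} (h : HC a F) (K l : ℕ) (β : Fin n → ℕ) :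
    ∃ C : ℝ, 0 ≤ C ∧ ∀ t, 0 < t → ∀ x,
      |iteratedDeriv l (fun τ => multiDeriv β (F τ) x) t /
        ((l.factorial : ℝ) * (multiFactorial β : ℝ))|
        ≤ C * kb K (a + (2 * l + ∑ i, β i)) t x := by
  obtain ⟨C, hC, hb⟩ := ((h.coeff l β).smul
    (((l.factorial : ℝ) * (multiFactorial β : ℝ))⁻¹)).bound K
  refine ⟨C, hC, fun t ht x => ?_⟩
  rw [div_eq_inv_mul]
  exact hb t ht x

/-- Away from the origin the Taylor polynomial itself is small. -/
lemma HC.heatTaylor_far {a : ℕ} {F : ℝ → E n → ℝ} (h : HC a F) (K : ℕ) {N P : ℕ} (hNP : N ≤ P) :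
    ∃ C : ℝ, 0 ≤ C ∧ ∀ t, 0 < t → ∀ x : E n, ∀ s, 0 ≤ s → ∀ y : E n, √t ≤ ‖y‖ →
      |heatTaylor N F t x s y| ≤ C * kb K a t x * ((√s + ‖y‖) / √t) ^ P := by
  choose C hC hb using fun (l : ℕ) (β : Fin n → ℕ) => h.coeff_bound K l β
  refine ⟨∑ j ∈ Finset.range N, ∑ l ∈ Finset.range (j / 2 + 1),
    ∑ β ∈ Finset.piAntidiag (Finset.univ : Finset (Fin n)) (j - 2 * l), C l β,
    Finset.sum_nonneg fun j _ => Finset.sum_nonneg fun l _ => Finset.sum_nonneg fun β _ => hC l β,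
    fun t ht x s hs y hy => ?_⟩
  have h0 : 0 < √t := Real.sqrt_pos.2 ht
  have hss : 0 ≤ √s := Real.sqrt_nonneg s
  have hr : 1 ≤ (√s + ‖y‖) / √t := by
    rw [le_div_iff₀ h0]; linarith
  rw [heatTaylor, Finset.sum_mul, Finset.sum_mul]
  refine (Finset.abs_sum_le_sum_abs _ _).trans (Finset.sum_le_sum fun j hj => ?_)
  rw [Finset.sum_mul, Finset.sum_mul]
  refine (Finset.abs_sum_le_sum_abs _ _).trans (Finset.sum_le_sum fun l hl => ?_)
  rw [Finset.sum_mul, Finset.sum_mul]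
  refine (Finset.abs_sum_le_sum_abs _ _).trans (Finset.sum_le_sum fun β hβ => ?_)
  have hβ' := sum_of_mem_piAntidiag hβ
  have hj := Finset.mem_range.1 hj
  have hl := Finset.mem_range.1 hl
  have e : 2 * l + ∑ i, β i = j := by omega
  rw [abs_mul, abs_mul, abs_pow, abs_neg, abs_of_nonneg hs]
  calc _ ≤ C l β * kb K (a + (2 * l + ∑ i, β i)) t x * (s ^ l * ‖y‖ ^ ∑ i, β i) := by
        have := kb_nonneg K (a + (2 * l + ∑ i, β i)) t x
        have := hC l β
        gcongr
        · exact hb l β t ht x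
        · exact abs_monom_le β y
    _ = C l β * kb K a t x * ((√s / √t) ^ (2 * l) * (‖y‖ / √t) ^ ∑ i, β i) := by
        rw [kb_add, pow_add (√t), div_pow, div_pow, pow_mul (√s), Real.sq_sqrt hs]
        field_simp
    _ ≤ C l β * kb K a t x * (((√s + ‖y‖) / √t) ^ (2 * l) * ((√s + ‖y‖) / √t) ^ ∑ i, β i) := by
        have := kb_nonneg K a t x
        have := hC l β
        have := norm_nonneg y
        gcongr <;> linarith
    _ ≤ _ := by
        have := kb_nonneg K a t x
        have := hC l β
        rw [← pow_add, e]
        gcongr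
        omega

/-- The weighted bound for the remainder of the parabolic Taylor expansion. -/
lemma HC.remainder_bound {a : ℕ} {F : ℝ → E n → ℝ} (h : HC a F) (K : ℕ) {N P : ℕ} (hNP : N ≤ P) :
    ∃ C : ℝ, 0 ≤ C ∧ ∀ t, 0 < t → ∀ x : E n, ∀ s, 0 ≤ s → s ≤ t / 2 → ∀ y : E n,
      (1 + ‖x‖ / √t) ^ P * |F (t - s) (x - y) - heatTaylor N F t x s y| ≤
        C * (((√s + ‖y‖) / √t) ^ N + ((√s + ‖y‖) / √t) ^ P) *
          (kb K a t x + kb K a t (x - y)) := by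
  obtain ⟨C1, hC1, hb1⟩ := h.nearTaylor (K + P) N
  obtain ⟨C2, hC2, hb2⟩ := h.heatTaylor_far (K + P) hNP
  obtain ⟨C3, hC3, hb3⟩ := h.bound (K + P)
  refine ⟨C1 + C2 + C3 * 2 ^ (n + a + (K + P)) * 2 ^ P, by positivity,
    fun t ht x s hs hst y => ?_⟩
  have h0 : 0 < √t := Real.sqrt_pos.2 ht
  have hss : 0 ≤ √s := Real.sqrt_nonneg s
  have hy0 := norm_nonneg y
  set r := (√s + ‖y‖) / √t with hr
  have hr0 : 0 ≤ r := by positivity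
  have k1 := kb_nonneg K a t x
  have k2 := kb_nonneg K a t (x - y)
  have hD : 0 ≤ C3 * 2 ^ (n + a + (K + P)) * 2 ^ P := by positivity
  -- For |y| ≤ √t the Taylor remainder is small, and the weight in x is absorbed by the decay of the
  -- kernel at x.
  rcases le_total ‖y‖ (√t) with hy | hy
  · calc _ ≤ (1 + ‖x‖ / √t) ^ P * (C1 * kb (K + P) a t x * r ^ N) := by
          gcongr; exact hb1 t ht x s hs hst y hy
      _ = C1 * r ^ N * ((1 + ‖x‖ / √t) ^ P * kb (K + P) a t x) := by ring
      _ = C1 * r ^ N * kb K a t x := by rw [weight_kb K P a ht]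
      _ ≤ (C1 + C2 + C3 * 2 ^ (n + a + (K + P)) * 2 ^ P) * (r ^ N + r ^ P) *
          (kb K a t x + kb K a t (x - y)) := by
          gcongr
          · linarith
          · linarith [pow_nonneg hr0 P]
          · linarith
  -- For |y| ≥ √t there is no cancellation to exploit: kernel and polynomial are bounded separately.
  -- The weight at x is split into a weight at x − y, absorbed by the kernel, and a weight at y,
  -- which is at most (2r)^P.
  · have hy1 : 1 ≤ ‖y‖ / √t := by rwa [le_div_iff₀ h0, one_mul]
    have hyr : 1 + ‖y‖ / √t ≤ 2 * r := by
      have : ‖y‖ / √t ≤ r := by rw [hr]; gcongr; linarith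
      linarith
    have hx : 1 + ‖x‖ / √t ≤ (1 + ‖x - y‖ / √t) * (1 + ‖y‖ / √t) := by
      have : ‖x‖ / √t ≤ (‖x - y‖ + ‖y‖) / √t := by
        gcongr
        simpa using norm_add_le (x - y) y
      rw [add_div] at this
      have : 0 ≤ (‖x - y‖ / √t) * (‖y‖ / √t) := by positivity
      nlinarith
    have f1 : (1 + ‖x‖ / √t) ^ P * |F (t - s) (x - y)| ≤
        C3 * 2 ^ (n + a + (K + P)) * 2 ^ P * (r ^ P * kb K a t (x - y)) := by
      calc _ ≤ ((1 + ‖x - y‖ / √t) * (2 * r)) ^ P *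
            (C3 * (2 ^ (n + a + (K + P)) * kb (K + P) a t (x - y))) := by
            gcongr
            · exact hx.trans (by gcongr)
            · refine (hb3 (t - s) (by linarith) _).trans ?_
              gcongr
              exact kb_time _ a ht (by linarith) (by linarith) _
        _ = C3 * 2 ^ (n + a + (K + P)) * 2 ^ P * r ^ P *
            ((1 + ‖x - y‖ / √t) ^ P * kb (K + P) a t (x - y)) := by
            rw [mul_pow, mul_pow]; ring
        _ = _ := by rw [weight_kb K P a ht]; ring
    have f2 : (1 + ‖x‖ / √t) ^ P * |heatTaylor N F t x s y| ≤ C2 * (r ^ P * kb K a t x) := by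
      calc _ ≤ (1 + ‖x‖ / √t) ^ P * (C2 * kb (K + P) a t x * r ^ P) := by
            gcongr; exact hb2 t ht x s hs y hy
        _ = C2 * r ^ P * ((1 + ‖x‖ / √t) ^ P * kb (K + P) a t x) := by ring
        _ = _ := by rw [weight_kb K P a ht]; ring
    calc _ ≤ (1 + ‖x‖ / √t) ^ P * (|F (t - s) (x - y)| + |heatTaylor N F t x s y|) := by
          gcongr; exact abs_sub _ _
      _ ≤ C3 * 2 ^ (n + a + (K + P)) * 2 ^ P * (r ^ P * kb K a t (x - y))
          + C2 * (r ^ P * kb K a t x) := by rw [mul_add]; exact add_le_add f1 f2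
      _ ≤ _ := by
          have := pow_nonneg hr0 N
          have := pow_nonneg hr0 P
          have e1 : 0 ≤ r ^ P * kb K a t (x - y) := by positivity
          have e2 : 0 ≤ r ^ P * kb K a t x := by positivity
          have e3 : 0 ≤ r ^ N * (kb K a t x + kb K a t (x - y)) := by positivity
          nlinarith [mul_nonneg hC1 e1, mul_nonneg hC1 e2, mul_nonneg hC2 e1, mul_nonneg hD e2,
            mul_nonneg (add_nonneg (add_nonneg hC1 hC2) hD) e3]

/-! ### Integrals of the majorant -/

lemma integrable_weight {K : ℕ} (hK : n + 1 ≤ K) :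
    Integrable (fun x : E n => ((1 + ‖x‖) ^ K)⁻¹) := by
  have h := integrable_one_add_norm (E := E n) (μ := volume) (r := (K : ℝ)) (by
    rw [finrank_euclideanSpace, Fintype.card_fin]
    exact_mod_cast hK)
  refine h.congr (Eventually.of_forall fun x => ?_)
  simp only
  rw [Real.rpow_neg (by positivity), Real.rpow_natCast]

/-- The integral of the profile `(1 + |x|)^{-K}`. -/
def weightMass (n K : ℕ) : ℝ := ∫ x : E n, ((1 + ‖x‖) ^ K)⁻¹

lemma weightMass_nonneg (n K : ℕ) : 0 ≤ weightMass n K :=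
  integral_nonneg fun x => by positivity

lemma kb_eq_comp (K a : ℕ) (t : ℝ) (x : E n) :
    kb K a t x = (√t ^ (n + a))⁻¹ * ((1 + ‖(√t)⁻¹ • x‖) ^ K)⁻¹ := by
  rw [kb, norm_smul, norm_inv, Real.norm_of_nonneg (Real.sqrt_nonneg t), mul_inv, div_eq_inv_mul]

lemma integrable_kb {K : ℕ} (hK : n + 1 ≤ K) (a : ℕ) {t : ℝ} (ht : 0 < t) :
    Integrable (fun x : E n => kb K a t x) := by
  have h0 : (√t)⁻¹ ≠ 0 := by positivity
  have := ((integrable_weight hK).comp_smul h0).const_mul (√t ^ (n + a))⁻¹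
  refine this.congr (Eventually.of_forall fun x => ?_)
  exact (kb_eq_comp K a t x).symm

lemma integral_kb (K a : ℕ) {t : ℝ} (ht : 0 < t) :
    ∫ x : E n, kb K a t x = weightMass n K / √t ^ a := by
  have h0 : 0 < √t := Real.sqrt_pos.2 ht
  simp_rw [kb_eq_comp K a t]
  rw [integral_const_mul, Measure.integral_comp_smul volume (fun x : E n => ((1 + ‖x‖) ^ K)⁻¹),
    finrank_euclideanSpace, Fintype.card_fin, weightMass, smul_eq_mul, inv_pow, inv_inv,
    abs_of_nonneg (by positivity), pow_add]
  field_simp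

lemma continuousOn_kb (K a : ℕ) :
    ContinuousOn (fun p : ℝ × E n => kb K a p.1 p.2) (Ioi 0 ×ˢ univ) := by
  unfold kb
  have hs : ContinuousOn (fun p : ℝ × E n => √p.1) (Ioi 0 ×ˢ univ) := by fun_prop
  refine ContinuousOn.inv₀ ((hs.pow _).mul ((continuousOn_const.add
    (ContinuousOn.div (by fun_prop) hs fun p hp => ?_)).pow _)) fun p hp => ?_
  · exact (Real.sqrt_pos.2 hp.1).ne'
  · have : 0 < √p.1 := Real.sqrt_pos.2 hp.1
    positivity

lemma integrableOn_inv_sqrt {s t : ℝ} : IntegrableOn (fun τ : ℝ => (√(t - τ))⁻¹) (Ioo s t) := by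
  rcases le_or_gt t s with h | h
  · simp [Ioo_eq_empty (not_lt.2 h)]
  have h1 : IntervalIntegrable (fun τ : ℝ => τ ^ (-(1 / 2) : ℝ)) volume 0 (t - s) :=
    intervalIntegral.intervalIntegrable_rpow' (by norm_num)
  have h2 := (h1.comp_sub_left t).symm
  simp only [sub_zero, sub_sub_cancel] at h2
  have h3 := ((intervalIntegrable_iff_integrableOn_Ioo_of_le h.le).1 h2)
  refine h3.congr_fun (fun τ hτ => ?_) measurableSet_Ioo
  simp only
  rw [Real.sqrt_eq_rpow, ← Real.rpow_neg (by linarith [hτ.2])]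

/-- The spatial mass is a multiple of (t−τ)^{-a/2}, which is integrable up to τ = t for a ≤ 1. One
spatial derivative of the heat kernel is therefore allowed. -/
lemma integrableOn_kb_spacetime {K : ℕ} (hK : n + 1 ≤ K) {a : ℕ} (ha : a ≤ 1) (s t : ℝ) (x : E n) :
    IntegrableOn (fun p : ℝ × E n => kb K a (t - p.1) (x - p.2)) (Ioo s t ×ˢ univ)
      (volume.prod volume) := by
  rw [IntegrableOn, ← Measure.prod_restrict, Measure.restrict_univ, integrable_prod_iff]
  · constructor
    · filter_upwards [ae_restrict_mem measurableSet_Ioo] with τ hτ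
      exact (integrable_kb hK a (by linarith [hτ.2])).comp_sub_left x
    · have h1 : IntegrableOn (fun τ : ℝ => weightMass n K * (√(t - τ) ^ a)⁻¹) (Ioo s t) := by
        refine Integrable.const_mul ?_ _
        rcases Nat.le_one_iff_eq_zero_or_eq_one.1 ha with rfl | rfl
        · simp
        · simpa using (integrableOn_inv_sqrt : IntegrableOn _ (Ioo s t)).integrable
      refine h1.congr_fun (fun τ hτ => ?_) measurableSet_Ioo
      simp only [Real.norm_of_nonneg (kb_nonneg _ _ _ _)]
      rw [integral_sub_left_eq_self (fun y : E n => kb K a (t - τ) y), integral_kb K a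
        (by linarith [hτ.2]), div_eq_mul_inv]
  · have h1 : ContinuousOn (fun p : ℝ × E n => kb K a (t - p.1) (x - p.2)) (Ioo s t ×ˢ univ) :=
      (continuousOn_kb K a).comp (f := fun p : ℝ × E n => (t - p.1, x - p.2)) (by fun_prop)
        fun p hp => ⟨by simpa using hp.1.2, mem_univ _⟩
    have := h1.aestronglyMeasurable (μ := volume.prod volume)
      (measurableSet_Ioo.prod MeasurableSet.univ)
    rwa [← Measure.prod_restrict, Measure.restrict_univ] at this

/-! ### Duhamel's formula with a cutoff -/

/-- Integration by parts against a reflected test function. -/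
lemma integral_pderiv_mul_comp_sub {g φ : E n → ℝ} (hg : ContDiff ℝ 1 g) (hφ : ContDiff ℝ 1 φ)
    (hc : HasCompactSupport φ) (x : E n) (i : Fin n) :
    ∫ y, pderiv i g y * φ (x - y) = ∫ y, g y * pderiv i φ (x - y) := by
  set ψ : E n → ℝ := fun y => φ (x - y) with hψ
  have hψ1 : ContDiff ℝ 1 ψ := hφ.comp (contDiff_const.sub contDiff_id)
  have hψc : HasCompactSupport ψ := by
    have := hc.comp_homeomorph (Homeomorph.subLeft x)
    exact this
  have hd : ∀ y, fderiv ℝ ψ y (ev i) = -pderiv i φ (x - y) := by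
    intro y
    have h1 : HasFDerivAt (fun y : E n => x - y) (-ContinuousLinearMap.id ℝ (E n)) y := by
      simpa using (hasFDerivAt_id y).const_sub x
    have h2 := ((hφ.differentiable (by simp) (x - y)).hasFDerivAt.comp y h1).fderiv
    change fderiv ℝ (φ ∘ fun y => x - y) y (ev i) = _
    rw [h2]
    simp [pderiv]
  have hgc : Continuous (fun y => fderiv ℝ g y (ev i)) :=
    (hg.continuous_fderiv (by simp)).clm_apply continuous_const
  have hψc' : Continuous (fun y => fderiv ℝ ψ y (ev i)) :=
    (hψ1.continuous_fderiv (by simp)).clm_apply continuous_const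
  have := integral_mul_fderiv_eq_neg_fderiv_mul_of_integrable (μ := volume) (f := g) (g := ψ)
    (v := ev i)
    ((hgc.mul hψ1.continuous).integrable_of_hasCompactSupport hψc.mul_left)
    ((hg.continuous.mul hψc').integrable_of_hasCompactSupport
      ((hψc.fderiv_apply (𝕜 := ℝ) (ev i)).mul_left))
    ((hg.continuous.mul hψ1.continuous).integrable_of_hasCompactSupport hψc.mul_left)
    (fun y _ => hg.differentiable (by simp) y) (fun y _ => hψ1.differentiable (by simp) y)
  simp only [hd, mul_neg, integral_neg, neg_inj] at this
  exact this.symm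

/-- Differentiation under the integral: on a compact time interval times the common support the
derivative is bounded by compactness, and that constant on the support is the dominating function.
-/
lemma hasDerivAt_integral_of_compact {Ψ Ψ' : ℝ → E n → ℝ} {a b τ : ℝ} (hτ : τ ∈ Ioo a b)
    (hd : ∀ σ ∈ Ioo a b, ∀ y, HasDerivAt (fun σ => Ψ σ y) (Ψ' σ y) σ)
    (hΨ : ContinuousOn (Function.uncurry Ψ) (Ioo a b ×ˢ univ))
    (hΨ' : ContinuousOn (Function.uncurry Ψ') (Ioo a b ×ˢ univ))
    {K : Set (E n)} (hK : IsCompact K) (h0 : ∀ σ ∈ Ioo a b, ∀ y ∉ K, Ψ σ y = 0)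
    (h0' : ∀ σ ∈ Ioo a b, ∀ y ∉ K, Ψ' σ y = 0) :
    HasDerivAt (fun σ => ∫ y, Ψ σ y) (∫ y, Ψ' τ y) τ := by
  obtain ⟨c, hac, hcτ⟩ := exists_between hτ.1
  obtain ⟨d, hτd, hdb⟩ := exists_between hτ.2
  have hsub : Icc c d ×ˢ K ⊆ Ioo a b ×ˢ (univ : Set (E n)) := fun p hp =>
    ⟨⟨hac.trans_le hp.1.1, hp.1.2.trans_lt hdb⟩, mem_univ _⟩
  obtain ⟨C, hC⟩ := (isCompact_Icc.prod hK).exists_bound_of_continuousOn (hΨ'.mono hsub)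
  have slice : ∀ (Φ : ℝ → E n → ℝ), ContinuousOn (Function.uncurry Φ) (Ioo a b ×ˢ univ) →
      ∀ σ ∈ Ioo a b, Continuous (Φ σ) := fun Φ hΦ σ hσ => by
    have := hΦ.comp_continuous (f := fun y => (σ, y)) (by fun_prop) fun y => ⟨hσ, mem_univ _⟩
    exact this
  refine (hasDerivAt_integral_of_dominated_loc_of_deriv_le (s := Icc c d)
    (bound := K.indicator fun _ => C) (F := Ψ) (F' := Ψ') (Icc_mem_nhds hcτ hτd)
    ?_ ?_ ?_ ?_ ?_ ?_).2
  · filter_upwards [Ioo_mem_nhds hτ.1 hτ.2] with σ hσ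
    exact (slice Ψ hΨ σ hσ).aestronglyMeasurable
  · refine (slice Ψ hΨ τ hτ).integrable_of_hasCompactSupport ?_
    exact HasCompactSupport.intro hK (h0 τ hτ)
  · exact (slice Ψ' hΨ' τ hτ).aestronglyMeasurable
  · refine Eventually.of_forall fun y σ hσ => ?_
    by_cases hy : y ∈ K
    · rw [indicator_of_mem hy]
      exact hC (σ, y) ⟨hσ, hy⟩
    · rw [indicator_of_notMem hy, h0' σ ⟨hac.trans_le hσ.1, hσ.2.trans_lt hdb⟩ y hy, norm_zero]
  · rw [integrable_indicator_iff hK.measurableSet]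
    exact integrableOn_const hK.measure_lt_top.ne
  · exact Eventually.of_forall fun y σ hσ => hd σ ⟨hac.trans_le hσ.1, hσ.2.trans_lt hdb⟩ y

/-- The heat kernel multiplied by a cutoff function. -/
def cutKernel (χ : E n → ℝ) (t : ℝ) (x : E n) : ℝ := heatKernel n t x * χ x

/-- The commutator of the Laplacian with the cutoff. -/
def cutError (χ : E n → ℝ) (t : ℝ) (x : E n) : ℝ :=
  ∑ i, (2 * (pderiv i (heatKernel n t) x * pderiv i χ x)
    + heatKernel n t x * pderiv i (pderiv i χ) x)

lemma SM.of_contDiff {χ : E n → ℝ} (hχ : ContDiff ℝ ∞ χ) : SM (fun _ x => χ x) := by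
  have : ContDiff ℝ ∞ (fun p : ℝ × E n => χ p.2) := hχ.comp contDiff_snd
  exact this.contDiffOn

lemma SM.cutKernel {χ : E n → ℝ} (hχ : ContDiff ℝ ∞ χ) : SM (cutKernel χ) :=
  SM.heatKernel.mul (SM.of_contDiff hχ)

lemma SM.cutError {χ : E n → ℝ} (hχ : ContDiff ℝ ∞ χ) : SM (cutError χ) :=
  SM.sum fun i _ => (((SM.heatKernel.dx i).mul (SM.of_contDiff (contDiff_pderiv hχ i))).const_mul 2).add
    (SM.heatKernel.mul (SM.of_contDiff (contDiff_pderiv (contDiff_pderiv hχ i) i)))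

lemma dx_cutKernel {χ : E n → ℝ} (hχ : ContDiff ℝ ∞ χ) {t : ℝ} (ht : 0 < t) (x : E n) (i : Fin n) :
    dx i (cutKernel χ) t x = pderiv i (heatKernel n t) x * χ x + heatKernel n t x * pderiv i χ x :=
  pderiv_mul (SM.heatKernel.slice_differentiable ht x) (hχ.differentiable (by simp) x) i

/-- Because G solves the heat equation, Gχ solves it up to terms containing derivatives of χ. These
terms vanish where χ is locally constant. -/
lemma laplacian_cutKernel {χ : E n → ℝ} (hχ : ContDiff ℝ ∞ χ) {t : ℝ} (ht : 0 < t) (x : E n) :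
    ∑ i, dx i (dx i (cutKernel χ)) t x = cutError χ t x + dt (heatKernel n) t x * χ x := by
  rw [heat_equation ht, cutError, Finset.sum_mul, ← Finset.sum_add_distrib]
  refine Finset.sum_congr rfl fun i _ => ?_
  have d1 := (SM.heatKernel (n := n)).slice_differentiable ht x
  have d2 := ((SM.heatKernel (n := n)).dx i).slice_differentiable ht x
  have d3 := hχ.differentiable (by simp) x
  have d4 := (contDiff_pderiv hχ i).differentiable (by simp) x
  have e : dx i (cutKernel χ) t = fun y => dx i (heatKernel n) t y * χ y
      + heatKernel n t y * pderiv i χ y := funext fun y => dx_cutKernel hχ ht y i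
  change pderiv i (dx i (cutKernel χ) t) x = _
  rw [e, pderiv_add (f := fun y => dx i (heatKernel n) t y * χ y)
    (g := fun y => heatKernel n t y * pderiv i χ y) (d2.mul d3) (d1.mul d4), pderiv_mul d2 d3,
    pderiv_mul d1 d4]
  simp only [dx]
  ring

lemma cutKernel_eq_zero {χ : E n → ℝ} {x : E n} (hx : x ∉ tsupport χ) (t : ℝ) :
    cutKernel χ t x = 0 := by
  rw [cutKernel, image_eq_zero_of_notMem_tsupport hx, mul_zero]

lemma tsupport_pderiv_subset (χ : E n → ℝ) (i : Fin n) : tsupport (pderiv i χ) ⊆ tsupport χ :=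
  tsupport_fderiv_apply_subset ℝ _

lemma cutError_eq_zero {χ : E n → ℝ} {x : E n} (hx : x ∉ tsupport χ) (t : ℝ) :
    cutError χ t x = 0 := by
  refine Finset.sum_eq_zero fun i _ => ?_
  rw [image_eq_zero_of_notMem_tsupport fun h => hx (tsupport_pderiv_subset χ i h),
    image_eq_zero_of_notMem_tsupport fun h => hx
      (tsupport_pderiv_subset χ i (tsupport_pderiv_subset _ i h))]
  simp

lemma dx_cutKernel_eq_zero {χ : E n → ℝ} {x : E n} (hx : x ∉ tsupport χ) (t : ℝ) (i : Fin n) :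
    dx i (cutKernel χ) t x = 0 := by
  refine image_eq_zero_of_notMem_tsupport fun h => hx ?_
  have hsub : Function.support (cutKernel χ t) ⊆ Function.support χ := by
    intro y hy h0
    exact hy (by simp [cutKernel, h0])
  exact closure_mono hsub (tsupport_pderiv_subset _ i h)

lemma hasCompactSupport_cutKernel {χ : E n → ℝ} (hc : HasCompactSupport χ) (t : ℝ) :
    HasCompactSupport (cutKernel χ t) := hc.mul_left

lemma exists_bound_of_compactSupport {f : E n → ℝ} (hf : Continuous f) (hc : HasCompactSupport f) :
    ∃ C : ℝ, 0 ≤ C ∧ ∀ x, |f x| ≤ C := by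
  obtain ⟨C, hC⟩ := hc.exists_bound_of_continuous hf
  exact ⟨C, (norm_nonneg _).trans (hC 0), hC⟩

lemma HasCompactSupport.pderiv {f : E n → ℝ} (hc : HasCompactSupport f) (i : Fin n) :
    HasCompactSupport (pderiv i f) := hc.fderiv_apply (𝕜 := ℝ) (ev i)

lemma dx_cutKernel_bound {χ : E n → ℝ} (hχ : ContDiff ℝ ∞ χ) (hc : HasCompactSupport χ) (K : ℕ)
    (i : Fin n) : ∃ C : ℝ, 0 ≤ C ∧ ∀ t, 0 < t → ∀ x,
      |dx i (cutKernel χ) t x| ≤ C * (kb K 0 t x + kb K 1 t x) := by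
  obtain ⟨C0, hC0, h0⟩ := exists_bound_of_compactSupport hχ.continuous hc
  obtain ⟨C1, hC1, h1⟩ := exists_bound_of_compactSupport (contDiff_pderiv hχ i).continuous
    (HasCompactSupport.pderiv hc i)
  obtain ⟨A0, hA0, a0⟩ := (HC.base (n := n)).bound K
  obtain ⟨A1, hA1, a1⟩ := ((HC.base (n := n)).dx i).bound K
  refine ⟨A1 * C0 + A0 * C1, by positivity, fun t ht x => ?_⟩
  have k0 := kb_nonneg K 0 t x
  have k1 := kb_nonneg K 1 t x
  rw [dx_cutKernel hχ ht]
  refine (abs_add_le _ _).trans ?_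
  rw [abs_mul, abs_mul]
  have e1 : |NSVorticity.pderiv i (heatKernel n t) x| * |χ x| ≤ A1 * kb K 1 t x * C0 := by
    gcongr
    · exact a1 t ht x
    · exact h0 x
  have e2 : |heatKernel n t x| * |NSVorticity.pderiv i χ x| ≤ A0 * kb K 0 t x * C1 := by
    gcongr
    · exact a0 t ht x
    · exact h1 x
  nlinarith [mul_nonneg (mul_nonneg hA1 hC0) k0, mul_nonneg (mul_nonneg hA0 hC1) k1]

lemma cutError_bound {χ : E n → ℝ} (hχ : ContDiff ℝ ∞ χ) (hc : HasCompactSupport χ) (K : ℕ) :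
    ∃ C : ℝ, 0 ≤ C ∧ ∀ t, 0 < t → ∀ x,
      |cutError χ t x| ≤ C * (kb K 0 t x + kb K 1 t x) := by
  choose C1 hC1 h1 using fun i => exists_bound_of_compactSupport (contDiff_pderiv hχ i).continuous
    (HasCompactSupport.pderiv hc i)
  choose C2 hC2 h2 using fun i => exists_bound_of_compactSupport
    (contDiff_pderiv (contDiff_pderiv hχ i) i).continuous
    (HasCompactSupport.pderiv (HasCompactSupport.pderiv hc i) i)
  obtain ⟨A0, hA0, a0⟩ := (HC.base (n := n)).bound K
  choose A1 hA1 a1 using fun i => ((HC.base (n := n)).dx i).bound K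
  refine ⟨∑ i, (2 * (A1 i * C1 i) + A0 * C2 i), Finset.sum_nonneg fun i _ => ?_, fun t ht x => ?_⟩
  · have := hA1 i; have := hC1 i; have := hC2 i
    positivity
  have k0 := kb_nonneg K 0 t x
  have k1 := kb_nonneg K 1 t x
  rw [Finset.sum_mul]
  refine (Finset.abs_sum_le_sum_abs _ _).trans (Finset.sum_le_sum fun i _ => ?_)
  refine (abs_add_le _ _).trans ?_
  rw [abs_mul, abs_mul, abs_mul, abs_two]
  have e1 : |NSVorticity.pderiv i (heatKernel n t) x| * |NSVorticity.pderiv i χ x| ≤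
      A1 i * kb K 1 t x * C1 i := by
    have := hA1 i
    gcongr
    · exact a1 i t ht x
    · exact h1 i x
  have e2 : |heatKernel n t x| * |NSVorticity.pderiv i (NSVorticity.pderiv i χ) x| ≤
      A0 * kb K 0 t x * C2 i := by
    gcongr
    · exact a0 t ht x
    · exact h2 i x
  nlinarith [mul_nonneg (mul_nonneg (hA1 i) (hC1 i)) k0, mul_nonneg (mul_nonneg hA0 (hC2 i)) k1]

lemma heatKernel_scale {t : ℝ} (ht : 0 < t) (z : E n) :
    √t ^ n * heatKernel n t (√t • z) = heatKernel n 1 z := by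
  have hpi := Real.pi_pos
  have h0 : 0 < √t := Real.sqrt_pos.2 ht
  simp only [heatKernel]
  rw [Real.mul_rpow (by positivity) ht.le, rpow_neg_half ht, norm_smul, Real.norm_of_nonneg h0.le,
    mul_pow, Real.sq_sqrt ht.le, mul_one]
  have : -(t * ‖z‖ ^ 2) / (4 * t) = -‖z‖ ^ 2 / (4 * 1) := by field_simp
  rw [this]
  field_simp

lemma integrable_heatKernel {t : ℝ} (ht : 0 < t) : Integrable (heatKernel n t) := by
  obtain ⟨C, hC, hb⟩ := (HC.base (n := n)).bound (n + 1)
  refine ((integrable_kb le_rfl 0 ht).const_mul C).mono'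
    (SM.heatKernel.slice_continuous ht).aestronglyMeasurable (Eventually.of_forall (hb t ht))

lemma mem_reflect_iff {T : Set (E n)} (x y : E n) : y ∈ (fun z => x - z) '' T ↔ x - y ∈ T := by
  constructor
  · rintro ⟨z, hz, rfl⟩
    simpa using hz
  · exact fun h => ⟨x - y, h, by simp⟩

/-- The heat kernel is an approximate identity. The compact support of χ makes this true for every
smooth v, without any bound at infinity. -/
lemma tendsto_cutKernel {v : ℝ → E n → ℝ} (hω : SM v) {χ : E n → ℝ} (hχ : ContDiff ℝ ∞ χ)
    (hc : HasCompactSupport χ) (h1 : χ 0 = 1) {t : ℝ} (ht : 0 < t) (x : E n) :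
    Tendsto (fun τ => ∫ y, v τ y * cutKernel χ (t - τ) (x - y)) (𝓝[<] t) (𝓝 (v t x)) := by
  have hK : IsCompact ((fun z => x - z) '' tsupport χ) :=
    hc.isCompact.image (by fun_prop)
  have hsub : Icc (t / 2) t ×ˢ ((fun z => x - z) '' tsupport χ) ⊆
      Ioi 0 ×ˢ (univ : Set (E n)) := fun p hp =>
    ⟨lt_of_lt_of_le (by positivity) hp.1.1, mem_univ _⟩
  obtain ⟨A, hA⟩ := (isCompact_Icc.prod hK).exists_bound_of_continuousOn (hω.continuousOn.mono hsub)
  obtain ⟨B, hB0, hB⟩ := exists_bound_of_compactSupport hχ.continuous hc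
  -- The substitution y = x − √(t−τ) z fixes the kernel to time 1, so that dominated convergence
  -- applies.
  have hI : ∀ τ ∈ Ioo (t / 2) t, ∫ y, v τ y * cutKernel χ (t - τ) (x - y) =
      ∫ z, v τ (x - √(t - τ) • z) * χ (√(t - τ) • z) * heatKernel n 1 z := by
    intro τ hτ
    have hσ : 0 < t - τ := by linarith [hτ.2]
    have h0 : 0 < √(t - τ) := Real.sqrt_pos.2 hσ
    have e1 := integral_sub_left_eq_self (fun z => v τ (x - z) * cutKernel χ (t - τ) z)
      (volume : Measure (E n)) x
    simp only [sub_sub_cancel] at e1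
    have e2 := Measure.integral_comp_smul volume (fun z => v τ (x - z) * cutKernel χ (t - τ) z)
      (√(t - τ))
    rw [e1, ← mul_right_inj' (a := (√(t - τ) ^ n)⁻¹) (by positivity)]
    rw [finrank_euclideanSpace, Fintype.card_fin, smul_eq_mul, abs_of_nonneg (by positivity)] at e2
    rw [← e2, ← integral_const_mul]
    refine integral_congr_ae (Eventually.of_forall fun z => ?_)
    simp only [cutKernel]
    rw [← heatKernel_scale hσ]
    field_simp
  have hev : ∀ᶠ τ in 𝓝[<] t, τ ∈ Ioo (t / 2) t := Ioo_mem_nhdsLT (by linarith)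
  have hlim : Tendsto (fun τ => ∫ z, v τ (x - √(t - τ) • z) * χ (√(t - τ) • z) * heatKernel n 1 z)
      (𝓝[<] t) (𝓝 (∫ z, v t x * heatKernel n 1 z)) := by
    refine tendsto_integral_filter_of_dominated_convergence
      (fun z => |A| * B * heatKernel n 1 z) ?_ ?_ ?_ ?_
    · filter_upwards [hev] with τ hτ
      have hτ0 : 0 < τ := by linarith [hτ.1]
      have c1 := hω.slice_continuous hτ0
      have c2 := (SM.heatKernel (n := n)).slice_continuous one_pos
      have c3 := hχ.continuous
      exact (by fun_prop : Continuous fun z => v τ (x - √(t - τ) • z) * χ (√(t - τ) • z)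
        * heatKernel n 1 z).aestronglyMeasurable
    · filter_upwards [hev] with τ hτ
      refine Eventually.of_forall fun z => ?_
      rw [norm_mul, norm_mul, Real.norm_of_nonneg (heatKernel_nonneg one_pos z)]
      refine mul_le_mul_of_nonneg_right ?_ (heatKernel_nonneg one_pos z)
      by_cases hz : √(t - τ) • z ∈ tsupport χ
      · refine mul_le_mul ?_ (hB _) (norm_nonneg _) (abs_nonneg _)
        exact (hA (τ, x - √(t - τ) • z) ⟨⟨hτ.1.le, hτ.2.le⟩, _, hz, rfl⟩).trans (le_abs_self A)
      · rw [image_eq_zero_of_notMem_tsupport hz, norm_zero, mul_zero]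
        positivity
    · exact (integrable_heatKernel one_pos).const_mul _
    · refine Eventually.of_forall fun z => ?_
      have l0 : Tendsto (fun τ => √(t - τ) • z) (𝓝[<] t) (𝓝 0) := by
        have : Continuous fun τ : ℝ => √(t - τ) • z := by fun_prop
        have := (this.tendsto t).mono_left (nhdsWithin_le_nhds (s := Iio t))
        simpa using this
      have l1 : Tendsto (fun τ => v τ (x - √(t - τ) • z)) (𝓝[<] t) (𝓝 (v t x)) := by
        have h1 : Tendsto (fun τ => (τ, x - √(t - τ) • z)) (𝓝[<] t) (𝓝 (t, x)) := by
          refine Tendsto.prodMk_nhds (tendsto_id.mono_left nhdsWithin_le_nhds) ?_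
          simpa using tendsto_const_nhds.sub l0
        exact ((hω.contDiffAt ht x).continuousAt.tendsto).comp h1
      have l2 : Tendsto (fun τ => χ (√(t - τ) • z)) (𝓝[<] t) (𝓝 1) := by
        rw [← h1]
        exact (hχ.continuous.tendsto 0).comp l0
      have := (l1.mul l2).mul_const (heatKernel n 1 z)
      simpa using this
  rw [integral_const_mul, integral_heatKernel_one, mul_one] at hlim
  refine hlim.congr' ?_
  filter_upwards [hev] with τ hτ using (hI τ hτ).symm

/-- The integrand of Duhamel's formula with a cutoff. -/
def cutDuhamel (v : ℝ → E n → ℝ) (F : Fin n → ℝ → E n → ℝ) (χ : E n → ℝ) (t : ℝ) (x : E n)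
    (τ : ℝ) (y : E n) : ℝ :=
  v τ y * cutError χ (t - τ) (x - y) + ∑ i, F i τ y * dx i (cutKernel χ) (t - τ) (x - y)

lemma SM.continuousOn_reflect {f : ℝ → E n → ℝ} (hf : SM f) {s t : ℝ} (x : E n) :
    ContinuousOn (fun p : ℝ × E n => f (t - p.1) (x - p.2)) (Ioo s t ×ˢ univ) :=
  hf.continuousOn.comp (f := fun p : ℝ × E n => (t - p.1, x - p.2)) (by fun_prop)
    fun _ hp => ⟨by simpa using hp.1.2, mem_univ _⟩

lemma SM.continuousOn_Ioo {f : ℝ → E n → ℝ} (hf : SM f) {s t : ℝ} (hs : 0 ≤ s) :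
    ContinuousOn (fun p : ℝ × E n => f p.1 p.2) (Ioo s t ×ˢ univ) :=
  hf.continuousOn.mono fun _ hp => ⟨hs.trans_lt hp.1.1, mem_univ _⟩

/-- On the reflected support of χ the smooth factors are bounded for times in [s, t], and the
kernels have the integrable singularity of at most one derivative of G. -/
lemma integrableOn_cutDuhamel {v : ℝ → E n → ℝ} (hω : SM v) {F : Fin n → ℝ → E n → ℝ}
    (hF : ∀ i, SM (F i)) {χ : E n → ℝ} (hχ : ContDiff ℝ ∞ χ) (hc : HasCompactSupport χ)
    {s t : ℝ} (hs : 0 < s) (x : E n) :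
    IntegrableOn (fun p : ℝ × E n => cutDuhamel v F χ t x p.1 p.2) (Ioo s t ×ˢ univ)
      (volume.prod volume) := by
  have hK : IsCompact ((fun z => x - z) '' tsupport χ) := hc.isCompact.image (by fun_prop)
  have hsub : Icc s t ×ˢ ((fun z => x - z) '' tsupport χ) ⊆
      Ioi 0 ×ˢ (univ : Set (E n)) := fun p hp => ⟨hs.trans_le hp.1.1, mem_univ _⟩
  obtain ⟨A, hA⟩ := (isCompact_Icc.prod hK).exists_bound_of_continuousOn (hω.continuousOn.mono hsub)
  choose B hB using fun i =>
    (isCompact_Icc.prod hK).exists_bound_of_continuousOn ((hF i).continuousOn.mono hsub)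
  obtain ⟨C, hC, h1⟩ := cutError_bound hχ hc (n + 1)
  choose D hD h2 using fun i => dx_cutKernel_bound hχ hc (n + 1) i
  have k0 := integrableOn_kb_spacetime (n := n) (K := n + 1) le_rfl (a := 0) (by norm_num) s t x
  have k1 := integrableOn_kb_spacetime (n := n) (K := n + 1) le_rfl (a := 1) (by norm_num) s t x
  refine ((k0.integrable.add k1.integrable).const_mul (|A| * C + ∑ i, |B i| * D i)).mono' ?_ ?_
  · refine ContinuousOn.aestronglyMeasurable ?_ (measurableSet_Ioo.prod MeasurableSet.univ)
    refine ((hω.continuousOn_Ioo hs.le).mul ((SM.cutError hχ).continuousOn_reflect x)).add ?_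
    refine continuousOn_finsetSum _ fun i _ => ?_
    exact ((hF i).continuousOn_Ioo hs.le).mul (((SM.cutKernel hχ).dx i).continuousOn_reflect x)
  · filter_upwards [ae_restrict_mem (measurableSet_Ioo.prod MeasurableSet.univ)] with p hp
    have hσ : 0 < t - p.1 := by linarith [hp.1.2]
    have hτ : p.1 ∈ Icc s t := ⟨hp.1.1.le, hp.1.2.le⟩
    have n0 := kb_nonneg (n + 1) 0 (t - p.1) (x - p.2)
    have n1 := kb_nonneg (n + 1) 1 (t - p.1) (x - p.2)
    by_cases hy : x - p.2 ∈ tsupport χ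
    · have hmem : (p.1, p.2) ∈ Icc s t ×ˢ ((fun z => x - z) '' tsupport χ) :=
        ⟨hτ, (mem_reflect_iff x p.2).2 hy⟩
      rw [cutDuhamel, add_mul, Finset.sum_mul]
      refine (norm_add_le _ _).trans (add_le_add ?_ ?_)
      · rw [norm_mul, mul_assoc]
        exact mul_le_mul ((hA _ hmem).trans (le_abs_self A)) (h1 _ hσ _) (norm_nonneg _)
          (abs_nonneg _)
      · refine (norm_sum_le _ _).trans (Finset.sum_le_sum fun i _ => ?_)
        rw [norm_mul, mul_assoc]
        exact mul_le_mul ((hB i _ hmem).trans (le_abs_self _)) (h2 i _ hσ _) (norm_nonneg _)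
          (abs_nonneg _)
    · rw [cutDuhamel, cutError_eq_zero hy, Finset.sum_eq_zero fun i _ => by
        rw [dx_cutKernel_eq_zero hy, mul_zero], mul_zero, add_zero, norm_zero]
      have : 0 ≤ |A| * C + ∑ i, |B i| * D i := by
        have : 0 ≤ ∑ i, |B i| * D i := Finset.sum_nonneg fun i _ => by
          have := hD i
          positivity
        positivity
      simp only [Pi.add_apply]
      positivity

/-- Duhamel's formula with a cutoff. -/
theorem duhamel_cutoff {v : ℝ → E n → ℝ} (hω : SM v) {F : Fin n → ℝ → E n → ℝ}
    (hF : ∀ i, SM (F i))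
    (heq : ∀ t, 0 < t → ∀ x, dt v t x = ∑ i, dx i (dx i v) t x + ∑ i, dx i (F i) t x)
    {χ : E n → ℝ} (hχ : ContDiff ℝ ∞ χ) (hc : HasCompactSupport χ) (h1 : χ 0 = 1)
    {s t : ℝ} (hs : 0 < s) (hst : s < t) (x : E n) :
    v t x = (∫ y, v s y * cutKernel χ (t - s) (x - y))
      + ∫ τ in Ioo s t, ∫ y, cutDuhamel v F χ t x τ y := by
  have hK : IsCompact ((fun z => x - z) '' tsupport χ) := hc.isCompact.image (by fun_prop)
  have hck := SM.cutKernel (n := n) hχ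
  set Ψ' : ℝ → E n → ℝ := fun τ y => dt v τ y * cutKernel χ (t - τ) (x - y)
    - v τ y * dt (cutKernel χ) (t - τ) (x - y) with hΨ'
  have hz : ∀ y ∉ (fun z => x - z) '' tsupport χ, x - y ∉ tsupport χ :=
    fun y hy h => hy ((mem_reflect_iff x y).2 h)
  have hdt0 : ∀ τ, 0 < τ → ∀ z, dt (cutKernel χ) τ z = dt (heatKernel n) τ z * χ z := by
    intro τ hτ z
    exact ((SM.heatKernel.hasDerivAt hτ z).mul_const (χ z)).deriv
  -- The interval begins at s/2 rather than s so that continuity at the endpoint s comes for free.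
  have hder : ∀ τ ∈ Ioo (s / 2) t, HasDerivAt
      (fun τ => ∫ y, v τ y * cutKernel χ (t - τ) (x - y)) (∫ y, Ψ' τ y) τ := by
    intro τ hτ
    have hs2 : 0 ≤ s / 2 := by positivity
    refine hasDerivAt_integral_of_compact hτ
      (Ψ := fun τ y => v τ y * cutKernel χ (t - τ) (x - y)) (Ψ' := Ψ') ?_ ?_ ?_ hK ?_ ?_
    · intro σ hσ y
      have := (hω.hasDerivAt (by linarith [hσ.1]) y).mul
        ((hck.hasDerivAt (t := t - σ) (by linarith [hσ.2]) (x - y)).comp_const_sub t σ)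
      refine this.congr_deriv ?_
      simp only [hΨ']
      ring
    · exact (hω.continuousOn_Ioo hs2).mul (hck.continuousOn_reflect x)
    · exact ((hω.dt.continuousOn_Ioo hs2).mul (hck.continuousOn_reflect x)).sub
        ((hω.continuousOn_Ioo hs2).mul (hck.dt.continuousOn_reflect x))
    · intro σ hσ y hy
      rw [cutKernel_eq_zero (hz y hy), mul_zero]
    · intro σ hσ y hy
      simp only [hΨ']
      rw [cutKernel_eq_zero (hz y hy), hdt0 _ (by linarith [hσ.2]),
        image_eq_zero_of_notMem_tsupport (hz y hy)]
      ring
  -- The equation for v is inserted and all spatial derivatives are moved to the kernel. The time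
  -- derivative of G then cancels against the Laplacian, leaving the commutator with χ and the flux.
  have hS : ∀ τ ∈ Ioo s t, ∫ y, Ψ' τ y = ∫ y, cutDuhamel v F χ t x τ y := by
    intro τ hτ
    have hτ0 : 0 < τ := hs.trans hτ.1
    have hσ : 0 < t - τ := by linarith [hτ.2]
    have hcs : HasCompactSupport (cutKernel χ (t - τ)) := hasCompactSupport_cutKernel hc _
    have crefl : ∀ {f : E n → ℝ}, Continuous f → Continuous fun y => f (x - y) :=
      fun hf => hf.comp (by fun_prop)
    have int : ∀ {f g : E n → ℝ}, Continuous f → Continuous g →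
        (∀ z ∉ tsupport χ, g z = 0) → Integrable fun y => f y * g (x - y) := by
      intro f g hf hg h0
      refine (hf.mul (crefl hg)).integrable_of_hasCompactSupport
        (HasCompactSupport.intro hK fun y hy => ?_)
      rw [Pi.mul_apply, h0 _ (hz y hy), mul_zero]
    have sl : ∀ {f : ℝ → E n → ℝ}, SM f → Continuous (f τ) := fun hf => hf.slice_continuous hτ0
    have ck0 : Continuous (cutKernel χ (t - τ)) := hck.slice_continuous hσ
    have zk : ∀ z ∉ tsupport χ, cutKernel χ (t - τ) z = 0 := fun z h => cutKernel_eq_zero h _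
    have zd : ∀ i, ∀ z ∉ tsupport χ, dx i (cutKernel χ) (t - τ) z = 0 :=
      fun i z h => dx_cutKernel_eq_zero h _ i
    have zdd : ∀ i, ∀ z ∉ tsupport χ, dx i (dx i (cutKernel χ)) (t - τ) z = 0 := fun i z h =>
      image_eq_zero_of_notMem_tsupport fun h' => h (by
        have h2 := tsupport_pderiv_subset _ i (tsupport_pderiv_subset _ i h')
        refine closure_mono ?_ h2
        intro y hy h0
        exact hy (by simp [cutKernel, h0]))
    have zt : ∀ z ∉ tsupport χ, dt (cutKernel χ) (t - τ) z = 0 := fun z h => by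
      rw [hdt0 _ hσ, image_eq_zero_of_notMem_tsupport h, mul_zero]
    have c1 : ∀ {f : ℝ → E n → ℝ}, SM f → ContDiff ℝ 1 (f τ) :=
      fun hf => (hf.slice hτ0).of_le (by exact_mod_cast le_top)
    have ck1 : ContDiff ℝ 1 (cutKernel χ (t - τ)) := (hck.slice hσ).of_le (by exact_mod_cast le_top)
    have dk1 : ∀ i, ContDiff ℝ 1 (dx i (cutKernel χ) (t - τ)) := fun i =>
      ((hck.dx i).slice hσ).of_le (by exact_mod_cast le_top)
    have p1 : ∀ i, ∫ y, dx i (F i) τ y * cutKernel χ (t - τ) (x - y)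
        = ∫ y, F i τ y * dx i (cutKernel χ) (t - τ) (x - y) := fun i =>
      integral_pderiv_mul_comp_sub (c1 (hF i)) ck1 hcs x i
    have p2 : ∀ i, ∫ y, dx i (dx i v) τ y * cutKernel χ (t - τ) (x - y)
        = ∫ y, v τ y * dx i (dx i (cutKernel χ)) (t - τ) (x - y) := fun i =>
      (integral_pderiv_mul_comp_sub (c1 (hω.dx i)) ck1 hcs x i).trans
        (integral_pderiv_mul_comp_sub (c1 hω) (dk1 i) (HasCompactSupport.pderiv hcs i) x i)
    have i1 : ∀ i, Integrable fun y => dx i (F i) τ y * cutKernel χ (t - τ) (x - y) :=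
      fun i => int (sl ((hF i).dx i)) ck0 zk
    have i2 : ∀ i, Integrable fun y => dx i (dx i v) τ y * cutKernel χ (t - τ) (x - y) :=
      fun i => int (sl ((hω.dx i).dx i)) ck0 zk
    have i3 : ∀ i, Integrable fun y => F i τ y * dx i (cutKernel χ) (t - τ) (x - y) :=
      fun i => int (sl (hF i)) ((hck.dx i).slice_continuous hσ) (zd i)
    have i4 : ∀ i, Integrable fun y => v τ y * dx i (dx i (cutKernel χ)) (t - τ) (x - y) :=
      fun i => int (sl hω) (((hck.dx i).dx i).slice_continuous hσ) (zdd i)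
    have i5 : Integrable fun y => v τ y * dt (cutKernel χ) (t - τ) (x - y) :=
      int (sl hω) (hck.dt.slice_continuous hσ) zt
    have i6 : Integrable fun y => v τ y * cutError χ (t - τ) (x - y) :=
      int (sl hω) ((SM.cutError hχ).slice_continuous hσ) fun z h => cutError_eq_zero h _
    have i12 : Integrable fun y => ∑ i, dx i (dx i v) τ y * cutKernel χ (t - τ) (x - y)
        + ∑ i, dx i (F i) τ y * cutKernel χ (t - τ) (x - y) :=
      (integrable_finsetSum _ fun i _ => i2 i).add (integrable_finsetSum _ fun i _ => i1 i)
    have e1 : ∫ y, Ψ' τ y = ((∑ i, ∫ y, v τ y * dx i (dx i (cutKernel χ)) (t - τ) (x - y))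
        + ∑ i, ∫ y, F i τ y * dx i (cutKernel χ) (t - τ) (x - y))
        - ∫ y, v τ y * dt (cutKernel χ) (t - τ) (x - y) := by
      rw [← Finset.sum_congr rfl fun i _ => p2 i, ← Finset.sum_congr rfl fun i _ => p1 i,
        ← integral_finsetSum _ fun i _ => i2 i, ← integral_finsetSum _ fun i _ => i1 i,
        ← integral_add (integrable_finsetSum _ fun i _ => i2 i)
          (integrable_finsetSum _ fun i _ => i1 i),
        ← integral_sub i12 i5]
      refine integral_congr_ae (Eventually.of_forall fun y => ?_)
      simp only [hΨ']
      rw [heq τ hτ0 y, add_mul, Finset.sum_mul, Finset.sum_mul]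
    rw [e1]
    simp only [cutDuhamel]
    rw [integral_add i6 (integrable_finsetSum _ fun i _ => i3 i),
      integral_finsetSum _ fun i _ => i3 i, add_sub_right_comm, add_left_inj,
      ← integral_finsetSum _ fun i _ => i4 i,
      ← integral_sub (integrable_finsetSum _ fun i _ => i4 i) i5]
    refine integral_congr_ae (Eventually.of_forall fun y => ?_)
    simp only
    rw [← Finset.mul_sum, laplacian_cutKernel hχ hσ, hdt0 _ hσ]
    ring
  have hint : IntervalIntegrable (fun τ => ∫ y, cutDuhamel v F χ t x τ y) volume s t := by
    rw [intervalIntegrable_iff_integrableOn_Ioo_of_le hst.le]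
    have := integrableOn_cutDuhamel hω hF hχ hc (t := t) hs x
    rw [IntegrableOn, ← Measure.prod_restrict, Measure.restrict_univ] at this
    exact this.integral_prod_left
  have hftc := intervalIntegral.integral_eq_sub_of_hasDerivAt_of_tendsto hst
    (f := fun τ => ∫ y, v τ y * cutKernel χ (t - τ) (x - y))
    (f' := fun τ => ∫ y, cutDuhamel v F χ t x τ y)
    (fun τ hτ => by
      rw [← hS τ hτ]
      exact hder τ ⟨by linarith [hτ.1], hτ.2⟩) hint
    ((hder s ⟨by linarith, hst⟩).continuousAt.tendsto.mono_left nhdsWithin_le_nhds)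
    (tendsto_cutKernel hω hχ hc h1 (hs.trans hst) x)
  rw [← integral_Ioc_eq_integral_Ioo, ← intervalIntegral.integral_of_le hst.le, hftc]
  ring

/-! ### Cutoff functions at scale r -/

/-- A fixed bump function, equal to one on the ball of radius `1/2`. -/
def bump (n : ℕ) : ContDiffBump (0 : E n) := ⟨1 / 2, 1, by norm_num, by norm_num⟩

/-- The bump function at scale `r`. -/
def cutoff (r : ℝ) (x : E n) : ℝ := bump n (r⁻¹ • x)

lemma contDiff_cutoff (r : ℝ) : ContDiff ℝ ∞ (cutoff (n := n) r) :=
  (bump n).contDiff.comp (contDiff_const_smul _)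

lemma cutoff_nonneg (r : ℝ) (x : E n) : 0 ≤ cutoff r x := (bump n).nonneg

lemma cutoff_le_one (r : ℝ) (x : E n) : cutoff r x ≤ 1 := (bump n).le_one

lemma abs_cutoff_le (r : ℝ) (x : E n) : |cutoff r x| ≤ 1 := by
  rw [abs_of_nonneg (cutoff_nonneg r x)]; exact cutoff_le_one r x

lemma cutoff_eq_one {r : ℝ} (hr : 0 < r) {x : E n} (hx : ‖x‖ ≤ r / 2) : cutoff r x = 1 := by
  refine (bump n).one_of_mem_closedBall ?_
  rw [mem_closedBall_zero_iff, norm_smul, norm_inv, Real.norm_of_nonneg hr.le, inv_mul_le_iff₀ hr]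
  simpa [bump, div_eq_mul_inv] using hx

lemma cutoff_zero {r : ℝ} (hr : 0 < r) : cutoff r (0 : E n) = 1 :=
  cutoff_eq_one hr (by rw [norm_zero]; positivity)

lemma cutoff_eq_zero {r : ℝ} (hr : 0 < r) {x : E n} (hx : r ≤ ‖x‖) : cutoff r x = 0 := by
  refine (bump n).zero_of_le_dist ?_
  rw [dist_zero_right, norm_smul, norm_inv, Real.norm_of_nonneg hr.le, le_inv_mul_iff₀ hr]
  simpa [bump] using hx

lemma tsupport_cutoff {r : ℝ} (hr : 0 < r) : tsupport (cutoff (n := n) r) ⊆ Metric.closedBall 0 r := by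
  refine closure_minimal (fun x hx => ?_) Metric.isClosed_closedBall
  rw [mem_closedBall_zero_iff]
  by_contra h
  exact hx (cutoff_eq_zero hr (le_of_not_ge h))

lemma hasCompactSupport_cutoff {r : ℝ} (hr : 0 < r) : HasCompactSupport (cutoff (n := n) r) :=
  HasCompactSupport.of_support_subset_isCompact (isCompact_closedBall 0 r)
    ((subset_tsupport _).trans (tsupport_cutoff hr))

lemma pderiv_comp_smul {f : E n → ℝ} (hf : Differentiable ℝ f) (c : ℝ) (i : Fin n) (x : E n) :
    pderiv i (fun y => f (c • y)) x = c * pderiv i f (c • x) := by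
  have h1 : HasFDerivAt (fun y : E n => c • y) (c • ContinuousLinearMap.id ℝ (E n)) x :=
    (hasFDerivAt_id x).const_smul c
  have h2 := ((hf (c • x)).hasFDerivAt.comp x h1).fderiv
  change fderiv ℝ (f ∘ fun y => c • y) x (ev i) = _
  rw [h2]
  simp [pderiv]

lemma contDiff_bump : ContDiff ℝ ∞ (bump n : E n → ℝ) := (bump n).contDiff

lemma pderiv_cutoff (r : ℝ) (i : Fin n) :
    pderiv i (cutoff (n := n) r) = fun x => r⁻¹ * pderiv i (bump n) (r⁻¹ • x) := by
  funext x
  exact pderiv_comp_smul (contDiff_bump.differentiable (by simp)) _ i x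

lemma pderiv_scaled {f : E n → ℝ} (hf : ContDiff ℝ ∞ f) (a c : ℝ) (i : Fin n) :
    pderiv i (fun x => a * f (c • x)) = fun x => a * c * pderiv i f (c • x) := by
  funext x
  have h1 : Differentiable ℝ f := hf.differentiable (by simp)
  have h2 : Differentiable ℝ fun x => f (c • x) := by fun_prop
  rw [pderiv_const_mul a (h2 x), pderiv_comp_smul h1, mul_assoc]

lemma pderiv_pderiv_cutoff (r : ℝ) (i j : Fin n) :
    pderiv j (pderiv i (cutoff (n := n) r)) =
      fun x => (r⁻¹ * r⁻¹) * pderiv j (pderiv i (bump n)) (r⁻¹ • x) := by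
  rw [pderiv_cutoff, pderiv_scaled (contDiff_pderiv contDiff_bump i)]

lemma pderiv_pderiv_pderiv_cutoff (r : ℝ) (i j k : Fin n) :
    pderiv k (pderiv j (pderiv i (cutoff (n := n) r))) =
      fun x => (r⁻¹ * r⁻¹ * r⁻¹) * pderiv k (pderiv j (pderiv i (bump n))) (r⁻¹ • x) := by
  rw [pderiv_pderiv_cutoff, pderiv_scaled (contDiff_pderiv (contDiff_pderiv contDiff_bump i) j)]

/-- Scale-invariant bounds for the derivatives of the cutoff functions. -/
lemma exists_cutoff_bound (n : ℕ) : ∃ C : ℝ, 0 ≤ C ∧ ∀ r : ℝ, 0 < r → ∀ (i j k : Fin n) (x : E n),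
    |pderiv i (cutoff r) x| ≤ C / r ∧ |pderiv j (pderiv i (cutoff r)) x| ≤ C / r ^ 2 ∧
    |pderiv k (pderiv j (pderiv i (cutoff r))) x| ≤ C / r ^ 3 := by
  have hc : HasCompactSupport (bump n : E n → ℝ) := (bump n).hasCompactSupport
  have d0 := contDiff_bump (n := n)
  choose A hA0 hA using fun i => exists_bound_of_compactSupport (contDiff_pderiv d0 i).continuous
    (HasCompactSupport.pderiv hc i)
  choose B hB0 hB using fun i j => exists_bound_of_compactSupport
    (contDiff_pderiv (contDiff_pderiv d0 i) j).continuous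
    (HasCompactSupport.pderiv (HasCompactSupport.pderiv hc i) j)
  choose C hC0 hC using fun i j k => exists_bound_of_compactSupport
    (contDiff_pderiv (contDiff_pderiv (contDiff_pderiv d0 i) j) k).continuous
    (HasCompactSupport.pderiv (HasCompactSupport.pderiv (HasCompactSupport.pderiv hc i) j) k)
  set S := ∑ i, A i + ∑ i, ∑ j, B i j + ∑ i, ∑ j, ∑ k, C i j k
  have sA : 0 ≤ ∑ i, A i := Finset.sum_nonneg fun i _ => hA0 i
  have sB : 0 ≤ ∑ i, ∑ j, B i j := Finset.sum_nonneg fun i _ => Finset.sum_nonneg fun j _ => hB0 i j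
  have sC : 0 ≤ ∑ i, ∑ j, ∑ k, C i j k := Finset.sum_nonneg fun i _ =>
    Finset.sum_nonneg fun j _ => Finset.sum_nonneg fun k _ => hC0 i j k
  have hAS : ∀ i, A i ≤ S := fun i => by
    have := Finset.single_le_sum (fun i _ => hA0 i) (Finset.mem_univ i)
    linarith
  have hBS : ∀ i j, B i j ≤ S := fun i j => by
    have h1 := Finset.single_le_sum (fun j _ => hB0 i j) (Finset.mem_univ j)
    have h2 := Finset.single_le_sum (f := fun i => ∑ j, B i j)
      (fun i _ => Finset.sum_nonneg fun j _ => hB0 i j) (Finset.mem_univ i)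
    linarith
  have hCS : ∀ i j k, C i j k ≤ S := fun i j k => by
    have h0 := Finset.single_le_sum (fun k _ => hC0 i j k) (Finset.mem_univ k)
    have h1 := Finset.single_le_sum (f := fun j => ∑ k, C i j k)
      (fun j _ => Finset.sum_nonneg fun k _ => hC0 i j k) (Finset.mem_univ j)
    have h2 := Finset.single_le_sum (f := fun i => ∑ j, ∑ k, C i j k) (fun i _ =>
      Finset.sum_nonneg fun j _ => Finset.sum_nonneg fun k _ => hC0 i j k) (Finset.mem_univ i)
    linarith
  refine ⟨S, by positivity, fun r hr i j k x => ⟨?_, ?_, ?_⟩⟩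
  · rw [pderiv_cutoff, abs_mul, abs_inv, abs_of_pos hr, div_eq_inv_mul]
    gcongr
    exact (hA i _).trans (hAS i)
  · rw [pderiv_pderiv_cutoff, abs_mul, ← mul_inv, abs_inv, ← sq, abs_of_pos (by positivity),
      div_eq_inv_mul]
    gcongr
    exact (hB i j _).trans (hBS i j)
  · have e : r⁻¹ * r⁻¹ * r⁻¹ = (r ^ 3)⁻¹ := by rw [← mul_inv, ← mul_inv]; congr 1; ring
    rw [pderiv_pderiv_pderiv_cutoff, abs_mul, e, abs_inv, abs_of_pos (by positivity),
      div_eq_inv_mul]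
    gcongr
    exact (hC i j k _).trans (hCS i j k)

lemma cutoff_eventually_one {r : ℝ} (hr : 0 < r) {x : E n} (hx : ‖x‖ < r / 2) :
    cutoff r =ᶠ[𝓝 x] fun _ => (1 : ℝ) := by
  filter_upwards [Metric.isOpen_ball.mem_nhds (mem_ball_zero_iff.2 hx)] with y hy
  exact cutoff_eq_one hr (mem_ball_zero_iff.1 hy).le

lemma pderiv_eventuallyEq_const {f : E n → ℝ} {x : E n} {c : ℝ} (h : f =ᶠ[𝓝 x] fun _ => c)
    (i : Fin n) : pderiv i f =ᶠ[𝓝 x] fun _ => (0 : ℝ) := by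
  filter_upwards [h.eventuallyEq_nhds] with y hy
  rw [pderiv, hy.fderiv_eq]
  simp

lemma pderiv_cutoff_near {r : ℝ} (hr : 0 < r) {x : E n} (hx : ‖x‖ < r / 2) (i : Fin n) :
    pderiv i (cutoff r) x = 0 :=
  (pderiv_eventuallyEq_const (cutoff_eventually_one hr hx) i).self_of_nhds

lemma pderiv_pderiv_cutoff_near {r : ℝ} (hr : 0 < r) {x : E n} (hx : ‖x‖ < r / 2) (i j : Fin n) :
    pderiv j (pderiv i (cutoff r)) x = 0 :=
  (pderiv_eventuallyEq_const
    (pderiv_eventuallyEq_const (cutoff_eventually_one hr hx) i) j).self_of_nhds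

lemma cutError_near {r : ℝ} (hr : 0 < r) {x : E n} (hx : ‖x‖ < r / 2) (t : ℝ) :
    cutError (cutoff r) t x = 0 := by
  refine Finset.sum_eq_zero fun i _ => ?_
  rw [pderiv_cutoff_near hr hx, pderiv_pderiv_cutoff_near hr hx]
  simp

/-- Since √t (1 + |x|/√t) = √t + |x| ≥ r/2, taking as many powers of the weight as of √t removes the
dependence on t. -/
lemma HC.bound_far {a : ℕ} {F : ℝ → E n → ℝ} (h : HC a F) :
    ∃ C : ℝ, 0 ≤ C ∧ ∀ t, 0 < t → ∀ r, 0 < r → ∀ x : E n, r / 2 ≤ ‖x‖ →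
      |F t x| ≤ C / r ^ (n + a) := by
  obtain ⟨C, hC, hb⟩ := h.bound (n + a)
  refine ⟨C * 2 ^ (n + a), by positivity, fun t ht r hr x hx => (hb t ht x).trans ?_⟩
  have h0 : 0 < √t := Real.sqrt_pos.2 ht
  have h1 : r ≤ 2 * (√t * (1 + ‖x‖ / √t)) := by
    rw [mul_add, mul_one, mul_div_cancel₀ _ h0.ne']
    linarith
  rw [kb, ← mul_pow, ← div_eq_mul_inv, div_le_div_iff₀ (by positivity) (by positivity), mul_assoc,
    ← mul_pow]
  gcongr

/-- The derivatives of the commutator at scale `r` are `O(r^{-3})` times an approximate identity. -/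
lemma exists_dx_cutError_bound (n : ℕ) : ∃ C : ℝ, 0 ≤ C ∧ ∀ r : ℝ, 0 < r → ∀ t, 0 < t →
    ∀ (h : Fin n) (x : E n), |dx h (cutError (cutoff r)) t x| ≤ C / r ^ 3 * kb (n + 1) 0 (r ^ 2) x := by
  obtain ⟨B, hB0, hB⟩ := exists_cutoff_bound n
  obtain ⟨A0, hA0, a0⟩ := (HC.base (n := n)).bound_far
  choose A1 hA1 a1 using fun i => ((HC.base (n := n)).dx i).bound_far
  choose A2 hA2 a2 using fun i j => (((HC.base (n := n)).dx i).dx j).bound_far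
  set S := A0 + ∑ i, A1 i + ∑ i, ∑ j, A2 i j
  have s1 : 0 ≤ ∑ i, A1 i := Finset.sum_nonneg fun i _ => hA1 i
  have s2 : 0 ≤ ∑ i, ∑ j, A2 i j := Finset.sum_nonneg fun i _ => Finset.sum_nonneg fun j _ => hA2 i j
  have h0S : A0 ≤ S := by linarith
  have h1S : ∀ i, A1 i ≤ S := fun i => by
    have := Finset.single_le_sum (fun i _ => hA1 i) (Finset.mem_univ i)
    linarith
  have h2S : ∀ i j, A2 i j ≤ S := fun i j => by
    have h1 := Finset.single_le_sum (fun j _ => hA2 i j) (Finset.mem_univ j)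
    have h2 := Finset.single_le_sum (f := fun i => ∑ j, A2 i j)
      (fun i _ => Finset.sum_nonneg fun j _ => hA2 i j) (Finset.mem_univ i)
    linarith
  have hS : 0 ≤ S := by positivity
  -- There are n summands of 2·2 + 2 products, each at most SB/r^{n+3}; the factor 2^{n+1} pays for
  -- the comparison `hk`.
  refine ⟨n * (6 * (S * B)) * 2 ^ (n + 1), by positivity, fun r hr t ht h x => ?_⟩
  have hkb := kb_nonneg (n + 1) 0 (r ^ 2) x
  have hrhs : 0 ≤ n * (6 * (S * B)) * 2 ^ (n + 1) / r ^ 3 * kb (n + 1) 0 (r ^ 2) x := by positivity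
  by_cases hx1 : ‖x‖ < r / 2
  · have : cutError (cutoff r) t =ᶠ[𝓝 x] fun _ => (0 : ℝ) := by
      filter_upwards [Metric.isOpen_ball.mem_nhds (mem_ball_zero_iff.2 hx1)] with y hy
      exact cutError_near hr (mem_ball_zero_iff.1 hy) t
    rw [dx, (pderiv_eventuallyEq_const this h).self_of_nhds, abs_zero]
    exact hrhs
  by_cases hx2 : r < ‖x‖
  · have : cutError (cutoff r) t =ᶠ[𝓝 x] fun _ => (0 : ℝ) := by
      have hmem : x ∈ (Metric.closedBall (0 : E n) r)ᶜ := by simpa using hx2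
      filter_upwards [Metric.isClosed_closedBall.isOpen_compl.mem_nhds hmem] with y hy
      exact cutError_eq_zero (fun h' => hy (tsupport_cutoff hr h')) t
    rw [dx, (pderiv_eventuallyEq_const this h).self_of_nhds, abs_zero]
    exact hrhs
  push Not at hx1 hx2
  -- On the ball of radius r the majorant at time r² is comparable to r^{-n}. The pointwise bound on
  -- the support is thereby turned into r^{-3} times a function whose mass does not depend on r.
  have hk : 1 ≤ 2 ^ (n + 1) * r ^ n * kb (n + 1) 0 (r ^ 2) x := by
    rw [kb, Real.sqrt_sq hr.le, add_zero, ← div_eq_mul_inv, le_div_iff₀ (by positivity), one_mul,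
      mul_comm]
    gcongr
    have : ‖x‖ / r ≤ 1 := by rw [div_le_one hr]; exact hx2
    linarith
  have e : dx h (cutError (cutoff r)) t x = ∑ i,
      (2 * (pderiv h (pderiv i (heatKernel n t)) x * pderiv i (cutoff r) x
          + pderiv i (heatKernel n t) x * pderiv h (pderiv i (cutoff r)) x)
        + (pderiv h (heatKernel n t) x * pderiv i (pderiv i (cutoff r)) x
          + heatKernel n t x * pderiv h (pderiv i (pderiv i (cutoff r))) x)) := by
    have c1 := contDiff_cutoff (n := n) r
    have g0 := (SM.heatKernel (n := n)).slice_differentiable ht x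
    have g1 : ∀ i, DifferentiableAt ℝ (pderiv i (heatKernel n t)) x := fun i =>
      ((SM.heatKernel (n := n)).dx i).slice_differentiable ht x
    have d1 : ∀ i, DifferentiableAt ℝ (pderiv i (cutoff (n := n) r)) x := fun i =>
      (contDiff_pderiv c1 i).differentiable (by simp) x
    have d2 : ∀ i, DifferentiableAt ℝ (pderiv i (pderiv i (cutoff (n := n) r))) x := fun i =>
      (contDiff_pderiv (contDiff_pderiv c1 i) i).differentiable (by simp) x
    have m1 : ∀ i, DifferentiableAt ℝ (fun y => pderiv i (heatKernel n t) y * pderiv i (cutoff r) y) x :=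
      fun i => (g1 i).mul (d1 i)
    have m2 : ∀ i, DifferentiableAt ℝ (fun y => 2 * (pderiv i (heatKernel n t) y *
      pderiv i (cutoff r) y)) x := fun i => (m1 i).const_mul 2
    have m3 : ∀ i, DifferentiableAt ℝ (fun y => heatKernel n t y *
      pderiv i (pderiv i (cutoff r)) y) x := fun i => g0.mul (d2 i)
    change pderiv h (fun y => ∑ i, (2 * (pderiv i (heatKernel n t) y * pderiv i (cutoff r) y)
      + heatKernel n t y * pderiv i (pderiv i (cutoff r)) y)) x = _
    have m4 : ∀ i, DifferentiableAt ℝ (fun y => 2 * (pderiv i (heatKernel n t) y * pderiv i (cutoff r) y)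
      + heatKernel n t y * pderiv i (pderiv i (cutoff r)) y) x := fun i => (m2 i).add (m3 i)
    rw [pderiv_sum fun i _ => m4 i]
    refine Finset.sum_congr rfl fun i _ => ?_
    rw [pderiv_add (m2 i) (m3 i), pderiv_const_mul 2 (m1 i), pderiv_mul (g1 i) (d1 i),
      pderiv_mul g0 (d2 i)]
  have pr : ∀ {p q P Q : ℝ} {a b : ℕ}, |p| ≤ P / r ^ (n + a) → P ≤ S → |q| ≤ Q / r ^ b → Q = B →
      a + b = 3 → |p * q| ≤ S * B / r ^ (n + 3) := by
    intro p q P Q a b hp hP hq hQ hab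
    rw [abs_mul, ← hab, ← add_assoc, pow_add r (n + a), ← div_mul_div_comm]
    refine mul_le_mul (hp.trans ?_) (hq.trans (by rw [hQ])) (abs_nonneg _) (by positivity)
    gcongr
  rw [e]
  have hterm : ∀ i : Fin n, |2 * (pderiv h (pderiv i (heatKernel n t)) x * pderiv i (cutoff r) x
          + pderiv i (heatKernel n t) x * pderiv h (pderiv i (cutoff r)) x)
        + (pderiv h (heatKernel n t) x * pderiv i (pderiv i (cutoff r)) x
          + heatKernel n t x * pderiv h (pderiv i (pderiv i (cutoff r))) x)|
      ≤ 6 * (S * B / r ^ (n + 3)) := by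
    intro i
    have t1 := pr (a := 2) (b := 1) (a2 i h t ht r hr x hx1) (h2S i h)
      (by rw [pow_one]; exact (hB r hr i i i x).1) rfl rfl
    have t2 := pr (a := 1) (b := 2) (a1 i t ht r hr x hx1) (h1S i) (hB r hr i h i x).2.1 rfl rfl
    have t3 := pr (a := 1) (b := 2) (a1 h t ht r hr x hx1) (h1S h) (hB r hr i i i x).2.1 rfl rfl
    have t4 := pr (a := 0) (b := 3) (a0 t ht r hr x hx1) h0S (hB r hr i i h x).2.2 rfl rfl
    change |pderiv h (pderiv i (heatKernel n t)) x * _| ≤ _ at t1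
    change |pderiv i (heatKernel n t) x * _| ≤ _ at t2
    change |pderiv h (heatKernel n t) x * _| ≤ _ at t3
    rw [abs_le] at t1 t2 t3 t4 ⊢
    constructor <;> linarith [t1.1, t1.2, t2.1, t2.2, t3.1, t3.2, t4.1, t4.2]
  calc _ ≤ ∑ i : Fin n, 6 * (S * B / r ^ (n + 3)) :=
        (Finset.abs_sum_le_sum_abs _ _).trans (Finset.sum_le_sum fun i _ => hterm i)
    _ = n * (6 * (S * B)) / r ^ 3 * (r ^ n)⁻¹ * 1 := by
        rw [Finset.sum_const, Finset.card_univ, Fintype.card_fin, nsmul_eq_mul, pow_add]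
        field_simp
    _ ≤ n * (6 * (S * B)) / r ^ 3 * (r ^ n)⁻¹ * (2 ^ (n + 1) * r ^ n * kb (n + 1) 0 (r ^ 2) x) := by
        gcongr
    _ = _ := by field_simp

/-- First derivatives of the cut-off heat kernel at scale `r`. -/
lemma exists_dx_cutKernel_bound (n : ℕ) : ∃ C : ℝ, 0 ≤ C ∧ ∀ r : ℝ, 0 < r → ∀ t, 0 < t →
    ∀ (h : Fin n) (x : E n), |dx h (cutKernel (cutoff r)) t x| ≤
      C * (kb (n + 1) 1 t x + r⁻¹ * kb (n + 1) 0 t x) := by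
  obtain ⟨B, hB0, hB⟩ := exists_cutoff_bound n
  obtain ⟨A0, hA0, a0⟩ := (HC.base (n := n)).bound (n + 1)
  choose A1 hA1 a1 using fun i => ((HC.base (n := n)).dx i).bound (n + 1)
  have s1 : 0 ≤ ∑ i, A1 i := Finset.sum_nonneg fun i _ => hA1 i
  refine ⟨∑ i, A1 i + A0 * B, by positivity, fun r hr t ht h x => ?_⟩
  have k0 := kb_nonneg (n + 1) 0 t x
  have k1 := kb_nonneg (n + 1) 1 t x
  have hr' : 0 ≤ r⁻¹ := by positivity
  rw [dx_cutKernel (contDiff_cutoff r) ht]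
  have e1 : |pderiv h (heatKernel n t) x * cutoff r x| ≤ (∑ i, A1 i) * kb (n + 1) 1 t x := by
    rw [abs_mul, ← mul_one ((∑ i, A1 i) * _)]
    refine mul_le_mul ((a1 h t ht x).trans ?_) (abs_cutoff_le r x) (abs_nonneg _) (by positivity)
    gcongr
    exact Finset.single_le_sum (fun i _ => hA1 i) (Finset.mem_univ h)
  have e2 : |heatKernel n t x * pderiv h (cutoff r) x| ≤ A0 * B * (r⁻¹ * kb (n + 1) 0 t x) := by
    rw [abs_mul]
    calc _ ≤ (A0 * kb (n + 1) 0 t x) * (B / r) :=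
          mul_le_mul (a0 t ht x) (hB r hr h h h x).1 (abs_nonneg _) (by positivity)
      _ = _ := by ring
  refine (abs_add_le _ _).trans ((add_le_add e1 e2).trans ?_)
  have m1 := mul_nonneg s1 (mul_nonneg hr' k0)
  have m2 := mul_nonneg (mul_nonneg hA0 hB0) k1
  nlinarith

/-! ### Divergence form of the vorticity equation and pointwise bounds -/

/-- The flux of the vorticity equation. -/
def flux (u : ℝ → E n → E n) (h k i : Fin n) (t : ℝ) (x : E n) : ℝ :=
  (if i = k then force u h t x else 0) - (if i = h then force u k t x else 0)

lemma SM.zero : SM (fun _ (_ : E n) => (0 : ℝ)) := contDiffOn_const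

lemma SM.flux {u : ℝ → E n → E n}
    (hu : ContDiffOn ℝ ∞ (Function.uncurry u) (Ioi 0 ×ˢ univ)) (h k i : Fin n) :
    SM (flux u h k i) := by
  refine SM.sub ?_ ?_
  · split_ifs
    · exact SM.force hu h
    · exact SM.zero
  · split_ifs
    · exact SM.force hu k
    · exact SM.zero

lemma sum_dx_flux {u : ℝ → E n → E n}
    (hu : ContDiffOn ℝ ∞ (Function.uncurry u) (Ioi 0 ×ˢ univ)) (h k : Fin n) {t : ℝ} (ht : 0 < t)
    (x : E n) : ∑ i, dx i (flux u h k i) t x = dx k (force u h) t x - dx h (force u k) t x := by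
  have d : ∀ h, DifferentiableAt ℝ (force u h t) x := fun h =>
    (SM.force hu h).slice_differentiable ht x
  have e : ∀ i, dx i (flux u h k i) t x = (if i = k then dx i (force u h) t x else 0)
      - (if i = h then dx i (force u k) t x else 0) := by
    intro i
    have h1 : DifferentiableAt ℝ (fun y => if i = k then force u h t y else 0) x := by
      split_ifs
      · exact d h
      · exact differentiableAt_const _
    have h2 : DifferentiableAt ℝ (fun y => if i = h then force u k t y else 0) x := by
      split_ifs
      · exact d k
      · exact differentiableAt_const _
    have := pderiv_sub h1 h2 i
    have e0 : dx i (flux u h k i) t x = pderiv i (fun y => (if i = k then force u h t y else 0)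
      - (if i = h then force u k t y else 0)) x := rfl
    rw [e0, this]
    congr 1
    · split_ifs
      · rfl
      · simp [pderiv]
    · split_ifs
      · rfl
      · simp [pderiv]
  simp [e]

lemma sum_flux_mul (u : ℝ → E n → E n) (h k : Fin n) (t : ℝ) (x : E n) (g : Fin n → ℝ) :
    ∑ i, flux u h k i t x * g i = force u h t x * g k - force u k t x * g h := by
  simp [flux, sub_mul]

/-- Integration by parts for the vorticity. -/
lemma integral_vorticity_mul {u : ℝ → E n → E n}
    (hu : ContDiffOn ℝ ∞ (Function.uncurry u) (Ioi 0 ×ˢ univ)) (h k : Fin n) {t : ℝ} (ht : 0 < t)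
    {φ : E n → ℝ} (hφ : ContDiff ℝ 1 φ) (hc : HasCompactSupport φ) (x : E n) :
    ∫ y, vorticity u h k t y * φ (x - y) =
      ∫ y, (u t y k * pderiv h φ (x - y) - u t y h * pderiv k φ (x - y)) := by
  have c1 : ∀ j, ContDiff ℝ 1 (fun y => u t y j) := fun j =>
    ((SM.component hu j).slice ht).of_le (by exact_mod_cast le_top)
  have hK : IsCompact ((fun z => x - z) '' tsupport φ) := hc.isCompact.image (by fun_prop)
  have hz : ∀ y ∉ (fun z => x - z) '' tsupport φ, x - y ∉ tsupport φ :=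
    fun y hy h => hy ((mem_reflect_iff x y).2 h)
  have i1 : ∀ i j, Integrable fun y => pderiv i (fun y => u t y j) y * φ (x - y) := by
    intro i j
    have cd : Continuous (pderiv i (fun y => u t y j)) :=
      (((SM.component hu j).dx i).slice_continuous ht)
    refine (cd.mul (hφ.continuous.comp (by fun_prop : Continuous fun y => x - y))).integrable_of_hasCompactSupport
      (HasCompactSupport.intro hK fun y hy => ?_)
    simp only [Pi.mul_apply, Function.comp_apply]
    rw [image_eq_zero_of_notMem_tsupport (hz y hy), mul_zero]
  have i2 : ∀ i j, Integrable fun y => u t y j * pderiv i φ (x - y) := by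
    intro i j
    have cd : Continuous (pderiv i φ) := (hφ.continuous_fderiv (by simp)).clm_apply continuous_const
    refine ((c1 j).continuous.mul (cd.comp (by fun_prop : Continuous fun y => x - y))).integrable_of_hasCompactSupport
      (HasCompactSupport.intro hK fun y hy => ?_)
    simp only [Pi.mul_apply, Function.comp_apply]
    rw [image_eq_zero_of_notMem_tsupport fun h' => hz y hy (tsupport_pderiv_subset φ i h'), mul_zero]
  rw [integral_sub (i2 h k) (i2 k h), ← integral_pderiv_mul_comp_sub (c1 k) hφ hc x h,
    ← integral_pderiv_mul_comp_sub (c1 h) hφ hc x k, ← integral_sub (i1 h k) (i1 k h)]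
  refine integral_congr_ae (Eventually.of_forall fun y => ?_)
  simp only [vorticity]
  ring

lemma integral_inv_sqrt {s t : ℝ} (h : s ≤ t) : ∫ τ in Ioo s t, (√(t - τ))⁻¹ = 2 * √(t - s) := by
  rw [← integral_Ioc_eq_integral_Ioo, ← intervalIntegral.integral_of_le h,
    intervalIntegral.integral_comp_sub_left (fun σ => (√σ)⁻¹) t, sub_self]
  have e : ∀ σ : ℝ, 0 ≤ σ → (√σ)⁻¹ = σ ^ (-(1 / 2) : ℝ) := fun σ hσ => by
    rw [Real.rpow_neg hσ, Real.sqrt_eq_rpow]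
  have : ∫ σ in (0 : ℝ)..(t - s), (√σ)⁻¹ = ∫ σ in (0 : ℝ)..(t - s), σ ^ (-(1 / 2) : ℝ) := by
    refine intervalIntegral.integral_congr fun σ hσ => e σ ?_
    rw [uIcc_of_le (sub_nonneg.2 h)] at hσ
    exact hσ.1
  rw [this, integral_rpow (Or.inl (by norm_num)), Real.sqrt_eq_rpow]
  norm_num
  ring

lemma integrable_kb_sub {K : ℕ} (hK : n + 1 ≤ K) (a : ℕ) {t : ℝ} (ht : 0 < t) (x : E n) :
    Integrable (fun y : E n => kb K a t (x - y)) :=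
  (integrable_kb hK a ht).comp_sub_left x

lemma integral_kb_sub (K a : ℕ) {t : ℝ} (ht : 0 < t) (x : E n) :
    ∫ y : E n, kb K a t (x - y) = weightMass n K / √t ^ a := by
  rw [← integral_kb K a ht]
  exact integral_sub_left_eq_self (fun y => kb K a t y) volume x

lemma integrable_mul_reflect {g φ : E n → ℝ} (hg : Continuous g) (hφ : Continuous φ)
    (hc : HasCompactSupport φ) (x : E n) : Integrable fun y => g y * φ (x - y) := by
  refine (hg.mul (hφ.comp (by fun_prop : Continuous fun y => x - y))).integrable_of_hasCompactSupport
    (HasCompactSupport.intro (hc.isCompact.image (by fun_prop : Continuous fun z => x - z))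
      fun y hy => ?_)
  simp only [Pi.mul_apply, Function.comp_apply]
  rw [image_eq_zero_of_notMem_tsupport fun h => hy ((mem_reflect_iff x y).2 h), mul_zero]

lemma hasCompactSupport_cutError {χ : E n → ℝ} (hc : HasCompactSupport χ) (t : ℝ) :
    HasCompactSupport (cutError χ t) :=
  HasCompactSupport.intro hc.isCompact fun _ hx => cutError_eq_zero hx t

lemma hasCompactSupport_dx_cutKernel {χ : E n → ℝ} (hc : HasCompactSupport χ) (i : Fin n) (t : ℝ) :
    HasCompactSupport (dx i (cutKernel χ) t) :=
  HasCompactSupport.intro hc.isCompact fun _ hx => dx_cutKernel_eq_zero hx t i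

/-- The size of the vorticity tensor. -/
def vort (u : ℝ → E n → E n) (t : ℝ) (x : E n) : ℝ := ∑ h, ∑ k, |vorticity u h k t x|

lemma vort_nonneg (u : ℝ → E n → E n) (t : ℝ) (x : E n) : 0 ≤ vort u t x :=
  Finset.sum_nonneg fun _ _ => Finset.sum_nonneg fun _ _ => abs_nonneg _

lemma abs_vorticity_le (u : ℝ → E n → E n) (h k : Fin n) (t : ℝ) (x : E n) :
    |vorticity u h k t x| ≤ vort u t x :=
  (Finset.single_le_sum (f := fun k => |vorticity u h k t x|) (fun _ _ => abs_nonneg _)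
    (Finset.mem_univ k)).trans
  (Finset.single_le_sum (f := fun h => ∑ k, |vorticity u h k t x|)
    (fun _ _ => Finset.sum_nonneg fun _ _ => abs_nonneg _) (Finset.mem_univ h))

lemma vort_le_of_forall {u : ℝ → E n → E n} {t : ℝ} {x : E n} {B : ℝ}
    (h : ∀ h k, |vorticity u h k t x| ≤ B) : vort u t x ≤ n ^ 2 * B := by
  refine (Finset.sum_le_sum fun i _ => Finset.sum_le_sum fun k _ => h i k).trans (le_of_eq ?_)
  simp [sq, mul_assoc]

lemma abs_force_le (u : ℝ → E n → E n) (h : Fin n) (t : ℝ) (x : E n) :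
    |force u h t x| ≤ ‖u t x‖ * vort u t x := by
  have h1 : ∑ j, |vorticity u j h t x| ≤ vort u t x :=
    Finset.sum_le_sum fun j _ => Finset.single_le_sum (f := fun k => |vorticity u j k t x|)
      (fun _ _ => abs_nonneg _) (Finset.mem_univ h)
  refine (Finset.abs_sum_le_sum_abs _ _).trans ((Finset.sum_le_sum fun j _ => ?_).trans
    ((Finset.mul_sum _ _ _).symm.le.trans (mul_le_mul_of_nonneg_left h1 (norm_nonneg _))))
  rw [abs_mul, mul_comm]
  exact mul_le_mul_of_nonneg_right (PiLp.norm_apply_le (u t x) j) (abs_nonneg _)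

/-! ### Pointwise bound of the vorticity from velocity bounds alone -/

/-- A smooth divergence-free flow solving the vorticity equation, with the decay of the velocity
in `L^1` and `L^∞`. -/
structure DecayingFlow (u : ℝ → E n → E n) (C : ℝ) : Prop where
  smooth : ContDiffOn ℝ ∞ (Function.uncurry u) (Ioi 0 ×ˢ univ)
  equation : ∀ (h k : Fin n) (t : ℝ), 0 < t → ∀ x, dt (vorticity u h k) t x =
    ∑ i, dx i (dx i (vorticity u h k)) t x + ∑ i, dx i (flux u h k i) t x
  divergence_free : ∀ t : ℝ, 0 < t → ∀ x : E n, ∑ j, pderiv j (fun y => u t y j) x = 0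
  nonneg : 0 ≤ C
  bound : ∀ t, 0 < t → ∀ x, ‖u t x‖ ≤ C / √(1 + t) ^ (n + 1)
  integrable : ∀ t, 0 < t → Integrable (u t)
  mass : ∀ t, 0 < t → ∫ x, ‖u t x‖ ≤ C

lemma one_le_sqrt_one_add {t : ℝ} (ht : 0 < t) : 1 ≤ √(1 + t) := by
  rw [Real.one_le_sqrt]; linarith

lemma DecayingFlow.norm_le {u : ℝ → E n → E n} {C : ℝ} (hf : DecayingFlow u C) {t : ℝ} (ht : 0 < t)
    (x : E n) : ‖u t x‖ ≤ C :=
  (hf.bound t ht x).trans (div_le_self hf.nonneg (one_le_pow₀ (one_le_sqrt_one_add ht)))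

lemma DecayingFlow.abs_le {u : ℝ → E n → E n} {C : ℝ} (hf : DecayingFlow u C) {t : ℝ} (ht : 0 < t)
    (x : E n) (j : Fin n) : |u t x j| ≤ C :=
  (PiLp.norm_apply_le (u t x) j).trans (hf.norm_le ht x)

lemma abs_mul_sub_mul_le {a b c d A B : ℝ} (ha : |a| ≤ A) (hb : |b| ≤ A) (hc : |c| ≤ B)
    (hd : |d| ≤ B) : |a * c - b * d| ≤ 2 * A * B := by
  have hA := (abs_nonneg a).trans ha
  have h1 : |a * c| ≤ A * B := by rw [abs_mul]; exact mul_le_mul ha hc (abs_nonneg _) hA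
  have h2 : |b * d| ≤ A * B := by rw [abs_mul]; exact mul_le_mul hb hd (abs_nonneg _) hA
  have := abs_sub (a * c) (b * d)
  linarith

/-- Interior estimate: the vorticity at a point is controlled by the size of the velocity and the
vorticity in a parabolic cylinder. -/
lemma exists_interior_estimate (n : ℕ) : ∃ C : ℝ, 0 ≤ C ∧ ∀ (u : ℝ → E n → E n) (C₀ : ℝ),
    DecayingFlow u C₀ → ∀ (h k : Fin n) (t r A : ℝ) (x : E n), 0 < r → r ^ 2 < t → 0 ≤ A →
    (∀ τ ∈ Ioo (t - r ^ 2) t, ∀ y, ‖x - y‖ ≤ r → vort u τ y ≤ A) →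
    |vorticity u h k t x| ≤ C * C₀ * (r⁻¹ + r * A) := by
  obtain ⟨C1, h1, b1⟩ := exists_dx_cutError_bound n
  obtain ⟨C2, h2, b2⟩ := exists_dx_cutKernel_bound n
  set m := weightMass n (n + 1) with hm
  have hm0 : 0 ≤ m := weightMass_nonneg n _
  refine ⟨4 * C2 * m + 2 * C1 * m + 6 * C2 * m, by positivity,
    fun u C₀ hf h k t r A x hr hrt hA hW => ?_⟩
  have hC₀ := hf.nonneg
  have hr2 : 0 < r ^ 2 := by positivity
  have hs : 0 < t - r ^ 2 := by linarith
  have hχ := contDiff_cutoff (n := n) r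
  have hc := hasCompactSupport_cutoff (n := n) hr
  have key := duhamel_cutoff (SM.vorticity hf.smooth h k) (fun i => SM.flux hf.smooth h k i)
    (hf.equation h k) hχ hc (cutoff_zero hr) hs (by linarith : t - r ^ 2 < t) x
  rw [key]
  have hle1 : (1 : WithTop ℕ∞) ≤ (∞ : WithTop ℕ∞) := by exact_mod_cast le_top
  -- The vorticity at the initial time is integrated by parts onto the kernel at time r², so only
  -- the velocity is needed; the gradient of the cut-off kernel has mass O(1/r).
  have T1 : |∫ y, vorticity u h k (t - r ^ 2) y * cutKernel (cutoff r) (t - (t - r ^ 2)) (x - y)|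
      ≤ 4 * C2 * m * (C₀ * r⁻¹) := by
    rw [sub_sub_cancel, integral_vorticity_mul hf.smooth h k hs
      (((SM.cutKernel hχ).slice hr2).of_le hle1) (hasCompactSupport_cutKernel hc _) x]
    have j : Integrable fun y => 2 * C₀ * (C2 * (kb (n + 1) 1 (r ^ 2) (x - y) +
        r⁻¹ * kb (n + 1) 0 (r ^ 2) (x - y))) :=
      (((integrable_kb_sub le_rfl 1 hr2 x).add
        ((integrable_kb_sub le_rfl 0 hr2 x).const_mul r⁻¹)).const_mul C2).const_mul (2 * C₀)
    rw [← Real.norm_eq_abs]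
    refine LE.le.trans (norm_integral_le_of_norm_le j (Eventually.of_forall fun y => ?_)) (le_of_eq ?_)
    · exact abs_mul_sub_mul_le (hf.abs_le hs y k) (hf.abs_le hs y h) (b2 r hr _ hr2 h _)
        (b2 r hr _ hr2 k _)
    rw [integral_const_mul, integral_const_mul, integral_add (integrable_kb_sub le_rfl 1 hr2 x)
      ((integrable_kb_sub le_rfl 0 hr2 x).const_mul r⁻¹), integral_const_mul, integral_kb_sub _ _ hr2,
      integral_kb_sub _ _ hr2, Real.sqrt_sq hr.le, ← hm]
    field_simp
    ring
  -- The commutator is treated by the same integration by parts and gives r^{-3} at each time, hence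
  -- 1/r after integration over a time r². The flux is at most C₀A times a kernel of mass
  -- (t−τ)^{-1/2} + 1/r, hence contributes C₀ A r.
  have T2 : ∀ τ ∈ Ioo (t - r ^ 2) t, ‖∫ y, cutDuhamel (vorticity u h k) (flux u h k) (cutoff r) t x τ y‖
      ≤ 2 * C₀ * (C1 / r ^ 3 * m) + 2 * (C₀ * A) * (C2 * (m * (√(t - τ))⁻¹ + r⁻¹ * m)) := by
    intro τ hτ
    have hτ0 : 0 < τ := hs.trans hτ.1
    have hσ : 0 < t - τ := sub_pos.2 hτ.2
    have i1 : Integrable fun y => vorticity u h k τ y * cutError (cutoff r) (t - τ) (x - y) :=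
      integrable_mul_reflect ((SM.vorticity hf.smooth h k).slice_continuous hτ0)
        ((SM.cutError hχ).slice_continuous hσ) (hasCompactSupport_cutError hc _) x
    have i2 : Integrable fun y => ∑ i, flux u h k i τ y * dx i (cutKernel (cutoff r)) (t - τ) (x - y) :=
      integrable_finsetSum _ fun i _ =>
        integrable_mul_reflect ((SM.flux hf.smooth h k i).slice_continuous hτ0)
        (((SM.cutKernel hχ).dx i).slice_continuous hσ) (hasCompactSupport_dx_cutKernel hc i _) x
    have e1 : ‖∫ y, vorticity u h k τ y * cutError (cutoff r) (t - τ) (x - y)‖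
        ≤ 2 * C₀ * (C1 / r ^ 3 * m) := by
      rw [integral_vorticity_mul hf.smooth h k hτ0 (((SM.cutError hχ).slice hσ).of_le hle1)
        (hasCompactSupport_cutError hc _) x]
      refine (norm_integral_le_of_norm_le ((((integrable_kb_sub le_rfl 0 hr2 x)).const_mul
        (C1 / r ^ 3)).const_mul (2 * C₀)) (Eventually.of_forall fun y =>
          abs_mul_sub_mul_le (hf.abs_le hτ0 y k) (hf.abs_le hτ0 y h)
        (b1 r hr _ hσ h _) (b1 r hr _ hσ k _))).trans (le_of_eq ?_)
      rw [integral_const_mul, integral_const_mul, integral_kb_sub _ _ hr2, ← hm, pow_zero, div_one]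
    have e2 : ‖∫ y, ∑ i, flux u h k i τ y * dx i (cutKernel (cutoff r)) (t - τ) (x - y)‖
        ≤ 2 * (C₀ * A) * (C2 * (m * (√(t - τ))⁻¹ + r⁻¹ * m)) := by
      have hpt : ∀ y, ‖∑ i, flux u h k i τ y * dx i (cutKernel (cutoff r)) (t - τ) (x - y)‖ ≤
          2 * (C₀ * A) * (C2 * (kb (n + 1) 1 (t - τ) (x - y) + r⁻¹ * kb (n + 1) 0 (t - τ) (x - y))) := by
        intro y
        rw [sum_flux_mul]
        by_cases hy : ‖x - y‖ ≤ r
        · have hfo : ∀ j, |force u j τ y| ≤ C₀ * A := fun j => (abs_force_le u j τ y).trans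
            (mul_le_mul (hf.norm_le hτ0 y) (hW τ hτ y hy) (vort_nonneg _ _ _) hC₀)
          exact abs_mul_sub_mul_le (hfo h) (hfo k) (b2 r hr _ hσ k _) (b2 r hr _ hσ h _)
        · have hn : x - y ∉ tsupport (cutoff (n := n) r) := fun h' => hy (by
            simpa using tsupport_cutoff hr h')
          rw [dx_cutKernel_eq_zero hn, dx_cutKernel_eq_zero hn]
          have k0 := kb_nonneg (n + 1) 0 (t - τ) (x - y)
          have k1 := kb_nonneg (n + 1) 1 (t - τ) (x - y)
          simp only [mul_zero, sub_zero, norm_zero]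
          positivity
      refine (norm_integral_le_of_norm_le (((((integrable_kb_sub le_rfl 1 hσ x)).add
        ((integrable_kb_sub le_rfl 0 hσ x).const_mul r⁻¹)).const_mul C2).const_mul (2 * (C₀ * A)))
        (Eventually.of_forall hpt)).trans (le_of_eq ?_)
      simp only [Pi.add_apply]
      rw [integral_const_mul, integral_const_mul, integral_add (integrable_kb_sub le_rfl 1 hσ x)
        ((integrable_kb_sub le_rfl 0 hσ x).const_mul r⁻¹), integral_const_mul, integral_kb_sub _ _ hσ,
        integral_kb_sub _ _ hσ, ← hm, pow_one, pow_zero, div_one, div_eq_mul_inv]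
    have : ∫ y, cutDuhamel (vorticity u h k) (flux u h k) (cutoff r) t x τ y =
        (∫ y, vorticity u h k τ y * cutError (cutoff r) (t - τ) (x - y)) +
        ∫ y, ∑ i, flux u h k i τ y * dx i (cutKernel (cutoff r)) (t - τ) (x - y) :=
      integral_add i1 i2
    rw [this]
    exact (norm_add_le _ _).trans (add_le_add e1 e2)
  have vol : (volume (Ioo (t - r ^ 2) t)).toReal = r ^ 2 := by
    rw [Real.volume_Ioo, sub_sub_cancel, ENNReal.toReal_ofReal hr2.le]
  have ic : ∀ c : ℝ, Integrable (fun _ : ℝ => c) (volume.restrict (Ioo (t - r ^ 2) t)) := fun c =>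
    integrableOn_const (by simp)
  have is : Integrable (fun τ : ℝ => (√(t - τ))⁻¹) (volume.restrict (Ioo (t - r ^ 2) t)) :=
    integrableOn_inv_sqrt
  have T3 : |∫ τ in Ioo (t - r ^ 2) t, ∫ y, cutDuhamel (vorticity u h k) (flux u h k) (cutoff r) t x τ y|
      ≤ 2 * C1 * m * (C₀ * r⁻¹) + 6 * C2 * m * (C₀ * (r * A)) := by
    have j1 : Integrable (fun τ : ℝ => m * (√(t - τ))⁻¹ + r⁻¹ * m)
      (volume.restrict (Ioo (t - r ^ 2) t)) := (is.const_mul m).add (ic _)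
    have j2 : Integrable (fun τ : ℝ => 2 * (C₀ * A) * (C2 * (m * (√(t - τ))⁻¹ + r⁻¹ * m)))
      (volume.restrict (Ioo (t - r ^ 2) t)) := (j1.const_mul C2).const_mul _
    refine (norm_integral_le_of_norm_le ((ic _).add j2)
      ((ae_restrict_iff' measurableSet_Ioo).2 (Eventually.of_forall T2))).trans (le_of_eq ?_)
    simp only [Pi.add_apply]
    rw [integral_add (ic _) j2, integral_const_mul (2 * (C₀ * A)), integral_const_mul C2,
      integral_add (is.const_mul m) (ic _), integral_const_mul m, integral_inv_sqrt (by linarith), setIntegral_const,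
      setIntegral_const, Measure.real, vol, sub_sub_cancel, Real.sqrt_sq hr.le]
    simp only [smul_eq_mul]
    field_simp
    ring
  refine (abs_add_le _ _).trans ((add_le_add T1 T3).trans ?_)
  have p1 : 0 ≤ C1 * m * (C₀ * (r * A)) := by positivity
  have p2 : 0 ≤ C2 * m * (C₀ * (r * A)) := by positivity
  have p3 : 0 ≤ C2 * m * (C₀ * r⁻¹) := by positivity
  nlinarith

lemma continuousOn_vort {u : ℝ → E n → E n}
    (hu : ContDiffOn ℝ ∞ (Function.uncurry u) (Ioi 0 ×ˢ univ)) :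
    ContinuousOn (fun p : ℝ × E n => vort u p.1 p.2) (Ioi 0 ×ˢ univ) :=
  continuousOn_finsetSum _ fun h _ => continuousOn_finsetSum _ fun k _ =>
    (SM.vorticity hu h k).continuousOn.abs

/-- The vorticity is bounded by `C max(1, t^{-1/2})`. -/
lemma DecayingFlow.exists_vort_le {u : ℝ → E n → E n} {C₀ : ℝ} (hf : DecayingFlow u C₀) :
    ∃ C : ℝ, 0 ≤ C ∧ ∀ t, 0 < t → ∀ x, vort u t x ≤ C * (1 + (√t)⁻¹) := by
  obtain ⟨C, hC, hloc⟩ := exists_interior_estimate n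
  have hC₀ := hf.nonneg
  set b := (n : ℝ) ^ 2 * (C * C₀) with hb
  have hb0 : 0 ≤ b := by positivity
  -- Small enough that 4bδ ≤ 1, for the absorption below, and that δ ≤ 1/2, so that the small
  -- cylinder stays inside the large one.
  set δ := (2 + 4 * b)⁻¹ with hδ
  have hδ0 : 0 < δ := by positivity
  have hδ1 : δ ≤ 1 / 2 := by
    rw [hδ, inv_le_comm₀ (by positivity) (by norm_num)]; norm_num; linarith
  have hδb : 4 * b * δ ≤ 1 := by
    rw [hδ, ← div_eq_mul_inv, div_le_one (by positivity)]; linarith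
  refine ⟨4 * (b * δ⁻¹), by positivity, fun T hT x₀ => ?_⟩
  set s := T / 2 with hs
  have hs0 : 0 < s := by positivity
  -- A parabolic distance to the lateral and bottom boundary of the cylinder over the unit ball,
  -- between the times T/2 and T.
  set D : ℝ × E n → ℝ := fun p => min (1 - ‖p.2 - x₀‖) √(p.1 - s) with hD
  set Q : Set (ℝ × E n) := Icc s T ×ˢ Metric.closedBall x₀ 1 with hQ
  have hQc : IsCompact Q := isCompact_Icc.prod (isCompact_closedBall x₀ 1)
  have hDc : Continuous D := by fun_prop
  have hQs : Q ⊆ Ioi 0 ×ˢ univ := fun p hp => ⟨hs0.trans_le hp.1.1, trivial⟩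
  have hcont : ContinuousOn (fun p => D p * vort u p.1 p.2) Q :=
    hDc.continuousOn.mul ((continuousOn_vort hf.smooth).mono hQs)
  have hmem0 : (T, x₀) ∈ Q := ⟨⟨by linarith, le_rfl⟩, by simp⟩
  -- By compactness the maximum of distance times vorticity is finite, which is the only a priori
  -- information required.
  obtain ⟨⟨t, x⟩, hp, hmax⟩ := hQc.exists_isMaxOn ⟨_, hmem0⟩ hcont
  set M := D (t, x) * vort u t x with hM
  have hmax' : ∀ p ∈ Q, D p * vort u p.1 p.2 ≤ M := fun p hp => hmax hp
  have ht0 : 0 < t := hs0.trans_le hp.1.1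
  have hx1 : ‖x - x₀‖ ≤ 1 := by simpa [dist_eq_norm] using hp.2
  have hDnn : 0 ≤ D (t, x) := le_min (by simpa using hx1) (Real.sqrt_nonneg _)
  have hM0 : 0 ≤ M := mul_nonneg hDnn (vort_nonneg _ _ _)
  have hMle : M ≤ 2 * (b * δ⁻¹) := by
    rcases hDnn.eq_or_lt with h0 | hDpos
    · rw [hM, ← h0, zero_mul]; positivity
    set d := D (t, x) with hd
    have d1 : d ≤ 1 - ‖x - x₀‖ := min_le_left _ _
    have d2 : d ≤ √(t - s) := min_le_right _ _
    have d3 : d ≤ 1 := d1.trans (by linarith [norm_nonneg (x - x₀)])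
    have d4 : d ^ 2 ≤ t - s := by
      have := (Real.le_sqrt' hDpos).1 d2
      exact this
    have hr : 0 < δ * d := by positivity
    have hr2 : (δ * d) ^ 2 ≤ d ^ 2 / 4 := by
      rw [mul_pow]
      have : δ ^ 2 ≤ (1 / 2) ^ 2 := by gcongr
      nlinarith [sq_nonneg d]
    -- Within the parabolic radius δd of the maximum point the distance is still at least d/2, so
    -- maximality bounds the vorticity there by 2M/d.
    have hA : ∀ τ ∈ Ioo (t - (δ * d) ^ 2) t, ∀ y, ‖x - y‖ ≤ δ * d → vort u τ y ≤ 2 * M / d := by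
      intro τ hτ y hy
      have hrd : δ * d ≤ d / 2 := by nlinarith
      have ny : ‖y - x₀‖ ≤ ‖x - x₀‖ + d / 2 := by
        calc ‖y - x₀‖ = ‖(x - x₀) - (x - y)‖ := by congr 1; abel
          _ ≤ ‖x - x₀‖ + ‖x - y‖ := norm_sub_le _ _
          _ ≤ _ := by linarith
      have hmem : (τ, y) ∈ Q := by
        refine ⟨⟨?_, hτ.2.le.trans hp.1.2⟩, ?_⟩
        · have := hτ.1; simp only; nlinarith [sq_nonneg d]
        · rw [mem_closedBall_iff_norm]; simp only; linarith
      have hDy : d / 2 ≤ D (τ, y) := by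
        refine le_min (by simp only; linarith) (Real.le_sqrt_of_sq_le ?_)
        have := hτ.1
        simp only
        nlinarith [sq_nonneg d]
      have := hmax' _ hmem
      simp only at this
      rw [le_div_iff₀ hDpos]
      have := mul_le_mul_of_nonneg_right hDy (vort_nonneg u τ y)
      linarith
    have hest : vort u t x ≤ b * ((δ * d)⁻¹ + δ * d * (2 * M / d)) := by
      rw [hb, mul_assoc]
      exact vort_le_of_forall fun h k => hloc u C₀ hf h k t (δ * d) (2 * M / d) x hr (by nlinarith)
        (by positivity) hA
    -- The interior estimate with r = δd now reads M ≤ b/δ + 2bδMd. As d ≤ 1 and 4bδ ≤ 1, the last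
    -- term is at most M/2 and is absorbed.
    have h1 : M ≤ d * (b * ((δ * d)⁻¹ + δ * d * (2 * M / d))) :=
      mul_le_mul_of_nonneg_left hest hDnn
    have h2 : d * (b * ((δ * d)⁻¹ + δ * d * (2 * M / d))) = b * δ⁻¹ + 2 * b * δ * M * d := by
      field_simp
    have h3 : 2 * b * δ * M * d ≤ 2 * b * δ * M := mul_le_of_le_one_right (by positivity) d3
    have h4 : (2 * b * δ) * M ≤ (1 / 2) * M := mul_le_mul_of_nonneg_right (by linarith) hM0
    linarith
  have hfin := hmax' _ hmem0
  have hsT : 0 < √T := Real.sqrt_pos.2 hT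
  -- At (T, x₀) the distance is min(1, √(T/2)), which bounds the vorticity by a multiple of 1 +
  -- T^{-1/2}.
  have hD0 : (1 + (√T)⁻¹)⁻¹ / 2 ≤ D (T, x₀) := by
    refine le_min ?_ ?_
    · simp only [sub_self, norm_zero, sub_zero]
      have : (1 + (√T)⁻¹)⁻¹ ≤ 1 := inv_le_one_of_one_le₀ (by linarith [inv_pos.2 hsT])
      linarith
    · have e1 : (1 + (√T)⁻¹)⁻¹ ≤ √T := by
        rw [inv_le_comm₀ (by positivity) hsT]; linarith
      refine Real.le_sqrt_of_sq_le ?_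
      have e2 : ((1 + (√T)⁻¹)⁻¹ / 2) ^ 2 ≤ (√T / 2) ^ 2 := by gcongr
      rw [div_pow √T, Real.sq_sqrt hT.le] at e2
      simp only
      linarith
  have h5 : (1 + (√T)⁻¹)⁻¹ / 2 * vort u T x₀ ≤ 2 * (b * δ⁻¹) :=
    ((mul_le_mul_of_nonneg_right hD0 (vort_nonneg _ _ _)).trans hfin).trans hMle
  have hpos : 0 < 1 + (√T)⁻¹ := by positivity
  rw [div_mul_eq_mul_div, inv_mul_eq_div, div_div, div_le_iff₀ (by positivity)] at h5
  linarith

/-! ### Removal of the cutoff: Duhamel's formula from a positive time -/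

lemma exists_cutError_bound (n : ℕ) : ∃ C : ℝ, 0 ≤ C ∧ ∀ r : ℝ, 1 ≤ r → ∀ t, 0 < t →
    ∀ x : E n, |cutError (cutoff r) t x| ≤ C * (kb (n + 1) 1 t x + kb (n + 1) 0 t x) := by
  obtain ⟨B, hB0, hB⟩ := exists_cutoff_bound n
  obtain ⟨A0, hA0, a0⟩ := (HC.base (n := n)).bound (n + 1)
  choose A1 hA1 a1 using fun i => ((HC.base (n := n)).dx i).bound (n + 1)
  refine ⟨∑ i : Fin n, (2 * (A1 i * B) + A0 * B),
    Finset.sum_nonneg fun i _ => by have := hA1 i; positivity, fun r hr t ht x => ?_⟩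
  have hr0 : 0 < r := by linarith
  have k0 := kb_nonneg (n + 1) 0 t x
  have k1 := kb_nonneg (n + 1) 1 t x
  rw [Finset.sum_mul]
  refine (Finset.abs_sum_le_sum_abs _ _).trans (Finset.sum_le_sum fun i _ => ?_)
  have b1 : |pderiv i (cutoff r) x| ≤ B := (hB r hr0 i i i x).1.trans (div_le_self hB0 hr)
  have b2 : |pderiv i (pderiv i (cutoff r)) x| ≤ B :=
    (hB r hr0 i i i x).2.1.trans (div_le_self hB0 (one_le_pow₀ hr))
  have e1 : |pderiv i (heatKernel n t) x * pderiv i (cutoff r) x| ≤ A1 i * kb (n + 1) 1 t x * B := by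
    rw [abs_mul]
    exact mul_le_mul (a1 i t ht x) b1 (abs_nonneg _) (mul_nonneg (hA1 i) k1)
  have e2 : |heatKernel n t x * pderiv i (pderiv i (cutoff r)) x| ≤ A0 * kb (n + 1) 0 t x * B := by
    rw [abs_mul]
    exact mul_le_mul (a0 t ht x) b2 (abs_nonneg _) (mul_nonneg hA0 k0)
  refine (abs_add_le _ _).trans ?_
  rw [abs_mul, abs_two]
  have p1 := mul_nonneg (mul_nonneg (hA1 i) hB0) k0
  have p2 := mul_nonneg (mul_nonneg hA0 hB0) k1
  calc _ ≤ 2 * (A1 i * kb (n + 1) 1 t x * B) + A0 * kb (n + 1) 0 t x * B := by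
        refine add_le_add (mul_le_mul_of_nonneg_left e1 zero_le_two) e2
    _ ≤ _ := by nlinarith

/-- The integrand of the nonlinear term in the Duhamel formula for the vorticity. -/
def forceTerm (u : ℝ → E n → E n) (h k : Fin n) (t : ℝ) (x : E n) (τ : ℝ) (y : E n) : ℝ :=
  force u h τ y * dx k (heatKernel n) (t - τ) (x - y)
    - force u k τ y * dx h (heatKernel n) (t - τ) (x - y)

lemma exists_forceTerm_bound (n K : ℕ) : ∃ C : ℝ, 0 ≤ C ∧ ∀ (u : ℝ → E n → E n) (h k : Fin n)
    (t : ℝ) (x : E n) (τ : ℝ) (y : E n), τ < t → |forceTerm u h k t x τ y| ≤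
      C * (‖u τ y‖ * vort u τ y * kb K 1 (t - τ) (x - y)) := by
  choose A hA a using fun i => ((HC.base (n := n)).dx i).bound K
  have hS : 0 ≤ ∑ i, A i := Finset.sum_nonneg fun i _ => hA i
  refine ⟨2 * ∑ i, A i, by positivity, fun u h k t x τ y hτ => ?_⟩
  have hb : ∀ i, |dx i (heatKernel n) (t - τ) (x - y)| ≤ (∑ i, A i) * kb K 1 (t - τ) (x - y) :=
    fun i => (a i _ (sub_pos.2 hτ) _).trans (mul_le_mul_of_nonneg_right
      (Finset.single_le_sum (fun i _ => hA i) (Finset.mem_univ i)) (kb_nonneg _ _ _ _))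
  refine (abs_mul_sub_mul_le (abs_force_le u h τ y) (abs_force_le u k τ y) (hb k) (hb h)).trans
    (le_of_eq ?_)
  ring

lemma SM.continuousOn_forceTerm {u : ℝ → E n → E n}
    (hu : ContDiffOn ℝ ∞ (Function.uncurry u) (Ioi 0 ×ˢ univ)) (h k : Fin n) {s t : ℝ} (hs : 0 ≤ s)
    (x : E n) :
    ContinuousOn (fun p : ℝ × E n => forceTerm u h k t x p.1 p.2) (Ioo s t ×ˢ univ) :=
  (((SM.force hu h).continuousOn_Ioo hs).mul (((SM.heatKernel).dx k).continuousOn_reflect x)).sub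
    (((SM.force hu k).continuousOn_Ioo hs).mul (((SM.heatKernel).dx h).continuousOn_reflect x))

lemma dx_cutKernel_near {r : ℝ} (hr : 0 < r) {x : E n} (hx : ‖x‖ < r / 2) {t : ℝ} (ht : 0 < t)
    (i : Fin n) : dx i (cutKernel (cutoff r)) t x = dx i (heatKernel n) t x := by
  rw [dx_cutKernel (contDiff_cutoff r) ht, cutoff_eq_one hr hx.le, pderiv_cutoff_near hr hx, mul_one,
    mul_zero, add_zero]
  rfl

lemma eventually_norm_lt_half (x : E n) : ∀ᶠ j : ℕ in atTop, ‖x‖ < ((j : ℝ) + 1) / 2 := by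
  obtain ⟨N, hN⟩ := exists_nat_gt (2 * ‖x‖)
  filter_upwards [eventually_ge_atTop N] with j hj
  have : (N : ℝ) ≤ j := by exact_mod_cast hj
  linarith

/-- Duhamel's formula for the vorticity, started at a positive time. -/
theorem DecayingFlow.duhamel {u : ℝ → E n → E n} {C₀ : ℝ} (hf : DecayingFlow u C₀) (h k : Fin n)
    {s t : ℝ} (hs : 0 < s) (hst : s < t) (x : E n) :
    vorticity u h k t x =
      (∫ y, (u s y k * dx h (heatKernel n) (t - s) (x - y)
        - u s y h * dx k (heatKernel n) (t - s) (x - y)))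
      + ∫ z in Ioo s t ×ˢ univ, forceTerm u h k t x z.1 z.2 ∂(volume.prod volume) := by
  obtain ⟨B, hB, hv⟩ := hf.exists_vort_le
  obtain ⟨C1, h1, b1⟩ := exists_cutError_bound n
  obtain ⟨C2, h2, b2⟩ := exists_dx_cutKernel_bound n
  have hC₀ := hf.nonneg
  set V := B * (1 + (√s)⁻¹) with hV
  have hss : 0 < √s := Real.sqrt_pos.2 hs
  have hV0 : 0 ≤ V := by positivity
  have hvort : ∀ τ, s ≤ τ → ∀ y, vort u τ y ≤ V := fun τ hτ y =>
    (hv τ (hs.trans_le hτ) y).trans (by rw [hV]; gcongr)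
  have hσ : 0 < t - s := sub_pos.2 hst
  set R : ℕ → ℝ := fun j => (j : ℝ) + 1 with hR
  have hR1 : ∀ j, 1 ≤ R j := fun j => by simp [hR]
  have hR0 : ∀ j, 0 < R j := fun j => by positivity
  have b2' : ∀ j t, 0 < t → ∀ (h : Fin n) (x : E n), |dx h (cutKernel (cutoff (R j))) t x| ≤
      C2 * (kb (n + 1) 1 t x + kb (n + 1) 0 t x) := fun j t ht h x => by
    refine (b2 (R j) (hR0 j) t ht h x).trans (mul_le_mul_of_nonneg_left (add_le_add_right ?_ _) h2)
    exact mul_le_of_le_one_left (kb_nonneg _ _ _ _) (inv_le_one_of_one_le₀ (hR1 j))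
  have hχ : ∀ j, ContDiff ℝ ∞ (cutoff (n := n) (R j)) := fun j => contDiff_cutoff _
  have hc : ∀ j, HasCompactSupport (cutoff (n := n) (R j)) := fun j => hasCompactSupport_cutoff (hR0 j)
  have hle1 : (1 : WithTop ℕ∞) ≤ (∞ : WithTop ℕ∞) := by exact_mod_cast le_top
  -- The first term is written with the velocity in place of the vorticity, because integrability of
  -- the vorticity in space is not yet known.
  have key : ∀ j, vorticity u h k t x =
      (∫ y, (u s y k * dx h (cutKernel (cutoff (R j))) (t - s) (x - y)
        - u s y h * dx k (cutKernel (cutoff (R j))) (t - s) (x - y)))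
      + ∫ z in Ioo s t ×ˢ univ, cutDuhamel (vorticity u h k) (flux u h k) (cutoff (R j)) t x z.1 z.2
        ∂(volume.prod volume) := by
    intro j
    have i0 := integrableOn_cutDuhamel (SM.vorticity hf.smooth h k)
      (fun i => SM.flux hf.smooth h k i) (hχ j) (hc j) (s := s) (t := t) hs x
    rw [duhamel_cutoff (SM.vorticity hf.smooth h k) (fun i => SM.flux hf.smooth h k i)
      (hf.equation h k) (hχ j) (hc j) (cutoff_zero (hR0 j)) hs hst x,
      integral_vorticity_mul hf.smooth h k hs (((SM.cutKernel (hχ j)).slice hσ).of_le hle1)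
      (hasCompactSupport_cutKernel (hc j) _) x, setIntegral_prod _ i0]
    simp only [setIntegral_univ]
    rfl
  -- As the cutoff radius tends to infinity, the kernels converge pointwise, being eventually
  -- constant in j, and are dominated by integrable majorants independent of j.
  refine tendsto_nhds_unique ((tendsto_const_nhds (f := (atTop : Filter ℕ))).congr key)
    (Tendsto.add ?_ ?_)
  · have j0 : Integrable fun y => 2 * C₀ * (C2 * (kb (n + 1) 1 (t - s) (x - y) +
        kb (n + 1) 0 (t - s) (x - y))) :=
      (((integrable_kb_sub le_rfl 1 hσ x).add
        (integrable_kb_sub le_rfl 0 hσ x)).const_mul C2).const_mul (2 * C₀)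
    have cc : ∀ j, Continuous fun y => u s y j := fun j =>
      (SM.component hf.smooth j).slice_continuous hs
    have ck : ∀ j (i : Fin n), Continuous fun y => dx i (cutKernel (cutoff (R j))) (t - s) (x - y) :=
      fun j i => (((SM.cutKernel (hχ j)).dx i).slice_continuous hσ).comp (by fun_prop)
    refine tendsto_integral_of_dominated_convergence _
      (fun j => (((cc k).mul (ck j h)).sub ((cc h).mul (ck j k))).aestronglyMeasurable) j0
      (fun j => Eventually.of_forall fun y => ?_) (Eventually.of_forall fun y => ?_)
    · exact abs_mul_sub_mul_le (hf.abs_le hs y k) (hf.abs_le hs y h) (b2' j _ hσ h _) (b2' j _ hσ k _)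
    · refine tendsto_const_nhds.congr' ?_
      filter_upwards [eventually_norm_lt_half (x - y)] with j hj
      rw [dx_cutKernel_near (hR0 j) hj hσ, dx_cutKernel_near (hR0 j) hj hσ]
  · have j0 : IntegrableOn (fun z : ℝ × E n => (V * C1 + 2 * (C₀ * V) * C2) *
        (kb (n + 1) 1 (t - z.1) (x - z.2) + kb (n + 1) 0 (t - z.1) (x - z.2))) (Ioo s t ×ˢ univ)
        (volume.prod volume) :=
      ((integrableOn_kb_spacetime le_rfl le_rfl s t x).add
        (integrableOn_kb_spacetime le_rfl zero_le_one s t x)).const_mul _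
    have hms : MeasurableSet (Ioo s t ×ˢ (univ : Set (E n))) := measurableSet_Ioo.prod .univ
    refine tendsto_integral_of_dominated_convergence _
      (fun j => (integrableOn_cutDuhamel (SM.vorticity hf.smooth h k)
        (fun i => SM.flux hf.smooth h k i) (hχ j) (hc j) (s := s) (t := t) hs x).aestronglyMeasurable)
      j0 (fun j => (ae_restrict_iff' hms).2 (Eventually.of_forall fun z hz => ?_))
      ((ae_restrict_iff' hms).2 (Eventually.of_forall fun z hz => ?_))
    · have hτ0 : 0 < z.1 := hs.trans hz.1.1
      have hτ : 0 < t - z.1 := sub_pos.2 hz.1.2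
      set Kb := kb (n + 1) 1 (t - z.1) (x - z.2) + kb (n + 1) 0 (t - z.1) (x - z.2)
      have e1 : |vorticity u h k z.1 z.2 * cutError (cutoff (R j)) (t - z.1) (x - z.2)| ≤
          V * (C1 * Kb) := by
        rw [abs_mul]
        exact mul_le_mul ((abs_vorticity_le u h k _ _).trans (hvort _ hz.1.1.le _))
          (b1 _ (hR1 j) _ hτ _) (abs_nonneg _) hV0
      have hfo : ∀ j, |force u j z.1 z.2| ≤ C₀ * V := fun j => (abs_force_le u j _ _).trans
        (mul_le_mul (hf.norm_le hτ0 _) (hvort _ hz.1.1.le _) (vort_nonneg _ _ _) hC₀)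
      have e2 : |∑ i, flux u h k i z.1 z.2 * dx i (cutKernel (cutoff (R j))) (t - z.1) (x - z.2)| ≤
          2 * (C₀ * V) * (C2 * Kb) := by
        rw [sum_flux_mul]
        exact abs_mul_sub_mul_le (hfo h) (hfo k) (b2' j _ hτ k _) (b2' j _ hτ h _)
      refine ((abs_add_le _ _).trans (add_le_add e1 e2)).trans (le_of_eq ?_)
      ring
    · have hτ : 0 < t - z.1 := sub_pos.2 hz.1.2
      refine tendsto_const_nhds.congr' ?_
      filter_upwards [eventually_norm_lt_half (x - z.2)] with j hj
      rw [cutDuhamel, sum_flux_mul, dx_cutKernel_near (hR0 j) hj hτ, dx_cutKernel_near (hR0 j) hj hτ,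
        cutError_near (hR0 j) hj, mul_zero, zero_add, forceTerm]

/-! ### The two endpoint norms and Young's inequality -/

/-- The `L^1` norm (`false`) and the supremum norm (`true`) of a nonnegative function. -/
def nm : Bool → (E n → ℝ≥0∞) → ℝ≥0∞
  | false, f => ∫⁻ x, f x
  | true, f => ⨆ x, f x

/-- Twice the scaling exponent of the norm `nm e` of an approximate identity. -/
def scal (n : ℕ) : Bool → ℕ
  | false => 0
  | true => n

lemma nm_mono (e : Bool) {f g : E n → ℝ≥0∞} (h : ∀ x, f x ≤ g x) : nm e f ≤ nm e g := by
  cases e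
  · exact lintegral_mono h
  · exact iSup_mono h

lemma nm_const_mul (e : Bool) {c : ℝ≥0∞} (hc : c ≠ ⊤) (f : E n → ℝ≥0∞) :
    nm e (fun x => c * f x) = c * nm e f := by
  cases e
  · exact lintegral_const_mul' c f hc
  · exact (ENNReal.mul_iSup c f).symm

lemma nm_add_le (e : Bool) {f : E n → ℝ≥0∞} (hf : Measurable f) (g : E n → ℝ≥0∞) :
    nm e (fun x => f x + g x) ≤ nm e f + nm e g := by
  cases e
  · exact (lintegral_add_left hf g).le
  · exact iSup_le fun x => add_le_add (le_iSup f x) (le_iSup g x)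

lemma nm_sum_le {ι : Type*} (e : Bool) (s : Finset ι) {f : ι → E n → ℝ≥0∞}
    (hf : ∀ i ∈ s, Measurable (f i)) : nm e (fun x => ∑ i ∈ s, f i x) ≤ ∑ i ∈ s, nm e (f i) := by
  classical
  induction s using Finset.induction_on with
  | empty => cases e <;> simp [nm]
  | insert a s ha ih =>
    simp only [Finset.sum_insert ha]
    refine (nm_add_le e (hf a (Finset.mem_insert_self a s)) _).trans (add_le_add le_rfl ?_)
    exact ih fun i hi => hf i (Finset.mem_insert_of_mem hi)

/-- Minkowski's integral inequality at the endpoints: Tonelli for L^1, and the integrand is at most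
its supremum for L^∞. -/
lemma nm_lintegral_le {α : Type*} [MeasurableSpace α] {ν : Measure α} [SFinite ν] (e : Bool)
    {H : α → E n → ℝ≥0∞} (hH : AEMeasurable (Function.uncurry H) (ν.prod volume)) :
    nm e (fun x => ∫⁻ a, H a x ∂ν) ≤ ∫⁻ a, nm e (H a) ∂ν := by
  cases e
  · exact (lintegral_lintegral_swap hH).symm.le
  · exact iSup_le fun x => lintegral_mono fun a => le_iSup (H a) x

lemma nm_sub_right (e : Bool) (f : E n → ℝ≥0∞) (y : E n) : nm e (fun x => f (x - y)) = nm e f := by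
  cases e
  · exact lintegral_sub_right_eq_self f y
  · exact (Equiv.subRight y).surjective.iSup_comp f

/-- Young's inequality with the mass on the second factor. -/
lemma nm_conv_le_left (e : Bool) {k f : E n → ℝ≥0∞} (hk : Measurable k) (hf : AEMeasurable f)
    (hk' : nm e k ≠ ⊤) : nm e (fun x => ∫⁻ y, k (x - y) * f y) ≤ nm e k * ∫⁻ y, f y := by
  have hm : AEMeasurable (Function.uncurry fun y x => k (x - y) * f y)
      ((volume : Measure (E n)).prod volume) :=
    (hk.comp (measurable_snd.sub measurable_fst)).aemeasurable.mul hf.comp_fst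
  refine (nm_lintegral_le e hm).trans ?_
  rw [← lintegral_const_mul' _ _ hk']
  refine lintegral_mono fun y => ?_
  rw [← nm_sub_right e k y]
  cases e
  · simp only [nm]
    have hm' : Measurable fun x => k (x - y) := hk.comp (measurable_id.sub_const y)
    exact (lintegral_mul_const _ hm').le
  · simp only [nm]
    rw [ENNReal.iSup_mul]

/-- Young's inequality with the mass on the first factor. -/
lemma nm_conv_le_right (e : Bool) {k f : E n → ℝ≥0∞} (hk : Measurable k) (hf : Measurable f) :
    nm e (fun x => ∫⁻ y, k (x - y) * f y) ≤ (∫⁻ y, k y) * nm e f := by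
  have e1 : (fun x => ∫⁻ y, k (x - y) * f y) = fun x => ∫⁻ y, k y * f (x - y) := by
    funext x
    rw [← lintegral_sub_left_eq_self (fun y => k y * f (x - y)) x]
    simp
  have hm : Measurable (Function.uncurry fun y x => k y * f (x - y)) :=
    (hk.comp measurable_fst).mul (hf.comp (measurable_snd.sub measurable_fst))
  rw [e1]
  refine (nm_lintegral_le e hm.aemeasurable).trans ?_
  rw [← lintegral_mul_const _ hk]
  refine lintegral_mono fun y => ?_
  rw [← nm_sub_right e f y]
  cases e
  · simp only [nm]
    have hm' : Measurable fun x => f (x - y) := hf.comp (measurable_id.sub_const y)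
    exact (lintegral_const_mul _ hm').le
  · simp only [nm]
    rw [ENNReal.mul_iSup]

lemma nm_iSup (e : Bool) {f : ℕ → E n → ℝ≥0∞} (hf : ∀ j, Measurable (f j)) (hm : Monotone f) :
    nm e (fun x => ⨆ j, f j x) = ⨆ j, nm e (f j) := by
  cases e
  · exact lintegral_iSup hf hm
  · exact iSup_comm

/-- The function `kb` with values in the extended nonnegative reals. -/
def kbE (K a : ℕ) (t : ℝ) (x : E n) : ℝ≥0∞ := ENNReal.ofReal (kb K a t x)

lemma measurable_kb (K a : ℕ) : Measurable fun p : ℝ × E n => kb K a p.1 p.2 := by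
  unfold kb
  fun_prop

lemma measurable_kbE (K a : ℕ) : Measurable fun p : ℝ × E n => kbE K a p.1 p.2 :=
  (measurable_kb K a).ennreal_ofReal

lemma measurable_kbE_slice (K a : ℕ) (t : ℝ) : Measurable fun x : E n => kbE K a t x :=
  (measurable_kbE K a).comp measurable_prodMk_left

lemma exists_nm_kbE_le (n K : ℕ) (hK : n + 1 ≤ K) : ∃ C : ℝ, 0 ≤ C ∧ ∀ (e : Bool) (a : ℕ) (t : ℝ), 0 < t →
    nm e (fun x : E n => kbE K a t x) ≤ ENNReal.ofReal (C * (√t ^ (scal n e + a))⁻¹) := by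
  refine ⟨max 1 (weightMass n K), by positivity, fun e a t ht => ?_⟩
  have h0 : 0 < √t := Real.sqrt_pos.2 ht
  cases e
  · simp only [nm, kbE, scal, zero_add]
    rw [← ofReal_integral_eq_lintegral_ofReal (integrable_kb hK a ht)
      (Eventually.of_forall fun x => kb_nonneg _ _ _ _), integral_kb K a ht, div_eq_mul_inv]
    gcongr
    exact le_max_right _ _
  · refine iSup_le fun x => ENNReal.ofReal_le_ofReal ((kb_le K a ht x).trans ?_)
    exact le_mul_of_one_le_left (by positivity) (le_max_left _ _)

/-! ### Singular time integrals and a Volterra inequality -/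

lemma lintegral_inv_sqrt_sub {s t : ℝ} (h : s ≤ t) :
    ∫⁻ τ in Ioo s t, ENNReal.ofReal (√(t - τ))⁻¹ = ENNReal.ofReal (2 * √(t - s)) := by
  rw [← ofReal_integral_eq_lintegral_ofReal integrableOn_inv_sqrt
    (Eventually.of_forall fun τ => by positivity), integral_inv_sqrt h]

lemma lintegral_inv_sqrt {t : ℝ} (h : 0 ≤ t) :
    ∫⁻ τ in Ioo 0 t, ENNReal.ofReal (√τ)⁻¹ = ENNReal.ofReal (2 * √t) := by
  have h1 := lintegral_inv_sqrt_sub h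
  rw [sub_zero] at h1
  rw [← h1, ← lintegral_indicator measurableSet_Ioo, ← lintegral_indicator measurableSet_Ioo,
    ← lintegral_sub_left_eq_self (indicator (Ioo 0 t) fun τ => ENNReal.ofReal (√(t - τ))⁻¹) t]
  congr 1
  funext τ
  simp only [indicator, mem_Ioo, sub_sub_cancel]
  congr 1
  rw [sub_pos, sub_lt_self_iff, and_comm]

/-- One of τ and t − τ is at least t/2, so one of the two singular factors is at most √(2/t). -/
lemma inv_sqrt_mul_inv_sqrt_le {t τ : ℝ} (h0 : 0 < τ) (h1 : τ < t) :
    (√(t - τ))⁻¹ * (√τ)⁻¹ ≤ √(2 / t) * ((√τ)⁻¹ + (√(t - τ))⁻¹) := by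
  have ht : 0 < t := h0.trans h1
  have hs : 0 < t - τ := sub_pos.2 h1
  have p0 : 0 ≤ (√τ)⁻¹ := by positivity
  have p1 : 0 ≤ (√(t - τ))⁻¹ := by positivity
  have p2 : 0 ≤ √(2 / t) := by positivity
  have key : ∀ σ, t / 2 ≤ σ → (√σ)⁻¹ ≤ √(2 / t) := fun σ hσ => by
    rw [← Real.sqrt_inv]
    refine Real.sqrt_le_sqrt ?_
    rw [← inv_div]
    exact inv_anti₀ (by positivity) hσ
  rcases le_total (t / 2) τ with h | h
  · have := mul_le_mul_of_nonneg_left (key τ h) p1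
    nlinarith
  · have := mul_le_mul_of_nonneg_right (key (t - τ) (by linarith)) p0
    nlinarith

/-- The scale-invariant integral is bounded independently of t: the preceding inequality gives 4√2 ≤
6. -/
lemma lintegral_inv_sqrt_mul_le {t : ℝ} (ht : 0 < t) :
    ∫⁻ τ in Ioo 0 t, ENNReal.ofReal ((√(t - τ))⁻¹ * (√τ)⁻¹) ≤ ENNReal.ofReal 6 := by
  have h1 : ∫⁻ τ in Ioo 0 t, ENNReal.ofReal ((√(t - τ))⁻¹ * (√τ)⁻¹) ≤
      ∫⁻ τ in Ioo 0 t, ENNReal.ofReal √(2 / t) *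
        (ENNReal.ofReal (√τ)⁻¹ + ENNReal.ofReal (√(t - τ))⁻¹) := by
    refine setLIntegral_mono' measurableSet_Ioo fun τ hτ => ?_
    rw [← ENNReal.ofReal_add (by positivity) (by positivity), ← ENNReal.ofReal_mul (by positivity)]
    exact ENNReal.ofReal_le_ofReal (inv_sqrt_mul_inv_sqrt_le hτ.1 hτ.2)
  refine h1.trans ?_
  rw [lintegral_const_mul' _ _ ENNReal.ofReal_ne_top, lintegral_add_left (by fun_prop),
    lintegral_inv_sqrt ht.le, lintegral_inv_sqrt_sub ht.le, sub_zero,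
    ← ENNReal.ofReal_add (by positivity) (by positivity), ← ENNReal.ofReal_mul (by positivity)]
  refine ENNReal.ofReal_le_ofReal ?_
  have h2 : √(2 / t) * √t = √2 := by
    rw [← Real.sqrt_mul (by positivity), div_mul_cancel₀ _ ht.ne']
  have h3 : √2 ≤ 3 / 2 := by rw [Real.sqrt_le_left (by norm_num)]; norm_num
  nlinarith

/-- After e^{lt} is factored out, the integral over all σ = t − τ > 0 is Γ(1/2) l^{-1/2} = √(π/l).
It becomes small relative to e^{lt} when l is large. -/
lemma lintegral_inv_sqrt_mul_exp_le {l : ℝ} (hl : 0 < l) (t : ℝ) :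
    ∫⁻ τ in Ioo 0 t, ENNReal.ofReal ((√(t - τ))⁻¹ * Real.exp (l * τ)) ≤
      ENNReal.ofReal (Real.exp (l * t) * √(Real.pi / l)) := by
  have e0 : ∀ σ ∈ Ioi (0 : ℝ), (√σ)⁻¹ * Real.exp (-(l * σ)) = σ ^ ((1 / 2 : ℝ) - 1) * Real.exp (-(l * σ)) := by
    intro σ hσ
    rw [Real.sqrt_eq_rpow, ← Real.rpow_neg (le_of_lt hσ)]
    norm_num
  have i1 : ∫ σ in Ioi (0 : ℝ), (√σ)⁻¹ * Real.exp (-(l * σ)) = √(Real.pi / l) := by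
    rw [setIntegral_congr_fun measurableSet_Ioi e0, Real.integral_rpow_mul_exp_neg_mul_Ioi
      (by norm_num) hl, Real.Gamma_one_half_eq, ← Real.sqrt_eq_rpow,
      ← Real.sqrt_mul (by positivity)]
    congr 1
    ring
  have i2 : IntegrableOn (fun σ : ℝ => (√σ)⁻¹ * Real.exp (-(l * σ))) (Ioi 0) := by
    by_contra h
    rw [integral_undef h] at i1
    have : 0 < √(Real.pi / l) := Real.sqrt_pos.2 (by positivity)
    linarith
  have h1 : ∫⁻ τ in Ioo 0 t, ENNReal.ofReal ((√(t - τ))⁻¹ * Real.exp (l * τ)) =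
      ∫⁻ τ in Ioo 0 t, ENNReal.ofReal (Real.exp (l * t)) *
        ENNReal.ofReal ((√(t - τ))⁻¹ * Real.exp (-(l * (t - τ)))) := by
    refine lintegral_congr fun τ => ?_
    rw [← ENNReal.ofReal_mul (by positivity)]
    congr 1
    rw [mul_left_comm, ← Real.exp_add]
    congr 2
    ring
  rw [h1, lintegral_const_mul' _ _ ENNReal.ofReal_ne_top, ENNReal.ofReal_mul (by positivity)]
  gcongr
  rw [← i1, ofReal_integral_eq_lintegral_ofReal i2 (Eventually.of_forall fun σ => by positivity),
    ← lintegral_indicator measurableSet_Ioo, ← lintegral_indicator measurableSet_Ioi,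
    ← lintegral_sub_left_eq_self (indicator (Ioi 0) _) t]
  refine lintegral_mono fun τ => ?_
  by_cases h : τ ∈ Ioo 0 t
  · rw [indicator_of_mem h, indicator_of_mem (show t - τ ∈ Ioi 0 from sub_pos.2 h.2)]
  · rw [indicator_of_notMem h]
    exact zero_le

lemma one_add_rpow_sqrt_cube {τ : ℝ} (h : 0 < τ) : (√(1 + τ) ^ 3)⁻¹ ≤ (1 + τ)⁻¹ * (√τ)⁻¹ := by
  have h1 : √(1 + τ) ^ 2 = 1 + τ := Real.sq_sqrt (by linarith)
  have h2 : √τ ≤ √(1 + τ) := Real.sqrt_le_sqrt (by linarith)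
  have h3 : 0 < √τ := Real.sqrt_pos.2 h
  rw [← mul_inv, pow_succ, h1]
  gcongr

/-- A supersolution of the Volterra equation with kernel `b (t-τ)^{-1/2} (1+τ)^{-3/2}`. -/
lemma exists_supersolution {b : ℝ} (hb : 0 ≤ b) : ∃ (c : ℝ) (ψ : ℝ → ℝ), (∀ t, 0 < t → 1 ≤ ψ t ∧ ψ t ≤ c) ∧
    ∀ t, 0 < t → ENNReal.ofReal b * ∫⁻ τ in Ioo 0 t,
      ENNReal.ofReal ((√(t - τ))⁻¹ * (√(1 + τ) ^ 3)⁻¹) * ENNReal.ofReal (ψ τ)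
      ≤ ENNReal.ofReal (ψ t) / 2 := by
  -- The supersolution grows exponentially up to time T and is constant afterwards. The choice of l
  -- makes b√(π/l) ≤ 1/4, and T = 24b makes 6b/(1+T) ≤ 1/4, so the two contributions add up to at
  -- most ψ/2.
  set l := Real.pi * (4 * b + 1) ^ 2 with hl
  set T := 24 * b with hT
  have hl0 : 0 < l := by have := Real.pi_pos; positivity
  have hT0 : 0 ≤ T := by positivity
  have hsl : √(Real.pi / l) = (4 * b + 1)⁻¹ := by
    rw [hl, ← div_div, div_self Real.pi_pos.ne', one_div, Real.sqrt_inv, Real.sqrt_sq (by positivity)]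
  have hb1 : b * (4 * b + 1)⁻¹ ≤ 1 / 4 := by
    rw [← div_eq_mul_inv, div_le_iff₀ (by positivity)]; linarith
  have hb2 : b * ((1 + T)⁻¹ * 6) ≤ 1 / 4 := by
    rw [hT, ← mul_assoc, ← div_eq_mul_inv, div_mul_eq_mul_div, div_le_iff₀ (by positivity)]; linarith
  have half : ∀ X : ℝ, ENNReal.ofReal (X / 2) = ENNReal.ofReal X / 2 := fun X => by
    rw [ENNReal.ofReal_div_of_pos two_pos]; simp
  refine ⟨Real.exp (l * T), fun t => Real.exp (l * min t T), fun t ht => ⟨?_, ?_⟩, fun t ht => ?_⟩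
  · exact Real.one_le_exp (mul_nonneg hl0.le (le_min ht.le hT0))
  · exact Real.exp_le_exp.2 (mul_le_mul_of_nonneg_left (min_le_right _ _) hl0.le)
  rcases le_total t T with h | h
  · have : ∫⁻ τ in Ioo 0 t, ENNReal.ofReal ((√(t - τ))⁻¹ * (√(1 + τ) ^ 3)⁻¹) *
        ENNReal.ofReal (Real.exp (l * min τ T)) ≤ ENNReal.ofReal (Real.exp (l * t) * √(Real.pi / l)) := by
      refine (setLIntegral_mono' measurableSet_Ioo fun τ hτ => ?_).trans
        (lintegral_inv_sqrt_mul_exp_le hl0 t)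
      rw [← ENNReal.ofReal_mul (by positivity), min_eq_left (hτ.2.le.trans h)]
      refine ENNReal.ofReal_le_ofReal (mul_le_mul_of_nonneg_right ?_ (Real.exp_pos _).le)
      exact mul_le_of_le_one_right (by positivity)
        (inv_le_one_of_one_le₀ (one_le_pow₀ (one_le_sqrt_one_add hτ.1)))
    refine (mul_le_mul_right this _).trans ?_
    simp only
    rw [← ENNReal.ofReal_mul hb, ← half, min_eq_left h, hsl]
    refine ENNReal.ofReal_le_ofReal ?_
    have := mul_le_mul_of_nonneg_right hb1 (Real.exp_pos (l * t)).le
    have := (Real.exp_pos (l * t)).le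
    linarith
  -- After time T the decay of the kernel is used: (1+τ)^{-3/2} ≤ (1+T)^{-1} τ^{-1/2}, which leaves
  -- the scale-invariant integral. Before T, the difference t − τ is replaced by the smaller T − τ.
  · have hpt : ∀ τ ∈ Ioo 0 t, ENNReal.ofReal ((√(t - τ))⁻¹ * (√(1 + τ) ^ 3)⁻¹) *
        ENNReal.ofReal (Real.exp (l * min τ T)) ≤
        (Ioo 0 T).indicator (fun τ => ENNReal.ofReal ((√(T - τ))⁻¹ * Real.exp (l * τ))) τ +
        ENNReal.ofReal (Real.exp (l * T) * (1 + T)⁻¹) * ENNReal.ofReal ((√(t - τ))⁻¹ * (√τ)⁻¹) := by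
      intro τ hτ
      rw [← ENNReal.ofReal_mul (by positivity)]
      by_cases hτT : τ < T
      · rw [indicator_of_mem (show τ ∈ Ioo 0 T from ⟨hτ.1, hτT⟩), min_eq_left hτT.le]
        refine le_trans (ENNReal.ofReal_le_ofReal (mul_le_mul_of_nonneg_right ?_ (Real.exp_pos _).le))
          le_self_add
        refine (mul_le_of_le_one_right (by positivity)
          (inv_le_one_of_one_le₀ (one_le_pow₀ (one_le_sqrt_one_add hτ.1)))).trans ?_
        exact inv_anti₀ (Real.sqrt_pos.2 (sub_pos.2 hτT)) (Real.sqrt_le_sqrt (by linarith))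
      · push Not at hτT
        rw [indicator_of_notMem (fun h' => hτT.not_gt h'.2), zero_add, min_eq_right hτT,
          ← ENNReal.ofReal_mul (by positivity)]
        refine ENNReal.ofReal_le_ofReal ?_
        have h1 : (√(1 + τ) ^ 3)⁻¹ ≤ (1 + T)⁻¹ * (√τ)⁻¹ :=
          (one_add_rpow_sqrt_cube hτ.1).trans (by gcongr)
        calc _ ≤ (√(t - τ))⁻¹ * ((1 + T)⁻¹ * (√τ)⁻¹) * Real.exp (l * T) := by gcongr
          _ = _ := by ring
    have hint : ∫⁻ τ in Ioo 0 t, ENNReal.ofReal ((√(t - τ))⁻¹ * (√(1 + τ) ^ 3)⁻¹) *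
        ENNReal.ofReal (Real.exp (l * min τ T)) ≤
        ENNReal.ofReal (Real.exp (l * T) * √(Real.pi / l) + Real.exp (l * T) * (1 + T)⁻¹ * 6) := by
      refine (setLIntegral_mono' measurableSet_Ioo hpt).trans ?_
      rw [lintegral_add_left (Measurable.indicator (by fun_prop) measurableSet_Ioo),
        lintegral_const_mul' _ _ ENNReal.ofReal_ne_top, ENNReal.ofReal_add (by positivity) (by positivity)]
      refine add_le_add ?_ ?_
      · rw [lintegral_indicator measurableSet_Ioo]
        exact (lintegral_mono' (Measure.restrict_mono_measure Measure.restrict_le_self _) le_rfl).trans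
          (lintegral_inv_sqrt_mul_exp_le hl0 T)
      · rw [ENNReal.ofReal_mul (p := Real.exp (l * T) * (1 + T)⁻¹) (by positivity)]
        exact mul_le_mul_right (lintegral_inv_sqrt_mul_le ht) _
    refine (mul_le_mul_right hint _).trans ?_
    simp only
    rw [← ENNReal.ofReal_mul hb, ← half, min_eq_right h, hsl]
    refine ENNReal.ofReal_le_ofReal ?_
    have h1 := mul_le_mul_of_nonneg_right hb1 (Real.exp_pos (l * T)).le
    have h2 := mul_le_mul_of_nonneg_right hb2 (Real.exp_pos (l * T)).le
    linarith

/-- A Gronwall lemma of Volterra type. -/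
lemma exists_volterra_bound {b : ℝ} (hb : 0 ≤ b) : ∃ c : ℝ, 0 ≤ c ∧ ∀ (A : ℝ) (f : ℝ → ℝ≥0∞), 0 ≤ A →
    (∀ T : ℝ, ∃ D : ℝ, 0 ≤ D ∧ ∀ t, 0 < t → t ≤ T → f t ≤ ENNReal.ofReal (D * (√t)⁻¹)) →
    (∀ t, 0 < t → f t ≤ ENNReal.ofReal A + ENNReal.ofReal b *
      ∫⁻ τ in Ioo 0 t, ENNReal.ofReal ((√(t - τ))⁻¹ * (√(1 + τ) ^ 3)⁻¹) * f τ) →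
    ∀ t, 0 < t → f t ≤ ENNReal.ofReal (c * A) := by
  obtain ⟨c, ψ, hψ, hint⟩ := exists_supersolution hb
  have hc : 1 ≤ c := (hψ 1 one_pos).1.trans (hψ 1 one_pos).2
  refine ⟨c * 2, by positivity, fun A f hA hfD hf t₀ ht₀ => ?_⟩
  obtain ⟨D, hD, hfb⟩ := hfD t₀
  -- One iteration of the inequality upgrades the a priori bound by t^{-1/2} to boundedness on (0,
  -- t₀], so that the supremum S below is finite.
  have hbd : ∀ t, 0 < t → t ≤ t₀ → f t ≤ ENNReal.ofReal (A + b * (D * 6)) := by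
    intro t ht htt
    refine (hf t ht).trans ?_
    rw [ENNReal.ofReal_add hA (by positivity), ENNReal.ofReal_mul hb]
    gcongr
    calc _ ≤ ∫⁻ τ in Ioo 0 t, ENNReal.ofReal D * ENNReal.ofReal ((√(t - τ))⁻¹ * (√τ)⁻¹) := by
          refine setLIntegral_mono' measurableSet_Ioo fun τ hτ => ?_
          refine (mul_le_mul_right (hfb τ hτ.1 (hτ.2.le.trans htt)) _).trans ?_
          rw [← ENNReal.ofReal_mul (by positivity), ← ENNReal.ofReal_mul hD]
          refine ENNReal.ofReal_le_ofReal ?_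
          have : (√(1 + τ) ^ 3)⁻¹ ≤ 1 := inv_le_one_of_one_le₀ (one_le_pow₀ (one_le_sqrt_one_add hτ.1))
          calc _ ≤ (√(t - τ))⁻¹ * 1 * (D * (√τ)⁻¹) := by gcongr
            _ = _ := by ring
      _ ≤ _ := by
          rw [lintegral_const_mul' _ _ ENNReal.ofReal_ne_top, ENNReal.ofReal_mul hD]
          exact mul_le_mul_right (lintegral_inv_sqrt_mul_le ht) _
  set S := ⨆ t ∈ Ioc 0 t₀, f t / ENNReal.ofReal (ψ t) with hS
  have hψ0 : ∀ t, 0 < t → ENNReal.ofReal (ψ t) ≠ 0 := fun t ht => by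
    have := (hψ t ht).1
    simp only [ne_eq, ENNReal.ofReal_eq_zero, not_le]; linarith
  have hψ1 : ∀ t, 0 < t → 1 ≤ ENNReal.ofReal (ψ t) := fun t ht => by
    rw [ENNReal.one_le_ofReal]; exact (hψ t ht).1
  have hStop : S ≠ ⊤ := by
    refine ne_top_of_le_ne_top (ENNReal.ofReal_ne_top (r := A + b * (D * 6)))
      (iSup₂_le fun t ht => ?_)
    exact (ENNReal.div_le_of_le_mul ((hbd t ht.1 ht.2).trans (le_mul_of_one_le_right (zero_le)
      (hψ1 t ht.1))))
  have hfS : ∀ t, 0 < t → t ≤ t₀ → f t ≤ ENNReal.ofReal (ψ t) * S := fun t ht htt => by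
    have : f t / ENNReal.ofReal (ψ t) ≤ S := le_iSup₂ (f := fun t (_ : t ∈ Ioc 0 t₀) =>
      f t / ENNReal.ofReal (ψ t)) t ⟨ht, htt⟩
    rw [mul_comm]
    exact (ENNReal.div_le_iff (hψ0 t ht) ENNReal.ofReal_ne_top).1 this
  -- Since ψ is a supersolution, the integral term is at most half of ψS. Finiteness of S then
  -- permits the absorption; the final constant does not involve the a priori bound D.
  have hSle : S ≤ ENNReal.ofReal A + S / 2 := by
    refine iSup₂_le fun t ht => ENNReal.div_le_of_le_mul ((hf t ht.1).trans ?_)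
    rw [add_mul]
    refine add_le_add (le_mul_of_one_le_right (zero_le) (hψ1 t ht.1)) ?_
    calc _ ≤ ENNReal.ofReal b * ∫⁻ τ in Ioo 0 t, ENNReal.ofReal ((√(t - τ))⁻¹ * (√(1 + τ) ^ 3)⁻¹) *
            ENNReal.ofReal (ψ τ) * S := by
          refine mul_le_mul_right (setLIntegral_mono' measurableSet_Ioo fun τ hτ => ?_) _
          rw [mul_assoc]
          exact mul_le_mul_right (hfS τ hτ.1 (hτ.2.le.trans ht.2)) _
      _ = (ENNReal.ofReal b * ∫⁻ τ in Ioo 0 t, ENNReal.ofReal ((√(t - τ))⁻¹ * (√(1 + τ) ^ 3)⁻¹) *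
            ENNReal.ofReal (ψ τ)) * S := by
          rw [lintegral_mul_const' _ _ hStop, mul_assoc]
      _ ≤ ENNReal.ofReal (ψ t) / 2 * S := mul_le_mul_left (hint t ht.1) _
      _ = _ := by rw [ENNReal.div_eq_inv_mul, ENNReal.div_eq_inv_mul, mul_assoc, mul_assoc,
            mul_comm S]
  have hS2 : S ≤ ENNReal.ofReal (2 * A) := by
    lift S to NNReal using hStop with s
    have h2 : (s : ℝ≥0∞) / 2 = ENNReal.ofReal ((s : ℝ) / 2) := by
      rw [ENNReal.ofReal_div_of_pos two_pos]; simp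
    rw [h2, ← ENNReal.ofReal_add hA (by positivity), ← ENNReal.ofReal_coe_nnreal,
      ENNReal.ofReal_le_ofReal_iff (by positivity)] at hSle
    rw [← ENNReal.ofReal_coe_nnreal]
    exact ENNReal.ofReal_le_ofReal (by linarith)
  refine (hfS t₀ ht₀ le_rfl).trans ?_
  rw [mul_assoc, ENNReal.ofReal_mul (by positivity)]
  exact mul_le_mul' (ENNReal.ofReal_le_ofReal (hψ t₀ ht₀).2) hS2

/-! ### Weak short-time bounds of the vorticity -/

/-- The size of the vorticity with values in the extended nonnegative reals, cut off at `t = 0`. -/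
def vortE (u : ℝ → E n → E n) (t : ℝ) (x : E n) : ℝ≥0∞ :=
  if 0 < t then ENNReal.ofReal (vort u t x) else 0

/-- The size of the velocity with values in the extended nonnegative reals, cut off at `t = 0`. -/
def velE (u : ℝ → E n → E n) (t : ℝ) (x : E n) : ℝ≥0∞ :=
  if 0 < t then ENNReal.ofReal ‖u t x‖ else 0

lemma vortE_of_pos (u : ℝ → E n → E n) {t : ℝ} (ht : 0 < t) (x : E n) :
    vortE u t x = ENNReal.ofReal (vort u t x) := if_pos ht

lemma velE_of_pos (u : ℝ → E n → E n) {t : ℝ} (ht : 0 < t) (x : E n) :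
    velE u t x = ENNReal.ofReal ‖u t x‖ := if_pos ht

lemma measurable_ite_pos {f : ℝ × E n → ℝ} (hf : ContinuousOn f (Ioi 0 ×ˢ univ)) :
    Measurable fun p : ℝ × E n => if 0 < p.1 then ENNReal.ofReal (f p) else 0 := by
  classical
  have h1 := (hf.measurable_piecewise (continuousOn_const (c := (0 : ℝ)))
    (measurableSet_Ioi.prod .univ)).ennreal_ofReal
  convert h1 using 1
  funext p
  by_cases hp : 0 < p.1
  · simp [Set.piecewise, hp]
  · simp [Set.piecewise, hp]

lemma measurable_vortE {u : ℝ → E n → E n}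
    (hu : ContDiffOn ℝ ∞ (Function.uncurry u) (Ioi 0 ×ˢ univ)) :
    Measurable fun p : ℝ × E n => vortE u p.1 p.2 := measurable_ite_pos (continuousOn_vort hu)

lemma measurable_velE {u : ℝ → E n → E n}
    (hu : ContDiffOn ℝ ∞ (Function.uncurry u) (Ioi 0 ×ˢ univ)) :
    Measurable fun p : ℝ × E n => velE u p.1 p.2 := measurable_ite_pos hu.continuousOn.norm

lemma measurable_conv_time {K a : ℕ} {g : ℝ → E n → ℝ≥0∞} (hg : Measurable fun p : ℝ × E n => g p.1 p.2)
    (t : ℝ) : Measurable (Function.uncurry fun (τ : ℝ) (x : E n) =>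
      ∫⁻ y, kbE K a (t - τ) (x - y) * g τ y) := by
  have h1 : Measurable fun q : (ℝ × E n) × E n => kbE K a (t - q.1.1) (q.1.2 - q.2) * g q.1.1 q.2 := by
    refine Measurable.mul ?_ ?_
    · exact (measurable_kbE K a).comp
        ((measurable_const.sub (measurable_fst.comp measurable_fst)).prodMk
          ((measurable_snd.comp measurable_fst).sub measurable_snd))
    · exact hg.comp ((measurable_fst.comp measurable_fst).prodMk measurable_snd)
  exact h1.lintegral_prod_right'

lemma exists_nm_conv_time_le (n K : ℕ) (hK : n + 1 ≤ K) : ∃ C : ℝ, 0 ≤ C ∧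
    ∀ (e : Bool) (a : ℕ) (g : ℝ → E n → ℝ≥0∞), (Measurable fun p : ℝ × E n => g p.1 p.2) →
    ∀ s t : ℝ,
    nm e (fun x => ∫⁻ τ in Ioo s t, ∫⁻ y, kbE K a (t - τ) (x - y) * g τ y) ≤
        ENNReal.ofReal C * ∫⁻ τ in Ioo s t, ENNReal.ofReal (√(t - τ) ^ (scal n e + a))⁻¹ * ∫⁻ y, g τ y ∧
    nm e (fun x => ∫⁻ τ in Ioo s t, ∫⁻ y, kbE K a (t - τ) (x - y) * g τ y) ≤
        ENNReal.ofReal C * ∫⁻ τ in Ioo s t, ENNReal.ofReal (√(t - τ) ^ a)⁻¹ * nm e (g τ) := by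
  obtain ⟨C, hC, hb⟩ := exists_nm_kbE_le n K hK
  refine ⟨C, hC, fun e a g hg s t => ?_⟩
  have h1 : nm e (fun x => ∫⁻ τ in Ioo s t, ∫⁻ y, kbE K a (t - τ) (x - y) * g τ y) ≤
      ∫⁻ τ in Ioo s t, nm e (fun x => ∫⁻ y, kbE K a (t - τ) (x - y) * g τ y) :=
    nm_lintegral_le e (measurable_conv_time hg t).aemeasurable
  have hgs : ∀ τ, Measurable (g τ) := fun τ => hg.comp measurable_prodMk_left
  constructor
  · refine h1.trans ?_
    rw [← lintegral_const_mul' _ _ ENNReal.ofReal_ne_top]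
    refine setLIntegral_mono' measurableSet_Ioo fun τ hτ => ?_
    have hk := hb e a (t - τ) (sub_pos.2 hτ.2)
    refine (nm_conv_le_left e (measurable_kbE_slice K a _) (hgs τ).aemeasurable
      (ne_top_of_le_ne_top ENNReal.ofReal_ne_top hk)).trans ?_
    rw [← mul_assoc, ← ENNReal.ofReal_mul hC]
    exact mul_le_mul_left hk _
  · refine h1.trans ?_
    rw [← lintegral_const_mul' _ _ ENNReal.ofReal_ne_top]
    refine setLIntegral_mono' measurableSet_Ioo fun τ hτ => ?_
    have hk := hb false a (t - τ) (sub_pos.2 hτ.2)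
    refine (nm_conv_le_right e (measurable_kbE_slice K a _) (hgs τ)).trans ?_
    rw [← mul_assoc, ← ENNReal.ofReal_mul hC]
    simp only [nm, scal, zero_add] at hk
    exact mul_le_mul_left hk _

lemma ofReal_abs_integral_le {α : Type*} [MeasurableSpace α] {ν : Measure α} (f : α → ℝ) :
    ENNReal.ofReal |∫ a, f a ∂ν| ≤ ∫⁻ a, ENNReal.ofReal |f a| ∂ν := by
  have := enorm_integral_le_lintegral_enorm (μ := ν) f
  simpa only [Real.enorm_eq_ofReal_abs] using this

lemma exists_force_integral_le (n K : ℕ) : ∃ C : ℝ, 0 ≤ C ∧ ∀ u : ℝ → E n → E n,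
    ContDiffOn ℝ ∞ (Function.uncurry u) (Ioi 0 ×ˢ univ) → ∀ (h k : Fin n) (s t : ℝ) (x : E n), 0 ≤ s →
    ∫⁻ z in Ioo s t ×ˢ univ, ENNReal.ofReal |forceTerm u h k t x z.1 z.2| ∂(volume.prod volume) ≤
      ENNReal.ofReal C * ∫⁻ τ in Ioo s t, ∫⁻ y, kbE K 1 (t - τ) (x - y) * (velE u τ y * vortE u τ y) := by
  obtain ⟨C, hC, hb⟩ := exists_forceTerm_bound n K
  refine ⟨C, hC, fun u hu h k s t x hs => ?_⟩
  have hm : Measurable fun z : ℝ × E n => kbE K 1 (t - z.1) (x - z.2) *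
      (velE u z.1 z.2 * vortE u z.1 z.2) :=
    ((measurable_kbE K 1).comp ((measurable_const.sub measurable_fst).prodMk
      (measurable_const.sub measurable_snd))).mul ((measurable_velE hu).mul (measurable_vortE hu))
  have hp : ∫⁻ τ in Ioo s t, ∫⁻ y, kbE K 1 (t - τ) (x - y) * (velE u τ y * vortE u τ y) =
      ∫⁻ z in Ioo s t ×ˢ univ, kbE K 1 (t - z.1) (x - z.2) * (velE u z.1 z.2 * vortE u z.1 z.2)
        ∂(volume.prod volume) := by
    rw [← Measure.prod_restrict, Measure.restrict_univ, lintegral_prod _ hm.aemeasurable]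
  rw [hp, ← lintegral_const_mul' _ _ ENNReal.ofReal_ne_top]
  refine setLIntegral_mono' (measurableSet_Ioo.prod .univ) fun z hz => ?_
  have h0 : 0 < z.1 := hs.trans_lt hz.1.1
  rw [velE_of_pos u h0, vortE_of_pos u h0, kbE, ← ENNReal.ofReal_mul (norm_nonneg _),
    ← ENNReal.ofReal_mul (kb_nonneg _ _ _ _), ← ENNReal.ofReal_mul hC, mul_comm (kb _ _ _ _)]
  exact ENNReal.ofReal_le_ofReal (hb u h k t x z.1 z.2 hz.1.2)

lemma ofReal_vort_le {u : ℝ → E n → E n} {t : ℝ} {x : E n} {B : ℝ≥0∞}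
    (h : ∀ h k, ENNReal.ofReal |vorticity u h k t x| ≤ B) :
    ENNReal.ofReal (vort u t x) ≤ (n : ℝ≥0∞) ^ 2 * B := by
  rw [vort, ENNReal.ofReal_sum_of_nonneg fun _ _ => Finset.sum_nonneg fun _ _ => abs_nonneg _]
  refine (Finset.sum_le_sum (g := fun _ => (n : ℝ≥0∞) * B) fun i _ => ?_).trans (le_of_eq ?_)
  · rw [ENNReal.ofReal_sum_of_nonneg fun _ _ => abs_nonneg _]
    refine (Finset.sum_le_sum fun k _ => h i k).trans (le_of_eq ?_)
    simp
  · simp [sq, mul_assoc]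

lemma natCast_sq_eq_ofReal (n : ℕ) : (n : ℝ≥0∞) ^ 2 = ENNReal.ofReal ((n : ℝ) ^ 2) := by
  rw [ENNReal.ofReal_pow (by positivity), ENNReal.ofReal_natCast]

lemma DecayingFlow.lintegral_velE_le {u : ℝ → E n → E n} {C₀ : ℝ} (hf : DecayingFlow u C₀) {t : ℝ}
    (ht : 0 < t) : ∫⁻ y, velE u t y ≤ ENNReal.ofReal C₀ := by
  simp only [velE_of_pos u ht]
  rw [← ofReal_integral_eq_lintegral_ofReal (hf.integrable t ht).norm
    (Eventually.of_forall fun _ => norm_nonneg _)]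
  exact ENNReal.ofReal_le_ofReal (hf.mass t ht)

lemma DecayingFlow.velE_le {u : ℝ → E n → E n} {C₀ : ℝ} (hf : DecayingFlow u C₀) (t : ℝ) (x : E n) :
    velE u t x ≤ ENNReal.ofReal (C₀ * (√(1 + t) ^ (n + 1))⁻¹) := by
  unfold velE
  split_ifs with h
  · rw [← div_eq_mul_inv]; exact ENNReal.ofReal_le_ofReal (hf.bound t h x)
  · exact zero_le

/-- Short-time bound for the vorticity in `L^1` and `L^∞`. -/
lemma DecayingFlow.exists_nm_vortE_le {u : ℝ → E n → E n} {C₀ : ℝ} (hf : DecayingFlow u C₀) (e : Bool)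
    (T : ℝ) : ∃ D : ℝ, 0 ≤ D ∧ ∀ t, 0 < t → t ≤ T → nm e (vortE u t) ≤ ENNReal.ofReal (D * (√t)⁻¹) := by
  obtain ⟨B, hB, hv⟩ := hf.exists_vort_le
  have hC₀ := hf.nonneg
  have hone : ∀ t, 0 < t → t ≤ T → 1 ≤ √T * (√t)⁻¹ := fun t ht htT => by
    rw [← div_eq_mul_inv, le_div_iff₀ (Real.sqrt_pos.2 ht), one_mul]
    exact Real.sqrt_le_sqrt htT
  cases e
  · obtain ⟨C1, h1, b1⟩ := exists_force_integral_le n (n + 1)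
    obtain ⟨C2, h2, b2⟩ := exists_nm_conv_time_le n (n + 1) le_rfl
    obtain ⟨C3, h3, b3⟩ := exists_nm_kbE_le n (n + 1) le_rfl
    choose A hA a using fun i => ((HC.base (n := n)).dx i).bound (n + 1)
    have hS : 0 ≤ ∑ i, A i := Finset.sum_nonneg fun i _ => hA i
    set S := ∑ i, A i with hSdef
    refine ⟨n ^ 2 * (2 * S * C3 * 2 * C₀ + C1 * C2 * C₀ * B * (2 * |T| + 2 * (2 * √T))),
      by positivity, fun t ht htT => ?_⟩
    -- Duhamel's formula is started at t/2: the velocity is integrable there with mass at most C₀,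
    -- and the pointwise vorticity bound is available on (t/2, t).
    set s := t / 2 with hs
    have hs0 : 0 < s := by positivity
    have hst : s < t := by linarith
    have hts : t - s = s := by linarith
    have hsq : 0 < √s := Real.sqrt_pos.2 hs0
    have htq : 0 < √t := Real.sqrt_pos.2 ht
    have hT0 : 0 < T := by linarith
    have sle : √s ≤ √t := Real.sqrt_le_sqrt hst.le
    have sge : √t ≤ 2 * √s := by
      rw [Real.sqrt_le_left (by positivity), mul_pow, Real.sq_sqrt hs0.le]; linarith
    have sinv : (√s)⁻¹ ≤ 2 * (√t)⁻¹ := by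
      rw [← div_eq_mul_inv, le_div_iff₀ htq, inv_mul_le_iff₀ hsq]; linarith
    have pt : ∀ x, vortE u t x ≤ ENNReal.ofReal (n ^ 2) * (ENNReal.ofReal (2 * S) *
        (∫⁻ y, kbE (n + 1) 1 s (x - y) * velE u s y) + ENNReal.ofReal C1 *
        ∫⁻ τ in Ioo s t, ∫⁻ y, kbE (n + 1) 1 (t - τ) (x - y) * (velE u τ y * vortE u τ y)) := by
      intro x
      rw [vortE_of_pos u ht, ← natCast_sq_eq_ofReal]
      refine ofReal_vort_le fun h k => ?_
      rw [hf.duhamel h k hs0 hst x]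
      refine (ENNReal.ofReal_le_ofReal (abs_add_le _ _)).trans
        ((ENNReal.ofReal_add_le).trans (add_le_add ?_ ?_))
      · refine (ofReal_abs_integral_le _).trans ?_
        rw [← lintegral_const_mul' _ _ ENNReal.ofReal_ne_top, hts]
        refine lintegral_mono fun y => ?_
        rw [velE_of_pos u hs0, kbE, ← ENNReal.ofReal_mul (kb_nonneg _ _ _ _),
          ← ENNReal.ofReal_mul (by positivity)]
        refine ENNReal.ofReal_le_ofReal ?_
        have hk : ∀ i, |dx i (heatKernel n) s (x - y)| ≤ S * kb (n + 1) 1 s (x - y) := fun i =>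
          (a i _ hs0 _).trans (mul_le_mul_of_nonneg_right
            (Finset.single_le_sum (fun i _ => hA i) (Finset.mem_univ i)) (kb_nonneg _ _ _ _))
        refine (abs_mul_sub_mul_le (PiLp.norm_apply_le (u s y) k) (PiLp.norm_apply_le (u s y) h)
          (hk h) (hk k)).trans (le_of_eq ?_)
        ring
      · exact (ofReal_abs_integral_le _).trans (b1 u hf.smooth h k s t x hs0.le)
    have hmeas : Measurable fun x => ENNReal.ofReal (2 * S) *
        (∫⁻ y, kbE (n + 1) 1 s (x - y) * velE u s y) := by
      have := measurable_conv_time (K := n + 1) (a := 1) (measurable_velE hf.smooth) (s + s)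
      have h' := (this.comp (measurable_prodMk_left (x := s))).const_mul (ENNReal.ofReal (2 * S))
      simpa [Function.uncurry, Function.comp_def] using h'
    refine (nm_mono false pt).trans ?_
    rw [nm_const_mul false ENNReal.ofReal_ne_top]
    refine (mul_le_mul_right (nm_add_le false hmeas _) _).trans ?_
    rw [nm_const_mul false ENNReal.ofReal_ne_top, nm_const_mul false ENNReal.ofReal_ne_top]
    have I1 : nm false (fun x => ∫⁻ y, kbE (n + 1) 1 s (x - y) * velE u s y) ≤
        ENNReal.ofReal (C3 * (2 * (√t)⁻¹) * C₀) := by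
      have hk := b3 false 1 s hs0
      refine (nm_conv_le_left false (measurable_kbE_slice _ _ _)
        ((measurable_velE hf.smooth).comp measurable_prodMk_left).aemeasurable
        (ne_top_of_le_ne_top ENNReal.ofReal_ne_top hk)).trans ?_
      refine (mul_le_mul' hk (hf.lintegral_velE_le hs0)).trans ?_
      rw [← ENNReal.ofReal_mul (by positivity)]
      refine ENNReal.ofReal_le_ofReal ?_
      simp only [scal, zero_add, pow_one]
      gcongr
    -- The velocity is measured in L^1 and the vorticity in the supremum norm.
    have I2 : nm false (fun x => ∫⁻ τ in Ioo s t, ∫⁻ y, kbE (n + 1) 1 (t - τ) (x - y) *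
        (velE u τ y * vortE u τ y)) ≤ ENNReal.ofReal (C2 * (C₀ * (B * (1 + (√s)⁻¹)) * (2 * √s))) := by
      refine (b2 false 1 _ ((measurable_velE hf.smooth).mul (measurable_vortE hf.smooth)) s t).1.trans ?_
      rw [ENNReal.ofReal_mul h2]
      refine mul_le_mul_right ?_ _
      have hτ' : ∀ τ ∈ Ioo s t, ENNReal.ofReal (√(t - τ) ^ (scal n false + 1))⁻¹ *
          ∫⁻ y, velE u τ y * vortE u τ y ≤ ENNReal.ofReal (C₀ * (B * (1 + (√s)⁻¹))) *
            ENNReal.ofReal (√(t - τ))⁻¹ := by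
        intro τ hτ
        have hτ0 : 0 < τ := hs0.trans hτ.1
        rw [mul_comm]
        simp only [scal, zero_add, pow_one]
        refine mul_le_mul_left ?_ _
        calc ∫⁻ y, velE u τ y * vortE u τ y ≤
            ∫⁻ y, velE u τ y * ENNReal.ofReal (B * (1 + (√s)⁻¹)) := by
              refine lintegral_mono fun y => mul_le_mul_right ?_ _
              rw [vortE_of_pos u hτ0]
              refine ENNReal.ofReal_le_ofReal ((hv τ hτ0 y).trans ?_)
              have := Real.sqrt_le_sqrt hτ.1.le
              gcongr
          _ ≤ _ := by
              rw [lintegral_mul_const' _ _ ENNReal.ofReal_ne_top, ENNReal.ofReal_mul hC₀]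
              exact mul_le_mul_left (hf.lintegral_velE_le hτ0) _
      refine (setLIntegral_mono' measurableSet_Ioo hτ').trans ?_
      rw [lintegral_const_mul' _ _ ENNReal.ofReal_ne_top, lintegral_inv_sqrt_sub hst.le, hts,
        ← ENNReal.ofReal_mul (by positivity)]
    refine (mul_le_mul_right (add_le_add (mul_le_mul_right I1 _) (mul_le_mul_right I2 _)) _).trans ?_
    rw [← ENNReal.ofReal_mul (by positivity), ← ENNReal.ofReal_mul h1,
      ← ENNReal.ofReal_add (by positivity) (by positivity), ← ENNReal.ofReal_mul (by positivity)]
    refine ENNReal.ofReal_le_ofReal ?_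
    rw [mul_assoc ((n : ℝ) ^ 2)]
    refine mul_le_mul_of_nonneg_left ?_ (by positivity)
    have e1 : (1 + (√s)⁻¹) * (2 * √s) ≤ (2 * |T| + 2 * (2 * √T)) * (√t)⁻¹ := by
      have q1 : (1 + (√s)⁻¹) * (2 * √s) = 2 * √s + 2 := by field_simp
      have q2 := hone t ht htT
      have q3 : √s ≤ |T| * (√t)⁻¹ := by
        rw [← div_eq_mul_inv, le_div_iff₀ htq]
        calc √s * √t ≤ √t * √t := by gcongr
          _ = t := Real.mul_self_sqrt ht.le
          _ ≤ |T| := htT.trans (le_abs_self T)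
      rw [q1, add_mul]
      have q4 : 0 ≤ √T * (√t)⁻¹ := by positivity
      nlinarith
    have e2 := mul_le_mul_of_nonneg_left e1 (by positivity : 0 ≤ C1 * C2 * C₀ * B)
    have e3 : 2 * S * (C3 * (2 * (√t)⁻¹) * C₀) + C1 * (C2 * (C₀ * (B * (1 + (√s)⁻¹)) * (2 * √s))) =
      2 * S * C3 * 2 * C₀ * (√t)⁻¹ + C1 * C2 * C₀ * B * ((1 + (√s)⁻¹) * (2 * √s)) := by ring
    rw [e3, add_mul]
    linarith
  · refine ⟨B * (√T + 1), by positivity, fun t ht htT => iSup_le fun x => ?_⟩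
    rw [vortE_of_pos u ht]
    refine ENNReal.ofReal_le_ofReal ((hv t ht x).trans ?_)
    rw [mul_assoc]
    refine mul_le_mul_of_nonneg_left ?_ hB
    have := hone t ht htT
    linarith

/-! ### Initial data and the decaying flow -/

/-- In polar coordinates the singularity |z|^{1−n} is exactly compensated by the Jacobian r^{n−1}.
-/
lemma integrable_norm_kernel (hn : 2 ≤ n) :
    Integrable fun z : E n => if ‖z‖ < 1 then ‖z‖ / ‖z‖ ^ n else 0 := by
  have : Nonempty (Fin n) := ⟨⟨0, by omega⟩⟩
  have : Nontrivial (E n) := inferInstance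
  refine (integrable_fun_norm_addHaar (volume : Measure (E n))
    (f := fun r : ℝ => if r < 1 then r / r ^ n else 0)).2 ?_
  have : EqOn (fun y : ℝ => y ^ (Module.finrank ℝ (E n) - 1) • (if y < 1 then y / y ^ n else 0))
      ((Ioo 0 1).indicator fun _ => (1 : ℝ)) (Ioi 0) := by
    intro y hy
    have hy0 : (0 : ℝ) < y := hy
    simp only [finrank_euclideanSpace, Fintype.card_fin, smul_eq_mul]
    by_cases h1 : y < 1
    · rw [if_pos h1, indicator_of_mem (show y ∈ Ioo (0 : ℝ) 1 from ⟨hy0, h1⟩)]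
      obtain ⟨m, rfl⟩ : ∃ m, n = m + 1 := ⟨n - 1, by omega⟩
      simp only [Nat.add_sub_cancel, pow_succ]
      field_simp
    · rw [if_neg h1, indicator_of_notMem (fun h => h1 h.2), mul_zero]
  rw [integrableOn_congr_fun this measurableSet_Ioi]
  exact ((integrable_indicator_iff measurableSet_Ioo).2
    (integrableOn_const (by simp))).integrableOn

lemma norm_kernel_le (hn : 2 ≤ n) (z : E n) (k : Fin n) :
    |z k / ‖z‖ ^ n| ≤ (if ‖z‖ < 1 then ‖z‖ / ‖z‖ ^ n else 0) + 1 := by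
  have h0 : |z k / ‖z‖ ^ n| ≤ ‖z‖ / ‖z‖ ^ n := by
    rw [abs_div, abs_of_nonneg (by positivity : 0 ≤ ‖z‖ ^ n)]
    gcongr
    exact PiLp.norm_apply_le z k
  split_ifs with h
  · linarith
  · push Not at h
    rw [zero_add]
    refine h0.trans (div_le_one_of_le₀ ?_ (by positivity))
    exact le_self_pow₀ h (by omega)

lemma measurable_kernel (k : Fin n) : Measurable fun p : E n × E n => (p.1 k - p.2 k) / ‖p.1 - p.2‖ ^ n := by
  have h1 : Measurable fun p : E n × E n => p.1 k :=
    (by fun_prop : Continuous fun p : E n × E n => p.1 k).measurable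
  have h2 : Measurable fun p : E n × E n => p.2 k :=
    (by fun_prop : Continuous fun p : E n × E n => p.2 k).measurable
  have h3 : Measurable fun p : E n × E n => ‖p.1 - p.2‖ ^ n :=
    (by fun_prop : Continuous fun p : E n × E n => ‖p.1 - p.2‖ ^ n).measurable
  exact (h1.sub h2).div h3

/-- The kernel is an integrable singularity plus a bounded part, so its integral in x over a unit
ball is bounded uniformly in y; Tonelli concludes. -/
lemma integrable_kernel_mul (hn : 2 ≤ n) {f : E n → ℝ} (hf : Integrable f) (k : Fin n) (x₀ : E n) :
    Integrable (fun p : E n × E n => (p.1 k - p.2 k) / ‖p.1 - p.2‖ ^ n * f p.2)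
      ((volume.restrict (Metric.ball x₀ 1)).prod volume) := by
  have hfm : AEStronglyMeasurable (fun p : E n × E n => f p.2)
      ((volume.restrict (Metric.ball x₀ 1)).prod volume) := hf.aestronglyMeasurable.comp_snd
  have hm : AEStronglyMeasurable (fun p : E n × E n => (p.1 k - p.2 k) / ‖p.1 - p.2‖ ^ n * f p.2)
      ((volume.restrict (Metric.ball x₀ 1)).prod volume) :=
    (measurable_kernel k).aestronglyMeasurable.mul hfm
  refine ⟨hm, ?_⟩
  rw [hasFiniteIntegral_iff_enorm, lintegral_prod_symm _ hm.enorm]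
  set g : E n → ℝ := fun z => if ‖z‖ < 1 then ‖z‖ / ‖z‖ ^ n else 0 with hg
  have hgi : Integrable g := integrable_norm_kernel hn
  have hg0 : ∀ z, 0 ≤ g z := fun z => by simp only [hg]; split_ifs <;> positivity
  set Q := (∫⁻ z, ENNReal.ofReal (g z)) + volume (Metric.ball x₀ 1) with hQ
  have hQt : Q ≠ ⊤ := by
    refine ENNReal.add_ne_top.2 ⟨?_, measure_ball_lt_top.ne⟩
    exact (hgi.lintegral_lt_top).ne
  have hle : ∀ y, ∫⁻ x in Metric.ball x₀ 1, ‖(x k - y k) / ‖x - y‖ ^ n * f y‖ₑ ≤ Q * ‖f y‖ₑ := by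
    intro y
    have : ∀ x : E n, ‖(x k - y k) / ‖x - y‖ ^ n * f y‖ₑ ≤
        (ENNReal.ofReal (g (x - y)) + 1) * ‖f y‖ₑ := by
      intro x
      rw [enorm_mul]
      refine mul_le_mul_left ?_ _
      rw [Real.enorm_eq_ofReal_abs, ← ENNReal.ofReal_one, ← ENNReal.ofReal_add (hg0 _) zero_le_one]
      exact ENNReal.ofReal_le_ofReal (norm_kernel_le hn (x - y) k)
    refine (lintegral_mono this).trans ?_
    rw [lintegral_mul_const' _ _ enorm_ne_top]
    refine mul_le_mul_left ?_ _
    rw [lintegral_add_right _ measurable_const, setLIntegral_const, one_mul]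
    refine add_le_add ?_ le_rfl
    rw [← lintegral_sub_right_eq_self (fun z => ENNReal.ofReal (g z)) y]
    exact lintegral_mono' Measure.restrict_le_self le_rfl
  refine (lintegral_mono hle).trans_lt ?_
  rw [lintegral_const_mul' _ _ hQt]
  exact ENNReal.mul_lt_top hQt.lt_top hf.2

/-- Needed to split integrals of a test function against the two components of the initial velocity
into separate integrals. -/
lemma locallyIntegrable_biotSavart (hn : 2 ≤ n) {w : Fin n → Fin n → E n → ℝ}
    (hw : ∀ i j, Integrable (w i j)) (j : Fin n) : LocallyIntegrable (biotSavart w j) := by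
  intro x₀
  refine ⟨Metric.ball x₀ 1, Metric.ball_mem_nhds x₀ one_pos, ?_⟩
  refine Integrable.const_mul (integrable_finsetSum _ fun k _ => ?_) _
  exact (integrable_kernel_mul hn (hw k j) k x₀).integral_prod_left

/-- The initial data: a weighted integrable tensor whose potential is the initial trace of `u`. -/
structure InitialVorticity (P : ℕ) (w : Fin n → Fin n → E n → ℝ) (u : ℝ → E n → E n) : Prop where
  integrable : ∀ i j, Integrable fun x => (1 + ‖x‖) ^ P * w i j x
  trace : ∀ (h k : Fin n) (φ : E n → ℝ), ContDiff ℝ ∞ φ → HasCompactSupport φ →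
    Tendsto (fun s => ∫ y, (u s y k * pderiv h φ y - u s y h * pderiv k φ y)) (𝓝[>] 0)
      (𝓝 (-∫ y, φ y * w h k y))

lemma integrable_mul_of_weight {P : ℕ} {f g : E n → ℝ} (hf : Integrable fun x => (1 + ‖x‖) ^ P * f x)
    (hg : Continuous g) {C : ℝ} (hb : ∀ x, |g x| ≤ C * (1 + ‖x‖) ^ P) : Integrable fun x => g x * f x := by
  have hpos : ∀ x : E n, 0 < (1 + ‖x‖) ^ P := fun x => by positivity
  have := hf.bdd_mul (f := fun x => g x / (1 + ‖x‖) ^ P) (c := C)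
    (hg.div (by fun_prop) fun x => (hpos x).ne').aestronglyMeasurable
    (Eventually.of_forall fun x => by
      rw [Real.norm_eq_abs, abs_div, abs_of_pos (hpos x), div_le_iff₀ (hpos x)]; exact hb x)
  refine this.congr (Eventually.of_forall fun x => ?_)
  have := (hpos x).ne'
  simp only
  field_simp

lemma integrable_of_weight {P : ℕ} {f : E n → ℝ} (hf : Integrable fun x => (1 + ‖x‖) ^ P * f x) :
    Integrable f := by
  have := integrable_mul_of_weight hf (continuous_const (y := (1 : ℝ))) (C := 1) fun x => by
    rw [abs_one, one_mul]; exact one_le_pow₀ (by linarith [norm_nonneg x])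
  simpa using this

lemma IsSmoothNSSolution.initialVorticity (hn : 2 ≤ n) {P : ℕ} {w : Fin n → Fin n → E n → ℝ}
    (hw : ∀ i j, Integrable fun x => (1 + ‖x‖) ^ P * w i j x) (hcurl : IsWeakCurl w (biotSavart w))
    {u : ℝ → E n → E n} (hu : IsSmoothNSSolution (biotSavart w) u) : InitialVorticity P w u := by
  refine ⟨hw, fun h k φ hφ hc => ?_⟩
  have hloc : ∀ j, LocallyIntegrable (biotSavart w j) := fun j =>
    locallyIntegrable_biotSavart hn (fun i j => integrable_of_weight (hw i j)) j
  have ia : ∀ i j, Integrable fun x => pderiv i φ x * biotSavart w j x := fun i j =>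
    (hloc j).integrable_smul_left_of_hasCompactSupport (contDiff_pderiv hφ i).continuous
      (HasCompactSupport.pderiv hc i)
  have iu : ∀ i j s, 0 < s → Integrable fun x => pderiv i φ x * u s x j := fun i j s hs =>
    ((contDiff_pderiv hφ i).continuous.mul ((SM.component hu.smooth j).slice_continuous hs)
      ).integrable_of_hasCompactSupport (HasCompactSupport.pderiv hc i).mul_right
  -- The weak curl identity turns the limit of the velocity integrals, which is known from the
  -- initial condition, into an integral against w.
  rw [hcurl h k φ hφ hc, neg_neg, integral_sub (ia h k) (ia k h)]
  refine ((hu.initial k _ (contDiff_pderiv hφ h) (HasCompactSupport.pderiv hc h)).sub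
    (hu.initial h _ (contDiff_pderiv hφ k) (HasCompactSupport.pderiv hc k))).congr' ?_
  filter_upwards [self_mem_nhdsWithin] with s hs
  rw [← integral_sub (iu h k s hs) (iu k h s hs)]
  refine integral_congr_ae (Eventually.of_forall fun y => ?_)
  simp only
  ring

/-- Only the endpoint decay rates q = 1 and q = ∞ of the velocity enter the proof. -/
lemma IsSmoothNSSolution.decayingFlow {a : Fin n → E n → ℝ} {u : ℝ → E n → E n}
    (hu : IsSmoothNSSolution a u) (hd : HasVelocityDecay u) : ∃ C, DecayingFlow u C := by
  obtain ⟨C1, h1⟩ := hd 1 le_rfl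
  obtain ⟨C2, h2⟩ := hd ⊤ le_top
  obtain ⟨p, hp, hmom⟩ := hu.momentum
  have hcont : ∀ t, 0 < t → Continuous (u t) := fun t ht => by
    have h0 : ContinuousOn (fun x : E n => Function.uncurry u (t, x)) univ :=
      hu.smooth.continuousOn.comp (by fun_prop) fun x _ => ⟨ht, trivial⟩
    exact continuousOn_univ.1 h0
  have hint : ∀ t, 0 < t → Integrable (u t) := fun t ht => by
    rw [← memLp_one_iff_integrable]
    exact ⟨(hcont t ht).aestronglyMeasurable, (h1 t ht).trans_lt ENNReal.ofReal_lt_top⟩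
  refine ⟨|C1| + |C2|, hu.smooth, fun h k t ht x => ?_, hu.divergence_free, by positivity,
    fun t ht x => ?_, hint, fun t ht => ?_⟩
  · rw [sum_dx_flux hu.smooth h k ht]
    exact vorticity_equation hu.smooth hp hmom h k ht x
  · have hb : 0 < 1 + t := by linarith
    have e : (1 + t) ^ (-((n : ℝ) / 2) * (1 - (1 / (⊤ : ℝ≥0∞)).toReal) - 1 / 2)
        = (√(1 + t) ^ (n + 1))⁻¹ := by
      rw [← rpow_neg_half hb]
      congr 1
      push_cast
      simp
      ring
    have h3 := h2 t ht
    rw [e, eLpNorm_exponent_top] at h3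
    have h4 : ∀ᵐ y, ‖u t y‖ ≤ (|C1| + |C2|) / √(1 + t) ^ (n + 1) := by
      filter_upwards [ae_le_eLpNormEssSup (f := u t) (μ := volume)] with y hy
      have h5 := hy.trans h3
      rw [← ofReal_norm] at h5
      have hx : C2 * (√(1 + t) ^ (n + 1))⁻¹ ≤ (|C1| + |C2|) / √(1 + t) ^ (n + 1) := by
        rw [div_eq_mul_inv]
        gcongr
        linarith [abs_nonneg C1, le_abs_self C2]
      have h6 := h5.trans (ENNReal.ofReal_le_ofReal hx)
      rwa [ENNReal.ofReal_le_ofReal_iff (by positivity)] at h6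
    -- The essential bound holds on a set of full measure, hence dense, and by continuity of the
    -- velocity closed. It therefore holds everywhere.
    have h5 : Dense {y | ‖u t y‖ ≤ (|C1| + |C2|) / √(1 + t) ^ (n + 1)} := Measure.dense_of_ae h4
    have h6 : IsClosed {y | ‖u t y‖ ≤ (|C1| + |C2|) / √(1 + t) ^ (n + 1)} :=
      isClosed_le (hcont t ht).norm continuous_const
    have h7 := h5.closure_eq
    rw [h6.closure_eq] at h7
    have : x ∈ {y | ‖u t y‖ ≤ (|C1| + |C2|) / √(1 + t) ^ (n + 1)} := by rw [h7]; trivial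
    exact this
  · have h3 := h1 t ht
    have hb : 1 ≤ 1 + t := by linarith
    rw [eLpNorm_one_eq_lintegral_enorm] at h3
    rw [integral_norm_eq_lintegral_enorm (hint t ht).aestronglyMeasurable]
    refine ENNReal.toReal_le_of_le_ofReal (by positivity) (h3.trans (ENNReal.ofReal_le_ofReal ?_))
    have e : (1 + t) ^ (-((n : ℝ) / 2) * (1 - (1 / (1 : ℝ≥0∞)).toReal) - 1 / 2) ≤ 1 :=
      Real.rpow_le_one_of_one_le_of_nonpos hb (by simp)
    have e0 : 0 ≤ (1 + t) ^ (-((n : ℝ) / 2) * (1 - (1 / (1 : ℝ≥0∞)).toReal) - 1 / 2) := by positivity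
    calc _ ≤ |C1| * (1 + t) ^ (-((n : ℝ) / 2) * (1 - (1 / (1 : ℝ≥0∞)).toReal) - 1 / 2) := by
          gcongr; exact le_abs_self _
      _ ≤ |C1| * 1 := by gcongr
      _ ≤ _ := by linarith [abs_nonneg C2]

/-! ### Duhamel's formula from the initial vorticity -/

/-- The force is at most C₀B(1 + τ^{-1/2}) and the kernel has mass of order (t−τ)^{-1/2}, so the
integrand is integrable at both ends of the time interval. -/
lemma DecayingFlow.integrableOn_forceTerm {u : ℝ → E n → E n} {C₀ : ℝ} (hf : DecayingFlow u C₀)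
    (h k : Fin n) (t : ℝ) (x : E n) :
    IntegrableOn (fun z : ℝ × E n => forceTerm u h k t x z.1 z.2) (Ioo 0 t ×ˢ univ)
      (volume.prod volume) := by
  refine ⟨(SM.continuousOn_forceTerm hf.smooth h k le_rfl x).aestronglyMeasurable
    (measurableSet_Ioo.prod .univ), ?_⟩
  rcases le_or_gt t 0 with ht | ht
  · simp [Ioo_eq_empty_of_le ht, HasFiniteIntegral]
  obtain ⟨B, hB, hv⟩ := hf.exists_vort_le
  obtain ⟨C1, h1, b1⟩ := exists_force_integral_le n (n + 1)
  obtain ⟨C2, h2, b2⟩ := exists_nm_conv_time_le n (n + 1) le_rfl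
  have hC₀ := hf.nonneg
  rw [hasFiniteIntegral_iff_enorm]
  simp only [Real.enorm_eq_ofReal_abs]
  refine (b1 u hf.smooth h k 0 t x le_rfl).trans_lt (ENNReal.mul_lt_top ENNReal.ofReal_lt_top ?_)
  have h3 := (b2 true 1 (fun τ y => velE u τ y * vortE u τ y) ((measurable_velE hf.smooth).mul (measurable_vortE hf.smooth)) 0 t).2
  refine ((le_iSup (fun x => ∫⁻ τ in Ioo 0 t, ∫⁻ y, kbE (n + 1) 1 (t - τ) (x - y) *
    (velE u τ y * vortE u τ y)) x).trans h3).trans_lt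
    (ENNReal.mul_lt_top ENNReal.ofReal_lt_top ?_)
  have h4 : ∀ τ ∈ Ioo 0 t, ENNReal.ofReal (√(t - τ) ^ 1)⁻¹ *
      nm true (fun y => velE u τ y * vortE u τ y) ≤ ENNReal.ofReal (C₀ * B) *
        (ENNReal.ofReal (√(t - τ))⁻¹ + ENNReal.ofReal ((√(t - τ))⁻¹ * (√τ)⁻¹)) := by
    intro τ hτ
    have h5 : nm true (fun y => velE u τ y * vortE u τ y) ≤
        ENNReal.ofReal (C₀ * B * (1 + (√τ)⁻¹)) := by
      refine iSup_le fun y => ?_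
      simp only
      rw [velE_of_pos u hτ.1, vortE_of_pos u hτ.1, ← ENNReal.ofReal_mul (norm_nonneg _), mul_assoc]
      exact ENNReal.ofReal_le_ofReal (mul_le_mul (hf.norm_le hτ.1 y) (hv τ hτ.1 y)
        (vort_nonneg _ _ _) hC₀)
    refine (mul_le_mul_right h5 _).trans (le_of_eq ?_)
    rw [← ENNReal.ofReal_add (by positivity) (by positivity), ← ENNReal.ofReal_mul (by positivity),
      ← ENNReal.ofReal_mul (by positivity)]
    congr 1
    ring
  refine (setLIntegral_mono' measurableSet_Ioo h4).trans_lt ?_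
  rw [lintegral_const_mul' _ _ ENNReal.ofReal_ne_top, lintegral_add_left (by fun_prop),
    lintegral_inv_sqrt_sub ht.le]
  exact ENNReal.mul_lt_top ENNReal.ofReal_lt_top (ENNReal.add_lt_top.2
    ⟨ENNReal.ofReal_lt_top, (lintegral_inv_sqrt_mul_le ht).trans_lt ENNReal.ofReal_lt_top⟩)

lemma HC.abs_time_sub_le {a : ℕ} {F : ℝ → E n → ℝ} (h : HC a F) {t : ℝ} (ht : 0 < t) :
    ∃ C : ℝ, 0 ≤ C ∧ ∀ s, 0 ≤ s → s ≤ t / 2 → ∀ x, |F (t - s) x - F t x| ≤ C * s := by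
  obtain ⟨C, hC, hb⟩ := h.dt.bound 0
  have ht2 : 0 < √(t / 2) := Real.sqrt_pos.2 (by positivity)
  refine ⟨C * (√(t / 2) ^ (n + (a + 2)))⁻¹, by positivity, fun s hs hst x => ?_⟩
  have := (convex_Icc (t / 2) t).norm_image_sub_le_of_norm_hasDerivWithin_le
    (f := fun τ => F τ x) (f' := fun τ => NSVorticity.dt F τ x)
    (C := C * (√(t / 2) ^ (n + (a + 2)))⁻¹) (x := t) (y := t - s)
    (fun τ hτ => (h.sm.hasDerivAt (by linarith [hτ.1]) x).hasDerivWithinAt)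
    (fun τ hτ => by
      have hτ0 : 0 < τ := by linarith [hτ.1]
      refine (hb τ hτ0 x).trans (mul_le_mul_of_nonneg_left ((kb_le _ _ hτ0 x).trans ?_) hC)
      have := Real.sqrt_le_sqrt hτ.1
      gcongr)
    ⟨by linarith, le_rfl⟩ ⟨by linarith, by linarith⟩
  rwa [sub_sub_cancel_left, norm_neg, Real.norm_of_nonneg hs] at this

/-- Where the cutoff differs from one the heat kernel is evaluated at distance at least r/2, and the
gradient of the cutoff is O(1/r). Only uniform smallness matters, since it is tested against a
velocity of bounded L^1 norm. -/
lemma exists_dx_cutKernel_sub_le (n : ℕ) {t : ℝ} (ht : 0 < t) : ∃ C : ℝ, 0 ≤ C ∧ ∀ r : ℝ, 1 ≤ r →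
    ∀ (h : Fin n) (x : E n), |dx h (heatKernel n) t x - dx h (cutKernel (cutoff r)) t x| ≤ C / r := by
  obtain ⟨B, hB0, hB⟩ := exists_cutoff_bound n
  obtain ⟨A0, hA0, a0⟩ := (HC.base (n := n)).bound 0
  choose A1 hA1 a1 using fun i => ((HC.base (n := n)).dx i).bound_far
  have hS : 0 ≤ ∑ i, A1 i := Finset.sum_nonneg fun i _ => hA1 i
  have htq : 0 < √t := Real.sqrt_pos.2 ht
  refine ⟨∑ i, A1 i + A0 * (√t ^ (n + 0))⁻¹ * B, by positivity, fun r hr h x => ?_⟩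
  have hr0 : 0 < r := by linarith
  rw [dx_cutKernel (contDiff_cutoff r) ht]
  have e : dx h (heatKernel n) t x - (pderiv h (heatKernel n t) x * cutoff r x +
      heatKernel n t x * pderiv h (cutoff r) x) =
      dx h (heatKernel n) t x * (1 - cutoff r x) - heatKernel n t x * pderiv h (cutoff r) x := by
    change pderiv h (heatKernel n t) x - _ = pderiv h (heatKernel n t) x * _ - _
    ring
  have e1 : |dx h (heatKernel n) t x * (1 - cutoff r x)| ≤ (∑ i, A1 i) / r := by
    rcases lt_or_ge ‖x‖ (r / 2) with hx | hx
    · rw [cutoff_eq_one hr0 hx.le, sub_self, mul_zero, abs_zero]; positivity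
    · have c1 : |1 - cutoff r x| ≤ 1 := by
        rw [abs_le]; constructor <;> linarith [cutoff_nonneg r x, cutoff_le_one r x]
      rw [abs_mul]
      refine (mul_le_of_le_one_right (abs_nonneg _) c1).trans ((a1 h t ht r hr0 x hx).trans ?_)
      have := Finset.single_le_sum (fun i _ => hA1 i) (Finset.mem_univ h)
      have hr' : r ≤ r ^ (n + (0 + 1)) := le_self_pow₀ hr (by omega)
      gcongr
  have e2 : |heatKernel n t x * pderiv h (cutoff r) x| ≤ A0 * (√t ^ (n + 0))⁻¹ * (B / r) := by
    rw [abs_mul]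
    refine mul_le_mul ((a0 t ht x).trans ?_) (hB r hr0 h h h x).1 (abs_nonneg _) (by positivity)
    exact mul_le_mul_of_nonneg_left (kb_le _ _ ht x) hA0
  rw [e]
  refine (abs_sub _ _).trans ((add_le_add e1 e2).trans (le_of_eq ?_))
  ring

lemma DecayingFlow.abs_integral_le {u : ℝ → E n → E n} {C₀ : ℝ} (hf : DecayingFlow u C₀) {s : ℝ}
    (hs : 0 < s) (h k : Fin n) {f g : E n → ℝ} {c : ℝ} (hg : ∀ y, |f y| ≤ c) (hg' : ∀ y, |g y| ≤ c) :
    |∫ y, (u s y k * f y - u s y h * g y)| ≤ 2 * c * C₀ := by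
  have hc : 0 ≤ c := (abs_nonneg _).trans (hg 0)
  have i : Integrable fun y => 2 * c * ‖u s y‖ := (hf.integrable s hs).norm.const_mul _
  rw [← Real.norm_eq_abs]
  refine (norm_integral_le_of_norm_le i (Eventually.of_forall fun y => ?_)).trans ?_
  · refine (abs_mul_sub_mul_le (PiLp.norm_apply_le (u s y) k) (PiLp.norm_apply_le (u s y) h)
      (hg y) (hg' y)).trans (le_of_eq ?_)
    ring
  · rw [integral_const_mul]
    exact mul_le_mul_of_nonneg_left (hf.mass s hs) (by positivity)

lemma pderiv_comp_const_sub {f : E n → ℝ} (hf : Differentiable ℝ f) (x : E n) (i : Fin n) (y : E n) :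
    pderiv i (fun y => f (x - y)) y = -pderiv i f (x - y) := by
  have h1 : HasFDerivAt (fun y : E n => x - y) (-ContinuousLinearMap.id ℝ (E n)) y :=
    (hasFDerivAt_id y).const_sub x
  have h2 := ((hf (x - y)).hasFDerivAt.comp y h1).fderiv
  change fderiv ℝ (f ∘ fun y => x - y) y (ev i) = _
  rw [h2]
  simp [pderiv]

/-- The Duhamel formula for the vorticity, started from the initial vorticity. -/
theorem DecayingFlow.representation {u : ℝ → E n → E n} {C₀ : ℝ} (hf : DecayingFlow u C₀) {P : ℕ}
    {w : Fin n → Fin n → E n → ℝ} (hw : InitialVorticity P w u) (h k : Fin n)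
    {t : ℝ} (ht : 0 < t) (x : E n) :
    vorticity u h k t x = (∫ y, heatKernel n t (x - y) * w h k y)
      + ∫ z in Ioo 0 t ×ˢ univ, forceTerm u h k t x z.1 z.2 ∂(volume.prod volume) := by
  have hC₀ := hf.nonneg
  have hwi : Integrable (w h k) := integrable_of_weight (hw.integrable h k)
  set X := vorticity u h k t x
    - ∫ z in Ioo 0 t ×ˢ univ, forceTerm u h k t x z.1 z.2 ∂(volume.prod volume) with hX
  suffices hmain : X = ∫ y, heatKernel n t (x - y) * w h k y by linarith
  obtain ⟨C1, h1, b1⟩ := exists_dx_cutKernel_sub_le n ht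
  choose A hA0 hA using fun i => ((HC.base (n := n)).dx i).abs_time_sub_le ht
  -- Starting times decreasing to 0 and staying below t/2, where the time difference of the kernel
  -- is Lipschitz.
  set s : ℕ → ℝ := fun j => t / ((j : ℝ) + 2) with hs
  have hs0 : ∀ j, 0 < s j := fun j => by positivity
  have hs2 : ∀ j, s j ≤ t / 2 := fun j => by
    simp only [hs]; gcongr; linarith [(Nat.cast_nonneg j : (0 : ℝ) ≤ j)]
  have hst : ∀ j, s j < t := fun j => by linarith [hs2 j]
  have hslim : Tendsto s atTop (𝓝 0) :=
    tendsto_const_nhds.div_atTop (tendsto_atTop_add_const_right _ _ tendsto_natCast_atTop_atTop)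
  have hslim' : Tendsto s atTop (𝓝[>] 0) :=
    tendsto_nhdsWithin_iff.2 ⟨hslim, Eventually.of_forall hs0⟩
  set Y : ℕ → ℝ := fun j => ∫ y, (u (s j) y k * dx h (heatKernel n) (t - s j) (x - y)
        - u (s j) y h * dx k (heatKernel n) (t - s j) (x - y)) with hY
  have hYX : Tendsto Y atTop (𝓝 X) := by
    have hmono : Monotone fun j => Ioo (s j) t ×ˢ (univ : Set (E n)) := fun i j hij => by
      refine prod_mono (Ioo_subset_Ioo_left ?_) le_rfl
      simp only [hs]
      have : (i : ℝ) ≤ j := by exact_mod_cast hij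
      gcongr
    have hun : ⋃ j, Ioo (s j) t ×ˢ (univ : Set (E n)) = Ioo 0 t ×ˢ univ := by
      rw [← iUnion_prod_const]
      congr 1
      ext τ
      simp only [mem_iUnion, mem_Ioo]
      constructor
      · rintro ⟨j, hj, hj'⟩
        exact ⟨(hs0 j).trans hj, hj'⟩
      · rintro ⟨h0, h1⟩
        obtain ⟨j, hj⟩ := (hslim.eventually_lt_const h0).exists
        exact ⟨j, hj, h1⟩
    have := tendsto_setIntegral_of_monotone (μ := volume.prod volume)
      (f := fun z : ℝ × E n => forceTerm u h k t x z.1 z.2)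
      (fun j => measurableSet_Ioo.prod .univ) hmono
      (by rw [hun]; exact hf.integrableOn_forceTerm h k t x)
    rw [hun] at this
    refine (tendsto_const_nhds.sub this).congr fun j => ?_
    rw [hf.duhamel h k (hs0 j) (hst j) x, add_sub_cancel_right]
  -- The initial trace is known only against compactly supported functions of y independent of s.
  -- The kernel at time t − s_j is therefore compared with the cut-off kernel at time t; the error
  -- is O(s_j + 1/r) uniformly, and j tends to infinity before r does.
  have hφ : ∀ r, 1 ≤ r → |X - ∫ y, cutKernel (cutoff r) t (x - y) * w h k y| ≤ 2 * (C1 / r) * C₀ := by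
    intro r hr
    have hr0 : 0 < r := by linarith
    have hχ := contDiff_cutoff (n := n) r
    have hc := hasCompactSupport_cutoff (n := n) hr0
    have hsl := (SM.cutKernel hχ).slice ht
    have hφs : ContDiff ℝ ∞ fun y => cutKernel (cutoff r) t (x - y) := hsl.comp (by fun_prop)
    have hφc : HasCompactSupport fun y => cutKernel (cutoff r) t (x - y) :=
      HasCompactSupport.intro (hc.isCompact.image (by fun_prop : Continuous fun z => x - z))
        fun y hy => cutKernel_eq_zero (fun h' => hy ((mem_reflect_iff x y).2 h')) t
    have hpd : ∀ i y, pderiv i (fun y => cutKernel (cutoff r) t (x - y)) y =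
        -dx i (cutKernel (cutoff r)) t (x - y) := fun i y =>
      pderiv_comp_const_sub (hsl.differentiable (by simp)) x i y
    have htr := ((hw.trace h k _ hφs hφc).comp hslim').neg
    rw [neg_neg] at htr
    have hsub := (hYX.sub htr).abs
    have hlim : Tendsto (fun j => 2 * ((A h + A k) * s j + C1 / r) * C₀) atTop
        (𝓝 (2 * ((A h + A k) * 0 + C1 / r) * C₀)) :=
      (((hslim.const_mul _).add_const _).const_mul 2).mul_const _
    rw [mul_zero, zero_add] at hlim
    refine le_of_tendsto_of_tendsto hsub hlim (Eventually.of_forall fun j => ?_)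
    have cu : ∀ i, Continuous fun y => u (s j) y i := fun i =>
      (SM.component hf.smooth i).slice_continuous (hs0 j)
    have iu : ∀ i, Integrable fun y => u (s j) y i := fun i =>
      (hf.integrable _ (hs0 j)).mono (cu i).aestronglyMeasurable
        (Eventually.of_forall fun y => PiLp.norm_apply_le _ i)
    have bG : ∀ i, ∃ c, ∀ y, |dx i (heatKernel n) (t - s j) (x - y)| ≤ c := fun i => by
      obtain ⟨C, hC, hb⟩ := ((HC.base (n := n)).dx i).bound 0
      have hp : 0 < t - s j := sub_pos.2 (hst j)
      exact ⟨_, fun y => (hb _ hp _).trans (mul_le_mul_of_nonneg_left (kb_le _ _ hp _) hC)⟩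
    have i1 : ∀ i l, Integrable fun y => u (s j) y i * dx l (heatKernel n) (t - s j) (x - y) := by
      intro i l
      obtain ⟨c, hcb⟩ := bG l
      have cG : Continuous fun y => dx l (heatKernel n) (t - s j) (x - y) :=
        (((SM.heatKernel (n := n)).dx l).slice_continuous (sub_pos.2 (hst j))).comp
          (by fun_prop : Continuous fun y : E n => x - y)
      refine ((iu i).bdd_mul cG.aestronglyMeasurable (Eventually.of_forall hcb)).congr
        (Eventually.of_forall fun y => mul_comm _ _)
    have i2 : ∀ i l, Integrable fun y => u (s j) y i * dx l (cutKernel (cutoff r)) t (x - y) :=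
      fun i l => integrable_mul_reflect (cu i) (((SM.cutKernel hχ).dx l).slice_continuous ht)
        (hasCompactSupport_dx_cutKernel hc l t) x
    have i3 : Integrable fun y => u (s j) y k * dx h (heatKernel n) (t - s j) (x - y)
        - u (s j) y h * dx k (heatKernel n) (t - s j) (x - y) := (i1 k h).sub (i1 h k)
    have i4 : Integrable fun y => u (s j) y k * dx h (cutKernel (cutoff r)) t (x - y)
        - u (s j) y h * dx k (cutKernel (cutoff r)) t (x - y) := (i2 k h).sub (i2 h k)
    have e : Y j - -∫ y, (u (s j) y k * pderiv h (fun y => cutKernel (cutoff r) t (x - y)) y -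
          u (s j) y h * pderiv k (fun y => cutKernel (cutoff r) t (x - y)) y) =
        ∫ y, (u (s j) y k * (dx h (heatKernel n) (t - s j) (x - y) - dx h (cutKernel (cutoff r)) t (x - y))
          - u (s j) y h * (dx k (heatKernel n) (t - s j) (x - y) - dx k (cutKernel (cutoff r)) t (x - y))) := by
      rw [← integral_neg, hY]
      simp only
      have : ∀ y, -(u (s j) y k * pderiv h (fun y => cutKernel (cutoff r) t (x - y)) y -
          u (s j) y h * pderiv k (fun y => cutKernel (cutoff r) t (x - y)) y) =
          u (s j) y k * dx h (cutKernel (cutoff r)) t (x - y)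
        - u (s j) y h * dx k (cutKernel (cutoff r)) t (x - y) := fun y => by
        rw [hpd, hpd]; ring
      simp only [this]
      rw [← integral_sub i3 i4]
      refine integral_congr_ae (Eventually.of_forall fun y => ?_)
      simp only
      ring
    simp only [Function.comp_apply]
    rw [e]
    have hdiff : ∀ i, A i ≤ A h + A k → ∀ y, |dx i (heatKernel n) (t - s j) (x - y)
        - dx i (cutKernel (cutoff r)) t (x - y)| ≤ (A h + A k) * s j + C1 / r := by
      intro i hi y
      have q1 := hA i (s j) (hs0 j).le (hs2 j) (x - y)
      have q2 := b1 r hr i (x - y)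
      have q3 := mul_le_mul_of_nonneg_right hi (hs0 j).le
      calc _ = |(dx i (heatKernel n) (t - s j) (x - y) - dx i (heatKernel n) t (x - y)) +
            (dx i (heatKernel n) t (x - y) - dx i (cutKernel (cutoff r)) t (x - y))| := by
              congr 1; ring
        _ ≤ _ := (abs_add_le _ _).trans (add_le_add (q1.trans q3) q2)
    exact hf.abs_integral_le (hs0 j) h k (hdiff h (by linarith [hA0 k])) (hdiff k (by linarith [hA0 h]))
  set R : ℕ → ℝ := fun j => (j : ℝ) + 1 with hR
  have hR1 : ∀ j, 1 ≤ R j := fun j => by simp [hR]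
  have hR0 : ∀ j, 0 < R j := fun j => by positivity
  obtain ⟨B, hB, hb⟩ := (HC.base (n := n)).bound 0
  have hlim1 : Tendsto (fun j => ∫ y, cutKernel (cutoff (R j)) t (x - y) * w h k y) atTop
      (𝓝 (∫ y, heatKernel n t (x - y) * w h k y)) := by
    refine tendsto_integral_of_dominated_convergence
      (fun y => B * (√t ^ (n + 0))⁻¹ * |w h k y|) (fun j => ?_) (hwi.abs.const_mul _)
      (fun j => Eventually.of_forall fun y => ?_) (Eventually.of_forall fun y => ?_)
    · exact (((SM.cutKernel (contDiff_cutoff (R j))).slice_continuous ht).comp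
        (by fun_prop : Continuous fun y : E n => x - y)).aestronglyMeasurable.mul
        hwi.aestronglyMeasurable
    · rw [Real.norm_eq_abs, abs_mul]
      refine mul_le_mul_of_nonneg_right ?_ (abs_nonneg _)
      rw [cutKernel, abs_mul]
      exact (mul_le_of_le_one_right (abs_nonneg _) (abs_cutoff_le _ _)).trans
        ((hb t ht _).trans (mul_le_mul_of_nonneg_left (kb_le _ _ ht _) hB))
    · refine tendsto_const_nhds.congr' ?_
      filter_upwards [eventually_norm_lt_half (x - y)] with j hj
      rw [cutKernel, cutoff_eq_one (hR0 j) hj.le, mul_one]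
  have hlim2 : Tendsto (fun j => 2 * (C1 / R j) * C₀) atTop (𝓝 (2 * 0 * C₀)) :=
    ((tendsto_const_nhds.div_atTop (tendsto_atTop_add_const_right _ _
      tendsto_natCast_atTop_atTop)).const_mul 2).mul_const _
  have := le_of_tendsto_of_tendsto (tendsto_const_nhds.sub hlim1).abs hlim2
    (Eventually.of_forall fun j => hφ (R j) (hR1 j))
  rw [mul_zero, zero_mul] at this
  have h0 := abs_nonpos_iff.1 this
  linarith

/-! ### Weights and the weighted Duhamel inequality -/

/-- The parabolic weight `(1 + |x| / (1+t)^{1/2})^M`. -/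
def lam (M : ℕ) (t : ℝ) (x : E n) : ℝ := (1 + ‖x‖ / √(1 + t)) ^ M

lemma lam_pos (M : ℕ) (t : ℝ) (x : E n) : 0 < lam M t x := by unfold lam; positivity

lemma one_le_lam (M : ℕ) (t : ℝ) (x : E n) : 1 ≤ lam M t x :=
  one_le_pow₀ (le_add_of_nonneg_right (by positivity))

lemma measurable_lam (M : ℕ) : Measurable fun p : ℝ × E n => lam M p.1 p.2 := by
  unfold lam
  fun_prop

/-- The weight is submultiplicative, as 1 + |x| ≤ (1 + |x−y|)(1 + |y|) in suitable units. The factor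
in x − y is absorbed by the kernel and the factor in y travels with the vorticity at time τ. -/
lemma lam_le (M : ℕ) {τ t : ℝ} (h0 : 0 ≤ τ) (h1 : τ < t) (x y : E n) :
    lam M t x ≤ (1 + ‖x - y‖ / √(t - τ)) ^ M * lam M τ y := by
  have p0 : 0 < √(t - τ) := Real.sqrt_pos.2 (by linarith)
  have p1 : 0 < √(1 + τ) := Real.sqrt_pos.2 (by linarith)
  have q0 : √(t - τ) ≤ √(1 + t) := Real.sqrt_le_sqrt (by linarith)
  have q1 : √(1 + τ) ≤ √(1 + t) := Real.sqrt_le_sqrt (by linarith)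
  unfold lam
  rw [← mul_pow]
  refine pow_le_pow_left₀ (by positivity) ?_ M
  have hx : ‖x‖ ≤ ‖x - y‖ + ‖y‖ := by
    calc ‖x‖ = ‖(x - y) + y‖ := by rw [sub_add_cancel]
      _ ≤ _ := norm_add_le _ _
  calc 1 + ‖x‖ / √(1 + t) ≤ 1 + (‖x - y‖ + ‖y‖) / √(1 + t) := by gcongr
    _ = 1 + (‖x - y‖ / √(1 + t) + ‖y‖ / √(1 + t)) := by rw [add_div]
    _ ≤ 1 + (‖x - y‖ / √(t - τ) + ‖y‖ / √(1 + τ)) := by gcongr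
    _ ≤ _ := by
      have : 0 ≤ ‖x - y‖ / √(t - τ) * (‖y‖ / √(1 + τ)) := by positivity
      linarith

lemma lam_mul_kb_le (M K a : ℕ) {τ t : ℝ} (h0 : 0 ≤ τ) (h1 : τ < t) (x y : E n) :
    lam M t x * kb (K + M) a (t - τ) (x - y) ≤ kb K a (t - τ) (x - y) * lam M τ y := by
  rw [← weight_kb K M a (sub_pos.2 h1)]
  calc _ ≤ (1 + ‖x - y‖ / √(t - τ)) ^ M * lam M τ y * kb (K + M) a (t - τ) (x - y) :=
        mul_le_mul_of_nonneg_right (lam_le M h0 h1 x y) (kb_nonneg _ _ _ _)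
    _ = _ := by ring

/-- The truncated weight. -/
def lamE (M : ℕ) (R : ℝ≥0∞) (t : ℝ) (x : E n) : ℝ≥0∞ := min (ENNReal.ofReal (lam M t x)) R

lemma measurable_lamE (M : ℕ) (R : ℝ≥0∞) : Measurable fun p : ℝ × E n => lamE M R p.1 p.2 :=
  (measurable_lam M).ennreal_ofReal.min measurable_const

/-- Truncation preserves the inequality: it holds for the full weight and trivially for the constant
R, hence for their minimum. Truncation makes all weighted norms finite before they are estimated. -/
lemma lamE_mul_kbE_le (M K a : ℕ) (R : ℝ≥0∞) {τ t : ℝ} (h0 : 0 ≤ τ) (h1 : τ < t) (x y : E n) :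
    lamE M R t x * kbE (K + M) a (t - τ) (x - y) ≤ kbE K a (t - τ) (x - y) * lamE M R τ y := by
  have e1 : ENNReal.ofReal (lam M t x) * kbE (K + M) a (t - τ) (x - y) ≤
      kbE K a (t - τ) (x - y) * ENNReal.ofReal (lam M τ y) := by
    rw [kbE, kbE, ← ENNReal.ofReal_mul (lam_pos _ _ _).le, ← ENNReal.ofReal_mul (kb_nonneg _ _ _ _)]
    exact ENNReal.ofReal_le_ofReal (lam_mul_kb_le M K a h0 h1 x y)
  have e2 : R * kbE (K + M) a (t - τ) (x - y) ≤ kbE K a (t - τ) (x - y) * R := by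
    rw [mul_comm]
    exact mul_le_mul_left (ENNReal.ofReal_le_ofReal (kb_anti (by omega) a (sub_pos.2 h1) _)) _
  have e3 : kbE K a (t - τ) (x - y) * lamE M R τ y =
      min (kbE K a (t - τ) (x - y) * ENNReal.ofReal (lam M τ y)) (kbE K a (t - τ) (x - y) * R) :=
    Monotone.map_min fun _ _ h => mul_le_mul_right h _
  rw [e3]
  exact le_min ((mul_le_mul_left (min_le_left _ _) _).trans e1)
    ((mul_le_mul_left (min_le_right _ _) _).trans e2)

/-- The weighted size of the initial vorticity. -/
def initE (M : ℕ) (w : Fin n → Fin n → E n → ℝ) (y : E n) : ℝ≥0∞ :=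
  ∑ h, ∑ k, ENNReal.ofReal ((1 + ‖y‖) ^ M * |w h k y|)

lemma le_initE (M : ℕ) (w : Fin n → Fin n → E n → ℝ) (h k : Fin n) (y : E n) :
    ENNReal.ofReal ((1 + ‖y‖) ^ M * |w h k y|) ≤ initE M w y :=
  (Finset.single_le_sum (f := fun k => ENNReal.ofReal ((1 + ‖y‖) ^ M * |w h k y|))
    (fun _ _ => zero_le) (Finset.mem_univ k)).trans
  (Finset.single_le_sum (f := fun h => ∑ k, ENNReal.ofReal ((1 + ‖y‖) ^ M * |w h k y|))
    (fun _ _ => zero_le) (Finset.mem_univ h))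

lemma InitialVorticity.abs_integrable {M : ℕ} {w : Fin n → Fin n → E n → ℝ} {u : ℝ → E n → E n}
    (hw : InitialVorticity M w u) (h k : Fin n) : Integrable fun y => (1 + ‖y‖) ^ M * |w h k y| := by
  refine (hw.integrable h k).abs.congr (Eventually.of_forall fun y => ?_)
  simp only
  rw [abs_mul, abs_of_nonneg (by positivity : 0 ≤ (1 + ‖y‖) ^ M)]

lemma InitialVorticity.aemeasurable_initE {M : ℕ} {w : Fin n → Fin n → E n → ℝ} {u : ℝ → E n → E n}
    (hw : InitialVorticity M w u) : AEMeasurable (initE M w) := by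
  unfold initE
  refine Finset.aemeasurable_fun_sum _ fun h _ => Finset.aemeasurable_fun_sum _ fun k _ => ?_
  exact (hw.abs_integrable h k).aestronglyMeasurable.aemeasurable.ennreal_ofReal

lemma InitialVorticity.exists_lintegral_le {M : ℕ} {w : Fin n → Fin n → E n → ℝ} {u : ℝ → E n → E n}
    (hw : InitialVorticity M w u) : ∃ A : ℝ, 0 ≤ A ∧ ∫⁻ y, initE M w y ≤ ENNReal.ofReal A := by
  have hfin : ∫⁻ y, initE M w y ≠ ⊤ := by
    unfold initE
    rw [lintegral_finsetSum' _ fun h _ => Finset.aemeasurable_fun_sum _ fun k _ =>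
      (hw.abs_integrable h k).aestronglyMeasurable.aemeasurable.ennreal_ofReal]
    refine (ENNReal.sum_lt_top.2 fun h _ => ?_).ne
    rw [lintegral_finsetSum' _ fun k _ =>
      (hw.abs_integrable h k).aestronglyMeasurable.aemeasurable.ennreal_ofReal]
    exact ENNReal.sum_lt_top.2 fun k _ => (hw.abs_integrable h k).lintegral_lt_top
  exact ⟨_, ENNReal.toReal_nonneg, (ENNReal.ofReal_toReal hfin).ge⟩

lemma DecayingFlow.exists_weighted_duhamel {u : ℝ → E n → E n} {C₀ : ℝ} (hf : DecayingFlow u C₀) {M : ℕ}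
    {w : Fin n → Fin n → E n → ℝ} (hw : InitialVorticity M w u) : ∃ C : ℝ, 0 ≤ C ∧
    ∀ (R : ℝ≥0∞) (t : ℝ), 0 < t → ∀ x, lamE M R t x * vortE u t x ≤
      ENNReal.ofReal C * ((∫⁻ y, kbE (n + 1) 0 t (x - y) * initE M w y) +
        ∫⁻ τ in Ioo 0 t, ∫⁻ y, kbE (n + 1) 1 (t - τ) (x - y) *
          (velE u τ y * (lamE M R τ y * vortE u τ y))) := by
  obtain ⟨A, hA, hG⟩ := (HC.base (n := n)).bound (n + 1 + M)
  obtain ⟨B, hB, hF⟩ := exists_force_integral_le n (n + 1 + M)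
  refine ⟨n ^ 2 * max A B, by positivity, fun R t ht x => ?_⟩
  set I1 := ∫⁻ y, kbE (n + 1 + M) 0 t (x - y) * ∑ h, ∑ k, ENNReal.ofReal |w h k y| with hI1
  set I2 := ∫⁻ τ in Ioo 0 t, ∫⁻ y, kbE (n + 1 + M) 1 (t - τ) (x - y) * (velE u τ y * vortE u τ y) with hI2
  have h1 : vortE u t x ≤ ENNReal.ofReal (n ^ 2 * max A B) * (I1 + I2) := by
    rw [vortE_of_pos u ht, ENNReal.ofReal_mul (by positivity), ← natCast_sq_eq_ofReal, mul_assoc]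
    refine ofReal_vort_le fun h k => ?_
    rw [hf.representation hw h k ht x, mul_add]
    refine (ENNReal.ofReal_le_ofReal (abs_add_le _ _)).trans
        ((ENNReal.ofReal_add_le).trans (add_le_add ?_ ?_))
    · refine (ofReal_abs_integral_le _).trans ?_
      rw [hI1, ← lintegral_const_mul' _ _ ENNReal.ofReal_ne_top]
      refine lintegral_mono fun y => ?_
      rw [← mul_assoc, abs_mul, kbE, ← ENNReal.ofReal_mul (p := max A B) (by positivity),
        ENNReal.ofReal_mul (abs_nonneg _)]
      refine mul_le_mul' (ENNReal.ofReal_le_ofReal ((hG t ht _).trans ?_)) ?_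
      · exact mul_le_mul_of_nonneg_right (le_max_left _ _) (kb_nonneg _ _ _ _)
      · exact (Finset.single_le_sum (f := fun k => ENNReal.ofReal |w h k y|)
          (fun _ _ => zero_le) (Finset.mem_univ k)).trans
          (Finset.single_le_sum (f := fun h => ∑ k, ENNReal.ofReal |w h k y|)
          (fun _ _ => zero_le) (Finset.mem_univ h))
    · refine ((ofReal_abs_integral_le _).trans (hF u hf.smooth h k 0 t x le_rfl)).trans ?_
      exact mul_le_mul_left (ENNReal.ofReal_le_ofReal (le_max_right _ _)) _
  refine (mul_le_mul_right h1 _).trans ?_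
  rw [mul_left_comm, mul_add]
  have hRt : lamE M R t x ≠ ⊤ := ne_top_of_le_ne_top ENNReal.ofReal_ne_top (min_le_left _ _)
  refine mul_le_mul_right (add_le_add ?_ ?_) _
  · rw [hI1, ← lintegral_const_mul' _ _ hRt]
    refine lintegral_mono fun y => ?_
    have h2 := lamE_mul_kbE_le M (n + 1) 0 R le_rfl ht x y
    rw [sub_zero] at h2
    rw [← mul_assoc]
    refine (mul_le_mul_left h2 _).trans ?_
    rw [mul_assoc]
    refine mul_le_mul_right ((mul_le_mul_left (min_le_left _ _) _).trans (le_of_eq ?_)) _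
    rw [initE, Finset.mul_sum]
    refine Finset.sum_congr rfl fun h _ => ?_
    rw [Finset.mul_sum]
    refine Finset.sum_congr rfl fun k _ => ?_
    rw [← ENNReal.ofReal_mul (lam_pos _ _ _).le]
    simp [lam]
  · rw [hI2, ← lintegral_const_mul' _ _ hRt]
    refine setLIntegral_mono' measurableSet_Ioo fun τ hτ => ?_
    rw [← lintegral_const_mul' _ _ hRt]
    refine lintegral_mono fun y => ?_
    rw [← mul_assoc]
    refine (mul_le_mul_left (lamE_mul_kbE_le M (n + 1) 1 R hτ.1.le hτ.2 x y) _).trans (le_of_eq ?_)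
    ring

lemma lintegral_Ioo_le_split (F : ℝ → ℝ≥0∞) (s r t : ℝ) :
    ∫⁻ τ in Ioo s t, F τ ≤ (∫⁻ τ in Ioo s r, F τ) + ∫⁻ τ in Ioo r t, F τ := by
  rw [restrict_Ioo_eq_restrict_Ioc (a := s) (b := r)]
  refine le_trans (lintegral_mono_set (t := Ioc s r ∪ Ioo r t) fun τ hτ => ?_)
    (lintegral_union_le _ _ _)
  rcases le_or_gt τ r with h | h
  · exact Or.inl ⟨hτ.1, h⟩
  · exact Or.inr ⟨h, hτ.2⟩

/-! ### Uniform bounds of the weighted vorticity -/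

/-- Decay of the weighted vorticity in `L^1` and `L^∞`. -/
def WeightedDecay (M a : ℕ) (u : ℝ → E n → E n) : Prop :=
  ∃ C : ℝ, 0 ≤ C ∧ ∀ (e : Bool) (t : ℝ), 0 < t →
    nm e (fun x => ENNReal.ofReal (lam M t x) * vortE u t x) ≤
      ENNReal.ofReal (C * ((√t ^ scal n e)⁻¹ * (√(1 + t) ^ a)⁻¹))

/-- Monotone convergence in the truncation level removes the truncation once the bound is
independent of it. -/
lemma nm_lam_le_of_forall {u : ℝ → E n → E n}
    (hu : ContDiffOn ℝ ∞ (Function.uncurry u) (Ioi 0 ×ˢ univ)) {M : ℕ} {e : Bool} {t : ℝ} {B : ℝ≥0∞}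
    (h : ∀ R : ℕ, nm e (fun x => lamE M R t x * vortE u t x) ≤ B) :
    nm e (fun x => ENNReal.ofReal (lam M t x) * vortE u t x) ≤ B := by
  have e1 : (fun x : E n => ENNReal.ofReal (lam M t x) * vortE u t x) =
      fun x => ⨆ R : ℕ, lamE M R t x * vortE u t x := by
    funext x
    rw [← ENNReal.iSup_mul]
    congr 1
    refine le_antisymm ?_ (iSup_le fun R => min_le_left _ _)
    obtain ⟨N, hN⟩ := exists_nat_ge (lam M t x)
    refine le_iSup_of_le N (le_min le_rfl ?_)
    rw [← ENNReal.ofReal_natCast]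
    exact ENNReal.ofReal_le_ofReal hN
  rw [e1, nm_iSup e]
  · exact iSup_le h
  · exact fun R => ((measurable_lamE M R).comp measurable_prodMk_left).mul
      ((measurable_vortE hu).comp measurable_prodMk_left)
  · intro R R' hR x
    exact mul_le_mul_left (min_le_min le_rfl (by exact_mod_cast hR)) _

/-- This is where n ≥ 2 makes the decay of the velocity strong enough for the Volterra kernel to be
harmless at large times. -/
lemma inv_pow_succ_le_cube (hn : 2 ≤ n) {t : ℝ} (ht : 0 < t) :
    (√(1 + t) ^ (n + 1))⁻¹ ≤ (√(1 + t) ^ 3)⁻¹ :=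
  inv_anti₀ (by positivity) (pow_le_pow_right₀ (one_le_sqrt_one_add ht) (by omega))

lemma nm_velE_mul_le {u : ℝ → E n → E n} {C₀ : ℝ} (hf : DecayingFlow u C₀) (e : Bool) (t : ℝ)
    (g : E n → ℝ≥0∞) : nm e (fun y => velE u t y * g y) ≤
      ENNReal.ofReal (C₀ * (√(1 + t) ^ (n + 1))⁻¹) * nm e g := by
  rw [← nm_const_mul e ENNReal.ofReal_ne_top]
  exact nm_mono e fun y => mul_le_mul_left (hf.velE_le t y) _

/-- The finiteness hypothesis of the Volterra lemma. The constant depends on R and T, which the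
conclusion of that lemma does not see. -/
lemma DecayingFlow.exists_truncated_le {u : ℝ → E n → E n} {C₀ : ℝ} (hf : DecayingFlow u C₀) {M : ℕ}
    (e : Bool) (R : ℕ) (T : ℝ) : ∃ D : ℝ, 0 ≤ D ∧ ∀ t, 0 < t → t ≤ T →
      nm e (fun x => lamE M R t x * vortE u t x) ≤ ENNReal.ofReal (D * (√t)⁻¹) := by
  obtain ⟨D, hD, h⟩ := hf.exists_nm_vortE_le e T
  refine ⟨R * D, by positivity, fun t ht htT => ?_⟩
  refine (nm_mono e fun x => mul_le_mul_left (min_le_right _ _) _).trans ?_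
  rw [nm_const_mul e (ENNReal.natCast_ne_top R), mul_assoc, ENNReal.ofReal_mul (by positivity),
    ENNReal.ofReal_natCast]
  exact mul_le_mul_right (h t ht htT) _

/-- The initial term is bounded by the weighted mass of ω_0; in the nonlinear term the velocity is
taken in L^∞, which leaves a Volterra inequality for the weighted L^1 norm. -/
lemma DecayingFlow.exists_weighted_mass_le (hn : 2 ≤ n) {u : ℝ → E n → E n} {C₀ : ℝ}
    (hf : DecayingFlow u C₀) {M : ℕ} {w : Fin n → Fin n → E n → ℝ} (hw : InitialVorticity M w u) :
    ∃ C : ℝ, 0 ≤ C ∧ ∀ (R : ℕ) (t : ℝ), 0 < t →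
      nm false (fun x => lamE M R t x * vortE u t x) ≤ ENNReal.ofReal C := by
  obtain ⟨A0, hA0, hA⟩ := hw.exists_lintegral_le
  obtain ⟨C1, h1, b1⟩ := hf.exists_weighted_duhamel hw
  obtain ⟨C2, h2, b2⟩ := exists_nm_conv_time_le n (n + 1) le_rfl
  obtain ⟨C3, h3, b3⟩ := exists_nm_kbE_le n (n + 1) le_rfl
  have hC₀ := hf.nonneg
  obtain ⟨c, hc, hV⟩ := exists_volterra_bound (b := C1 * (C2 * C₀)) (by positivity)
  refine ⟨c * (C1 * (C3 * A0)), by positivity, fun R => hV _ _ (by positivity)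
    (hf.exists_truncated_le false R) fun t ht => ?_⟩
  have hm1 : AEMeasurable (fun x => ∫⁻ τ in Ioo 0 t, ∫⁻ y, kbE (n + 1) 1 (t - τ) (x - y) *
      (velE u τ y * (lamE M R τ y * vortE u τ y))) := by
    have := measurable_conv_time (K := n + 1) (a := 1) (g := fun τ y => velE u τ y *
      (lamE M R τ y * vortE u τ y)) ((measurable_velE hf.smooth).mul
      ((measurable_lamE M R).mul (measurable_vortE hf.smooth))) t
    exact (this.lintegral_prod_left (μ := volume.restrict (Ioo 0 t))).aemeasurable
  refine (nm_mono false (b1 R t ht)).trans ?_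
  rw [nm_const_mul false ENNReal.ofReal_ne_top, ENNReal.ofReal_mul h1, ENNReal.ofReal_mul h1,
    mul_assoc, ← mul_add]
  refine mul_le_mul_right ?_ _
  have hadd : nm false (fun x => (∫⁻ y, kbE (n + 1) 0 t (x - y) * initE M w y) +
      ∫⁻ τ in Ioo 0 t, ∫⁻ y, kbE (n + 1) 1 (t - τ) (x - y) *
          (velE u τ y * (lamE M R τ y * vortE u τ y))) =
      nm false (fun x => ∫⁻ y, kbE (n + 1) 0 t (x - y) * initE M w y) +
      nm false (fun x => ∫⁻ τ in Ioo 0 t, ∫⁻ y, kbE (n + 1) 1 (t - τ) (x - y) *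
          (velE u τ y * (lamE M R τ y * vortE u τ y))) := lintegral_add_right' _ hm1
  rw [hadd]
  refine add_le_add ?_ ?_
  · have hk := b3 false 0 t ht
    refine (nm_conv_le_left false (measurable_kbE_slice _ _ _) hw.aemeasurable_initE
      (ne_top_of_le_ne_top ENNReal.ofReal_ne_top hk)).trans ((mul_le_mul' hk hA).trans (le_of_eq ?_))
    rw [← ENNReal.ofReal_mul (by positivity)]
    simp [scal]
  · refine (b2 false 1 (fun τ y => velE u τ y * (lamE M R τ y * vortE u τ y))
      ((measurable_velE hf.smooth).mul ((measurable_lamE M R).mul (measurable_vortE hf.smooth)))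
      0 t).2.trans ?_
    rw [ENNReal.ofReal_mul h2, mul_assoc, ← lintegral_const_mul' (ENNReal.ofReal C₀) _
      ENNReal.ofReal_ne_top]
    refine mul_le_mul_right (setLIntegral_mono' measurableSet_Ioo fun τ hτ => ?_) _
    refine (mul_le_mul_right (nm_velE_mul_le hf false τ _) _).trans ?_
    rw [← mul_assoc, ← mul_assoc, ← ENNReal.ofReal_mul (by positivity), ← ENNReal.ofReal_mul hC₀]
    refine mul_le_mul_left (ENNReal.ofReal_le_ofReal ?_) _
    have := inv_pow_succ_le_cube hn hτ.1
    calc _ ≤ (√(t - τ) ^ 1)⁻¹ * (C₀ * (√(1 + τ) ^ 3)⁻¹) := by gcongr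
      _ = _ := by ring

/-- The Volterra lemma is applied to t^{n/2} times the weighted supremum, with the time integral
split at t/2. -/
lemma DecayingFlow.exists_weighted_sup_le (hn : 2 ≤ n) {u : ℝ → E n → E n} {C₀ : ℝ}
    (hf : DecayingFlow u C₀) {M : ℕ} {w : Fin n → Fin n → E n → ℝ} (hw : InitialVorticity M w u) :
    ∃ C : ℝ, 0 ≤ C ∧ ∀ (R : ℕ) (t : ℝ), 0 < t →
      ENNReal.ofReal (√t ^ n) * nm true (fun x => lamE M R t x * vortE u t x) ≤ ENNReal.ofReal C := by
  obtain ⟨A0, hA0, hA⟩ := hw.exists_lintegral_le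
  obtain ⟨C1, h1, b1⟩ := hf.exists_weighted_duhamel hw
  obtain ⟨C2, h2, b2⟩ := exists_nm_conv_time_le n (n + 1) le_rfl
  obtain ⟨C3, h3, b3⟩ := exists_nm_kbE_le n (n + 1) le_rfl
  obtain ⟨C4, h4, b4⟩ := hf.exists_weighted_mass_le hn hw
  have hC₀ := hf.nonneg
  obtain ⟨c, hc, hV⟩ := exists_volterra_bound (b := C1 * (C2 * C₀ * 2 ^ n)) (by positivity)
  refine ⟨c * (C1 * (C3 * A0 + C2 * (2 ^ n * 2 * (C₀ * C4) * 2))), by positivity,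
    fun R => hV _ _ (by positivity) ?_ fun t ht => ?_⟩
  · intro T
    obtain ⟨D, hD, hb⟩ := hf.exists_truncated_le (M := M) true R T
    refine ⟨√T ^ n * D, by positivity, fun t ht htT => ?_⟩
    rw [mul_assoc, ENNReal.ofReal_mul (by positivity)]
    have := Real.sqrt_le_sqrt htT
    exact mul_le_mul' (ENNReal.ofReal_le_ofReal (by gcongr)) (hb t ht htT)
  set g : ℝ → E n → ℝ≥0∞ := fun τ y => velE u τ y * (lamE M R τ y * vortE u τ y) with hg
  have hgm : Measurable fun p : ℝ × E n => g p.1 p.2 := (measurable_velE hf.smooth).mul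
    ((measurable_lamE M R).mul (measurable_vortE hf.smooth))
  set F : ℝ → E n → ℝ≥0∞ := fun τ x => ∫⁻ y, kbE (n + 1) 1 (t - τ) (x - y) * g τ y with hF
  have htq : 0 < √t := Real.sqrt_pos.2 ht
  have hpt : ∀ x, lamE M R t x * vortE u t x ≤ ENNReal.ofReal C1 *
      ((∫⁻ y, kbE (n + 1) 0 t (x - y) * initE M w y) + ((∫⁻ τ in Ioo 0 (t / 2), F τ x)
        + ∫⁻ τ in Ioo (t / 2) t, F τ x)) := fun x =>
    (b1 R t ht x).trans (mul_le_mul_right (add_le_add le_rfl (lintegral_Ioo_le_split _ _ _ _)) _)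
  have hsup : nm true (fun x => lamE M R t x * vortE u t x) ≤ ENNReal.ofReal C1 *
      (nm true (fun x => ∫⁻ y, kbE (n + 1) 0 t (x - y) * initE M w y) +
      (nm true (fun x => ∫⁻ τ in Ioo 0 (t / 2), F τ x) +
       nm true (fun x => ∫⁻ τ in Ioo (t / 2) t, F τ x))) := by
    refine iSup_le fun x => (hpt x).trans (mul_le_mul_right (add_le_add ?_ (add_le_add ?_ ?_)) _)
    · exact le_iSup (fun x => ∫⁻ y, kbE (n + 1) 0 t (x - y) * initE M w y) x
    · exact le_iSup (fun x => ∫⁻ τ in Ioo 0 (t / 2), F τ x) x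
    · exact le_iSup (fun x => ∫⁻ τ in Ioo (t / 2) t, F τ x) x
  refine (mul_le_mul_right hsup _).trans ?_
  have t1 : ENNReal.ofReal (√t ^ n) * nm true (fun x => ∫⁻ y, kbE (n + 1) 0 t (x - y) * initE M w y) ≤
      ENNReal.ofReal (C3 * A0) := by
    have hk := b3 true 0 t ht
    refine (mul_le_mul_right ((nm_conv_le_left true (measurable_kbE_slice _ _ _) hw.aemeasurable_initE
      (ne_top_of_le_ne_top ENNReal.ofReal_ne_top hk)).trans (mul_le_mul' hk hA)) _).trans (le_of_eq ?_)
    rw [← ENNReal.ofReal_mul (by positivity), ← ENNReal.ofReal_mul (by positivity)]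
    congr 1
    simp only [scal, add_zero]
    field_simp
  -- For τ < t/2 the kernel is taken in L^∞ and the weighted vorticity in L^1, where it is already
  -- bounded. The velocity is estimated by τ^{-1/2} only, which makes the time integral of order √t
  -- and cancels the derivative of the kernel.
  have t2 : ENNReal.ofReal (√t ^ n) * nm true (fun x => ∫⁻ τ in Ioo 0 (t / 2), F τ x) ≤
      ENNReal.ofReal (C2 * (2 ^ n * 2 * (C₀ * C4) * 2)) := by
    have e1 : (fun x => ∫⁻ τ in Ioo 0 (t / 2), F τ x) ≤ fun x => ∫⁻ τ in Ioo 0 t,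
        ∫⁻ y, kbE (n + 1) 1 (t - τ) (x - y) * (Ioo 0 (t / 2)).indicator (fun τ => g τ y) τ := by
      intro x
      simp only
      rw [← lintegral_indicator measurableSet_Ioo, ← lintegral_indicator measurableSet_Ioo]
      refine lintegral_mono fun τ => ?_
      by_cases hτ : τ ∈ Ioo 0 (t / 2)
      · rw [indicator_of_mem hτ, indicator_of_mem (show τ ∈ Ioo 0 t from ⟨hτ.1, by linarith [hτ.1, hτ.2]⟩)]
        simp only [indicator_of_mem hτ]
        exact le_rfl
      · rw [indicator_of_notMem hτ]; exact zero_le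
    have hgm' : Measurable fun p : ℝ × E n => (Ioo 0 (t / 2)).indicator (fun τ => g τ p.2) p.1 := by
      have : (fun p : ℝ × E n => (Ioo 0 (t / 2)).indicator (fun τ => g τ p.2) p.1) =
          (Ioo 0 (t / 2) ×ˢ univ).indicator fun p => g p.1 p.2 := by
        funext p
        simp [indicator]
      rw [this]
      exact hgm.indicator (measurableSet_Ioo.prod .univ)
    refine (mul_le_mul_right ((nm_mono true e1).trans (b2 true 1 (fun τ y =>
      (Ioo 0 (t / 2)).indicator (fun τ => g τ y) τ) hgm' 0 t).1) _).trans ?_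
    rw [ENNReal.ofReal_mul h2, mul_left_comm]
    refine mul_le_mul_right ?_ _
    rw [← lintegral_const_mul' _ _ ENNReal.ofReal_ne_top]
    have e2 : ∀ τ ∈ Ioo 0 t, ENNReal.ofReal (√t ^ n) * (ENNReal.ofReal (√(t - τ) ^ (scal n true + 1))⁻¹ *
        ∫⁻ y, (Ioo 0 (t / 2)).indicator (fun τ => g τ y) τ) ≤
        (Ioo 0 (t / 2)).indicator (fun τ => ENNReal.ofReal (2 ^ n * 2 * (√t)⁻¹ * (C₀ * C4)) *
          ENNReal.ofReal (√τ)⁻¹) τ := by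
      intro τ hτt
      by_cases hτ : τ ∈ Ioo 0 (t / 2)
      · simp only [indicator_of_mem hτ]
        have hτ0 : 0 < τ := hτ.1
        have hs : √t ≤ 2 * √(t - τ) := by
          rw [Real.sqrt_le_left (by positivity), mul_pow, Real.sq_sqrt (by linarith [hτ.2])]
          linarith [hτ.2]
        have hsp : 0 < √(t - τ) := Real.sqrt_pos.2 (by linarith [hτ.2])
        have i1 : ∫⁻ y, g τ y ≤ ENNReal.ofReal (C₀ * C4 * (√τ)⁻¹) := by
          have j1 := (nm_velE_mul_le hf false τ fun y => lamE M R τ y * vortE u τ y).trans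
            (mul_le_mul_right (b4 R τ hτ0) _)
          refine j1.trans ?_
          rw [← ENNReal.ofReal_mul (by positivity)]
          refine ENNReal.ofReal_le_ofReal ?_
          have j2 : (√(1 + τ) ^ (n + 1))⁻¹ ≤ (√τ)⁻¹ := by
            refine inv_anti₀ (Real.sqrt_pos.2 hτ0) ?_
            exact (Real.sqrt_le_sqrt (by linarith)).trans
              (le_self_pow₀ (one_le_sqrt_one_add hτ0) (by omega))
          calc _ ≤ C₀ * (√τ)⁻¹ * C4 := by gcongr
            _ = _ := by ring
        refine (mul_le_mul_right (mul_le_mul_right i1 _) _).trans ?_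
        rw [← ENNReal.ofReal_mul (by positivity), ← ENNReal.ofReal_mul (by positivity),
          ← ENNReal.ofReal_mul (by positivity)]
        refine ENNReal.ofReal_le_ofReal ?_
        have j3 : √t ^ n * (√(t - τ) ^ (scal n true + 1))⁻¹ ≤ 2 ^ n * 2 * (√t)⁻¹ := by
          simp only [scal]
          rw [← div_eq_mul_inv, ← div_eq_mul_inv, div_le_div_iff₀ (by positivity) htq, ← pow_succ,
            ← pow_succ, ← mul_pow]
          gcongr
        calc _ = √t ^ n * (√(t - τ) ^ (scal n true + 1))⁻¹ * (C₀ * C4 * (√τ)⁻¹) := by ring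
          _ ≤ 2 ^ n * 2 * (√t)⁻¹ * (C₀ * C4 * (√τ)⁻¹) := by gcongr
          _ = _ := by ring
      · simp [indicator_of_notMem hτ]
    refine (setLIntegral_mono' measurableSet_Ioo e2).trans ?_
    rw [lintegral_indicator measurableSet_Ioo]
    refine (lintegral_mono' (Measure.restrict_mono_measure Measure.restrict_le_self _) le_rfl).trans ?_
    rw [lintegral_const_mul' _ _ ENNReal.ofReal_ne_top, lintegral_inv_sqrt (by positivity),
      ← ENNReal.ofReal_mul (by positivity)]
    refine ENNReal.ofReal_le_ofReal ?_
    have : √(t / 2) ≤ √t := Real.sqrt_le_sqrt (by linarith)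
    calc _ ≤ 2 ^ n * 2 * (√t)⁻¹ * (C₀ * C4) * (2 * √t) := by gcongr
      _ = _ := by field_simp
  -- For τ > t/2 the kernel is taken in L^1, and t^{n/2} ≤ 2^n τ^{n/2} moves the factor inside the
  -- integral, where the unknown appears.
  have t3 : ENNReal.ofReal (√t ^ n) * nm true (fun x => ∫⁻ τ in Ioo (t / 2) t, F τ x) ≤
      ENNReal.ofReal (C2 * C₀ * 2 ^ n) * ∫⁻ τ in Ioo 0 t,
        ENNReal.ofReal ((√(t - τ))⁻¹ * (√(1 + τ) ^ 3)⁻¹) *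
          (ENNReal.ofReal (√τ ^ n) * nm true (fun x => lamE M R τ x * vortE u τ x)) := by
    refine (mul_le_mul_right (b2 true 1 g hgm (t / 2) t).2 _).trans ?_
    rw [mul_left_comm, mul_assoc C2, ENNReal.ofReal_mul h2, mul_assoc]
    refine mul_le_mul_right ?_ _
    rw [← lintegral_const_mul' _ _ ENNReal.ofReal_ne_top, ← lintegral_const_mul' _ _ ENNReal.ofReal_ne_top]
    refine (setLIntegral_mono' measurableSet_Ioo fun τ hτ => ?_).trans
      (lintegral_mono_set (Ioo_subset_Ioo_left (by positivity)))
    have hτ0 : 0 < τ := by linarith [hτ.1]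
    refine (mul_le_mul_right (mul_le_mul_right (nm_velE_mul_le hf true τ _) _) _).trans ?_
    rw [← mul_assoc, ← mul_assoc, ← mul_assoc, ← mul_assoc, ← ENNReal.ofReal_mul (by positivity),
      ← ENNReal.ofReal_mul (by positivity), ← ENNReal.ofReal_mul (by positivity),
      ← ENNReal.ofReal_mul (by positivity)]
    refine mul_le_mul_left (ENNReal.ofReal_le_ofReal ?_) _
    have hs : √t ≤ 2 * √τ := by
      rw [Real.sqrt_le_left (by positivity), mul_pow, Real.sq_sqrt hτ0.le]
      linarith [hτ.1]
    have j1 := inv_pow_succ_le_cube hn hτ0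
    have j2 : √t ^ n ≤ 2 ^ n * √τ ^ n := by rw [← mul_pow]; gcongr
    calc _ ≤ 2 ^ n * √τ ^ n * (√(t - τ) ^ 1)⁻¹ * (C₀ * (√(1 + τ) ^ 3)⁻¹) := by gcongr
      _ = _ := by ring
  rw [mul_left_comm, mul_add (ENNReal.ofReal (√t ^ n)), mul_add (ENNReal.ofReal (√t ^ n)),
    ENNReal.ofReal_mul (p := C1) h1, ENNReal.ofReal_mul (p := C1) h1,
    mul_assoc (ENNReal.ofReal C1)]
  refine le_of_le_of_eq (mul_le_mul_right ?_ _) (mul_add _ _ _)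
  rw [ENNReal.ofReal_add (by positivity) (by positivity), add_assoc]
  exact add_le_add t1 (add_le_add t2 t3)

/-- The weighted vorticity is bounded in `L^1`, and decays like `t^{-n/2}` in `L^∞`. -/
lemma DecayingFlow.weightedDecay_zero (hn : 2 ≤ n) {u : ℝ → E n → E n} {C₀ : ℝ}
    (hf : DecayingFlow u C₀) {M : ℕ} {w : Fin n → Fin n → E n → ℝ} (hw : InitialVorticity M w u) :
    WeightedDecay M 0 u := by
  obtain ⟨C1, h1, b1⟩ := hf.exists_weighted_mass_le hn hw
  obtain ⟨C2, h2, b2⟩ := hf.exists_weighted_sup_le hn hw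
  refine ⟨C1 + C2, by positivity, fun e t ht => nm_lam_le_of_forall hf.smooth fun R => ?_⟩
  cases e
  · refine (b1 R t ht).trans (ENNReal.ofReal_le_ofReal ?_)
    simp [scal, h2]
  · have hp : 0 < √t ^ n := by have := Real.sqrt_pos.2 ht; positivity
    have := (ENNReal.le_div_iff_mul_le (b := ENNReal.ofReal (√t ^ n)) (Or.inl (ENNReal.ofReal_pos.2 hp).ne')
      (Or.inl ENNReal.ofReal_ne_top)).2 ((mul_comm _ _).trans_le (b2 R t ht))
    refine this.trans ?_
    rw [← ENNReal.ofReal_div_of_pos hp]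
    refine ENNReal.ofReal_le_ofReal ?_
    simp only [scal, pow_zero, inv_one, mul_one, div_eq_mul_inv]
    gcongr
    linarith

/-! ### Vanishing moments of velocity, vorticity and force -/

lemma tendsto_natCast_add_one : Tendsto (fun j : ℕ => (j : ℝ) + 1) atTop atTop :=
  tendsto_atTop_add_const_right _ _ tendsto_natCast_atTop_atTop

/-- The divergence theorem on the whole space. -/
lemma integral_divergence_eq_zero {F : Fin n → E n → ℝ} (hF : ∀ i, ContDiff ℝ 1 (F i)) {f : E n → ℝ}
    (hf : Integrable f) (hb : ∀ i x, |F i x| ≤ (1 + ‖x‖) * f x)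
    (hg : Integrable fun x => ∑ i, pderiv i (F i) x) : ∫ x, ∑ i, pderiv i (F i) x = 0 := by
  obtain ⟨B, hB0, hB⟩ := exists_cutoff_bound n
  set R : ℕ → ℝ := fun j => (j : ℝ) + 1 with hR
  have hR1 : ∀ j, 1 ≤ R j := fun j => by simp [hR]
  have hR0 : ∀ j, 0 < R j := fun j => by positivity
  have hle1 : (1 : WithTop ℕ∞) ≤ (∞ : WithTop ℕ∞) := by exact_mod_cast le_top
  have hχ : ∀ j, ContDiff ℝ 1 (cutoff (n := n) (R j)) := fun j => (contDiff_cutoff _).of_le hle1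
  have hc : ∀ j, HasCompactSupport (cutoff (n := n) (R j)) := fun j => hasCompactSupport_cutoff (hR0 j)
  have hf0 : ∀ (i : Fin n) x, 0 ≤ f x := fun i x => by
    have := (abs_nonneg _).trans (hb i x)
    by_contra h
    have : (1 + ‖x‖) * f x < 0 := mul_neg_of_pos_of_neg (by positivity) (not_le.1 h)
    linarith
  have cp : ∀ i, Continuous fun x => pderiv i (F i) x := fun i =>
    ((hF i).continuous_fderiv (by simp)).clm_apply continuous_const
  have lim1 : Tendsto (fun j => ∫ y, (∑ i, pderiv i (F i) y) * cutoff (R j) (0 - y)) atTop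
      (𝓝 (∫ x, ∑ i, pderiv i (F i) x)) := by
    refine tendsto_integral_of_dominated_convergence (fun y => |∑ i, pderiv i (F i) y|)
      (fun j => ?_) hg.abs (fun j => Eventually.of_forall fun y => ?_) (Eventually.of_forall fun y => ?_)
    · exact hg.aestronglyMeasurable.mul
        ((hχ j).continuous.comp (by fun_prop : Continuous fun y : E n => 0 - y)).aestronglyMeasurable
    · rw [Real.norm_eq_abs, abs_mul]
      exact mul_le_of_le_one_right (abs_nonneg _) (abs_cutoff_le _ _)
    · refine tendsto_const_nhds.congr' ?_
      filter_upwards [eventually_norm_lt_half (0 - y)] with j hj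
      rw [cutoff_eq_one (hR0 j) hj.le, mul_one]
  have e : ∀ j, ∫ y, (∑ i, pderiv i (F i) y) * cutoff (R j) (0 - y) =
      ∫ y, ∑ i, F i y * pderiv i (cutoff (R j)) (0 - y) := by
    intro j
    simp only [Finset.sum_mul]
    rw [integral_finsetSum _ fun i _ => integrable_mul_reflect (cp i) (hχ j).continuous (hc j) 0,
      integral_finsetSum _ fun i _ => integrable_mul_reflect (hF i).continuous
        (contDiff_pderiv (contDiff_cutoff (R j)) i).continuous (HasCompactSupport.pderiv (hc j) i) 0]
    exact Finset.sum_congr rfl fun i _ => integral_pderiv_mul_comp_sub (hF i) (hχ j) (hc j) 0 i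
  -- The gradient of the cutoff is O(1/R) and lives on R/2 ≤ |y| ≤ R. The field may therefore exceed
  -- an integrable function by a factor 1 + |y|: the quotient (1+|y|)/R stays bounded and the
  -- integrand tends to zero pointwise.
  have lim2 : Tendsto (fun j => ∫ y, ∑ i, F i y * pderiv i (cutoff (R j)) (0 - y)) atTop
      (𝓝 (∫ _ : E n, (0 : ℝ))) := by
    refine tendsto_integral_of_dominated_convergence (fun y => ∑ _i : Fin n, 2 * B * f y)
      (fun j => ?_) (integrable_finsetSum _ fun i _ => hf.const_mul _)
      (fun j => Eventually.of_forall fun y => ?_) (Eventually.of_forall fun y => ?_)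
    · exact (continuous_finsetSum _ fun i _ => (hF i).continuous.mul
        ((contDiff_pderiv (contDiff_cutoff (R j)) i).continuous.comp
          (by fun_prop : Continuous fun y : E n => 0 - y))).aestronglyMeasurable
    · refine (Finset.abs_sum_le_sum_abs _ _).trans (Finset.sum_le_sum fun i _ => ?_)
      have h0 := hf0 i y
      rcases lt_or_ge (R j) ‖y‖ with hy | hy
      · have : pderiv i (cutoff (R j)) (0 - y) = 0 := by
          refine image_eq_zero_of_notMem_tsupport fun h' => ?_
          have := tsupport_cutoff (hR0 j) (tsupport_pderiv_subset _ i h')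
          rw [mem_closedBall_zero_iff, zero_sub, norm_neg] at this
          linarith
        rw [this, mul_zero, abs_zero]
        positivity
      · rw [abs_mul]
        have hd := (hB (R j) (hR0 j) i i i (0 - y)).1
        have : (1 + ‖y‖) / R j ≤ 2 := by rw [div_le_iff₀ (hR0 j)]; linarith [hR1 j]
        calc _ ≤ (1 + ‖y‖) * f y * (B / R j) :=
              mul_le_mul (hb i y) hd (abs_nonneg _) (by positivity)
          _ = (1 + ‖y‖) / R j * (B * f y) := by ring
          _ ≤ 2 * (B * f y) := by gcongr
          _ = _ := by ring
    · refine tendsto_const_nhds.congr' ?_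
      filter_upwards [eventually_norm_lt_half (0 - y)] with j hj
      rw [Finset.sum_eq_zero fun i _ => ?_]
      rw [pderiv_cutoff_near (hR0 j) hj, mul_zero]
  simp only [← e, integral_zero] at lim2
  exact tendsto_nhds_unique lim1 lim2

lemma pderiv_coord (i j : Fin n) (x : E n) : pderiv i (fun y : E n => y j) x = if i = j then 1 else 0 := by
  have h : HasFDerivAt (fun y : E n => y j) (EuclideanSpace.proj j : E n →L[ℝ] ℝ) x :=
    (EuclideanSpace.proj j : E n →L[ℝ] ℝ).hasFDerivAt
  rw [pderiv, h.fderiv]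
  simp [eq_comm]

lemma pderiv_coord_mul {f : E n → ℝ} {x : E n} (hf : DifferentiableAt ℝ f x) (i j : Fin n) :
    pderiv i (fun y : E n => y j * f y) x = (if i = j then f x else 0) + x j * pderiv i f x := by
  have h : DifferentiableAt ℝ (fun y : E n => y j) x := by fun_prop
  rw [pderiv_mul h hf, pderiv_coord]
  simp

lemma contDiff_coord (j : Fin n) : ContDiff ℝ 1 fun y : E n => y j := by fun_prop

namespace DecayingFlow

variable {u : ℝ → E n → E n} {C₀ : ℝ}

lemma contDiff_component (hf : DecayingFlow u C₀) {t : ℝ} (ht : 0 < t) (j : Fin n) :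
    ContDiff ℝ 1 fun y => u t y j :=
  ((SM.component hf.smooth j).slice ht).of_le (by exact_mod_cast le_top)

lemma differentiableAt_component (hf : DecayingFlow u C₀) {t : ℝ} (ht : 0 < t) (j : Fin n) (x : E n) :
    DifferentiableAt ℝ (fun y => u t y j) x :=
  (hf.contDiff_component ht j).differentiable (by simp) x

lemma integrable_component (hf : DecayingFlow u C₀) {t : ℝ} (ht : 0 < t) (j : Fin n) :
    Integrable fun y => u t y j :=
  (hf.integrable t ht).mono (hf.contDiff_component ht j).continuous.aestronglyMeasurable
    (Eventually.of_forall fun y => PiLp.norm_apply_le _ j)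

/-- The velocity has mean zero. -/
lemma integral_component (hf : DecayingFlow u C₀) {t : ℝ} (ht : 0 < t) (j : Fin n) :
    ∫ y, u t y j = 0 := by
  -- Since div u = 0, u_j is the divergence of y_j u, a field of the linear growth just allowed.
  have e : ∀ x, ∑ i, pderiv i (fun y : E n => y j * u t y i) x = u t x j := by
    intro x
    have : ∀ i, pderiv i (fun y : E n => y j * u t y i) x =
        (if i = j then u t x i else 0) + x j * pderiv i (fun y => u t y i) x := fun i =>
      pderiv_coord_mul (hf.differentiableAt_component ht i x) i j
    simp only [this]
    rw [Finset.sum_add_distrib, ← Finset.mul_sum, hf.divergence_free t ht x]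
    simp
  have := integral_divergence_eq_zero (F := fun i y => y j * u t y i) (f := fun y => ‖u t y‖)
    (fun i => (contDiff_coord j).mul (hf.contDiff_component ht i)) (hf.integrable t ht).norm
    (fun i x => by
      rw [abs_mul]
      exact mul_le_mul ((PiLp.norm_apply_le x j).trans (by linarith)) (PiLp.norm_apply_le (u t x) i)
        (abs_nonneg _) (by positivity))
    (by simp only [e]; exact hf.integrable_component ht j)
  simpa only [e] using this

/-- The vorticity has vanishing first moments. -/
lemma integral_coord_mul_vorticity (hf : DecayingFlow u C₀) {t : ℝ} (ht : 0 < t) (h k l : Fin n)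
    (hi : Integrable fun y => y l * vorticity u h k t y) : ∫ y, y l * vorticity u h k t y = 0 := by
  -- Up to velocity components, whose means vanish, y_l ω_{hk} equals ∂_h(y_l u_k) − ∂_k(y_l u_h).
  have e : ∀ x, ∑ i, pderiv i (fun y : E n => (if i = h then y l * u t y k else 0) -
      (if i = k then y l * u t y h else 0)) x =
      ((if h = l then u t x k else 0) - (if k = l then u t x h else 0)) + x l * vorticity u h k t x := by
    intro x
    have d : ∀ j, DifferentiableAt ℝ (fun y : E n => y l * u t y j) x := fun j =>
      (((contDiff_coord l).mul (hf.contDiff_component ht j)).differentiable (by simp)) x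
    have e1 : ∀ i, pderiv i (fun y : E n => (if i = h then y l * u t y k else 0) -
      (if i = k then y l * u t y h else 0)) x = (if i = h then pderiv i (fun y : E n => y l * u t y k) x
        else 0) - (if i = k then pderiv i (fun y : E n => y l * u t y h) x else 0) := by
      intro i
      have d1 : DifferentiableAt ℝ (fun y : E n => if i = h then y l * u t y k else 0) x := by
        split_ifs
        · exact d k
        · exact differentiableAt_const _
      have d2 : DifferentiableAt ℝ (fun y : E n => if i = k then y l * u t y h else 0) x := by
        split_ifs
        · exact d h
        · exact differentiableAt_const _
      rw [pderiv_sub d1 d2]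
      congr 1
      · split_ifs
        · rfl
        · simp [pderiv]
      · split_ifs
        · rfl
        · simp [pderiv]
    simp only [e1, Finset.sum_sub_distrib, Finset.sum_ite_eq', Finset.mem_univ, if_true]
    rw [pderiv_coord_mul (hf.differentiableAt_component ht k x),
      pderiv_coord_mul (hf.differentiableAt_component ht h x), vorticity]
    ring
  have iu : Integrable fun x => (if h = l then u t x k else 0) - (if k = l then u t x h else 0) := by
    refine Integrable.sub ?_ ?_
    · split_ifs
      · exact hf.integrable_component ht k
      · exact integrable_zero _ _ _
    · split_ifs
      · exact hf.integrable_component ht h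
      · exact integrable_zero _ _ _
  have z : ∫ x, ((if h = l then u t x k else 0) - (if k = l then u t x h else 0)) = 0 := by
    rw [integral_sub]
    · split_ifs <;> simp [hf.integral_component ht]
    · split_ifs
      · exact hf.integrable_component ht k
      · exact integrable_zero _ _ _
    · split_ifs
      · exact hf.integrable_component ht h
      · exact integrable_zero _ _ _
  have hb : ∀ (j : Fin n) (x : E n), |x l * u t x j| ≤ (1 + ‖x‖) * ‖u t x‖ := fun j x => by
    rw [abs_mul]
    exact mul_le_mul ((PiLp.norm_apply_le x l).trans (by linarith)) (PiLp.norm_apply_le (u t x) j)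
      (abs_nonneg _) (by positivity)
  have := integral_divergence_eq_zero (F := fun i y => (if i = h then y l * u t y k else 0) -
      (if i = k then y l * u t y h else 0)) (f := fun y => 2 * ‖u t y‖)
    (fun i => by
      refine ContDiff.sub ?_ ?_
      · split_ifs
        · exact (contDiff_coord l).mul (hf.contDiff_component ht k)
        · exact contDiff_const
      · split_ifs
        · exact (contDiff_coord l).mul (hf.contDiff_component ht h)
        · exact contDiff_const)
    ((hf.integrable t ht).norm.const_mul 2)
    (fun i x => by
      have p : 0 ≤ (1 + ‖x‖) * ‖u t x‖ := by positivity
      have a1 : |if i = h then x l * u t x k else 0| ≤ (1 + ‖x‖) * ‖u t x‖ := by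
        split_ifs
        · exact hb k x
        · simpa using p
      have a2 : |if i = k then x l * u t x h else 0| ≤ (1 + ‖x‖) * ‖u t x‖ := by
        split_ifs
        · exact hb h x
        · simpa using p
      refine (abs_sub _ _).trans ((add_le_add a1 a2).trans (le_of_eq ?_))
      ring)
    (by simp only [e]; exact iu.add hi)
  simp only [e] at this
  rw [integral_add iu hi, z, zero_add] at this
  exact this

/-- The force has mean zero. -/
lemma integral_force (hf : DecayingFlow u C₀) {t : ℝ} (ht : 0 < t) (h : Fin n)
    (hi : Integrable (force u h t)) : ∫ y, force u h t y = 0 := by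
  have c := fun j => hf.contDiff_component ht j
  have d := fun (j : Fin n) x => hf.differentiableAt_component ht j x
  have c2 : ContDiff ℝ 1 fun y => ∑ j, u t y j * u t y j := ContDiff.sum fun j _ => (c j).mul (c j)
  -- By incompressibility f_h = div(u_h u) − ½ ∂_h |u|².
  have e : ∀ x, ∑ i, pderiv i (fun y : E n => u t y i * u t y h -
      (if i = h then 1 / 2 * ∑ j, u t y j * u t y j else 0)) x = force u h t x := by
    intro x
    have d1 : ∀ i, DifferentiableAt ℝ (fun y : E n => u t y i * u t y h) x := fun i => (d i x).mul (d h x)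
    have d3 : DifferentiableAt ℝ (fun y => ∑ j, u t y j * u t y j) x := c2.differentiable (by simp) x
    have e1 : ∀ i, pderiv i (fun y : E n => u t y i * u t y h -
      (if i = h then 1 / 2 * ∑ j, u t y j * u t y j else 0)) x =
        pderiv i (fun y : E n => u t y i * u t y h) x -
        (if i = h then pderiv i (fun y : E n => 1 / 2 * ∑ j, u t y j * u t y j) x else 0) := by
      intro i
      have d2 : DifferentiableAt ℝ (fun y : E n => if i = h then 1 / 2 * ∑ j, u t y j * u t y j else 0) x := by
        split_ifs
        · exact d3.const_mul _
        · exact differentiableAt_const _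
      rw [pderiv_sub (d1 i) d2]
      congr 1
      split_ifs
      · rfl
      · simp [pderiv]
    have e2 : ∀ i, pderiv i (fun y : E n => u t y i * u t y h) x =
        pderiv i (fun y => u t y i) x * u t x h + u t x i * pderiv i (fun y => u t y h) x := fun i =>
      pderiv_mul (d i x) (d h x) i
    have d4 : ∀ j, DifferentiableAt ℝ (fun y : E n => u t y j * u t y j) x := fun j => (d j x).mul (d j x)
    have e3 : pderiv h (fun y : E n => 1 / 2 * ∑ j, u t y j * u t y j) x =
        ∑ j, u t x j * pderiv h (fun y => u t y j) x := by
      rw [pderiv_const_mul _ d3, pderiv_sum fun j _ => d4 j, Finset.mul_sum]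
      refine Finset.sum_congr rfl fun j _ => ?_
      rw [pderiv_mul (d j x) (d j x)]
      ring
    simp only [e1, Finset.sum_sub_distrib, Finset.sum_ite_eq', Finset.mem_univ, if_true, e2, e3,
      Finset.sum_add_distrib, ← Finset.sum_mul, hf.divergence_free t ht x, zero_mul, zero_add]
    rw [← Finset.sum_sub_distrib, force]
    refine Finset.sum_congr rfl fun j _ => ?_
    rw [vorticity]
    ring
  have := integral_divergence_eq_zero (F := fun i y => u t y i * u t y h -
      (if i = h then 1 / 2 * ∑ j, u t y j * u t y j else 0)) (f := fun y => (1 + n) * C₀ * ‖u t y‖)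
    (fun i => by
      refine ((c i).mul (c h)).sub ?_
      split_ifs
      · exact contDiff_const.mul c2
      · exact contDiff_const)
    ((hf.integrable t ht).norm.const_mul _)
    (fun i x => by
      have hC := hf.nonneg
      have b : ∀ j l, |u t x j * u t x l| ≤ C₀ * ‖u t x‖ := fun j l => by
        rw [abs_mul]
        exact mul_le_mul (hf.abs_le ht x j) (PiLp.norm_apply_le (u t x) l) (abs_nonneg _) hC
      have b2 : |if i = h then 1 / 2 * ∑ j, u t x j * u t x j else 0| ≤ n * (C₀ * ‖u t x‖) := by
        have p : 0 ≤ n * (C₀ * ‖u t x‖) := by positivity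
        split_ifs
        · rw [abs_mul, abs_of_pos (by norm_num : (0 : ℝ) < 1 / 2)]
          have : |∑ j, u t x j * u t x j| ≤ n * (C₀ * ‖u t x‖) := by
            refine (Finset.abs_sum_le_sum_abs _ _).trans
              ((Finset.sum_le_sum fun j _ => b j j).trans (le_of_eq ?_))
            simp
          linarith
        · simpa using p
      have p : 0 ≤ ‖x‖ * ((1 + n) * C₀ * ‖u t x‖) := by positivity
      refine (abs_sub _ _).trans ((add_le_add (b i h) b2).trans ?_)
      linarith)
    (by simp only [e]; exact hi)
  simpa only [e] using this

end DecayingFlow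

namespace WeightedDecay

variable {M a : ℕ} {u : ℝ → E n → E n}

/-- The weighted mass of the vorticity, as a real integral. -/
lemma exists_integral_le (hd : WeightedDecay M a u)
    (hu : ContDiffOn ℝ ∞ (Function.uncurry u) (Ioi 0 ×ˢ univ)) : ∃ C : ℝ, 0 ≤ C ∧ ∀ t, 0 < t →
    Integrable (fun x => lam M t x * vort u t x) ∧
    ∫ x, lam M t x * vort u t x ≤ C * (√(1 + t) ^ a)⁻¹ := by
  obtain ⟨C, hC, hb⟩ := hd
  refine ⟨C, hC, fun t ht => ?_⟩
  have h1 := hb false t ht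
  simp only [nm, scal, pow_zero, inv_one, one_mul] at h1
  have e : ∀ x, ENNReal.ofReal (lam M t x) * vortE u t x = ENNReal.ofReal (lam M t x * vort u t x) := by
    intro x
    rw [vortE_of_pos u ht, ENNReal.ofReal_mul (lam_pos _ _ _).le]
  simp only [e] at h1
  have nn : ∀ x, 0 ≤ lam M t x * vort u t x := fun x => mul_nonneg (lam_pos _ _ _).le (vort_nonneg _ _ _)
  have hm : AEStronglyMeasurable (fun x => lam M t x * vort u t x) volume := by
    have c1 : Continuous fun x : E n => vort u t x :=
      continuous_finsetSum _ fun h _ => continuous_finsetSum _ fun k _ =>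
        ((SM.vorticity hu h k).slice_continuous ht).abs
    exact ((measurable_lam M).comp measurable_prodMk_left).aestronglyMeasurable.mul
      c1.aestronglyMeasurable
  have hi : Integrable fun x => lam M t x * vort u t x :=
    ⟨hm, (hasFiniteIntegral_iff_ofReal (Eventually.of_forall nn)).2 (h1.trans_lt ENNReal.ofReal_lt_top)⟩
  refine ⟨hi, ?_⟩
  rw [← ofReal_integral_eq_lintegral_ofReal hi (Eventually.of_forall nn)] at h1
  exact (ENNReal.ofReal_le_ofReal_iff (by positivity)).1 h1

lemma integrable_mul_vorticity (hd : WeightedDecay M a u)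
    (hu : ContDiffOn ℝ ∞ (Function.uncurry u) (Ioi 0 ×ˢ univ)) {t : ℝ} (ht : 0 < t) (h k : Fin n)
    {g : E n → ℝ} (hg : Continuous g) {c : ℝ} (hb : ∀ x, |g x| ≤ c * lam M t x) :
    Integrable fun x => g x * vorticity u h k t x := by
  obtain ⟨C, hC, hi⟩ := hd.exists_integral_le hu
  refine ((hi t ht).1.const_mul c).mono' (hg.mul ((SM.vorticity hu h k).slice_continuous
    ht)).aestronglyMeasurable (Eventually.of_forall fun x => ?_)
  have hc : 0 ≤ c * lam M t x := (abs_nonneg _).trans (hb x)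
  rw [Real.norm_eq_abs, abs_mul, ← mul_assoc]
  exact mul_le_mul (hb x) (abs_vorticity_le _ _ _ _ _) (abs_nonneg _) hc

end WeightedDecay

/-! ### Vanishing moments of the initial vorticity -/

lemma norm_pow_le_lam {j M : ℕ} (hj : j ≤ M) {t : ℝ} (ht : 0 ≤ t) (x : E n) :
    ‖x‖ ^ j ≤ √(1 + t) ^ j * lam M t x := by
  have h0 : 0 < √(1 + t) := Real.sqrt_pos.2 (by linarith)
  have h1 : ‖x‖ = √(1 + t) * (‖x‖ / √(1 + t)) := by field_simp
  have h2 : 0 ≤ ‖x‖ / √(1 + t) := by positivity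
  calc ‖x‖ ^ j = √(1 + t) ^ j * (‖x‖ / √(1 + t)) ^ j := by rw [← mul_pow, ← h1]
    _ ≤ √(1 + t) ^ j * (1 + ‖x‖ / √(1 + t)) ^ j := by gcongr; linarith
    _ ≤ _ := by
      unfold lam
      gcongr
      linarith

/-- The initial vorticity has mean zero. -/
lemma InitialVorticity.integral_eq_zero {M : ℕ} {w : Fin n → Fin n → E n → ℝ} {u : ℝ → E n → E n} {C₀ : ℝ}
    (hw : InitialVorticity M w u) (hf : DecayingFlow u C₀) (h k : Fin n) : ∫ y, w h k y = 0 := by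
  obtain ⟨B, hB0, hB⟩ := exists_cutoff_bound n
  have hwi : Integrable (w h k) := integrable_of_weight (hw.integrable h k)
  -- Testing the trace with the cutoff itself, the velocity is paired with a gradient of size 1/r,
  -- and its L^1 norm is bounded uniformly in s.
  have hbd : ∀ j : ℕ, |∫ y, cutoff ((j : ℝ) + 1) y * w h k y| ≤ 2 * (B / ((j : ℝ) + 1)) * C₀ := by
    intro j
    have hr : 0 < (j : ℝ) + 1 := by positivity
    have := (hw.trace h k _ (contDiff_cutoff _) (hasCompactSupport_cutoff hr)).abs
    rw [abs_neg] at this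
    refine le_of_tendsto this ?_
    filter_upwards [self_mem_nhdsWithin] with s hs
    exact hf.abs_integral_le hs h k (fun y => (hB _ hr h h h y).1) (fun y => (hB _ hr k k k y).1)
  have lim1 : Tendsto (fun j : ℕ => ∫ y, cutoff ((j : ℝ) + 1) y * w h k y) atTop (𝓝 (∫ y, w h k y)) := by
    refine tendsto_integral_of_dominated_convergence (fun y => |w h k y|)
      (fun j => (contDiff_cutoff _).continuous.aestronglyMeasurable.mul hwi.aestronglyMeasurable) hwi.abs
      (fun j => Eventually.of_forall fun y => ?_) (Eventually.of_forall fun y => ?_)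
    · rw [Real.norm_eq_abs, abs_mul]
      exact mul_le_of_le_one_left (abs_nonneg _) (abs_cutoff_le _ _)
    · refine tendsto_const_nhds.congr' ?_
      filter_upwards [eventually_norm_lt_half y] with j hj
      rw [cutoff_eq_one (by positivity) hj.le, one_mul]
  have lim2 : Tendsto (fun j : ℕ => 2 * (B / ((j : ℝ) + 1)) * C₀) atTop (𝓝 (2 * 0 * C₀)) :=
    ((tendsto_const_nhds.div_atTop tendsto_natCast_add_one).const_mul 2).mul_const _
  have := le_of_tendsto_of_tendsto lim1.abs lim2 (Eventually.of_forall hbd)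
  rw [mul_zero, zero_mul] at this
  exact abs_nonpos_iff.1 this

/-- The initial vorticity has vanishing first moments. -/
lemma InitialVorticity.integral_coord_eq_zero {M : ℕ} (hM : 2 ≤ M) {w : Fin n → Fin n → E n → ℝ}
    {u : ℝ → E n → E n} {C₀ : ℝ} (hw : InitialVorticity M w u) (hf : DecayingFlow u C₀)
    (hd : WeightedDecay M 0 u) (h k l : Fin n) : ∫ y, y l * w h k y = 0 := by
  obtain ⟨C, hC, hi⟩ := hd.exists_integral_le hf.smooth
  have hcoord : ∀ y : E n, |y l| ≤ 1 * (1 + ‖y‖) ^ M := fun y => by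
    rw [one_mul]
    exact (PiLp.norm_apply_le y l).trans ((by linarith : ‖y‖ ≤ 1 + ‖y‖).trans
      (le_self_pow₀ (by linarith [norm_nonneg y]) (by omega)))
  have hwi : Integrable fun y => y l * w h k y :=
    integrable_mul_of_weight (hw.integrable h k) (by fun_prop) hcoord
  have hbd : ∀ j : ℕ, |∫ y, (y l * cutoff ((j : ℝ) + 1) y) * w h k y| ≤ 4 * C / ((j : ℝ) + 1) := by
    intro j
    have hr : 0 < (j : ℝ) + 1 := by positivity
    set r := (j : ℝ) + 1
    set φ : E n → ℝ := fun y => y l * cutoff r y with hφdef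
    have hφ : ContDiff ℝ ∞ φ := (by fun_prop : ContDiff ℝ ∞ fun y : E n => y l).mul (contDiff_cutoff r)
    have hφc : HasCompactSupport φ := (hasCompactSupport_cutoff hr).mul_left
    have htr := (hw.trace h k φ hφ hφc).abs
    rw [abs_neg] at htr
    refine le_of_tendsto htr ?_
    filter_upwards [Ioo_mem_nhdsGT (zero_lt_one' ℝ)] with s hs
    have hs0 : 0 < s := hs.1
    have hsq : √(1 + s) ^ 2 ≤ 2 := by rw [Real.sq_sqrt (by linarith)]; linarith [hs.2]
    set φ' : E n → ℝ := fun z => φ (0 - z)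
    have hle1 : (1 : WithTop ℕ∞) ≤ (∞ : WithTop ℕ∞) := by exact_mod_cast le_top
    have hφ' : ContDiff ℝ ∞ φ' := hφ.comp (by fun_prop : ContDiff ℝ ∞ fun z : E n => 0 - z)
    have hφc' : HasCompactSupport φ' := hφc.comp_homeomorph (Homeomorph.subLeft (0 : E n))
    have hib := integral_vorticity_mul hf.smooth h k hs0 (hφ'.of_le hle1) hφc' 0
    have hpd : ∀ i y, pderiv i φ' (0 - y) = -pderiv i φ y := fun i y => by
      rw [pderiv_comp_const_sub (hφ.differentiable (by simp)), sub_sub_cancel]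
    have e1 : ∫ y, (u s y k * pderiv h φ y - u s y h * pderiv k φ y) = -∫ y, φ y * vorticity u h k s y := by
      have e2 : ∫ y, vorticity u h k s y * φ' (0 - y) = ∫ y, φ y * vorticity u h k s y := by
        refine integral_congr_ae (Eventually.of_forall fun y => ?_)
        simp only [φ', sub_sub_cancel]
        ring
      rw [← e2, hib, ← integral_neg]
      refine integral_congr_ae (Eventually.of_forall fun y => ?_)
      simp only [hpd]
      ring
    have i1 : Integrable fun y => y l * vorticity u h k s y := by
      refine hd.integrable_mul_vorticity hf.smooth hs0 h k (by fun_prop) (c := √(1 + s) ^ 1) fun y => ?_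
      exact (PiLp.norm_apply_le y l).trans (by simpa using norm_pow_le_lam (by omega : 1 ≤ M) hs0.le y)
    have i2 : Integrable fun y => φ y * vorticity u h k s y := by
      refine hd.integrable_mul_vorticity hf.smooth hs0 h k hφ.continuous (c := √(1 + s) ^ 1) fun y => ?_
      refine LE.le.trans ?_ (norm_pow_le_lam (by omega : 1 ≤ M) hs0.le y)
      rw [hφdef, pow_one]
      simp only
      rw [abs_mul]
      exact (mul_le_of_le_one_right (abs_nonneg _) (abs_cutoff_le _ _)).trans (PiLp.norm_apply_le y l)
    -- The first moment at the positive time s vanishes, so it may be subtracted; only the part of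
    -- the moment outside the ball of radius r/2 remains.
    have e3 : ∫ y, φ y * vorticity u h k s y = ∫ y, (φ y - y l) * vorticity u h k s y := by
      have : ∫ y, (φ y - y l) * vorticity u h k s y =
          (∫ y, φ y * vorticity u h k s y) - ∫ y, y l * vorticity u h k s y := by
        rw [← integral_sub i2 i1]
        simp only [sub_mul]
      rw [this, hf.integral_coord_mul_vorticity hs0 h k l i1, sub_zero]
    rw [e1, abs_neg, e3]
    have hpt : ∀ y, ‖(φ y - y l) * vorticity u h k s y‖ ≤ 4 / r * (lam M s y * vort u s y) := by
      intro y
      have hl := lam_pos M s y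
      have hv := vort_nonneg u s y
      rcases le_or_gt ‖y‖ (r / 2) with hy | hy
      · have : φ y - y l = 0 := by rw [hφdef]; simp only; rw [cutoff_eq_one hr hy]; ring
        rw [this, zero_mul, norm_zero]
        positivity
      · have b1 : |φ y - y l| ≤ ‖y‖ := by
          have : φ y - y l = y l * (cutoff r y - 1) := by rw [hφdef]; ring
          rw [this, abs_mul]
          refine (mul_le_of_le_one_right (abs_nonneg _) ?_).trans (PiLp.norm_apply_le y l)
          rw [abs_le]; constructor <;> linarith [cutoff_nonneg r y, cutoff_le_one r y]
        -- On |y| > r/2 one has |y| ≤ (2/r)|y|², and for s < 1 a second moment is controlled by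
        -- twice the weight. This is where M ≥ 2 is needed.
        have b2 : ‖y‖ ≤ 4 / r * lam M s y := by
          have b3 := norm_pow_le_lam hM hs0.le y
          have b4 : ‖y‖ ^ 2 ≤ 2 * lam M s y := b3.trans (by gcongr)
          rw [div_mul_eq_mul_div, le_div_iff₀ hr]
          nlinarith [norm_nonneg y]
        rw [Real.norm_eq_abs, abs_mul, ← mul_assoc]
        exact mul_le_mul (b1.trans b2) (abs_vorticity_le _ _ _ _ _) (abs_nonneg _) (by positivity)
    refine (norm_integral_le_of_norm_le ((hi s hs0).1.const_mul _) (Eventually.of_forall hpt)).trans ?_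
    rw [integral_const_mul]
    have := (hi s hs0).2
    simp only [pow_zero, inv_one, mul_one] at this
    rw [mul_comm 4 C, mul_div_assoc, mul_comm C]
    gcongr
  have lim1 : Tendsto (fun j : ℕ => ∫ y, (y l * cutoff ((j : ℝ) + 1) y) * w h k y) atTop
      (𝓝 (∫ y, y l * w h k y)) := by
    refine tendsto_integral_of_dominated_convergence (fun y => |y l * w h k y|)
      (fun j => ?_) hwi.abs
      (fun j => Eventually.of_forall fun y => ?_) (Eventually.of_forall fun y => ?_)
    · exact ((by fun_prop : Continuous fun y : E n => y l).mul
        (contDiff_cutoff _).continuous).aestronglyMeasurable.mul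
        (integrable_of_weight (hw.integrable h k)).aestronglyMeasurable
    · rw [Real.norm_eq_abs, abs_mul, abs_mul, abs_mul]
      exact mul_le_mul_of_nonneg_right (mul_le_of_le_one_right (abs_nonneg _) (abs_cutoff_le _ _))
        (abs_nonneg _)
    · refine tendsto_const_nhds.congr' ?_
      filter_upwards [eventually_norm_lt_half y] with j hj
      rw [cutoff_eq_one (by positivity) hj.le, mul_one]
  have lim2 : Tendsto (fun j : ℕ => 4 * C / ((j : ℝ) + 1)) atTop (𝓝 0) :=
    tendsto_const_nhds.div_atTop tendsto_natCast_add_one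
  exact abs_nonpos_iff.1 (le_of_tendsto_of_tendsto lim1.abs lim2 (Eventually.of_forall hbd))

/-! ### Space-time moments of the force -/

lemma WeightedDecay.exists_mass_le {M a : ℕ} {u : ℝ → E n → E n} {C₀ : ℝ} (hd : WeightedDecay M a u)
    (hf : DecayingFlow u C₀) : ∃ C : ℝ, 0 ≤ C ∧ ∀ s, 0 < s →
      ∫⁻ y, ENNReal.ofReal (lam M s y) * (velE u s y * vortE u s y) ≤
        ENNReal.ofReal (C * (√(1 + s) ^ (n + 1 + a))⁻¹) := by
  obtain ⟨C, hC, hb⟩ := hd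
  have hC₀ := hf.nonneg
  refine ⟨C₀ * C, by positivity, fun s hs => ?_⟩
  have h1 := (nm_velE_mul_le hf false s fun y => ENNReal.ofReal (lam M s y) * vortE u s y).trans
    (mul_le_mul_right (hb false s hs) _)
  rw [← ENNReal.ofReal_mul (by positivity)] at h1
  refine (lintegral_mono fun y => (mul_left_comm _ _ _).le).trans (h1.trans (le_of_eq ?_))
  congr 1
  simp only [scal, pow_zero, inv_one, one_mul]
  rw [pow_add _ (n + 1) a, mul_inv]
  ring

lemma pow_le_sqrt_pow {s : ℝ} (hs : 0 ≤ s) (l : ℕ) : s ^ l ≤ √(1 + s) ^ (2 * l) := by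
  rw [pow_mul, Real.sq_sqrt (by linarith)]
  gcongr
  linarith

lemma continuous_monom_neg (β : Fin n → ℕ) : Continuous fun y : E n => monom β (-y) := by
  unfold monom
  fun_prop

/-- The integrand of the space-time moments. -/
def momentTerm (u : ℝ → E n → E n) (l : ℕ) (β : Fin n → ℕ) (j h : Fin n) (z : ℝ × E n) : ℝ :=
  (-z.1) ^ l * monom β (-z.2) * (vorticity u j h z.1 z.2 * u z.1 z.2 j)

/-- Each power of s counts as two powers of √(1+s), and each power of |y| as one together with the
weight, so the time density has exponent 2l + |β| − (n+1+a) in √(1+s). The time set is left free for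
use on (0,t/2), (t/2,∞) and (0,∞). -/
lemma WeightedDecay.exists_moment_le {M a : ℕ} {u : ℝ → E n → E n} {C₀ : ℝ} (hd : WeightedDecay M a u)
    (hf : DecayingFlow u C₀) : ∃ C : ℝ, 0 ≤ C ∧ ∀ (l : ℕ) (β : Fin n → ℕ) (j h : Fin n), ∑ i, β i ≤ M →
    ∀ S : Set ℝ, MeasurableSet S → S ⊆ Ioi 0 →
      AEStronglyMeasurable (momentTerm u l β j h) ((volume.prod volume).restrict (S ×ˢ univ)) ∧
      ∫⁻ z in S ×ˢ univ, ‖momentTerm u l β j h z‖ₑ ∂(volume.prod volume) ≤ ENNReal.ofReal C *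
        ∫⁻ s in S, ENNReal.ofReal (√(1 + s) ^ (2 * l + ∑ i, β i) * (√(1 + s) ^ (n + 1 + a))⁻¹) := by
  obtain ⟨C, hC, hb⟩ := hd.exists_mass_le hf
  refine ⟨C, hC, fun l β j h hβ S hS hSs => ?_⟩
  have hcont : ContinuousOn (momentTerm u l β j h) (Ioi 0 ×ˢ univ) := by
    refine ContinuousOn.mul (Continuous.continuousOn ?_) ?_
    · exact (by fun_prop : Continuous fun z : ℝ × E n => (-z.1) ^ l).mul
        ((continuous_monom_neg β).comp continuous_snd)
    · exact (SM.vorticity hf.smooth j h).continuousOn.mul (SM.component hf.smooth j).continuousOn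
  have hm : AEStronglyMeasurable (momentTerm u l β j h)
      ((volume.prod volume).restrict (S ×ˢ univ)) :=
    (hcont.mono (prod_mono hSs le_rfl)).aestronglyMeasurable (hS.prod .univ)
  refine ⟨hm, ?_⟩
  rw [← Measure.prod_restrict, Measure.restrict_univ] at hm ⊢
  rw [lintegral_prod _ hm.enorm, ← lintegral_const_mul' _ _ ENNReal.ofReal_ne_top]
  refine setLIntegral_mono' hS fun s hs => ?_
  have hs0 : 0 < s := hSs hs
  have hpt : ∀ y, ‖momentTerm u l β j h (s, y)‖ₑ ≤ ENNReal.ofReal (√(1 + s) ^ (2 * l + ∑ i, β i)) *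
      (ENNReal.ofReal (lam M s y) * (velE u s y * vortE u s y)) := by
    intro y
    rw [Real.enorm_eq_ofReal_abs, velE_of_pos u hs0, vortE_of_pos u hs0,
      ← ENNReal.ofReal_mul (norm_nonneg _), ← ENNReal.ofReal_mul (lam_pos _ _ _).le,
      ← ENNReal.ofReal_mul (by positivity)]
    refine ENNReal.ofReal_le_ofReal ?_
    simp only [momentTerm]
    rw [abs_mul, abs_mul, abs_pow, abs_neg, abs_of_pos hs0, abs_mul, pow_add]
    have h1 : |monom β (-y)| ≤ √(1 + s) ^ (∑ i, β i) * lam M s y :=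
      (abs_monom_le β y).trans (norm_pow_le_lam hβ hs0.le y)
    have h2 := pow_le_sqrt_pow hs0.le l
    have h3 : |vorticity u j h s y| * |u s y j| ≤ ‖u s y‖ * vort u s y := by
      rw [mul_comm]
      exact mul_le_mul (PiLp.norm_apply_le (u s y) j) (abs_vorticity_le _ _ _ _ _) (abs_nonneg _)
        (norm_nonneg _)
    have hl := lam_pos M s y
    calc _ ≤ √(1 + s) ^ (2 * l) * (√(1 + s) ^ (∑ i, β i) * lam M s y) * (‖u s y‖ * vort u s y) := by
          gcongr
      _ = _ := by ring
  refine (lintegral_mono hpt).trans ?_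
  rw [lintegral_const_mul' _ _ ENNReal.ofReal_ne_top]
  refine (mul_le_mul_right (hb s hs0) _).trans (le_of_eq ?_)
  rw [← ENNReal.ofReal_mul (by positivity), ← ENNReal.ofReal_mul hC]
  congr 1
  ring

lemma WeightedDecay.integrableOn_momentTerm {M a : ℕ} {u : ℝ → E n → E n} {C₀ : ℝ}
    (hd : WeightedDecay M a u) (hf : DecayingFlow u C₀) {l : ℕ} {β : Fin n → ℕ} (j h : Fin n)
    (hβ : ∑ i, β i ≤ M) {S : Set ℝ} (hS : MeasurableSet S) (hSs : S ⊆ Ioi 0)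
    (hfin : ∫⁻ s in S, ENNReal.ofReal (√(1 + s) ^ (2 * l + ∑ i, β i) * (√(1 + s) ^ (n + 1 + a))⁻¹) < ⊤) :
    IntegrableOn (momentTerm u l β j h) (S ×ˢ univ) (volume.prod volume) := by
  obtain ⟨C, hC, hb⟩ := hd.exists_moment_le hf
  obtain ⟨h1, h2⟩ := hb l β j h hβ S hS hSs
  exact ⟨h1, h2.trans_lt (ENNReal.mul_lt_top ENNReal.ofReal_lt_top hfin)⟩

lemma continuous_sqrt_one_add_pow (N : ℕ) {P : ℕ} :
    ContinuousOn (fun s : ℝ => √(1 + s) ^ N * (√(1 + s) ^ P)⁻¹) (Ici 0) := by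
  refine ContinuousOn.mul (by fun_prop) (ContinuousOn.inv₀ (by fun_prop) fun s hs => ?_)
  have : 0 < √(1 + s) := Real.sqrt_pos.2 (by have : (0 : ℝ) ≤ s := hs; linarith)
  positivity

lemma lintegral_sqrt_pow_lt_top (N P : ℕ) (t : ℝ) :
    ∫⁻ s in Ioo 0 t, ENNReal.ofReal (√(1 + s) ^ N * (√(1 + s) ^ P)⁻¹) < ⊤ := by
  have h1 : ContinuousOn (fun s : ℝ => √(1 + s) ^ N * (√(1 + s) ^ P)⁻¹) (Icc 0 t) :=
    (continuous_sqrt_one_add_pow N).mono Icc_subset_Ici_self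
  exact (h1.integrableOn_Icc.mono_set Ioo_subset_Icc_self).lintegral_lt_top

lemma force_moment_eq (u : ℝ → E n → E n) (l : ℕ) (β : Fin n → ℕ) (h : Fin n) (z : ℝ × E n) :
    (-z.1) ^ l * monom β (-z.2) * force u h z.1 z.2 = ∑ j, momentTerm u l β j h z := by
  simp only [force, momentTerm, Finset.mul_sum]

/-! ### The Taylor part of the vorticity -/

section Expansion

variable {M a : ℕ} {u : ℝ → E n → E n} {C₀ : ℝ}

lemma WeightedDecay.integrableOn_force_moment (hd : WeightedDecay M a u) (hf : DecayingFlow u C₀)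
    (l : ℕ) {β : Fin n → ℕ} (h : Fin n) (hβ : ∑ i, β i ≤ M) (t : ℝ) :
    IntegrableOn (fun z : ℝ × E n => (-z.1) ^ l * monom β (-z.2) * force u h z.1 z.2)
      (Ioo 0 t ×ˢ univ) (volume.prod volume) := by
  simp only [force_moment_eq]
  exact integrable_finsetSum _ fun j _ => hd.integrableOn_momentTerm hf j h hβ measurableSet_Ioo
    (fun s hs => hs.1) (lintegral_sqrt_pow_lt_top _ _ _)

/-- The coefficients of the parabolic Taylor expansion. -/
def taylorCoeff (F : ℝ → E n → ℝ) (l : ℕ) (β : Fin n → ℕ) (t : ℝ) (x : E n) : ℝ :=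
  iteratedDeriv l (fun τ => multiDeriv β (F τ) x) t / ((l.factorial : ℝ) * (multiFactorial β : ℝ))

lemma heatTaylor_def (N : ℕ) (F : ℝ → E n → ℝ) (t : ℝ) (x : E n) (s : ℝ) (y : E n) :
    heatTaylor N F t x s y = ∑ j ∈ Finset.range N, ∑ l ∈ Finset.range (j / 2 + 1),
      ∑ β ∈ Finset.piAntidiag (Finset.univ : Finset (Fin n)) (j - 2 * l),
        taylorCoeff F l β t x * ((-s) ^ l * monom β (-y)) := rfl

lemma sum_le_of_mem {N j l : ℕ} (hN : j < N) {β : Fin n → ℕ}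
    (hβ : β ∈ Finset.piAntidiag (Finset.univ : Finset (Fin n)) (j - 2 * l)) : ∑ i, β i < N := by
  rw [sum_of_mem_piAntidiag hβ]; omega

lemma WeightedDecay.integrableOn_force_taylor (hd : WeightedDecay M a u) (hf : DecayingFlow u C₀)
    (F : ℝ → E n → ℝ) {N : ℕ} (hN : N ≤ M + 1) (t : ℝ) (x : E n) (h : Fin n) (T : ℝ) :
    IntegrableOn (fun z : ℝ × E n => force u h z.1 z.2 * heatTaylor N F t x z.1 z.2)
      (Ioo 0 T ×ˢ univ) (volume.prod volume) ∧
    ∫ z in Ioo 0 T ×ˢ univ, force u h z.1 z.2 * heatTaylor N F t x z.1 z.2 ∂(volume.prod volume) =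
      ∑ j ∈ Finset.range N, ∑ l ∈ Finset.range (j / 2 + 1),
        ∑ β ∈ Finset.piAntidiag (Finset.univ : Finset (Fin n)) (j - 2 * l), taylorCoeff F l β t x *
          ∫ z in Ioo 0 T ×ˢ univ, (-z.1) ^ l * monom β (-z.2) * force u h z.1 z.2 ∂(volume.prod volume) := by
  have e : ∀ z : ℝ × E n, force u h z.1 z.2 * heatTaylor N F t x z.1 z.2 =
      ∑ j ∈ Finset.range N, ∑ l ∈ Finset.range (j / 2 + 1),
        ∑ β ∈ Finset.piAntidiag (Finset.univ : Finset (Fin n)) (j - 2 * l), taylorCoeff F l β t x *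
          ((-z.1) ^ l * monom β (-z.2) * force u h z.1 z.2) := by
    intro z
    rw [heatTaylor_def]
    simp only [Finset.mul_sum]
    refine Finset.sum_congr rfl fun j _ => Finset.sum_congr rfl fun l _ =>
      Finset.sum_congr rfl fun β _ => ?_
    ring
  have i3 : ∀ j ∈ Finset.range N, ∀ l, ∀ β ∈ Finset.piAntidiag (Finset.univ : Finset (Fin n)) (j - 2 * l),
      Integrable (fun z : ℝ × E n => taylorCoeff F l β t x *
        ((-z.1) ^ l * monom β (-z.2) * force u h z.1 z.2))
        ((volume.prod volume).restrict (Ioo 0 T ×ˢ univ)) := fun j hj l β hβ =>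
    (hd.integrableOn_force_moment hf l h (by
      have := sum_le_of_mem (Finset.mem_range.1 hj) hβ; omega) T).const_mul _
  simp only [e]
  constructor
  · exact integrable_finsetSum _ fun j hj => integrable_finsetSum _ fun l _ =>
      integrable_finsetSum _ fun β hβ => i3 j hj l β hβ
  · rw [integral_finsetSum _ fun j hj => integrable_finsetSum _ fun l _ =>
      integrable_finsetSum _ fun β hβ => i3 j hj l β hβ]
    refine Finset.sum_congr rfl fun j hj => ?_
    rw [integral_finsetSum _ fun l _ => integrable_finsetSum _ fun β hβ => i3 j hj l β hβ]
    refine Finset.sum_congr rfl fun l _ => ?_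
    rw [integral_finsetSum _ fun β hβ => i3 j hj l β hβ]
    exact Finset.sum_congr rfl fun β _ => integral_const_mul _ _

lemma abs_monom_le_weight {P : ℕ} {β : Fin n → ℕ} (hβ : ∑ i, β i ≤ P) (y : E n) :
    |monom β (-y)| ≤ 1 * (1 + ‖y‖) ^ P := by
  rw [one_mul]
  refine (abs_monom_le β y).trans ?_
  calc ‖y‖ ^ (∑ i, β i) ≤ (1 + ‖y‖) ^ (∑ i, β i) := by gcongr; linarith
    _ ≤ _ := pow_le_pow_right₀ (by linarith [norm_nonneg y]) hβ

lemma InitialVorticity.integrable_taylor {P : ℕ} {w : Fin n → Fin n → E n → ℝ}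
    (hw : InitialVorticity P w u) (F : ℝ → E n → ℝ) {N : ℕ} (hN : N ≤ P + 1) (t : ℝ) (x : E n)
    (h k : Fin n) : Integrable (fun y => heatTaylor N F t x 0 y * w h k y) ∧
    ∫ y, heatTaylor N F t x 0 y * w h k y = ∑ j ∈ Finset.range N,
      ∑ β ∈ Finset.piAntidiag (Finset.univ : Finset (Fin n)) j, taylorCoeff F 0 β t x *
        ∫ y, monom β (-y) * w h k y := by
  have e : ∀ y : E n, heatTaylor N F t x 0 y * w h k y =
      ∑ j ∈ Finset.range N, ∑ β ∈ Finset.piAntidiag (Finset.univ : Finset (Fin n)) j,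
        taylorCoeff F 0 β t x * (monom β (-y) * w h k y) := by
    intro y
    rw [heatTaylor_def]
    simp only [Finset.sum_mul]
    refine Finset.sum_congr rfl fun j _ => ?_
    -- At s = 0 only the terms without time derivatives survive.
    rw [Finset.sum_range_succ', Finset.sum_eq_zero, zero_add]
    · refine Finset.sum_congr rfl fun β _ => ?_
      simp
      ring
    · intro l _
      refine Finset.sum_eq_zero fun β _ => ?_
      simp
  have i2 : ∀ j ∈ Finset.range N, ∀ β ∈ Finset.piAntidiag (Finset.univ : Finset (Fin n)) j,
      Integrable (fun y : E n => taylorCoeff F 0 β t x * (monom β (-y) * w h k y)) := fun j hj β hβ => by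
    have := Finset.mem_range.1 hj
    refine (integrable_mul_of_weight (hw.integrable h k) (continuous_monom_neg β)
      (abs_monom_le_weight ?_)).const_mul _
    rw [sum_of_mem_piAntidiag hβ]
    omega
  simp only [e]
  constructor
  · exact integrable_finsetSum _ fun j hj => integrable_finsetSum _ fun β hβ => i2 j hj β hβ
  · rw [integral_finsetSum _ fun j hj => integrable_finsetSum _ fun β hβ => i2 j hj β hβ]
    refine Finset.sum_congr rfl fun j hj => ?_
    rw [integral_finsetSum _ fun β hβ => i2 j hj β hβ]
    exact Finset.sum_congr rfl fun β _ => integral_const_mul _ _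

/-- The Taylor part of the representation of the vorticity. -/
def taylorPart (N : ℕ) (w : Fin n → Fin n → E n → ℝ) (u : ℝ → E n → E n) (h k : Fin n) (t : ℝ)
    (x : E n) : ℝ :=
  (∫ y, heatTaylor (N + 1) (heatKernel n) t x 0 y * w h k y)
    + ((∫ z in Ioo 0 (t / 2) ×ˢ univ,
        force u h z.1 z.2 * heatTaylor N (dx k (heatKernel n)) t x z.1 z.2 ∂(volume.prod volume))
    - ∫ z in Ioo 0 (t / 2) ×ˢ univ,
        force u k z.1 z.2 * heatTaylor N (dx h (heatKernel n)) t x z.1 z.2 ∂(volume.prod volume))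

/-- The remainder of the parabolic Taylor expansion. -/
def heatRem (N : ℕ) (F : ℝ → E n → ℝ) (t : ℝ) (x : E n) (s : ℝ) (y : E n) : ℝ :=
  F (t - s) (x - y) - heatTaylor N F t x s y

/-- The kernel of the nonlinear term already carries one derivative, so it is expanded to order N
when G itself is expanded to order N + 1. The interval (t/2, t) is left unexpanded because the
kernel is singular at s = t. -/
lemma DecayingFlow.sub_taylorPart {w : Fin n → Fin n → E n → ℝ} (hf : DecayingFlow u C₀)
    (hd : WeightedDecay M a u) (hw : InitialVorticity M w u) {N : ℕ} (hN : N + 1 ≤ M) (h k : Fin n)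
    {t : ℝ} (ht : 0 < t) (x : E n) :
    vorticity u h k t x - taylorPart N w u h k t x =
      (∫ y, heatRem (N + 1) (heatKernel n) t x 0 y * w h k y)
      + (∫ z in Ioo 0 (t / 2) ×ˢ univ, (force u h z.1 z.2 * heatRem N (dx k (heatKernel n)) t x z.1 z.2
        - force u k z.1 z.2 * heatRem N (dx h (heatKernel n)) t x z.1 z.2) ∂(volume.prod volume))
      + ∫ z in Ioo (t / 2) t ×ˢ univ, forceTerm u h k t x z.1 z.2 ∂(volume.prod volume) := by
  obtain ⟨B, hB, hb⟩ := (HC.base (n := n)).bound 0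
  have g1 : Integrable fun y => heatKernel n t (x - y) * w h k y := by
    refine (integrable_of_weight (hw.integrable h k)).bdd_mul (c := B * (√t ^ (n + 0))⁻¹)
      (((SM.heatKernel (n := n)).slice_continuous ht).comp
        (by fun_prop : Continuous fun y : E n => x - y)).aestronglyMeasurable
      (Eventually.of_forall fun y => (hb t ht _).trans
        (mul_le_mul_of_nonneg_left (kb_le _ _ ht _) hB))
  have g2 := (hw.integrable_taylor (heatKernel n) (by omega : N + 1 ≤ M + 1) t x h k).1
  have hfull := hf.integrableOn_forceTerm h k t x
  have f1 : IntegrableOn (fun z : ℝ × E n => forceTerm u h k t x z.1 z.2) (Ioo 0 (t / 2) ×ˢ univ)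
      (volume.prod volume) :=
    hfull.mono_set (prod_mono (Ioo_subset_Ioo_right (by linarith)) le_rfl)
  have f2 : IntegrableOn (fun z : ℝ × E n => forceTerm u h k t x z.1 z.2) (Ioo (t / 2) t ×ˢ univ)
      (volume.prod volume) :=
    hfull.mono_set (prod_mono (Ioo_subset_Ioo_left (by linarith)) le_rfl)
  have q1 := (hd.integrableOn_force_taylor hf (dx k (heatKernel n)) (by omega : N ≤ M + 1) t x h (t / 2)).1
  have q2 := (hd.integrableOn_force_taylor hf (dx h (heatKernel n)) (by omega : N ≤ M + 1) t x k (t / 2)).1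
  have hsplit : ∫ z in Ioo 0 t ×ˢ univ, forceTerm u h k t x z.1 z.2 ∂(volume.prod volume) =
      (∫ z in Ioo 0 (t / 2) ×ˢ univ, forceTerm u h k t x z.1 z.2 ∂(volume.prod volume))
      + ∫ z in Ioo (t / 2) t ×ˢ univ, forceTerm u h k t x z.1 z.2 ∂(volume.prod volume) := by
    rw [← setIntegral_union _ (measurableSet_Ioo.prod .univ) f1 f2]
    · refine setIntegral_congr_set ?_
      have hnull : (volume.prod volume) (({t / 2} : Set ℝ) ×ˢ (univ : Set (E n))) = 0 := by
        rw [Measure.prod_prod, Real.volume_singleton, zero_mul]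
      have hae : ∀ᵐ z : ℝ × E n ∂(volume.prod volume), z.1 ≠ t / 2 := by
        rw [ae_iff]
        refine measure_mono_null (fun z hz => ?_) hnull
        simp only [ne_eq, not_not, mem_ofPred_eq] at hz
        exact ⟨hz, trivial⟩
      filter_upwards [hae] with z hz
      apply propext
      change z ∈ Ioo 0 t ×ˢ univ ↔ z ∈ Ioo 0 (t / 2) ×ˢ univ ∪ Ioo (t / 2) t ×ˢ univ
      simp only [mem_prod, mem_Ioo, mem_univ, and_true, mem_union]
      constructor
      · rintro ⟨h1, h2⟩
        rcases lt_or_gt_of_ne hz with h3 | h3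
        · exact Or.inl ⟨h1, h3⟩
        · exact Or.inr ⟨h3, h2⟩
      · rintro (⟨h1, h2⟩ | ⟨h1, h2⟩)
        · exact ⟨h1, by linarith⟩
        · exact ⟨by linarith, h2⟩
    · rw [Set.disjoint_left]
      rintro z ⟨h1, -⟩ ⟨h2, -⟩
      exact lt_asymm h1.2 h2.1
  have e1 : ∫ y, heatRem (N + 1) (heatKernel n) t x 0 y * w h k y =
      (∫ y, heatKernel n t (x - y) * w h k y) - ∫ y, heatTaylor (N + 1) (heatKernel n) t x 0 y * w h k y := by
    rw [← integral_sub g1 g2]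
    simp only [heatRem, sub_zero, sub_mul]
  have e2 : ∫ z in Ioo 0 (t / 2) ×ˢ univ, (force u h z.1 z.2 * heatRem N (dx k (heatKernel n)) t x z.1 z.2
        - force u k z.1 z.2 * heatRem N (dx h (heatKernel n)) t x z.1 z.2) ∂(volume.prod volume) =
      (∫ z in Ioo 0 (t / 2) ×ˢ univ, forceTerm u h k t x z.1 z.2 ∂(volume.prod volume)) -
      ((∫ z in Ioo 0 (t / 2) ×ˢ univ,
        force u h z.1 z.2 * heatTaylor N (dx k (heatKernel n)) t x z.1 z.2 ∂(volume.prod volume))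
      - ∫ z in Ioo 0 (t / 2) ×ˢ univ,
        force u k z.1 z.2 * heatTaylor N (dx h (heatKernel n)) t x z.1 z.2 ∂(volume.prod volume)) := by
    have q12 : IntegrableOn (fun z : ℝ × E n =>
        force u h z.1 z.2 * heatTaylor N (dx k (heatKernel n)) t x z.1 z.2
        - force u k z.1 z.2 * heatTaylor N (dx h (heatKernel n)) t x z.1 z.2)
        (Ioo 0 (t / 2) ×ˢ univ) (volume.prod volume) := q1.sub q2
    rw [← integral_sub q1 q2, ← integral_sub f1 q12]
    refine integral_congr_ae (Eventually.of_forall fun z => ?_)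
    simp only [heatRem, forceTerm]
    ring
  rw [e1, e2, hf.representation hw h k ht x, hsplit, taylorPart]
  ring

lemma taylorPart_eq {w : Fin n → Fin n → E n → ℝ} (hf : DecayingFlow u C₀)
    (hd : WeightedDecay M a u) (hw : InitialVorticity M w u) {N : ℕ} (hN : N + 1 ≤ M) (h k : Fin n)
    (t : ℝ) (x : E n) : taylorPart N w u h k t x =
      (∑ j ∈ Finset.range (N + 1), ∑ β ∈ Finset.piAntidiag (Finset.univ : Finset (Fin n)) j,
        taylorCoeff (heatKernel n) 0 β t x * ∫ y, monom β (-y) * w h k y)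
      + ((∑ j ∈ Finset.range N, ∑ l ∈ Finset.range (j / 2 + 1),
          ∑ β ∈ Finset.piAntidiag (Finset.univ : Finset (Fin n)) (j - 2 * l),
          taylorCoeff (dx k (heatKernel n)) l β t x * ∫ z in Ioo 0 (t / 2) ×ˢ univ,
            (-z.1) ^ l * monom β (-z.2) * force u h z.1 z.2 ∂(volume.prod volume))
        - ∑ j ∈ Finset.range N, ∑ l ∈ Finset.range (j / 2 + 1),
          ∑ β ∈ Finset.piAntidiag (Finset.univ : Finset (Fin n)) (j - 2 * l),
          taylorCoeff (dx h (heatKernel n)) l β t x * ∫ z in Ioo 0 (t / 2) ×ˢ univ,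
            (-z.1) ^ l * monom β (-z.2) * force u k z.1 z.2 ∂(volume.prod volume)) := by
  rw [taylorPart, (hw.integrable_taylor (heatKernel n) (by omega : N + 1 ≤ M + 1) t x h k).2,
    (hd.integrableOn_force_taylor hf (dx k (heatKernel n)) (by omega : N ≤ M + 1) t x h (t / 2)).2,
    (hd.integrableOn_force_taylor hf (dx h (heatKernel n)) (by omega : N ≤ M + 1) t x k (t / 2)).2]

end Expansion

/-! ### Vanishing coefficients of low order -/

lemma monom_of_mem_zero {β : Fin n → ℕ} (hβ : β ∈ Finset.piAntidiag (Finset.univ : Finset (Fin n)) 0)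
    (y : E n) : monom β y = 1 := by
  have h := sum_of_mem_piAntidiag hβ
  have : ∀ i, β i = 0 := fun i => Finset.sum_eq_zero_iff.1 h i (Finset.mem_univ i)
  simp [monom, this]

lemma exists_monom_of_mem_one {β : Fin n → ℕ}
    (hβ : β ∈ Finset.piAntidiag (Finset.univ : Finset (Fin n)) 1) : ∃ i, ∀ y : E n, monom β y = y i := by
  have h := sum_of_mem_piAntidiag hβ
  obtain ⟨i, hi⟩ : ∃ i, β i ≠ 0 := by
    by_contra hc
    push Not at hc
    simp [hc] at h
  have h2 := Finset.add_sum_erase Finset.univ β (Finset.mem_univ i)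
  have hi1 : β i = 1 := by omega
  have h3 : ∑ j ∈ Finset.univ.erase i, β j = 0 := by omega
  refine ⟨i, fun y => ?_⟩
  rw [monom, ← Finset.mul_prod_erase _ _ (Finset.mem_univ i), hi1, pow_one,
    Finset.prod_eq_one, mul_one]
  intro j hj
  rw [Finset.sum_eq_zero_iff.1 h3 j hj, pow_zero]

/-- The moments of the initial vorticity of order at most one vanish. -/
lemma InitialVorticity.moment_eq_zero {M : ℕ} (hM : 2 ≤ M) {w : Fin n → Fin n → E n → ℝ}
    {u : ℝ → E n → E n} {C₀ : ℝ} (hw : InitialVorticity M w u) (hf : DecayingFlow u C₀)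
    (hd : WeightedDecay M 0 u) (h k : Fin n) {j : ℕ} (hj : j < 2) {β : Fin n → ℕ}
    (hβ : β ∈ Finset.piAntidiag (Finset.univ : Finset (Fin n)) j) : ∫ y, monom β (-y) * w h k y = 0 := by
  interval_cases j
  · simp only [monom_of_mem_zero hβ, one_mul]
    exact hw.integral_eq_zero hf h k
  · obtain ⟨i, hi⟩ := exists_monom_of_mem_one hβ
    simp only [hi, PiLp.neg_apply, neg_mul]
    rw [integral_neg, hw.integral_coord_eq_zero hM hf hd h k i, neg_zero]

/-- The space-time mean of the force vanishes. -/
lemma integral_force_moment_zero {M a : ℕ} {u : ℝ → E n → E n} {C₀ : ℝ} (hf : DecayingFlow u C₀)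
    (hd : WeightedDecay M a u) (h : Fin n) {l : ℕ} (hl : l = 0) {β : Fin n → ℕ}
    (hβ : β ∈ Finset.piAntidiag (Finset.univ : Finset (Fin n)) 0) (T : ℝ) :
    ∫ z in Ioo 0 T ×ˢ univ, (-z.1) ^ l * monom β (-z.2) * force u h z.1 z.2 ∂(volume.prod volume) = 0 := by
  have hi := hd.integrableOn_force_moment hf l (β := β) h (by rw [sum_of_mem_piAntidiag hβ]; omega) T
  rw [setIntegral_prod _ hi]
  subst hl
  refine setIntegral_eq_zero_of_forall_eq_zero fun s hs => ?_
  have hfi : Integrable (force u h s) := by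
    refine integrable_finsetSum _ fun j _ => ?_
    have := hd.integrable_mul_vorticity hf.smooth hs.1 j h
      (hf.contDiff_component hs.1 j).continuous (c := C₀) fun x =>
        (hf.abs_le hs.1 x j).trans (le_mul_of_one_le_right hf.nonneg (one_le_lam M s x))
    exact this.congr (Eventually.of_forall fun x => mul_comm _ _)
  simp only [monom_of_mem_zero hβ, pow_zero, one_mul, setIntegral_univ]
  exact hf.integral_force hs.1 h hfi

/-! ### Estimates of the three remainder terms -/

lemma nm_const_mul_of_measurable (e : Bool) (c : ℝ≥0∞) {f : E n → ℝ≥0∞} (hf : Measurable f) :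
    nm e (fun x => c * f x) = c * nm e f := by
  cases e
  · exact lintegral_const_mul c hf
  · exact (ENNReal.mul_iSup c f).symm

/-- The remainder bounds have the form of a density times a kernel at x plus a kernel at x − y; both
kernels have the same norm, hence the factor 2. -/
lemma nm_lintegral_kbE_le {α : Type*} [MeasurableSpace α] {ν : Measure α} [SFinite ν] (e : Bool)
    (K a : ℕ) (t : ℝ) {c : α → ℝ≥0∞} (hc : AEMeasurable c ν) {y : α → E n} (hy : Measurable y) :
    nm e (fun x => ∫⁻ z, c z * (kbE K a t x + kbE K a t (x - y z)) ∂ν) ≤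
      2 * nm e (fun x : E n => kbE K a t x) * ∫⁻ z, c z ∂ν := by
  have hk := measurable_kbE_slice (n := n) K a t
  have hm : AEMeasurable (Function.uncurry fun z (x : E n) => c z * (kbE K a t x + kbE K a t (x - y z)))
      (ν.prod volume) :=
    hc.comp_fst.mul ((hk.comp measurable_snd).add
      (hk.comp (measurable_snd.sub (hy.comp measurable_fst)))).aemeasurable
  refine (nm_lintegral_le e hm).trans ?_
  rw [← lintegral_const_mul'' _ hc]
  refine lintegral_mono fun z => ?_
  have hk' : Measurable fun x : E n => kbE K a t (x - y z) := hk.comp (measurable_id.sub_const _)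
  have hadd : Measurable fun x : E n => kbE K a t x + kbE K a t (x - y z) := hk.add hk'
  rw [nm_const_mul_of_measurable e (c z) hadd, mul_comm]
  refine mul_le_mul_left ((nm_add_le e hk _).trans (le_of_eq ?_)) _
  rw [nm_sub_right e (fun x => kbE K a t x), two_mul]

/-- For t ≥ 1 every power of |y|/√t between N + 1 and M is at most t^{-(N+1)/2}(1+|y|)^M, and the
weighted initial vorticity is integrable. -/
lemma InitialVorticity.exists_rem_le {M N : ℕ} (hN : N + 1 ≤ M) {w : Fin n → Fin n → E n → ℝ} :
    ∃ C : ℝ, 0 ≤ C ∧ ∀ (h k : Fin n) (t : ℝ), 1 ≤ t → ∀ x,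
      ENNReal.ofReal ((1 + ‖x‖ / √t) ^ M) *
        ENNReal.ofReal |∫ y, heatRem (N + 1) (heatKernel n) t x 0 y * w h k y| ≤
      ∫⁻ y, (ENNReal.ofReal (C * (√t ^ (N + 1))⁻¹) * initE M w y) *
        (kbE (n + 1) 0 t x + kbE (n + 1) 0 t (x - y)) := by
  obtain ⟨C, hC, hb⟩ := (HC.base (n := n)).remainder_bound (n + 1) hN
  refine ⟨2 * C, by positivity, fun h k t ht x => ?_⟩
  have ht0 : 0 < t := by linarith
  have h1 : 1 ≤ √t := Real.one_le_sqrt.2 ht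
  have h0 : 0 < √t := by linarith
  refine (mul_le_mul_right (ofReal_abs_integral_le _) _).trans ?_
  rw [← lintegral_const_mul' _ _ ENNReal.ofReal_ne_top]
  refine lintegral_mono fun y => ?_
  refine le_trans ?_ (mul_le_mul_left (mul_le_mul_right (le_initE M w h k y) _) _)
  rw [kbE, kbE, ← ENNReal.ofReal_mul (by positivity), ← ENNReal.ofReal_mul (by positivity),
    ← ENNReal.ofReal_add (kb_nonneg _ _ _ _) (kb_nonneg _ _ _ _), ← ENNReal.ofReal_mul (by positivity)]
  refine ENNReal.ofReal_le_ofReal ?_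
  have hk : 0 ≤ kb (n + 1) 0 t x + kb (n + 1) 0 t (x - y) :=
    add_nonneg (kb_nonneg _ _ _ _) (kb_nonneg _ _ _ _)
  have hq : ∀ j, N + 1 ≤ j → j ≤ M → ((√(0 : ℝ) + ‖y‖) / √t) ^ j ≤ (√t ^ (N + 1))⁻¹ * (1 + ‖y‖) ^ M := by
    intro j h3 h4
    rw [Real.sqrt_zero, zero_add, div_pow, div_eq_inv_mul]
    refine mul_le_mul (inv_anti₀ (by positivity) (pow_le_pow_right₀ h1 h3)) ?_ (by positivity)
      (by positivity)
    calc ‖y‖ ^ j ≤ (1 + ‖y‖) ^ j := by gcongr; linarith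
      _ ≤ _ := pow_le_pow_right₀ (by linarith [norm_nonneg y]) h4
  rw [abs_mul, ← mul_assoc]
  calc _ ≤ (C * (((√(0 : ℝ) + ‖y‖) / √t) ^ (N + 1) + ((√(0 : ℝ) + ‖y‖) / √t) ^ M) *
          (kb (n + 1) 0 t x + kb (n + 1) 0 t (x - y))) * |w h k y| :=
        mul_le_mul_of_nonneg_right (hb t ht0 x 0 le_rfl (by linarith) y) (abs_nonneg _)
    _ ≤ (C * ((√t ^ (N + 1))⁻¹ * (1 + ‖y‖) ^ M + (√t ^ (N + 1))⁻¹ * (1 + ‖y‖) ^ M) *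
          (kb (n + 1) 0 t x + kb (n + 1) 0 t (x - y))) * |w h k y| := by
        gcongr
        · exact hq _ le_rfl hN
        · exact hq _ hN le_rfl
    _ = _ := by ring

/-- For s ≤ t/2 and t ≥ 1 the quotient √(1+s)/√t is at most 2, so its powers beyond the N-th cost
only a constant; the powers in y go into the weight at time s. -/
lemma scaled_pow_le {M N j : ℕ} (hNj : N ≤ j) (hj : j ≤ M) {s t : ℝ} (hs : 0 ≤ s) (hst : s ≤ t / 2)
    (ht : 1 ≤ t) (y : E n) :
    ((√s + ‖y‖) / √t) ^ j ≤ 2 ^ M * ((√t ^ N)⁻¹ * √(1 + s) ^ N) * lam M s y := by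
  have h1 : 1 ≤ √t := Real.one_le_sqrt.2 ht
  have h0 : 0 < √t := by linarith
  have p1 : 0 < √(1 + s) := Real.sqrt_pos.2 (by linarith)
  have q1 : √(1 + s) / √t ≤ 2 := by
    rw [div_le_iff₀ h0, Real.sqrt_le_left (by positivity), mul_pow, Real.sq_sqrt (by linarith)]
    linarith
  have q2 : (√s + ‖y‖) / √t ≤ √(1 + s) / √t * (1 + ‖y‖ / √(1 + s)) := by
    rw [div_mul_eq_mul_div]
    gcongr
    have : √s ≤ √(1 + s) := Real.sqrt_le_sqrt (by linarith)
    rw [mul_add, mul_one, mul_div_cancel₀ _ p1.ne']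
    linarith
  have q3 : 1 ≤ 1 + ‖y‖ / √(1 + s) := le_add_of_nonneg_right (by positivity)
  have q4 : (√(1 + s) / √t) ^ j ≤ 2 ^ M * (√(1 + s) / √t) ^ N := by
    obtain ⟨d, rfl⟩ := Nat.exists_eq_add_of_le hNj
    rw [pow_add, mul_comm]
    refine mul_le_mul_of_nonneg_right ?_ (by positivity)
    calc (√(1 + s) / √t) ^ d ≤ 2 ^ d := pow_le_pow_left₀ (by positivity) q1 d
      _ ≤ 2 ^ M := pow_le_pow_right₀ (by norm_num) (by omega)
  calc ((√s + ‖y‖) / √t) ^ j ≤ (√(1 + s) / √t * (1 + ‖y‖ / √(1 + s))) ^ j := by gcongr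
    _ = (√(1 + s) / √t) ^ j * (1 + ‖y‖ / √(1 + s)) ^ j := mul_pow _ _ _
    _ ≤ (2 ^ M * (√(1 + s) / √t) ^ N) * (1 + ‖y‖ / √(1 + s)) ^ M := by
        gcongr
    _ = _ := by rw [lam, div_pow]; ring

lemma exists_force_rem_le {M N : ℕ} (hN : N ≤ M) : ∃ C : ℝ, 0 ≤ C ∧
    ∀ (u : ℝ → E n → E n) (h k : Fin n) (t : ℝ), 1 ≤ t → ∀ x,
      ENNReal.ofReal ((1 + ‖x‖ / √t) ^ M) * ENNReal.ofReal |∫ z in Ioo 0 (t / 2) ×ˢ univ,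
        (force u h z.1 z.2 * heatRem N (dx k (heatKernel n)) t x z.1 z.2
          - force u k z.1 z.2 * heatRem N (dx h (heatKernel n)) t x z.1 z.2) ∂(volume.prod volume)| ≤
      ∫⁻ z in Ioo 0 (t / 2) ×ˢ univ, (ENNReal.ofReal (C * (√t ^ N)⁻¹) * (ENNReal.ofReal (√(1 + z.1) ^ N) *
        (ENNReal.ofReal (lam M z.1 z.2) * (velE u z.1 z.2 * vortE u z.1 z.2)))) *
        (kbE (n + 1) 1 t x + kbE (n + 1) 1 t (x - z.2)) ∂(volume.prod volume) := by
  choose A hA hb using fun i : Fin n => ((HC.base (n := n)).dx i).remainder_bound (n + 1) hN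
  have hS : 0 ≤ ∑ i, A i := Finset.sum_nonneg fun i _ => hA i
  refine ⟨2 * ((∑ i, A i) * (2 * 2 ^ M)), by positivity, fun u h k t ht x => ?_⟩
  have ht0 : 0 < t := by linarith
  have h1 : 1 ≤ √t := Real.one_le_sqrt.2 ht
  have h0 : 0 < √t := by linarith
  refine (mul_le_mul_right (ofReal_abs_integral_le _) _).trans ?_
  rw [← lintegral_const_mul' _ _ ENNReal.ofReal_ne_top]
  refine setLIntegral_mono' (measurableSet_Ioo.prod .univ) fun z hz => ?_
  obtain ⟨s, y⟩ := z
  have hs : 0 < s := hz.1.1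
  have hst : s < t / 2 := hz.1.2
  simp only
  have hl := lam_pos M s y
  have hv := vort_nonneg u s y
  rw [velE_of_pos u hs, vortE_of_pos u hs, kbE, kbE, ← ENNReal.ofReal_mul (by positivity),
    ← ENNReal.ofReal_mul (by positivity), ← ENNReal.ofReal_mul hl.le,
    ← ENNReal.ofReal_mul (by positivity), ← ENNReal.ofReal_mul (by positivity),
    ← ENNReal.ofReal_add (kb_nonneg _ _ _ _) (kb_nonneg _ _ _ _), ← ENNReal.ofReal_mul (by positivity)]
  refine ENNReal.ofReal_le_ofReal ?_
  have hk : 0 ≤ kb (n + 1) 1 t x + kb (n + 1) 1 t (x - y) :=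
    add_nonneg (kb_nonneg _ _ _ _) (kb_nonneg _ _ _ _)
  set κ := kb (n + 1) 1 t x + kb (n + 1) 1 t (x - y) with hκ
  have hr : ∀ i, (1 + ‖x‖ / √t) ^ M * |heatRem N (dx i (heatKernel n)) t x s y| ≤ (∑ i, A i) *
      (2 ^ M * ((√t ^ N)⁻¹ * √(1 + s) ^ N) * lam M s y + 2 ^ M * ((√t ^ N)⁻¹ * √(1 + s) ^ N) * lam M s y)
        * κ := by
    intro i
    refine (hb i t ht0 x s hs.le hst.le y).trans ?_
    gcongr
    · exact Finset.single_le_sum (fun i _ => hA i) (Finset.mem_univ i)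
    · exact scaled_pow_le le_rfl hN hs.le hst.le ht y
    · exact scaled_pow_le hN le_rfl hs.le hst.le ht y
  have hr' : ∀ i, |(1 + ‖x‖ / √t) ^ M * heatRem N (dx i (heatKernel n)) t x s y| ≤ (∑ i, A i) *
      (2 ^ M * ((√t ^ N)⁻¹ * √(1 + s) ^ N) * lam M s y + 2 ^ M * ((√t ^ N)⁻¹ * √(1 + s) ^ N) * lam M s y)
        * κ := fun i => by
    rw [abs_mul, abs_of_nonneg (by positivity : 0 ≤ (1 + ‖x‖ / √t) ^ M)]
    exact hr i
  have hm := abs_mul_sub_mul_le (abs_force_le u h s y) (abs_force_le u k s y) (hr' k) (hr' h)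
  calc _ = |(1 + ‖x‖ / √t) ^ M * (force u h s y * heatRem N (dx k (heatKernel n)) t x s y
        - force u k s y * heatRem N (dx h (heatKernel n)) t x s y)| := by
        rw [abs_mul ((1 + ‖x‖ / √t) ^ M), abs_of_nonneg (by positivity : 0 ≤ (1 + ‖x‖ / √t) ^ M)]
    _ = |force u h s y * ((1 + ‖x‖ / √t) ^ M * heatRem N (dx k (heatKernel n)) t x s y)
        - force u k s y * ((1 + ‖x‖ / √t) ^ M * heatRem N (dx h (heatKernel n)) t x s y)| := by
        congr 1; ring
    _ ≤ _ := hm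
    _ = _ := by ring

lemma lam_of_one_le (M : ℕ) {t : ℝ} (ht : 1 ≤ t) (x : E n) :
    (1 + ‖x‖ / √t) ^ M ≤ 2 ^ M * lam M t x := by
  have h1 : 1 ≤ √t := Real.one_le_sqrt.2 ht
  have h0 : 0 < √t := by linarith
  have h2 : √(1 + t) ≤ 2 * √t := by
    rw [Real.sqrt_le_left (by positivity), mul_pow, Real.sq_sqrt (by linarith)]
    linarith
  have h3 : 0 < √(1 + t) := Real.sqrt_pos.2 (by linarith)
  rw [lam, ← mul_pow]
  refine pow_le_pow_left₀ (by positivity) ?_ M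
  have : ‖x‖ / √t ≤ 2 * (‖x‖ / √(1 + t)) := by
    rw [div_le_iff₀ h0, mul_div_assoc', div_mul_eq_mul_div, le_div_iff₀ h3]
    nlinarith [norm_nonneg x]
  linarith

/-- On (t/2, t) the velocity is O(t^{-(n+1)/2}), the weighted vorticity keeps its decay at time t,
and the singular kernel integrates to √t. The gain over the norm scaling is thus t^{-(n+a)/2}. -/
lemma WeightedDecay.exists_late_force_le {M a : ℕ} {u : ℝ → E n → E n} {C₀ : ℝ}
    (hd : WeightedDecay M a u) (hf : DecayingFlow u C₀) : ∃ C : ℝ, 0 ≤ C ∧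
    ∀ (e : Bool) (t : ℝ), 1 ≤ t → ∃ g : E n → ℝ≥0∞, Measurable g ∧ (∀ (h k : Fin n) (x : E n),
      ENNReal.ofReal ((1 + ‖x‖ / √t) ^ M) * ENNReal.ofReal
        |∫ z in Ioo (t / 2) t ×ˢ univ, forceTerm u h k t x z.1 z.2 ∂(volume.prod volume)| ≤ g x) ∧
      nm e g ≤ ENNReal.ofReal (C * (√t ^ (scal n e + (n + a)))⁻¹) := by
  obtain ⟨C1, h1, b1⟩ := exists_force_integral_le n (n + 1 + M)
  obtain ⟨C2, h2, b2⟩ := exists_nm_conv_time_le n (n + 1) le_rfl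
  obtain ⟨C3, h3, b3⟩ := hd
  have hC₀ := hf.nonneg
  refine ⟨2 ^ M * C1 * (C2 * (C₀ * C3 * 2 ^ (n + 1 + n + a) * 2)), by positivity, fun e t ht => ?_⟩
  have ht0 : 0 < t := by linarith
  have hq1 : 1 ≤ √t := Real.one_le_sqrt.2 ht
  have hq0 : 0 < √t := by linarith
  set G : ℝ → E n → ℝ≥0∞ := fun τ y => velE u τ y * (ENNReal.ofReal (lam M τ y) * vortE u τ y) with hG
  have hGm : Measurable fun p : ℝ × E n => G p.1 p.2 :=
    (measurable_velE hf.smooth).mul ((measurable_lam M).ennreal_ofReal.mul (measurable_vortE hf.smooth))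
  refine ⟨fun x => ENNReal.ofReal (2 ^ M * C1) *
    ∫⁻ τ in Ioo (t / 2) t, ∫⁻ y, kbE (n + 1) 1 (t - τ) (x - y) * G τ y, ?_, fun h k x => ?_, ?_⟩
  · have := (measurable_conv_time (K := n + 1) (a := 1) hGm t)
    exact (this.comp measurable_swap).lintegral_prod_right'.const_mul _
  · refine (mul_le_mul' (ENNReal.ofReal_le_ofReal (lam_of_one_le M ht x))
      ((ofReal_abs_integral_le _).trans (b1 u hf.smooth h k (t / 2) t x (by linarith)))).trans ?_
    rw [ENNReal.ofReal_mul (by positivity), ENNReal.ofReal_mul (by positivity),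
      mul_mul_mul_comm]
    refine mul_le_mul_right ?_ _
    rw [← lintegral_const_mul' _ _ ENNReal.ofReal_ne_top]
    refine setLIntegral_mono' measurableSet_Ioo fun τ hτ => ?_
    rw [← lintegral_const_mul' _ _ ENNReal.ofReal_ne_top]
    refine lintegral_mono fun y => ?_
    have hτ0 : 0 ≤ τ := by linarith [hτ.1]
    simp only [hG]
    rw [← mul_assoc, mul_left_comm (velE u τ y), ← mul_assoc (kbE _ _ _ _)]
    refine mul_le_mul_left ?_ _
    rw [kbE, kbE, ← ENNReal.ofReal_mul (lam_pos _ _ _).le, ← ENNReal.ofReal_mul (kb_nonneg _ _ _ _)]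
    exact ENNReal.ofReal_le_ofReal (lam_mul_kb_le M (n + 1) 1 hτ0 hτ.2 x y)
  · rw [nm_const_mul e ENNReal.ofReal_ne_top]
    refine (mul_le_mul_right (b2 e 1 G hGm (t / 2) t).2 _).trans ?_
    have hpt : ∀ τ ∈ Ioo (t / 2) t, ENNReal.ofReal (√(t - τ) ^ 1)⁻¹ * nm e (G τ) ≤
        ENNReal.ofReal (C₀ * C3 * 2 ^ (n + 1 + n + a) * (√t ^ (scal n e + (n + 1 + a)))⁻¹) *
          ENNReal.ofReal (√(t - τ))⁻¹ := by
      intro τ hτ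
      have hτ0 : 0 < τ := by linarith [hτ.1]
      rw [pow_one, mul_comm]
      refine mul_le_mul_left ?_ _
      refine (nm_velE_mul_le hf e τ _).trans ((mul_le_mul_right (b3 e τ hτ0) _).trans ?_)
      have hp : 0 < √τ := Real.sqrt_pos.2 hτ0
      have hp' : 0 < √(1 + τ) := Real.sqrt_pos.2 (by linarith)
      have hs : √t ≤ 2 * √τ := by
        rw [Real.sqrt_le_left (by positivity), mul_pow, Real.sq_sqrt hτ0.le]
        linarith [hτ.1]
      have hs' : √t ≤ 2 * √(1 + τ) := hs.trans (by gcongr; linarith)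
      have hinv : ∀ {b : ℝ} (k : ℕ), 0 < b → √t ≤ 2 * b → (b ^ k)⁻¹ ≤ 2 ^ k * (√t ^ k)⁻¹ := by
        intro b k hb hbt
        rw [← div_eq_mul_inv, le_div_iff₀ (by positivity), inv_mul_le_iff₀ (by positivity), mul_comm,
          ← mul_pow]
        gcongr
      rw [← ENNReal.ofReal_mul (by positivity)]
      refine ENNReal.ofReal_le_ofReal ?_
      have hsc : (2 : ℝ) ^ scal n e ≤ 2 ^ n := by
        refine pow_le_pow_right₀ (by norm_num) ?_
        cases e <;> simp [scal]
      calc _ ≤ C₀ * (2 ^ (n + 1) * (√t ^ (n + 1))⁻¹) * (C3 * ((2 ^ (scal n e) * (√t ^ scal n e)⁻¹) *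
            (2 ^ a * (√t ^ a)⁻¹))) := by
            have := hinv (n + 1) hp' hs'
            have := hinv a hp' hs'
            have := hinv (scal n e) hp hs
            gcongr
        _ ≤ C₀ * (2 ^ (n + 1) * (√t ^ (n + 1))⁻¹) * (C3 * ((2 ^ n * (√t ^ scal n e)⁻¹) *
            (2 ^ a * (√t ^ a)⁻¹))) := by gcongr
        _ = _ := by
            rw [pow_add (√t) (scal n e), pow_add (√t) (n + 1), pow_add 2 (n + 1 + n) a, pow_add 2 (n + 1) n,
              mul_inv, mul_inv]
            ring
    refine (mul_le_mul_right (mul_le_mul_right (setLIntegral_mono' measurableSet_Ioo hpt) _) _).trans ?_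
    rw [lintegral_const_mul' _ _ ENNReal.ofReal_ne_top, lintegral_inv_sqrt_sub (by linarith),
      ← ENNReal.ofReal_mul (by positivity), ← ENNReal.ofReal_mul h2, ← ENNReal.ofReal_mul (by positivity)]
    refine ENNReal.ofReal_le_ofReal ?_
    have hle : √(t - t / 2) ≤ √t := Real.sqrt_le_sqrt (by linarith)
    calc _ ≤ 2 ^ M * C1 * (C2 * (C₀ * C3 * 2 ^ (n + 1 + n + a) * (√t ^ (scal n e + (n + 1 + a)))⁻¹ *
          (2 * √t))) := by gcongr
      _ = _ := by
        rw [show scal n e + (n + 1 + a) = scal n e + (n + a) + 1 by ring, pow_succ √t, mul_inv]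
        field_simp

/-- The remainder of the asymptotic expansion of the vorticity. -/
lemma WeightedDecay.exists_sub_taylorPart_le {M a N : ℕ} {u : ℝ → E n → E n} {C₀ : ℝ}
    (hd : WeightedDecay M a u) (hf : DecayingFlow u C₀) {w : Fin n → Fin n → E n → ℝ}
    (hw : InitialVorticity M w u) (hN : N + 1 ≤ M) (hNa : N + 1 ≤ n + a) {L : ℝ → ℝ}
    (hL1 : ∀ t, 1 ≤ t → 1 ≤ L t)
    (hL : ∀ t, 1 ≤ t → ∫⁻ s in Ioo 0 (t / 2), ENNReal.ofReal (√(1 + s) ^ N * (√(1 + s) ^ (n + 1 + a))⁻¹) ≤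
      ENNReal.ofReal (L t)) : ∃ C : ℝ, 0 ≤ C ∧ ∀ (e : Bool) (h k : Fin n) (t : ℝ), 1 ≤ t →
      nm e (fun x => ENNReal.ofReal ((1 + ‖x‖ / √t) ^ M) *
        ENNReal.ofReal |vorticity u h k t x - taylorPart N w u h k t x|) ≤
      ENNReal.ofReal (C * (√t ^ (scal n e + (N + 1)))⁻¹ * L t) := by
  obtain ⟨C1, h1, b1⟩ := InitialVorticity.exists_rem_le hN (w := w)
  obtain ⟨C2, h2, b2⟩ := exists_force_rem_le (n := n) (by omega : N ≤ M)
  obtain ⟨C3, h3, b3⟩ := hd.exists_late_force_le hf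
  obtain ⟨C4, h4, b4⟩ := exists_nm_kbE_le n (n + 1) le_rfl
  obtain ⟨C5, h5, b5⟩ := hd.exists_mass_le hf
  obtain ⟨A, hA, bA⟩ := hw.exists_lintegral_le
  refine ⟨2 * C4 * (C2 * C5) + (C3 + 2 * C4 * (C1 * A)), by positivity, fun e h k t ht => ?_⟩
  have ht0 : 0 < t := by linarith
  have hq1 : 1 ≤ √t := Real.one_le_sqrt.2 ht
  have hq0 : 0 < √t := by linarith
  have hLt := hL1 t ht
  obtain ⟨g, hgm, hg, hgn⟩ := b3 e t ht
  set c2 : ℝ × E n → ℝ≥0∞ := fun z => ENNReal.ofReal (C2 * (√t ^ N)⁻¹) * (ENNReal.ofReal (√(1 + z.1) ^ N) *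
    (ENNReal.ofReal (lam M z.1 z.2) * (velE u z.1 z.2 * vortE u z.1 z.2))) with hc2
  have hc2m : Measurable c2 := by
    refine measurable_const.mul (Measurable.mul (by fun_prop) ?_)
    exact (measurable_lam M).ennreal_ofReal.mul
      ((measurable_velE hf.smooth).mul (measurable_vortE hf.smooth))
  set c1 : E n → ℝ≥0∞ := fun y => ENNReal.ofReal (C1 * (√t ^ (N + 1))⁻¹) * initE M w y with hc1
  have hc1m : AEMeasurable c1 := hw.aemeasurable_initE.const_mul _
  set F2 : E n → ℝ≥0∞ := fun x => ∫⁻ z in Ioo 0 (t / 2) ×ˢ univ,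
    c2 z * (kbE (n + 1) 1 t x + kbE (n + 1) 1 t (x - z.2)) ∂(volume.prod volume) with hF2
  have hk := measurable_kbE_slice (n := n) (n + 1) 1 t
  have hF2m : Measurable F2 := by
    have : Measurable fun p : E n × (ℝ × E n) =>
        c2 p.2 * (kbE (n + 1) 1 t p.1 + kbE (n + 1) 1 t (p.1 - p.2.2)) :=
      (hc2m.comp measurable_snd).mul ((hk.comp measurable_fst).add (hk.comp
        (measurable_fst.sub (measurable_snd.comp measurable_snd))))
    exact this.lintegral_prod_right'
  set F1 : E n → ℝ≥0∞ := fun x => ∫⁻ y, c1 y * (kbE (n + 1) 0 t x + kbE (n + 1) 0 t (x - y)) with hF1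
  have hpt : ∀ x, ENNReal.ofReal ((1 + ‖x‖ / √t) ^ M) *
      ENNReal.ofReal |vorticity u h k t x - taylorPart N w u h k t x| ≤ F2 x + (g x + F1 x) := by
    intro x
    rw [hf.sub_taylorPart hd hw hN h k ht0 x]
    refine (mul_le_mul_right ((ENNReal.ofReal_le_ofReal ((abs_add_le _ _).trans (add_le_add_left
      (abs_add_le _ _) _))).trans (ENNReal.ofReal_add_le.trans (add_le_add_left ENNReal.ofReal_add_le _))) _).trans ?_
    rw [mul_add, mul_add]
    refine (add_le_add (add_le_add (b1 h k t ht x) (b2 u h k t ht x)) (hg h k x)).trans (le_of_eq ?_)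
    simp only [hF1, hF2, hc1, hc2]
    ring
  refine (nm_mono e hpt).trans ((nm_add_le e hF2m _).trans (add_le_add le_rfl (nm_add_le e hgm _))) |>.trans ?_
  have I1 : nm e F1 ≤ ENNReal.ofReal (2 * C4 * (C1 * A) * (√t ^ (scal n e + (N + 1)))⁻¹) := by
    refine (nm_lintegral_kbE_le e (n + 1) 0 t hc1m measurable_id).trans ?_
    have e1 : ∫⁻ y, c1 y ≤ ENNReal.ofReal (C1 * (√t ^ (N + 1))⁻¹ * A) := by
      simp only [hc1]
      rw [lintegral_const_mul' _ _ ENNReal.ofReal_ne_top, ENNReal.ofReal_mul (p := C1 * _) (by positivity)]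
      exact mul_le_mul_right bA _
    refine (mul_le_mul' (mul_le_mul_right (b4 e 0 t ht0) _) e1).trans ?_
    rw [← ENNReal.ofReal_ofNat, ← ENNReal.ofReal_mul (by positivity), ← ENNReal.ofReal_mul (by positivity)]
    refine ENNReal.ofReal_le_ofReal (le_of_eq ?_)
    rw [add_zero, pow_add √t (scal n e), mul_inv]
    ring
  have I2 : nm e F2 ≤ ENNReal.ofReal (2 * C4 * (C2 * C5) * (√t ^ (scal n e + (N + 1)))⁻¹ * L t) := by
    refine (nm_lintegral_kbE_le e (n + 1) 1 t hc2m.aemeasurable measurable_snd).trans ?_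
    have e1 : ∫⁻ z in Ioo 0 (t / 2) ×ˢ univ, c2 z ∂(volume.prod volume) ≤
        ENNReal.ofReal (C2 * (√t ^ N)⁻¹ * (C5 * L t)) := by
      rw [← Measure.prod_restrict, Measure.restrict_univ, lintegral_prod _ hc2m.aemeasurable]
      have e2 : ∀ s ∈ Ioo 0 (t / 2), ∫⁻ y, c2 (s, y) ≤ ENNReal.ofReal (C2 * (√t ^ N)⁻¹ * C5) *
          ENNReal.ofReal (√(1 + s) ^ N * (√(1 + s) ^ (n + 1 + a))⁻¹) := by
        intro s hs
        simp only [hc2]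
        rw [lintegral_const_mul' _ _ ENNReal.ofReal_ne_top, lintegral_const_mul' _ _ ENNReal.ofReal_ne_top]
        refine (mul_le_mul_right (mul_le_mul_right (b5 s hs.1) _) _).trans (le_of_eq ?_)
        rw [← ENNReal.ofReal_mul (by positivity), ← ENNReal.ofReal_mul (by positivity),
          ← ENNReal.ofReal_mul (by positivity)]
        congr 1
        ring
      refine (setLIntegral_mono' measurableSet_Ioo e2).trans ?_
      rw [lintegral_const_mul' _ _ ENNReal.ofReal_ne_top, ← mul_assoc,
        ENNReal.ofReal_mul (p := C2 * (√t ^ N)⁻¹ * C5) (by positivity)]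
      exact mul_le_mul_right (hL t ht) _
    refine (mul_le_mul' (mul_le_mul_right (b4 e 1 t ht0) _) e1).trans ?_
    rw [← ENNReal.ofReal_ofNat, ← ENNReal.ofReal_mul (by positivity), ← ENNReal.ofReal_mul (by positivity)]
    refine ENNReal.ofReal_le_ofReal (le_of_eq ?_)
    rw [pow_add √t (scal n e) 1, pow_add √t (scal n e), pow_add √t N, mul_inv, mul_inv, mul_inv]
    ring
  refine (add_le_add I2 (add_le_add hgn I1)).trans ?_
  rw [← ENNReal.ofReal_add (by positivity) (by positivity), ← ENNReal.ofReal_add (by positivity) (by positivity)]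
  refine ENNReal.ofReal_le_ofReal ?_
  -- The hypothesis N + 1 ≤ n + a is what keeps the late part below the Taylor remainders for t ≥ 1.
  have e3 : (√t ^ (scal n e + (n + a)))⁻¹ ≤ (√t ^ (scal n e + (N + 1)))⁻¹ :=
    inv_anti₀ (by positivity) (pow_le_pow_right₀ hq1 (by omega))
  set p := (√t ^ (scal n e + (N + 1)))⁻¹ with hp
  have hp0 : 0 ≤ p := by positivity
  have e4 : C3 * (√t ^ (scal n e + (n + a)))⁻¹ + 2 * C4 * (C1 * A) * p ≤
      (C3 + 2 * C4 * (C1 * A)) * p * L t := by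
    have : C3 * (√t ^ (scal n e + (n + a)))⁻¹ ≤ C3 * p := by gcongr
    have h7 : 0 ≤ (C3 + 2 * C4 * (C1 * A)) * p := by positivity
    have := le_mul_of_one_le_right h7 hLt
    linarith
  linarith

/-! ### Time integrals and improvement of the decay -/

lemma lintegral_inv_sqrt_cube {a : ℝ} (ha : 0 ≤ a) :
    ∫⁻ s in Ioi a, ENNReal.ofReal (√(1 + s) ^ 3)⁻¹ = ENNReal.ofReal (2 * (√(1 + a))⁻¹) := by
  have hderiv : ∀ s ∈ Ici a, HasDerivAt (fun s : ℝ => -2 * (√(1 + s))⁻¹) (√(1 + s) ^ 3)⁻¹ s := by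
    intro s hs
    have h0 : 0 < 1 + s := by have : a ≤ s := hs; linarith
    have hq : 0 < √(1 + s) := Real.sqrt_pos.2 h0
    have h1 : HasDerivAt (fun s : ℝ => √(1 + s)) (1 / (2 * √(1 + s))) s :=
      ((hasDerivAt_id s).const_add 1).sqrt h0.ne'
    have h2 := (h1.inv hq.ne').const_mul (-2)
    refine h2.congr_deriv ?_
    field_simp
  have hlim : Tendsto (fun s : ℝ => -2 * (√(1 + s))⁻¹) atTop (𝓝 0) := by
    have : Tendsto (fun s : ℝ => (√(1 + s))⁻¹) atTop (𝓝 0) :=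
      (Real.tendsto_sqrt_atTop.comp (tendsto_atTop_add_const_left _ 1 tendsto_id)).inv_tendsto_atTop
    simpa using this.const_mul (-2)
  have hpos : ∀ s ∈ Ioi a, 0 ≤ (√(1 + s) ^ 3)⁻¹ := fun s _ => by positivity
  rw [← ofReal_integral_eq_lintegral_ofReal (integrableOn_Ioi_deriv_of_nonneg' hderiv hpos hlim)
    (Eventually.of_forall fun s => by positivity), integral_Ioi_of_hasDerivAt_of_nonneg' hderiv hpos hlim]
  congr 1
  ring

lemma sqrt_pow_mul_inv_le {N d P : ℕ} (hP : N + (d + 3) ≤ P) {a s : ℝ} (ha : 0 ≤ a) (hs : a ≤ s) :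
    √(1 + s) ^ N * (√(1 + s) ^ P)⁻¹ ≤ (√(1 + a) ^ d)⁻¹ * (√(1 + s) ^ 3)⁻¹ := by
  have h1 : 1 ≤ √(1 + s) := Real.one_le_sqrt.2 (by linarith)
  have h2 : 0 < √(1 + a) := Real.sqrt_pos.2 (by linarith)
  calc √(1 + s) ^ N * (√(1 + s) ^ P)⁻¹ ≤ √(1 + s) ^ N * (√(1 + s) ^ (N + (d + 3)))⁻¹ := by
        gcongr
    _ = (√(1 + s) ^ d)⁻¹ * (√(1 + s) ^ 3)⁻¹ := by
        rw [pow_add, pow_add]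
        field_simp
    _ ≤ _ := by gcongr

/-- Three surplus powers of √(1+s) are needed for convergence at infinity; each further one yields a
power of √(1+a). -/
lemma lintegral_Ioi_sqrt_pow_le {N d P : ℕ} (hP : N + (d + 3) ≤ P) {a : ℝ} (ha : 0 ≤ a) :
    ∫⁻ s in Ioi a, ENNReal.ofReal (√(1 + s) ^ N * (√(1 + s) ^ P)⁻¹) ≤
      ENNReal.ofReal (2 * (√(1 + a) ^ (d + 1))⁻¹) := by
  have h2 : 0 < √(1 + a) := Real.sqrt_pos.2 (by linarith)
  have h1 : ∀ s ∈ Ioi a, ENNReal.ofReal (√(1 + s) ^ N * (√(1 + s) ^ P)⁻¹) ≤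
      ENNReal.ofReal (√(1 + a) ^ d)⁻¹ * ENNReal.ofReal (√(1 + s) ^ 3)⁻¹ := by
    intro s hs
    rw [← ENNReal.ofReal_mul (by positivity)]
    exact ENNReal.ofReal_le_ofReal (sqrt_pow_mul_inv_le hP ha (le_of_lt hs))
  refine (setLIntegral_mono' measurableSet_Ioi h1).trans (le_of_eq ?_)
  rw [lintegral_const_mul' _ _ ENNReal.ofReal_ne_top, lintegral_inv_sqrt_cube ha,
    ← ENNReal.ofReal_mul (by positivity), pow_succ, mul_inv]
  congr 1
  ring

lemma lintegral_Ioo_sqrt_pow_le_two {N P : ℕ} (hP : N + 3 ≤ P) (T : ℝ) :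
    ∫⁻ s in Ioo 0 T, ENNReal.ofReal (√(1 + s) ^ N * (√(1 + s) ^ P)⁻¹) ≤ ENNReal.ofReal 2 := by
  refine (lintegral_mono_set fun s hs => hs.1).trans ((lintegral_Ioi_sqrt_pow_le (d := 0)
    (by omega) le_rfl).trans (le_of_eq ?_))
  simp

/-- With only two surplus powers the integrand is 1/(1+s). This borderline case occurs exactly for m
= n and produces the logarithm. -/
lemma lintegral_Ioo_sqrt_pow_le_log {N P : ℕ} (hP : P = N + 2) {T : ℝ} (hT : 0 ≤ T) :
    ∫⁻ s in Ioo 0 T, ENNReal.ofReal (√(1 + s) ^ N * (√(1 + s) ^ P)⁻¹) ≤ ENNReal.ofReal (Real.log (1 + T)) := by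
  have hcont : ContinuousOn (fun s : ℝ => (1 + s)⁻¹) (Icc 0 T) :=
    ContinuousOn.inv₀ (by fun_prop) fun s hs => by have := hs.1; positivity
  have hi : IntegrableOn (fun s : ℝ => (1 + s)⁻¹) (Ioo 0 T) :=
    hcont.integrableOn_Icc.mono_set Ioo_subset_Icc_self
  have h1 : ∀ s ∈ Ioo 0 T, ENNReal.ofReal (√(1 + s) ^ N * (√(1 + s) ^ P)⁻¹) ≤ ENNReal.ofReal (1 + s)⁻¹ := by
    intro s hs
    have h0 : 0 < 1 + s := by linarith [hs.1]
    have hq : 0 < √(1 + s) := Real.sqrt_pos.2 h0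
    refine ENNReal.ofReal_le_ofReal (le_of_eq ?_)
    rw [hP, pow_add, Real.sq_sqrt h0.le]
    field_simp
  refine (setLIntegral_mono' measurableSet_Ioo h1).trans (le_of_eq ?_)
  rw [← ofReal_integral_eq_lintegral_ofReal hi ((ae_restrict_iff' measurableSet_Ioo).2
    (Eventually.of_forall fun s hs => inv_nonneg.2 (by linarith [hs.1]))), ← integral_Ioc_eq_integral_Ioo,
    ← intervalIntegral.integral_of_le hT]
  congr 1
  have hd : ∀ s ∈ uIcc 0 T, HasDerivAt (fun s : ℝ => Real.log (1 + s)) (1 + s)⁻¹ s := by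
    intro s hs
    rw [uIcc_of_le hT] at hs
    have h0 : 1 + s ≠ 0 := by have := hs.1; positivity
    simpa using ((hasDerivAt_id s).const_add 1).log h0
  rw [intervalIntegral.integral_eq_sub_of_hasDerivAt hd
    ((uIcc_of_le hT).symm ▸ hcont).intervalIntegrable]
  simp

/-- For N ≤ 1 only moments of ω_0 of order at most 1 and the mean of the force enter, and all of
these vanish. -/
lemma taylorPart_eq_zero {M a N : ℕ} {u : ℝ → E n → E n} {C₀ : ℝ} {w : Fin n → Fin n → E n → ℝ}
    (hf : DecayingFlow u C₀) (hd : WeightedDecay M a u) (hd0 : WeightedDecay M 0 u)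
    (hw : InitialVorticity M w u) (hM : 2 ≤ M) (hN : N ≤ 1) (h k : Fin n) (t : ℝ) (x : E n) :
    taylorPart N w u h k t x = 0 := by
  have hz : ∀ i k' : Fin n, ∑ j ∈ Finset.range N, ∑ l ∈ Finset.range (j / 2 + 1),
      ∑ β ∈ Finset.piAntidiag (Finset.univ : Finset (Fin n)) (j - 2 * l),
      taylorCoeff (dx k' (heatKernel n)) l β t x * ∫ z in Ioo 0 (t / 2) ×ˢ univ,
        (-z.1) ^ l * monom β (-z.2) * force u i z.1 z.2 ∂(volume.prod volume) = 0 := by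
    intro i k'
    refine Finset.sum_eq_zero fun j hj => Finset.sum_eq_zero fun l hl => Finset.sum_eq_zero fun β hβ => ?_
    have hj0 : j = 0 := by have := Finset.mem_range.1 hj; omega
    subst hj0
    have hl0 : l = 0 := by have := Finset.mem_range.1 hl; omega
    rw [integral_force_moment_zero hf hd i hl0 (by simpa using hβ), mul_zero]
  rw [taylorPart_eq hf hd hw (by omega), hz, hz, sub_zero, add_zero]
  refine Finset.sum_eq_zero fun j hj => Finset.sum_eq_zero fun β hβ => ?_
  rw [hw.moment_eq_zero hM hf hd0 h k (by have := Finset.mem_range.1 hj; omega) hβ, mul_zero]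

lemma measurable_abs_vorticity {u : ℝ → E n → E n}
    (hu : ContDiffOn ℝ ∞ (Function.uncurry u) (Ioi 0 ×ˢ univ)) (h k : Fin n) {t : ℝ} (ht : 0 < t) :
    Measurable fun x => ENNReal.ofReal |vorticity u h k t x| :=
  ((SM.vorticity hu h k).slice_continuous ht).abs.measurable.ennreal_ofReal

lemma nm_mul_vortE_le {u : ℝ → E n → E n}
    (hu : ContDiffOn ℝ ∞ (Function.uncurry u) (Ioi 0 ×ˢ univ)) (e : Bool) {t : ℝ} (ht : 0 < t)
    {g : E n → ℝ≥0∞} (hg : Measurable g) {B : ℝ≥0∞}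
    (hB : ∀ h k, nm e (fun x => g x * ENNReal.ofReal |vorticity u h k t x|) ≤ B) :
    nm e (fun x => g x * vortE u t x) ≤ (n : ℝ≥0∞) ^ 2 * B := by
  have e1 : (fun x => g x * vortE u t x) =
      fun x => ∑ h, ∑ k, g x * ENNReal.ofReal |vorticity u h k t x| := by
    funext x
    rw [vortE_of_pos u ht, vort, ENNReal.ofReal_sum_of_nonneg fun _ _ => Finset.sum_nonneg fun _ _ => abs_nonneg _,
      Finset.mul_sum]
    refine Finset.sum_congr rfl fun h _ => ?_
    rw [ENNReal.ofReal_sum_of_nonneg fun _ _ => abs_nonneg _, Finset.mul_sum]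
  have hm : ∀ h k, Measurable fun x => g x * ENNReal.ofReal |vorticity u h k t x| := fun h k =>
    hg.mul (measurable_abs_vorticity hu h k ht)
  rw [e1]
  refine (nm_sum_le e _ fun h _ => Finset.measurable_fun_sum _ fun k _ => hm h k).trans ?_
  refine (Finset.sum_le_sum fun h _ => (nm_sum_le e _ fun k _ => hm h k).trans
    (Finset.sum_le_sum fun k _ => hB h k)).trans (le_of_eq ?_)
  simp [sq, mul_assoc]

lemma measurable_lam_slice (M : ℕ) (t : ℝ) : Measurable fun x : E n => ENNReal.ofReal (lam M t x) :=
  ((measurable_lam M).comp measurable_prodMk_left).ennreal_ofReal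

/-- As the Taylor part vanishes, the vorticity coincides with its own remainder and inherits the
rate t^{-(N+1)/2}. Existing decay enters only through convergence of the time integral and the late
part. -/
lemma WeightedDecay.improve {M a N : ℕ} {u : ℝ → E n → E n} {C₀ : ℝ} {w : Fin n → Fin n → E n → ℝ}
    (hf : DecayingFlow u C₀) (hd : WeightedDecay M a u) (hd0 : WeightedDecay M 0 u)
    (hw : InitialVorticity M w u) (hM : 2 ≤ M) (hN : N ≤ 1) (hNa : N + 1 ≤ n + a)
    (hP : N + 3 ≤ n + 1 + a) : WeightedDecay M (N + 1) u := by
  obtain ⟨C1, h1, b1⟩ := hd.exists_sub_taylorPart_le hf hw (N := N) (L := fun _ => 2) (by omega) hNa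
    (fun _ _ => one_le_two) fun t _ => lintegral_Ioo_sqrt_pow_le_two hP _
  obtain ⟨C2, h2, b2⟩ := hd0
  refine ⟨n ^ 2 * (2 ^ (N + 1) * (C1 * 2)) + 2 ^ (N + 1) * C2, by positivity, fun e t ht => ?_⟩
  have hq0 : 0 < √t := Real.sqrt_pos.2 ht
  have hq1 : 0 < √(1 + t) := Real.sqrt_pos.2 (by linarith)
  rcases le_or_gt 1 t with h | h
  · have hpt : nm e (fun x => ENNReal.ofReal (lam M t x) * vortE u t x) ≤ (n : ℝ≥0∞) ^ 2 *
        ENNReal.ofReal (C1 * (√t ^ (scal n e + (N + 1)))⁻¹ * 2) := by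
      refine nm_mul_vortE_le hf.smooth e ht (measurable_lam_slice M t) fun i k => ?_
      refine le_trans (nm_mono e fun x => ?_) (b1 e i k t h)
      rw [taylorPart_eq_zero hf hd ⟨C2, h2, b2⟩ hw hM hN, sub_zero]
      refine mul_le_mul_left (ENNReal.ofReal_le_ofReal ?_) _
      unfold lam
      gcongr
      linarith
    refine hpt.trans ?_
    rw [natCast_sq_eq_ofReal, ← ENNReal.ofReal_mul (by positivity)]
    refine ENNReal.ofReal_le_ofReal ?_
    have h3 : (√t ^ (N + 1))⁻¹ ≤ 2 ^ (N + 1) * (√(1 + t) ^ (N + 1))⁻¹ := by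
      rw [← div_eq_mul_inv, le_div_iff₀ (by positivity), inv_mul_le_iff₀ (by positivity), mul_comm,
        ← mul_pow]
      gcongr
      rw [Real.sqrt_le_left (by positivity), mul_pow, Real.sq_sqrt ht.le]
      linarith
    have h4 : 0 ≤ 2 ^ (N + 1) * C2 * ((√t ^ scal n e)⁻¹ * (√(1 + t) ^ (N + 1))⁻¹) := by positivity
    rw [pow_add √t, mul_inv]
    calc _ ≤ (n : ℝ) ^ 2 * (C1 * ((√t ^ scal n e)⁻¹ * (2 ^ (N + 1) * (√(1 + t) ^ (N + 1))⁻¹)) * 2) := by gcongr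
      _ = n ^ 2 * (2 ^ (N + 1) * (C1 * 2)) * ((√t ^ scal n e)⁻¹ * (√(1 + t) ^ (N + 1))⁻¹) := by ring
      _ ≤ _ := by linarith
  -- For t < 1 the factor (1+t)^{-(N+1)/2} is bounded below, so the undecayed bound suffices.
  · refine (b2 e t ht).trans (ENNReal.ofReal_le_ofReal ?_)
    have h3 : 1 ≤ 2 ^ (N + 1) * (√(1 + t) ^ (N + 1))⁻¹ := by
      rw [← div_eq_mul_inv, le_div_iff₀ (by positivity), one_mul]
      gcongr
      rw [Real.sqrt_le_left (by positivity)]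
      linarith
    have h4 : 0 ≤ n ^ 2 * (2 ^ (N + 1) * (C1 * 2)) * ((√t ^ scal n e)⁻¹ * (√(1 + t) ^ (N + 1))⁻¹) := by
      positivity
    have h5 : 0 ≤ C2 * (√t ^ scal n e)⁻¹ := by positivity
    have h6 := le_mul_of_one_le_right h5 h3
    rw [pow_zero, inv_one, mul_one]
    linarith

/-- The weighted vorticity decays like `(1+t)^{-1}` in `L^1`. -/
lemma DecayingFlow.weightedDecay_two (hn : 2 ≤ n) {M : ℕ} {u : ℝ → E n → E n} {C₀ : ℝ}
    {w : Fin n → Fin n → E n → ℝ} (hf : DecayingFlow u C₀) (hw : InitialVorticity M w u) (hM : 2 ≤ M) :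
    WeightedDecay M 2 u := by
  have h0 : WeightedDecay M 0 u := hf.weightedDecay_zero hn hw
  -- With n ≥ 2 and no decay the order N = 0 is admissible; the half power gained makes N = 1
  -- admissible.
  have h1 : WeightedDecay M 1 u := h0.improve hf h0 hw hM (N := 0) (by omega) (by omega) (by omega)
  exact h1.improve hf h0 hw hM (N := 1) le_rfl (by omega) (by omega)

/-- With a = 2 the density is at most (1+s)^{(m−n−3)/2}, which is integrable for m ≤ n. -/
lemma WeightedDecay.integrableOn_moment {M m : ℕ} {u : ℝ → E n → E n} {C₀ : ℝ}
    (hd : WeightedDecay M 2 u) (hf : DecayingFlow u C₀) (hm : m ≤ n) (hM : m ≤ M) (j h : Fin n) {l : ℕ}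
    {β : Fin n → ℕ} (hβ : 2 * l + ∑ i, β i ≤ m) :
    IntegrableOn (momentTerm u l β j h) (Ioi 0 ×ˢ univ) (volume.prod volume) :=
  hd.integrableOn_momentTerm hf j h (by omega) measurableSet_Ioi le_rfl
    ((lintegral_Ioi_sqrt_pow_le (d := 0) (by omega) le_rfl).trans_lt ENNReal.ofReal_lt_top)

/-! ### Comparison of the Taylor part with the profiles -/

/-- The part of the profile of order `p` that comes from the initial vorticity. -/
def initialProfile (w : Fin n → Fin n → E n → ℝ) (h k : Fin n) (p : ℕ) (t : ℝ) (x : E n) : ℝ :=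
  ∑ α ∈ Finset.piAntidiag (Finset.univ : Finset (Fin n)) p,
    taylorCoeff (heatKernel n) 0 α t x * ∫ y, monom α (-y) * w h k y

/-- The part of the profile of order `p` that comes from the force at times in `S`. -/
def forceProfile (u : ℝ → E n → E n) (S : Set ℝ) (h k : Fin n) (p : ℕ) (t : ℝ) (x : E n) : ℝ :=
  ∑ l ∈ Finset.range ((p - 1) / 2 + 1),
    ∑ β ∈ Finset.piAntidiag (Finset.univ : Finset (Fin n)) (p - 1 - 2 * l),
      taylorCoeff (dx k (heatKernel n)) l β t x *
        ∫ z in S ×ˢ univ, (-z.1) ^ l * monom β (-z.2) * force u h z.1 z.2 ∂(volume.prod volume)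

section

variable {M m : ℕ} {u : ℝ → E n → E n} {C₀ : ℝ} {w : Fin n → Fin n → E n → ℝ}

lemma parabolic_order {p l : ℕ} (hp : 1 ≤ p) (hl : l ∈ Finset.range ((p - 1) / 2 + 1)) {β : Fin n → ℕ}
    (hβ : β ∈ Finset.piAntidiag (Finset.univ : Finset (Fin n)) (p - 1 - 2 * l)) :
    1 + (2 * l + ∑ i, β i) = p := by
  have h1 := Finset.mem_range.1 hl
  rw [sum_of_mem_piAntidiag hβ]
  omega

lemma WeightedDecay.integrableOn_force_moment_Ioi (hd : WeightedDecay M 2 u) (hf : DecayingFlow u C₀)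
    (hm : m ≤ n) (hM : m ≤ M) (h : Fin n) {l : ℕ} {β : Fin n → ℕ} (hβ : 2 * l + ∑ i, β i ≤ m) :
    IntegrableOn (fun z : ℝ × E n => (-z.1) ^ l * monom β (-z.2) * force u h z.1 z.2)
      (Ioi 0 ×ˢ univ) (volume.prod volume) := by
  simp only [force_moment_eq]
  exact integrable_finsetSum _ fun j _ => hd.integrableOn_moment hf hm hM j h hβ

/-- Absolute convergence justifies Fubini, which passes from the iterated integrals defining the
moments to integrals over space-time. -/
lemma sum_nonlinearMoment (hd : WeightedDecay M 2 u) (hf : DecayingFlow u C₀)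
    (hm : m ≤ n) (hM : m ≤ M) (h : Fin n) {l : ℕ} {β : Fin n → ℕ} (hβ : 2 * l + ∑ i, β i ≤ m) :
    ∑ j, nonlinearMoment u l β j h = ∫ z in Ioi 0 ×ˢ univ,
      (-z.1) ^ l * monom β (-z.2) * force u h z.1 z.2 ∂(volume.prod volume) := by
  simp only [force_moment_eq]
  rw [integral_finsetSum _ fun j _ => hd.integrableOn_moment hf hm hM j h hβ]
  refine Finset.sum_congr rfl fun j _ => ?_
  rw [setIntegral_prod _ (hd.integrableOn_moment hf hm hM j h hβ)]
  simp only [setIntegral_univ, momentTerm, nonlinearMoment]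

lemma Omega_eq (hd : WeightedDecay M 2 u) (hf : DecayingFlow u C₀) (hm : m ≤ n) (hM : m ≤ M)
    (h k : Fin n) {p : ℕ} (hp1 : 1 ≤ p) (hp : p ≤ m + 1) (t : ℝ) (x : E n) :
    Omega u w h k p t x = initialProfile w h k p t x + forceProfile u (Ioi 0) h k p t x
      - forceProfile u (Ioi 0) k h p t x := by
  have e1 : ∀ i i' : Fin n, ∑ l ∈ Finset.range ((p - 1) / 2 + 1),
      ∑ β ∈ Finset.piAntidiag (Finset.univ : Finset (Fin n)) (p - 1 - 2 * l), ∑ j,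
        iteratedDeriv l (fun s => multiDeriv β (pderiv i' (heatKernel n s)) x) t /
          ((l.factorial : ℝ) * (multiFactorial β : ℝ)) * nonlinearMoment u l β j i =
      forceProfile u (Ioi 0) i i' p t x := by
    intro i i'
    refine Finset.sum_congr rfl fun l hl => Finset.sum_congr rfl fun β hβ => ?_
    have := parabolic_order hp1 hl hβ
    rw [← Finset.mul_sum, sum_nonlinearMoment hd hf hm hM i (by omega)]
    rfl
  rw [Omega, e1, e1, initialProfile]
  simp only [taylorCoeff, iteratedDeriv_zero, Nat.factorial_zero, Nat.cast_one, one_mul]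

/-- Order j of the initial term matches p = j, while order j of the nonlinear term matches p = j +
1, the kernel being already differentiated. Hence p = 0, 1 drop out by the vanishing moments. -/
lemma taylorPart_eq_sum (hd : WeightedDecay M 2 u) (hd0 : WeightedDecay M 0 u) (hf : DecayingFlow u C₀)
    (hw : InitialVorticity M w u) (hM : m + 2 ≤ M) (h k : Fin n) (t : ℝ) (x : E n) :
    taylorPart (m + 1) w u h k t x = ∑ p ∈ Finset.Icc 2 (m + 1), (initialProfile w h k p t x
      + forceProfile u (Ioo 0 (t / 2)) h k p t x - forceProfile u (Ioo 0 (t / 2)) k h p t x) := by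
  have hI : ∀ f : ℕ → ℝ, ∑ p ∈ Finset.Icc 2 (m + 1), f p = ∑ i ∈ Finset.range m, f (i + 2) := by
    intro f
    rw [Finset.range_eq_Ico, Finset.sum_Ico_add' f 0 m 2]
    rfl
  have hF : ∀ i i' : Fin n, forceProfile u (Ioo 0 (t / 2)) i i' 1 t x = 0 := by
    intro i i'
    refine Finset.sum_eq_zero fun l hl => Finset.sum_eq_zero fun β hβ => ?_
    have hl0 : l = 0 := by have := Finset.mem_range.1 hl; omega
    rw [integral_force_moment_zero hf hd i hl0 (by simpa using hβ), mul_zero]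
  have hA : ∀ j, j < 2 → initialProfile w h k j t x = 0 := fun j hj =>
    Finset.sum_eq_zero fun β hβ => by rw [hw.moment_eq_zero (by omega) hf hd0 h k hj hβ, mul_zero]
  have e2 : ∀ i i' : Fin n, ∑ j ∈ Finset.range (m + 1), ∑ l ∈ Finset.range (j / 2 + 1),
      ∑ β ∈ Finset.piAntidiag (Finset.univ : Finset (Fin n)) (j - 2 * l),
      taylorCoeff (dx i' (heatKernel n)) l β t x * ∫ z in Ioo 0 (t / 2) ×ˢ univ,
        (-z.1) ^ l * monom β (-z.2) * force u i z.1 z.2 ∂(volume.prod volume) =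
      ∑ p ∈ Finset.Icc 2 (m + 1), forceProfile u (Ioo 0 (t / 2)) i i' p t x := by
    intro i i'
    have : ∀ j, ∑ l ∈ Finset.range (j / 2 + 1),
      ∑ β ∈ Finset.piAntidiag (Finset.univ : Finset (Fin n)) (j - 2 * l),
      taylorCoeff (dx i' (heatKernel n)) l β t x * ∫ z in Ioo 0 (t / 2) ×ˢ univ,
        (-z.1) ^ l * monom β (-z.2) * force u i z.1 z.2 ∂(volume.prod volume) =
        forceProfile u (Ioo 0 (t / 2)) i i' (j + 1) t x := fun j => rfl
    simp only [this]
    rw [Finset.sum_range_succ', hF, add_zero, hI]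
  have e3 : ∑ j ∈ Finset.range (m + 1 + 1), ∑ β ∈ Finset.piAntidiag (Finset.univ : Finset (Fin n)) j,
        taylorCoeff (heatKernel n) 0 β t x * ∫ y, monom β (-y) * w h k y =
      ∑ p ∈ Finset.Icc 2 (m + 1), initialProfile w h k p t x := by
    change ∑ j ∈ Finset.range (m + 1 + 1), initialProfile w h k j t x = _
    rw [Finset.sum_range_succ', Finset.sum_range_succ', hA 0 (by omega), hA (0 + 1) (by omega), add_zero,
      add_zero, hI]
  rw [taylorPart_eq hf hd hw (by omega), e2, e2, e3, ← Finset.sum_sub_distrib, ← Finset.sum_add_distrib]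
  exact Finset.sum_congr rfl fun p _ => by ring

lemma exists_taylorCoeff_bound (n K : ℕ) : ∃ C : ℕ → (Fin n → ℕ) → ℝ, (∀ l β, 0 ≤ C l β) ∧
    (∀ β t, 0 < t → ∀ x, |taylorCoeff (heatKernel n) 0 β t x| ≤ C 0 β * kb K (∑ i, β i) t x) ∧
    ∀ i l β t, 0 < t → ∀ x,
      |taylorCoeff (dx i (heatKernel n)) l β t x| ≤ C l β * kb K (1 + (2 * l + ∑ i, β i)) t x := by
  choose A hA a using fun β => (HC.base (n := n)).coeff_bound K 0 β
  choose B hB b using fun (i : Fin n) l β => ((HC.base (n := n)).dx i).coeff_bound K l β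
  have hS : ∀ l β, 0 ≤ ∑ i, B i l β := fun l β => Finset.sum_nonneg fun i _ => hB i l β
  refine ⟨fun l β => A β + ∑ i, B i l β, fun l β => add_nonneg (hA β) (hS l β), fun β t ht x => ?_,
    fun i l β t ht x => ?_⟩
  · have := a β t ht x
    simp only [mul_zero, zero_add] at this
    refine this.trans (mul_le_mul_of_nonneg_right ?_ (kb_nonneg _ _ _ _))
    linarith [hS 0 β]
  · have := b i l β t ht x
    rw [zero_add] at this
    refine this.trans (mul_le_mul_of_nonneg_right ?_ (kb_nonneg _ _ _ _))
    have := Finset.single_le_sum (f := fun i => B i l β) (fun i _ => hB i l β) (Finset.mem_univ i)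
    linarith [hA β]

lemma exists_initialProfile_bound (w : Fin n → Fin n → E n → ℝ) (K p : ℕ) : ∃ C : ℝ, 0 ≤ C ∧
    ∀ h k t, 0 < t → ∀ x, |initialProfile w h k p t x| ≤ C * kb K p t x := by
  obtain ⟨A, hA, a, -⟩ := exists_taylorCoeff_bound n K
  refine ⟨∑ α ∈ Finset.piAntidiag (Finset.univ : Finset (Fin n)) p, A 0 α *
    ∑ h, ∑ k, |∫ y, monom α (-y) * w h k y|, Finset.sum_nonneg fun α _ => mul_nonneg (hA 0 α)
    (Finset.sum_nonneg fun h _ => Finset.sum_nonneg fun k _ => abs_nonneg _), fun h k t ht x => ?_⟩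
  refine (Finset.abs_sum_le_sum_abs _ _).trans ?_
  rw [Finset.sum_mul]
  refine Finset.sum_le_sum fun α hα => ?_
  have h1 := a α t ht x
  rw [sum_of_mem_piAntidiag hα] at h1
  have h2 : |∫ y, monom α (-y) * w h k y| ≤ ∑ h, ∑ k, |∫ y, monom α (-y) * w h k y| :=
    (Finset.single_le_sum (f := fun k => |∫ y, monom α (-y) * w h k y|) (fun _ _ => abs_nonneg _)
      (Finset.mem_univ k)).trans (Finset.single_le_sum
      (f := fun h => ∑ k, |∫ y, monom α (-y) * w h k y|)
      (fun _ _ => Finset.sum_nonneg fun _ _ => abs_nonneg _) (Finset.mem_univ h))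
  rw [abs_mul, mul_right_comm]
  exact mul_le_mul h1 h2 (abs_nonneg _) (mul_nonneg (hA 0 α) (kb_nonneg _ _ _ _))

/-- The density has exponent p − 1 − (n+3) in √(1+s); integrating its tail from s raises this by
two, to p − (n+2). -/
lemma WeightedDecay.exists_forceProfile_le (hd : WeightedDecay M 2 u) (hf : DecayingFlow u C₀)
    (K : ℕ) {p : ℕ} (hp1 : 1 ≤ p) (hp : p ≤ n + 1) (hM : p ≤ M + 1) : ∃ C : ℝ, 0 ≤ C ∧
    ∀ h k s, 0 ≤ s → ∀ t, 0 < t → ∀ x, |forceProfile u (Ioi s) h k p t x| ≤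
      C * (√(1 + s) ^ (n + 2 - p))⁻¹ * kb K p t x := by
  obtain ⟨A, hA, -, a⟩ := exists_taylorCoeff_bound n K
  obtain ⟨B, hB, b⟩ := hd.exists_moment_le hf
  refine ⟨∑ l ∈ Finset.range ((p - 1) / 2 + 1),
    ∑ β ∈ Finset.piAntidiag (Finset.univ : Finset (Fin n)) (p - 1 - 2 * l), A l β * (n * (B * 2)),
    Finset.sum_nonneg fun l _ => Finset.sum_nonneg fun β _ => mul_nonneg (hA l β) (by positivity),
    fun h k s hs t ht x => ?_⟩
  have hmom : ∀ l β, 1 + (2 * l + ∑ i, β i) = p →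
      |∫ z in Ioi s ×ˢ univ, (-z.1) ^ l * monom β (-z.2) * force u h z.1 z.2 ∂(volume.prod volume)| ≤
        n * (B * 2) * (√(1 + s) ^ (n + 2 - p))⁻¹ := by
    intro l β hβ
    rw [← ENNReal.ofReal_le_ofReal_iff (by positivity), ← Real.enorm_eq_ofReal_abs]
    refine (enorm_integral_le_lintegral_enorm _).trans ?_
    simp only [force_moment_eq]
    have hj := fun j => b l β j h (by omega) (Ioi s) measurableSet_Ioi (Ioi_subset_Ioi hs)
    refine (lintegral_mono fun z => enorm_sum_le _ _).trans ?_
    rw [lintegral_finsetSum' _ fun j _ => (hj j).1.enorm]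
    refine (Finset.sum_le_sum fun j _ => (hj j).2.trans (mul_le_mul_right
      (lintegral_Ioi_sqrt_pow_le (d := n + 1 - p) (by omega) hs) _)).trans (le_of_eq ?_)
    rw [Finset.sum_const, Finset.card_univ, Fintype.card_fin, nsmul_eq_mul, ← ENNReal.ofReal_natCast,
      ← ENNReal.ofReal_mul hB, ← ENNReal.ofReal_mul (by positivity)]
    congr 1
    rw [show n + 1 - p + 1 = n + 2 - p by omega]
    ring
  refine (Finset.abs_sum_le_sum_abs _ _).trans ?_
  rw [Finset.sum_mul, Finset.sum_mul]
  refine Finset.sum_le_sum fun l hl => (Finset.abs_sum_le_sum_abs _ _).trans ?_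
  rw [Finset.sum_mul, Finset.sum_mul]
  refine Finset.sum_le_sum fun β hβ => ?_
  have ho := parabolic_order hp1 hl hβ
  have h1 := a k l β t ht x
  rw [ho] at h1
  rw [abs_mul]
  refine (mul_le_mul h1 (hmom l β ho) (abs_nonneg _) (mul_nonneg (hA l β) (kb_nonneg _ _ _ _))).trans
    (le_of_eq ?_)
  ring

/-- The moments are finite constants, so each profile inherits the parabolic scaling and rapid decay
of derivatives of G of total order p. -/
lemma WeightedDecay.exists_Omega_bound (hd : WeightedDecay M 2 u) (hf : DecayingFlow u C₀)
    (w : Fin n → Fin n → E n → ℝ) (K : ℕ) {p : ℕ} (hp1 : 1 ≤ p) (hp : p ≤ n + 1) (hM : p ≤ M + 1) :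
    ∃ C : ℝ, 0 ≤ C ∧ ∀ h k t, 0 < t → ∀ x, |Omega u w h k p t x| ≤ C * kb K p t x := by
  obtain ⟨A, hA, a⟩ := exists_initialProfile_bound w K p
  obtain ⟨B, hB, b⟩ := hd.exists_forceProfile_le hf K hp1 hp hM
  refine ⟨A + B + B, by positivity, fun h k t ht x => ?_⟩
  have b' : ∀ i i', |forceProfile u (Ioi 0) i i' p t x| ≤ B * kb K p t x := fun i i' => by
    simpa using b i i' 0 le_rfl t ht x
  rw [Omega_eq hd hf (m := p - 1) (by omega) (by omega) h k hp1 (by omega)]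
  refine (abs_sub _ _).trans ((add_le_add ((abs_add_le _ _).trans (add_le_add (a h k t ht x) (b' h k)))
    (b' k h)).trans (le_of_eq (by ring)))

lemma forceProfile_sub (hd : WeightedDecay M 2 u) (hf : DecayingFlow u C₀) {p : ℕ} (hp1 : 1 ≤ p)
    (hp : p ≤ n + 1) (hM : p ≤ M + 1) (h k : Fin n) {t : ℝ} (ht : 0 < t) (x : E n) :
    forceProfile u (Ioi 0) h k p t x - forceProfile u (Ioo 0 (t / 2)) h k p t x =
      forceProfile u (Ioi (t / 2)) h k p t x := by
  unfold forceProfile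
  rw [← Finset.sum_sub_distrib]
  refine Finset.sum_congr rfl fun l hl => ?_
  rw [← Finset.sum_sub_distrib]
  refine Finset.sum_congr rfl fun β hβ => ?_
  have ho := parabolic_order hp1 hl hβ
  have hi := hd.integrableOn_force_moment_Ioi hf (m := p - 1) (by omega) (by omega) h (l := l) (β := β)
    (by omega)
  rw [← mul_sub]
  congr 1
  have hsub : Ioc 0 (t / 2) ×ˢ (univ : Set (E n)) ⊆ Ioi 0 ×ˢ univ := prod_mono (fun s hs => hs.1) le_rfl
  have hsub' : Ioi (t / 2) ×ˢ (univ : Set (E n)) ⊆ Ioi 0 ×ˢ univ :=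
    prod_mono (Ioi_subset_Ioi (by linarith)) le_rfl
  have hc : ∫ z in Ioo 0 (t / 2) ×ˢ univ, (-z.1) ^ l * monom β (-z.2) * force u h z.1 z.2
      ∂(volume.prod volume) = ∫ z in Ioc 0 (t / 2) ×ˢ univ, (-z.1) ^ l * monom β (-z.2) * force u h z.1 z.2
      ∂(volume.prod volume) := by
    rw [← Measure.prod_restrict, ← Measure.prod_restrict, restrict_Ioo_eq_restrict_Ioc]
  rw [hc, sub_eq_iff_eq_add', ← setIntegral_union _ (measurableSet_Ioi.prod .univ) (hi.mono_set hsub)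
    (hi.mono_set hsub'), ← union_prod, Ioc_union_Ioi_eq_Ioi (by linarith)]
  rw [Set.disjoint_left]
  rintro z ⟨h1, -⟩ ⟨h2, -⟩
  exact not_lt.2 h1.2 h2

/-- For large times the truncated profiles are close to the full ones. -/
lemma exists_taylorPart_sub_Omega_le (hd : WeightedDecay M 2 u) (hd0 : WeightedDecay M 0 u)
    (hf : DecayingFlow u C₀) (hw : InitialVorticity M w u) (hm : m ≤ n) (hM : m + 2 ≤ M) (K : ℕ) :
    ∃ C : ℝ, 0 ≤ C ∧ ∀ h k t, 1 ≤ t → ∀ x,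
      |taylorPart (m + 1) w u h k t x - ∑ p ∈ Finset.Icc 2 (m + 1), Omega u w h k p t x| ≤
        C * kb K (n + 2) t x := by
  choose! B hB b using fun p (hp : 1 ≤ p ∧ p ≤ m + 1) =>
    hd.exists_forceProfile_le hf K hp.1 (by omega) (by omega : p ≤ M + 1)
  refine ⟨∑ p ∈ Finset.Icc 2 (m + 1), 2 * (B p * 2 ^ (n + 2 - p)), Finset.sum_nonneg fun p hp => ?_,
    fun h k t ht x => ?_⟩
  · have := Finset.mem_Icc.1 hp
    have := hB p ⟨by omega, by omega⟩
    positivity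
  have ht0 : 0 < t := by linarith
  have hq : 0 < √t := Real.sqrt_pos.2 ht0
  rw [taylorPart_eq_sum hd hd0 hf hw hM, ← Finset.sum_sub_distrib, Finset.sum_mul]
  refine (Finset.abs_sum_le_sum_abs _ _).trans (Finset.sum_le_sum fun p hp => ?_)
  have hp' := Finset.mem_Icc.1 hp
  have hp1 : 1 ≤ p ∧ p ≤ m + 1 := ⟨by omega, by omega⟩
  have hBp := hB p hp1
  have key : ∀ i i', |forceProfile u (Ioi (t / 2)) i i' p t x| ≤
      B p * 2 ^ (n + 2 - p) * kb K (n + 2) t x := by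
    intro i i'
    refine (b p hp1 i i' (t / 2) (by linarith) t ht0 x).trans ?_
    have h1 : (√(1 + t / 2) ^ (n + 2 - p))⁻¹ ≤ 2 ^ (n + 2 - p) * (√t ^ (n + 2 - p))⁻¹ := by
      have : 0 < √(1 + t / 2) := Real.sqrt_pos.2 (by linarith)
      rw [← div_eq_mul_inv, le_div_iff₀ (by positivity), inv_mul_le_iff₀ (by positivity), mul_comm,
        ← mul_pow]
      gcongr
      rw [Real.sqrt_le_left (by positivity), mul_pow, Real.sq_sqrt (by linarith)]
      linarith
    -- The tail of the moment compensates the lower order of the kernel, so every p contributes with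
    -- the same total order n + 2, at least the m + 2 of the claimed rate.
    have h2 : kb K (n + 2) t x = kb K p t x * (√t ^ (n + 2 - p))⁻¹ := by
      rw [← div_eq_mul_inv, ← kb_add]
      congr 1
      omega
    have hk := kb_nonneg K p t x
    rw [h2]
    calc _ ≤ B p * (2 ^ (n + 2 - p) * (√t ^ (n + 2 - p))⁻¹) * kb K p t x := by gcongr
      _ = _ := by ring
  rw [Omega_eq hd hf hm (by omega) h k hp1.1 hp1.2]
  have e1 := forceProfile_sub hd hf hp1.1 (by omega) (by omega) h k ht0 x
  have e2 := forceProfile_sub hd hf hp1.1 (by omega) (by omega) k h ht0 x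
  have e3 : initialProfile w h k p t x + forceProfile u (Ioo 0 (t / 2)) h k p t x
      - forceProfile u (Ioo 0 (t / 2)) k h p t x - (initialProfile w h k p t x
      + forceProfile u (Ioi 0) h k p t x - forceProfile u (Ioi 0) k h p t x) =
      forceProfile u (Ioi (t / 2)) k h p t x - forceProfile u (Ioi (t / 2)) h k p t x := by
    rw [← e1, ← e2]; ring
  rw [e3]
  refine (abs_sub _ _).trans ((add_le_add (key k h) (key h k)).trans (le_of_eq (by ring)))

end

/-! ### Interpolation and the final error estimate -/

/-- Interpolation between `L^1` and `L^∞`. -/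
lemma eLpNorm_le_of_nm_le {f : E n → ℝ} {X t : ℝ} (hX : 0 ≤ X) (ht : 0 < t)
    (h : ∀ e, nm e (fun x => ENNReal.ofReal |f x|) ≤ ENNReal.ofReal (X * (√t ^ scal n e)⁻¹))
    {q : ℝ≥0∞} (hq : 1 ≤ q) :
    eLpNorm f q volume ≤ ENNReal.ofReal (X * t ^ (-((n : ℝ) / 2) * (1 - (1 / q).toReal))) := by
  have h0 := h false
  have h1 : ∀ x, ‖f x‖ₑ ≤ ENNReal.ofReal (X * (√t ^ n)⁻¹) := fun x => by
    rw [Real.enorm_eq_ofReal_abs]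
    exact (le_iSup (fun x => ENNReal.ofReal |f x|) x).trans (h true)
  simp only [nm, scal, pow_zero, inv_one, mul_one, ← Real.enorm_eq_ofReal_abs] at h0
  have hs : (√t ^ n)⁻¹ = t ^ (-((n : ℝ) / 2)) := by rw [← rpow_neg_half ht, neg_div]
  rcases eq_or_ne q ⊤ with rfl | hqt
  · rw [eLpNorm_exponent_top]
    refine (eLpNormEssSup_le_of_ae_enorm_bound (Eventually.of_forall h1)).trans (le_of_eq ?_)
    simp [hs]
  · have hr : 1 ≤ q.toReal := by
      rw [← ENNReal.toReal_one]
      exact ENNReal.toReal_mono hqt hq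
    rw [eLpNorm_eq_lintegral_rpow_enorm_toReal (by positivity) hqt, one_div q, ENNReal.toReal_inv]
    set r := q.toReal with hrdef
    have hr0 : 0 < r := by linarith
    have hS : 0 ≤ X * (√t ^ n)⁻¹ := by positivity
    -- The r-th power is bounded by the supremum to the power r − 1 times the integral, which is the
    -- whole of the interpolation.
    have h2 : ∫⁻ x, ‖f x‖ₑ ^ r ≤ ENNReal.ofReal ((X * (√t ^ n)⁻¹) ^ (r - 1) * X) := by
      rw [ENNReal.ofReal_mul (by positivity), ← ENNReal.ofReal_rpow_of_nonneg hS (by linarith)]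
      refine le_trans ?_ (mul_le_mul_right h0 _)
      rw [← lintegral_const_mul' _ _ (ENNReal.rpow_ne_top_of_nonneg (by linarith) ENNReal.ofReal_ne_top)]
      refine lintegral_mono fun x => ?_
      calc ‖f x‖ₑ ^ r = ‖f x‖ₑ ^ ((r - 1) + 1) := by rw [sub_add_cancel]
        _ = ‖f x‖ₑ ^ (r - 1) * ‖f x‖ₑ := by
            rw [ENNReal.rpow_add_of_nonneg _ _ (by linarith) zero_le_one, ENNReal.rpow_one]
        _ ≤ _ := mul_le_mul_left (ENNReal.rpow_le_rpow (h1 x) (by linarith)) _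
    refine (ENNReal.rpow_le_rpow h2 (by positivity)).trans ?_
    rw [ENNReal.ofReal_rpow_of_nonneg (by positivity) (by positivity)]
    refine ENNReal.ofReal_le_ofReal (le_of_eq ?_)
    have e1 : (X * (√t ^ n)⁻¹) ^ (r - 1) * X = X ^ r * ((√t ^ n)⁻¹) ^ (r - 1) := by
      rw [Real.mul_rpow hX (by positivity), mul_right_comm]
      congr 1
      calc X ^ (r - 1) * X = X ^ (r - 1) * X ^ (1 : ℝ) := by rw [Real.rpow_one]
        _ = X ^ ((r - 1) + 1) := (Real.rpow_add_of_nonneg hX (by linarith) zero_le_one).symm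
        _ = X ^ r := by rw [sub_add_cancel]
    rw [e1, Real.mul_rpow (by positivity) (by positivity), ← Real.rpow_mul hX, mul_one_div_cancel hr0.ne',
      Real.rpow_one, hs, ← Real.rpow_mul ht.le, ← Real.rpow_mul ht.le]
    congr 2
    field_simp

lemma norm_rpow_le_weight {M : ℕ} {μ t : ℝ} (hμ : 0 ≤ μ) (hM : μ ≤ M) (ht : 0 < t) (x : E n) :
    ‖x‖ ^ μ ≤ t ^ (μ / 2) * (1 + ‖x‖ / √t) ^ M := by
  have h0 : 0 < √t := Real.sqrt_pos.2 ht
  have h1 : 0 ≤ ‖x‖ / √t := by positivity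
  have h2 : √t ^ μ = t ^ (μ / 2) := by
    rw [Real.sqrt_eq_rpow, ← Real.rpow_mul ht.le, one_div, inv_mul_eq_div]
  calc ‖x‖ ^ μ = (√t * (‖x‖ / √t)) ^ μ := by rw [mul_div_cancel₀ _ h0.ne']
    _ = √t ^ μ * (‖x‖ / √t) ^ μ := Real.mul_rpow h0.le h1
    _ ≤ √t ^ μ * (1 + ‖x‖ / √t) ^ (M : ℝ) := by
        gcongr
        calc (‖x‖ / √t) ^ μ ≤ (1 + ‖x‖ / √t) ^ μ := by gcongr; linarith
          _ ≤ _ := Real.rpow_le_rpow_of_exponent_le (by linarith) hM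
    _ = _ := by rw [h2, Real.rpow_natCast]

/-- A lower bound independent of t, so that terms without the logarithm can be absorbed into those
with it. -/
lemma half_le_logFactor (n m : ℕ) {t : ℝ} (ht : 0 < t) : 1 / 2 ≤ logFactor n m t := by
  unfold logFactor
  split_ifs
  · have := Real.log_two_gt_d9
    have := Real.log_le_log (by norm_num : (0 : ℝ) < 2) (by linarith : 2 ≤ 2 + t)
    linarith
  · norm_num

/-- The difference between the vorticity and its asymptotic expansion. -/
def profileError (m : ℕ) (w : Fin n → Fin n → E n → ℝ) (u : ℝ → E n → E n) (h k : Fin n) (t : ℝ)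
    (x : E n) : ℝ := vorticity u h k t x - ∑ p ∈ Finset.Icc 2 (m + 1), Omega u w h k p t x

section

variable {M m : ℕ} {u : ℝ → E n → E n} {C₀ : ℝ} {w : Fin n → Fin n → E n → ℝ}

lemma exists_profileError_large_time (hd : WeightedDecay M 2 u) (hd0 : WeightedDecay M 0 u)
    (hf : DecayingFlow u C₀) (hw : InitialVorticity M w u) (hm : m ≤ n) (hM : m + 2 ≤ M) :
    ∃ C : ℝ, 0 ≤ C ∧ ∀ (e : Bool) (h k : Fin n) (t : ℝ), 1 ≤ t →
      nm e (fun x => ENNReal.ofReal ((1 + ‖x‖ / √t) ^ M) * ENNReal.ofReal |profileError m w u h k t x|) ≤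
      ENNReal.ofReal (C * (√t ^ (scal n e + (m + 2)))⁻¹ * logFactor n m t) := by
  -- With a = 2 and N = m + 1 the time integral has the exponents m + 1 and n + 3: three surplus
  -- powers for m < n, and only two for m = n.
  obtain ⟨C1, h1, b1⟩ := hd.exists_sub_taylorPart_le hf hw (N := m + 1)
    (L := fun t => 2 * logFactor n m t) (by omega) (by omega)
    (fun t ht => by linarith [half_le_logFactor n m (by linarith : 0 < t)]) (by
      intro t ht
      by_cases hmn : m = n
      · refine (lintegral_Ioo_sqrt_pow_le_log (by omega) (by linarith)).trans
          (ENNReal.ofReal_le_ofReal ?_)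
        rw [logFactor, if_pos hmn]
        have := Real.log_le_log (by linarith : 0 < 1 + t / 2) (by linarith : 1 + t / 2 ≤ 2 + t)
        have := Real.log_nonneg (by linarith : 1 ≤ 2 + t)
        linarith
      · rw [logFactor, if_neg hmn, mul_one]
        exact lintegral_Ioo_sqrt_pow_le_two (by omega) _)
  obtain ⟨C2, h2, b2⟩ := exists_taylorPart_sub_Omega_le hd hd0 hf hw hm hM (n + 1 + M)
  obtain ⟨C3, h3, b3⟩ := exists_nm_kbE_le n (n + 1) le_rfl
  refine ⟨2 * (C2 * C3) + 2 * C1, by positivity, fun e h k t ht => ?_⟩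
  have ht0 : 0 < t := by linarith
  have hq : 1 ≤ √t := Real.one_le_sqrt.2 ht
  have hL := half_le_logFactor n m ht0
  have hpt : ∀ x, ENNReal.ofReal ((1 + ‖x‖ / √t) ^ M) * ENNReal.ofReal |profileError m w u h k t x| ≤
      ENNReal.ofReal C2 * kbE (n + 1) (n + 2) t x + ENNReal.ofReal ((1 + ‖x‖ / √t) ^ M) *
        ENNReal.ofReal |vorticity u h k t x - taylorPart (m + 1) w u h k t x| := by
    intro x
    have e1 : profileError m w u h k t x = (taylorPart (m + 1) w u h k t x
        - ∑ p ∈ Finset.Icc 2 (m + 1), Omega u w h k p t x)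
        + (vorticity u h k t x - taylorPart (m + 1) w u h k t x) := by rw [profileError]; ring
    rw [e1]
    refine (mul_le_mul_right ((ENNReal.ofReal_le_ofReal (abs_add_le _ _)).trans ENNReal.ofReal_add_le) _).trans ?_
    rw [mul_add]
    refine add_le_add_left ?_ _
    rw [kbE, ← ENNReal.ofReal_mul (by positivity), ← ENNReal.ofReal_mul h2, ← weight_kb (n + 1) M _ ht0 x]
    refine ENNReal.ofReal_le_ofReal ((mul_le_mul_of_nonneg_left (b2 h k t ht x) (by positivity)).trans
      (le_of_eq ?_))
    ring
  refine (nm_mono e hpt).trans ((nm_add_le e ((measurable_kbE_slice _ _ t).const_mul _) _).trans ?_)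
  rw [nm_const_mul e ENNReal.ofReal_ne_top]
  refine (add_le_add (mul_le_mul_right (b3 e (n + 2) t ht0) _) (b1 e h k t ht)).trans ?_
  rw [← ENNReal.ofReal_mul h2, ← ENNReal.ofReal_add (by positivity) (by positivity)]
  refine ENNReal.ofReal_le_ofReal ?_
  have e2 : (√t ^ (scal n e + (n + 2)))⁻¹ ≤ (√t ^ (scal n e + (m + 2)))⁻¹ :=
    inv_anti₀ (by positivity) (pow_le_pow_right₀ hq (by omega))
  have e3 : (√t ^ (scal n e + (m + 2)))⁻¹ ≤ 2 * ((√t ^ (scal n e + (m + 2)))⁻¹ * logFactor n m t) := by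
    have : 0 ≤ (√t ^ (scal n e + (m + 2)))⁻¹ := by positivity
    nlinarith
  have e4 := mul_le_mul_of_nonneg_left (e2.trans e3) (by positivity : 0 ≤ C2 * C3)
  rw [show m + 1 + 1 = m + 2 from rfl]
  linarith

/-- For t ≤ 1 vorticity and profiles are bounded separately by the triangle inequality. The weighted
vorticity contributes the constant 1, and the most singular profile, p = m + 1, contributes
t^{μ/2−(m+1)/2}. -/
lemma exists_profileError_small_time (hd : WeightedDecay M 2 u) (hd0 : WeightedDecay M 0 u)
    (hf : DecayingFlow u C₀) (w : Fin n → Fin n → E n → ℝ) (hm : m ≤ n) (hM : m ≤ M) {μ : ℝ} (hμ : 0 ≤ μ)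
    (hμM : μ ≤ M) :
    ∃ C : ℝ, 0 ≤ C ∧ ∀ (e : Bool) (h k : Fin n) (t : ℝ), 0 < t → t ≤ 1 →
      nm e (fun x => ENNReal.ofReal (‖x‖ ^ μ) * ENNReal.ofReal |profileError m w u h k t x|) ≤
      ENNReal.ofReal (C * (1 + t ^ (μ / 2) * (√t ^ (m + 1))⁻¹) * (√t ^ scal n e)⁻¹) := by
  choose! B hB b using fun p (hp : 1 ≤ p ∧ p ≤ m + 1) =>
    hd.exists_Omega_bound hf w (n + 1 + M) hp.1 (by omega) (by omega : p ≤ M + 1)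
  obtain ⟨C1, h1, b1⟩ := hd0
  obtain ⟨C3, h3, b3⟩ := exists_nm_kbE_le n (n + 1) le_rfl
  set S := ∑ p ∈ Finset.Icc 2 (m + 1), B p with hS
  have hS0 : 0 ≤ S := Finset.sum_nonneg fun p hp => by
    have := Finset.mem_Icc.1 hp
    exact hB p ⟨by omega, by omega⟩
  refine ⟨2 ^ M * C1 + S * C3, by positivity, fun e h k t ht ht1 => ?_⟩
  have hq : 0 < √t := Real.sqrt_pos.2 ht
  have hq1 : √t ≤ 1 := Real.sqrt_le_one.2 ht1
  have hO : ∀ x, |∑ p ∈ Finset.Icc 2 (m + 1), Omega u w h k p t x| ≤ S * kb (n + 1 + M) (m + 1) t x := by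
    intro x
    refine (Finset.abs_sum_le_sum_abs _ _).trans ?_
    rw [hS, Finset.sum_mul]
    refine Finset.sum_le_sum fun p hp => ?_
    have hp' := Finset.mem_Icc.1 hp
    refine (b p ⟨by omega, by omega⟩ h k t ht x).trans
      (mul_le_mul_of_nonneg_left ?_ (hB p ⟨by omega, by omega⟩))
    -- Since √t ≤ 1, raising the order of the majorant from p to m + 1 only enlarges it.
    rw [show m + 1 = p + (m + 1 - p) by omega, kb_add]
    exact le_div_self (kb_nonneg _ _ _ _) (by positivity) (pow_le_one₀ hq.le hq1)
  have hlam : ∀ x : E n, ‖x‖ ^ μ ≤ 2 ^ M * lam M t x := by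
    intro x
    have h4 : √(1 + t) ≤ 2 := by rw [Real.sqrt_le_left (by norm_num)]; linarith
    have h5 : 0 < √(1 + t) := Real.sqrt_pos.2 (by linarith)
    calc ‖x‖ ^ μ ≤ (1 + ‖x‖) ^ μ := by gcongr; linarith
      _ ≤ (1 + ‖x‖) ^ (M : ℝ) := Real.rpow_le_rpow_of_exponent_le (by linarith [norm_nonneg x]) hμM
      _ = (1 + ‖x‖) ^ M := Real.rpow_natCast _ _
      _ ≤ (2 * (1 + ‖x‖ / √(1 + t))) ^ M := by
          gcongr
          have : ‖x‖ ≤ 2 * (‖x‖ / √(1 + t)) := by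
            rw [mul_div_assoc', le_div_iff₀ h5]
            nlinarith [norm_nonneg x]
          linarith
      _ = _ := mul_pow _ _ _
  have hpt : ∀ x, ENNReal.ofReal (‖x‖ ^ μ) * ENNReal.ofReal |profileError m w u h k t x| ≤
      ENNReal.ofReal (t ^ (μ / 2) * S) * kbE (n + 1) (m + 1) t x +
        ENNReal.ofReal (2 ^ M) * (ENNReal.ofReal (lam M t x) * vortE u t x) := by
    intro x
    rw [vortE_of_pos u ht, kbE, ← ENNReal.ofReal_mul (lam_pos _ _ _).le, ← ENNReal.ofReal_mul (by positivity),
      ← ENNReal.ofReal_mul (by positivity), ← ENNReal.ofReal_mul (by positivity),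
      ← ENNReal.ofReal_add (mul_nonneg (by positivity) (kb_nonneg _ _ _ _))
        (mul_nonneg (by positivity) (mul_nonneg (lam_pos _ _ _).le (vort_nonneg _ _ _)))]
    refine ENNReal.ofReal_le_ofReal ?_
    have e1 : |profileError m w u h k t x| ≤ vort u t x + S * kb (n + 1 + M) (m + 1) t x :=
      (abs_sub _ _).trans (add_le_add (abs_vorticity_le u h k t x) (hO x))
    have e2 : ‖x‖ ^ μ * (S * kb (n + 1 + M) (m + 1) t x) ≤ t ^ (μ / 2) * S * kb (n + 1) (m + 1) t x := by
      rw [← weight_kb (n + 1) M _ ht x]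
      have := mul_le_mul_of_nonneg_right (norm_rpow_le_weight hμ hμM ht x)
        (mul_nonneg hS0 (kb_nonneg (n + 1 + M) (m + 1) t x))
      linarith
    have e3 := mul_le_mul_of_nonneg_right (hlam x) (vort_nonneg u t x)
    have e4 := mul_le_mul_of_nonneg_left e1 (by positivity : 0 ≤ ‖x‖ ^ μ)
    linarith
  refine (nm_mono e hpt).trans ((nm_add_le e ((measurable_kbE_slice _ _ t).const_mul _) _).trans ?_)
  rw [nm_const_mul e ENNReal.ofReal_ne_top, nm_const_mul e ENNReal.ofReal_ne_top]
  refine (add_le_add (mul_le_mul_right (b3 e (m + 1) t ht) _) (mul_le_mul_right (b1 e t ht) _)).trans ?_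
  rw [← ENNReal.ofReal_mul (by positivity), ← ENNReal.ofReal_mul (by positivity),
    ← ENNReal.ofReal_add (by positivity) (by positivity)]
  refine ENNReal.ofReal_le_ofReal ?_
  rw [pow_add √t, mul_inv, pow_zero, inv_one, mul_one]
  have e5 : 0 ≤ 2 ^ M * C1 * (t ^ (μ / 2) * (√t ^ (m + 1))⁻¹) * (√t ^ scal n e)⁻¹ := by positivity
  have e6 : 0 ≤ S * C3 * (√t ^ scal n e)⁻¹ := by positivity
  linarith

/-- The time dependence of the error of the expansion. -/
def errorRate (n m : ℕ) (μ t : ℝ) : ℝ :=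
  (t ^ (-(m : ℝ) / 2 - 1 / 2 + μ / 2) + (1 + t) ^ (-(m : ℝ) / 2 - 1 / 2 + μ / 2)) *
    (1 + t) ^ (-(1 / 2) : ℝ) * logFactor n m t

lemma one_add_rpow_neg_half {t : ℝ} (ht : 0 < t) : (1 + t) ^ (-(1 / 2) : ℝ) = (√(1 + t))⁻¹ := by
  rw [Real.rpow_neg (by linarith), Real.sqrt_eq_rpow]

lemma rpow_mul_inv_sqrt_pow {t : ℝ} (ht : 0 < t) (μ : ℝ) (m : ℕ) :
    t ^ (μ / 2) * (√t ^ (m + 1))⁻¹ = t ^ (-(m : ℝ) / 2 - 1 / 2 + μ / 2) := by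
  rw [← rpow_neg_half ht, ← Real.rpow_add ht]
  congr 1
  push_cast
  ring

lemma le_errorRate_of_one_le (n m : ℕ) (μ : ℝ) {t : ℝ} (ht : 1 ≤ t) :
    t ^ (μ / 2) * (√t ^ (m + 2))⁻¹ * logFactor n m t ≤ 2 * errorRate n m μ t := by
  have ht0 : 0 < t := by linarith
  have hL := half_le_logFactor n m ht0
  have hq : 0 < √t := Real.sqrt_pos.2 ht0
  have hq1 : 0 < √(1 + t) := Real.sqrt_pos.2 (by linarith)
  have h1 : (√t)⁻¹ ≤ 2 * (√(1 + t))⁻¹ := by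
    rw [← div_eq_mul_inv, le_div_iff₀ hq1, inv_mul_le_iff₀ hq, Real.sqrt_le_left (by positivity), mul_pow,
      Real.sq_sqrt ht0.le]
    linarith
  have h2 : 0 ≤ (1 + t) ^ (-(m : ℝ) / 2 - 1 / 2 + μ / 2) := by positivity
  rw [errorRate, one_add_rpow_neg_half ht0, pow_succ _ (m + 1), mul_inv, ← mul_assoc,
    rpow_mul_inv_sqrt_pow ht0]
  set γ := -(m : ℝ) / 2 - 1 / 2 + μ / 2 with hγ
  calc t ^ γ * (√t)⁻¹ * logFactor n m t ≤ (t ^ γ + (1 + t) ^ γ) * (2 * (√(1 + t))⁻¹) * logFactor n m t := by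
        gcongr
        linarith
    _ = _ := by ring

/-- The exponent γ may have either sign. The summand (1+t)^γ accounts for the constant 1: on (0, 1]
it is at least 2^{-|γ|}, whereas t^γ may tend to 0. -/
lemma le_errorRate_of_le_one (n m : ℕ) (μ : ℝ) {t : ℝ} (ht : 0 < t) (ht1 : t ≤ 1) :
    1 + t ^ (μ / 2) * (√t ^ (m + 1))⁻¹ ≤
      4 * 2 ^ |-(m : ℝ) / 2 - 1 / 2 + μ / 2| * errorRate n m μ t := by
  have hL := half_le_logFactor n m ht
  have hq1 : 0 < √(1 + t) := Real.sqrt_pos.2 (by linarith)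
  have h1 : 1 / 2 ≤ (√(1 + t))⁻¹ := by
    rw [one_div]
    refine inv_anti₀ hq1 ?_
    rw [Real.sqrt_le_left (by norm_num)]
    linarith
  rw [errorRate, one_add_rpow_neg_half ht, rpow_mul_inv_sqrt_pow ht]
  set γ := -(m : ℝ) / 2 - 1 / 2 + μ / 2 with hγ
  have h2 : 1 ≤ (2 : ℝ) ^ |γ| := Real.one_le_rpow (by norm_num) (abs_nonneg _)
  have h3 : 1 ≤ (2 : ℝ) ^ |γ| * (1 + t) ^ γ := by
    calc (1 : ℝ) = (1 + t) ^ |γ| * (1 + t) ^ (-|γ|) := by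
          rw [← Real.rpow_add (by linarith), add_neg_cancel, Real.rpow_zero]
      _ ≤ 2 ^ |γ| * (1 + t) ^ γ := by
          refine mul_le_mul ?_ ?_ (by positivity) (by positivity)
          · exact Real.rpow_le_rpow (by linarith) (by linarith) (abs_nonneg _)
          · exact Real.rpow_le_rpow_of_exponent_le (by linarith) (neg_abs_le γ)
  have h4 : 0 ≤ t ^ γ := by positivity
  have h5 := le_mul_of_one_le_left h4 h2
  have h6 : 1 ≤ 4 * ((√(1 + t))⁻¹ * logFactor n m t) := by nlinarith
  calc 1 + t ^ γ ≤ 2 ^ |γ| * (t ^ γ + (1 + t) ^ γ) := by linarith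
    _ ≤ 2 ^ |γ| * (t ^ γ + (1 + t) ^ γ) * (4 * ((√(1 + t))⁻¹ * logFactor n m t)) :=
        le_mul_of_one_le_right (by positivity) h6
    _ = _ := by ring

lemma exists_profileError_le (hd : WeightedDecay M 2 u) (hd0 : WeightedDecay M 0 u)
    (hf : DecayingFlow u C₀) (hw : InitialVorticity M w u) (hm : m ≤ n) (hM : m + 2 ≤ M) {μ : ℝ}
    (hμ : 0 ≤ μ) (hμM : μ ≤ M) : ∃ C : ℝ, 0 ≤ C ∧ ∀ (e : Bool) (h k : Fin n) (t : ℝ), 0 < t →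
      nm e (fun x => ENNReal.ofReal |‖x‖ ^ μ * profileError m w u h k t x|) ≤
      ENNReal.ofReal (C * errorRate n m μ t * (√t ^ scal n e)⁻¹) := by
  obtain ⟨C1, h1, b1⟩ := exists_profileError_large_time hd hd0 hf hw hm hM
  obtain ⟨C2, h2, b2⟩ := exists_profileError_small_time hd hd0 hf w hm (by omega) hμ hμM
  set K : ℝ := 4 * 2 ^ |-(m : ℝ) / 2 - 1 / 2 + μ / 2| with hK
  have hK0 : 0 ≤ K := by positivity
  refine ⟨C1 * 2 + C2 * K, by positivity, fun e h k t ht => ?_⟩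
  have hL := half_le_logFactor n m ht
  have hE : 0 ≤ errorRate n m μ t := by unfold errorRate; positivity
  have e0 : (fun x => ENNReal.ofReal |‖x‖ ^ μ * profileError m w u h k t x|) =
      fun x => ENNReal.ofReal (‖x‖ ^ μ) * ENNReal.ofReal |profileError m w u h k t x| := by
    funext x
    rw [abs_mul, abs_of_nonneg (by positivity : 0 ≤ ‖x‖ ^ μ), ENNReal.ofReal_mul (by positivity)]
  rw [e0]
  -- For t ≥ 1, |x|^μ is replaced by t^{μ/2} times the parabolic weight before the large-time bound
  -- is applied; the small-time bound already contains |x|^μ.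
  rcases le_or_gt 1 t with h' | h'
  · have e1 : ∀ x, ENNReal.ofReal (‖x‖ ^ μ) * ENNReal.ofReal |profileError m w u h k t x| ≤
        ENNReal.ofReal (t ^ (μ / 2)) * (ENNReal.ofReal ((1 + ‖x‖ / √t) ^ M) *
          ENNReal.ofReal |profileError m w u h k t x|) := by
      intro x
      rw [← mul_assoc, ← ENNReal.ofReal_mul (p := t ^ (μ / 2)) (by positivity)]
      exact mul_le_mul_left (ENNReal.ofReal_le_ofReal (norm_rpow_le_weight hμ hμM ht x)) _
    refine (nm_mono e e1).trans ?_
    rw [nm_const_mul e ENNReal.ofReal_ne_top]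
    refine (mul_le_mul_right (b1 e h k t h') _).trans ?_
    rw [← ENNReal.ofReal_mul (by positivity)]
    refine ENNReal.ofReal_le_ofReal ?_
    have e2 := mul_le_mul_of_nonneg_left (le_errorRate_of_one_le n m μ h')
      (by positivity : 0 ≤ C1 * (√t ^ scal n e)⁻¹)
    have e3 : 0 ≤ C2 * K * errorRate n m μ t * (√t ^ scal n e)⁻¹ := by positivity
    rw [pow_add √t (scal n e), mul_inv]
    linarith
  · refine (b2 e h k t ht h'.le).trans (ENNReal.ofReal_le_ofReal ?_)
    have e2 := mul_le_mul_of_nonneg_left (le_errorRate_of_le_one n m μ ht h'.le)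
      (by positivity : 0 ≤ C2 * (√t ^ scal n e)⁻¹)
    have e3 : 0 ≤ C1 * 2 * errorRate n m μ t * (√t ^ scal n e)⁻¹ := by positivity
    rw [← hK] at e2
    linarith

end

end NSVorticity

end

theorem proposition2p3 (n m : ℕ) (hn : 2 ≤ n) (hm : 1 ≤ m) (hmn : m ≤ n)
    (w : Fin n → Fin n → NSVorticity.E n → ℝ)
    (hw : ∀ i j, Integrable (fun x => (1 + ‖x‖) ^ (n + m + 1) * w i j x) volume)
    (hcurl : NSVorticity.IsWeakCurl w (NSVorticity.biotSavart w))
    (u : ℝ → NSVorticity.E n → NSVorticity.E n)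
    (hu : NSVorticity.IsSmoothNSSolution (NSVorticity.biotSavart w) u)
    (hdecay : NSVorticity.HasVelocityDecay u) :
    -- the coefficients of the profiles are absolutely convergent integrals
    (∀ (j h : Fin n) (l : ℕ) (β : Fin n → ℕ), 1 ≤ 2 * l + ∑ i, β i → 2 * l + ∑ i, β i ≤ m →
      IntegrableOn (fun z : ℝ × NSVorticity.E n =>
        (-z.1) ^ l * NSVorticity.monom β (-z.2) *
          (NSVorticity.vorticity u j h z.1 z.2 * u z.1 z.2 j))
        (Ioi 0 ×ˢ univ) (volume.prod volume)) ∧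
    ∀ (q : ℝ≥0∞) (μ : ℝ), 1 ≤ q → 0 ≤ μ → μ ≤ (n : ℝ) + m + 1 →
      ∃ C : ℝ, ∀ (h k : Fin n) (t : ℝ), 0 < t →
        eLpNorm (fun x : NSVorticity.E n => ‖x‖ ^ μ *
            (NSVorticity.vorticity u h k t x
              - ∑ p ∈ Finset.Icc 2 (m + 1), NSVorticity.Omega u w h k p t x)) q volume
          ≤ ENNReal.ofReal (C * t ^ (-((n : ℝ) / 2) * (1 - (1 / q).toReal))
              * (t ^ (-(m : ℝ) / 2 - 1 / 2 + μ / 2)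
                + (1 + t) ^ (-(m : ℝ) / 2 - 1 / 2 + μ / 2))
              * (1 + t) ^ (-(1 / 2) : ℝ) * NSVorticity.logFactor n m t) := by
  obtain ⟨C₀, hf⟩ := hu.decayingFlow hdecay
  have hI : NSVorticity.InitialVorticity (n + m + 1) w u := hu.initialVorticity hn hw hcurl
  -- The weight exponent is that of the initial vorticity, n + m + 1. It is at least μ, and at least
  -- the order m + 2 of the highest expansion.
  have hd0 : NSVorticity.WeightedDecay (n + m + 1) 0 u := hf.weightedDecay_zero hn hI
  have hd : NSVorticity.WeightedDecay (n + m + 1) 2 u := hf.weightedDecay_two hn hI (by omega)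
  refine ⟨fun j h l β _ hβ => hd.integrableOn_moment hf hmn (by omega) j h hβ, fun q μ hq hμ hμM => ?_⟩
  obtain ⟨C, hC, hb⟩ := NSVorticity.exists_profileError_le hd hd0 hf hI hmn (by omega) hμ
    (by push_cast; exact hμM)
  refine ⟨C, fun h k t ht => ?_⟩
  have hL := NSVorticity.half_le_logFactor n m ht
  have hE : 0 ≤ NSVorticity.errorRate n m μ t := by unfold NSVorticity.errorRate; positivity
  refine (NSVorticity.eLpNorm_le_of_nm_le (mul_nonneg hC hE) ht (fun e => hb e h k t ht) hq).trans
    (le_of_eq ?_)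
  rw [NSVorticity.errorRate]
  congr 1
  ring
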